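/- Let $0<q<1$, $0\le\nu<1$, and let $k\ge1$ be an integer. Write $\Xi(z)=\frac{1-z}{1-\nu z}$, $\mathbf V(z)=\prod_{1\le i<j\le k}(z_i-z_j)$, $\mathbb W^k=\{n\in\mathbb Z^k: n_1\ge\dots\ge n_k\}$, $(a;q)_m=\prod_{i=0}^{m-1}(1-aq^i)$, and $\mathfrak m(n)=\prod_{c}\frac{(\nu;q)_c}{(q;q)_c}$, the product running over the sizes $c$ of the clusters of equal coordinates of $n$. Put $$\Psi^\ell_z(n)=\sum_{\sigma\in S(k)}\prod_{B<A}\frac{z_{\sigma(A)}-qz_{\sigma(B)}}{z_{\sigma(A)}-z_{\sigma(B)}}\prod_{j}\Xi(z_{\sigma(j)})^{-n_j},$$ $$\Psi^r_z(n)=(-1)^k(1-q)^kq^{\frac{k(k-1)}2}\mathfrak m(n)\sum_{\sigma\in S(k)}\prod_{B<A}\frac{z_{\sigma(A)}-q^{-1}z_{\sigma(B)}}{z_{\sigma(A)}-z_{\sigma(B)}}\prod_{j}\Xi(z_{\sigma(j)})^{n_j},$$ $$S(x,y)=\tfrac{1-q}{1-q\nu}+\tfrac{q-\nu}{1-q\nu}\,y+\tfrac{\nu(1-q)}{1-q\nu}\,xy-x,$$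 $$\Phi^\ell_\xi(n)=\sum_{\sigma}\operatorname{sgn}(\sigma)\prod_{B<A}S(\xi_{\sigma(A)},\xi_{\sigma(B)})\prod_j\xi_{\sigma(j)}^{-n_j},$$ $$\Phi^r_\xi(n)=\mathfrak m(n)\Big(\tfrac{1-q}{1-\nu}\Big)^k\sum_{\sigma}\operatorname{sgn}(\sigma)\prod_{B<A}S(\xi_{\sigma(B)},\xi_{\sigma(A)})\prod_j\xi_{\sigma(j)}^{n_j}.$$ Contours are piecewise $C^1$ simple closed curves, positively oriented. Let $\gamma$ be a contour that contains $1$ and its own image $q\gamma$ in its interior and has $\nu^{-1}$ in its exterior (no condition on $\nu^{-1}$ if $\nu=0$). Let $\gamma'$ be a contour that contains $\gamma$ in its interior, lies inside $q^{-1}\gamma$, has $\nu^{-1}$ in its exterior (again no condition if $\nu=0$), and is such that $|\Xi(z)|<|\Xi(w)|$ for all $z\in\gamma$, $w\in\gamma'$. **(1) Variables $z$.** Let $F$ be such that, for $M$ large enough, $\mathbf V(z)F(z)\prod_j\Xi(z_j)^{-M}$ is holomorphic in all variables in a neighborhood of the closed exterior of $\gamma$ (including $\infty$), and let $G$ be such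 that $\mathbf V(w)G(w)$ is holomorphic in all variables in a neighborhood of the closed region between $\gamma$ and $\gamma'$. Assume that the integrand on the right-hand side below is absolutely integrable on $\gamma\times\dots\times\gamma$ (this is automatic if, for example, $G$ itself is holomorphic near the closed region between $\gamma$ and $\gamma'$). Then all the integrals on the left exist, the series converges absolutely, and $$\sum_{n\in\mathbb W^k}\Big(\oint_\gamma\!\!\cdots\!\oint_\gamma\frac{dz}{(2\pi i)^k}\Psi^r_z(n)\mathbf V(z)F(z)\Big)\Big(\oint_\gamma\!\!\cdots\!\oint_\gamma\frac{dw}{(2\pi i)^k}\Psi^\ell_w(n)\mathbf V(w)G(w)\Big)$$ $$=\oint_\gamma\!\!\cdots\!\oint_\gamma\frac{dz}{(2\pi i)^k}(-1)^{\frac{k(k-1)}2}\prod_{j=1}^k(1-z_j)(1-\nu z_j)\prod_{A\ne B}(z_A-qz_B)\sum_{\sigma\in S(k)}\operatorname{sgn}(\sigma)F(z)G(z_{\sigma(1)},\dots,z_{\sigma(k)}).$$ **(2) Variables $\xi$.** Let $F$ be such that, for $M$ large enough, $\mathbf V(\xi)F(\xi)\prod_j\xi_j^{-M}$ is holomorphic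 in a neighborhood of the closed exterior of $\Xi(\gamma)$ (including $\infty$), let $\mathbf V(\varsigma)G(\varsigma)$ be holomorphic in a neighborhood of the closed region between $\Xi(\gamma)$ and $\Xi(\gamma')$, and assume that the integrand on the right-hand side below is absolutely integrable on $\Xi(\gamma)\times\dots\times\Xi(\gamma)$. Then all the integrals on the left exist, the series converges absolutely, and $$\sum_{n\in\mathbb W^k}\Big(\oint_{\Xi(\gamma)}\!\!\!\cdots\!\oint_{\Xi(\gamma)}\frac{d\xi}{(2\pi i)^k}\Phi^r_\xi(n)F(\xi)\Big)\Big(\oint_{\Xi(\gamma)}\!\!\!\cdots\!\oint_{\Xi(\gamma)}\frac{d\varsigma}{(2\pi i)^k}\Phi^\ell_\varsigma(n)G(\varsigma)\Big)$$ $$=\oint_{\Xi(\gamma)}\!\!\!\cdots\!\oint_{\Xi(\gamma)}\frac{d\xi}{(2\pi i)^k}\prod_{j=1}^k\xi_j\prod_{A\ne B}S(\xi_A,\xi_B)\sum_{\sigma\in S(k)}\operatorname{sgn}(\sigma)F(\xi)G(\xi_{\sigma(1)},\dots,\xi_{\sigma(k)}).$$ **(3) Equivalence.** For arbitrary functions $F,G$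 on $\mathbb C^k$, the identity in (2) (meaning: the series converges absolutely to the right-hand side) holds for $F,G$ if and only if the identity in (1) holds for $\tilde F,\tilde G$, where $\tilde F(z)=\prod_j(1-\nu\xi_j)^{k+1}F(\xi)$ and $\tilde G(z)=\prod_j(1-\nu\xi_j)^{k+1}G(\xi)$ with $\xi_j=\Xi(z_j)$. -/

import Mathlib

open MeasureTheory Set
open scoped BigOperators

noncomputable section

namespace QHahn

/-! ### Contours in the complex plane

A contour is a parametrized closed curve `γ`, of which only the restriction to `[0, 1]` matters. -/

/-- The set of points of the curve. -/
def trace (γ : ℝ → ℂ) : Set ℂ := γ '' Icc (0 : ℝ) 1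

/-- The points inside the closed curve: they lie in a bounded component of the complement. -/
def inside (γ : ℝ → ℂ) : Set ℂ :=
  {p | p ∉ trace γ ∧ Bornology.IsBounded (connectedComponentIn (trace γ)ᶜ p)}

/-- The points outside the closed curve: they lie in the unbounded component of the complement. -/
def outside (γ : ℝ → ℂ) : Set ℂ :=
  {p | p ∉ trace γ ∧ ¬ Bornology.IsBounded (connectedComponentIn (trace γ)ᶜ p)}

/-- Piecewise continuously differentiable on `[0, 1]`: continuously differentiable (with one-sided
derivatives at the end points) on each interval of a finite subdivision. -/
def PiecewiseC1 (γ : ℝ → ℂ) : Prop :=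
  ∃ (m : ℕ) (p : ℕ → ℝ), p 0 = 0 ∧ p m = 1 ∧ Monotone p ∧
    ∀ i < m, ContDiffOn ℝ 1 γ (Icc (p i) (p (i + 1)))

/-- The winding number of the curve about a point `p`. -/
def winding (γ : ℝ → ℂ) (p : ℂ) : ℂ :=
  (2 * Real.pi * Complex.I)⁻¹ * ∫ t in (0 : ℝ)..1, deriv γ t / (γ t - p)

/-- Positively oriented, piecewise smooth, simple closed contours. -/
structure IsPositiveContour (γ : ℝ → ℂ) : Prop where
  closed : γ 0 = γ 1
  simple : InjOn γ (Ico (0 : ℝ) 1)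
  piecewiseC1 : PiecewiseC1 γ
  positive : ∀ p ∈ inside γ, winding γ p = 1

/-- The map `z ↦ (1 - z) / (1 - ν z)`. -/
def xi (ν : ℝ) (z : ℂ) : ℂ := (1 - z) / (1 - ν * z)

/-- The contour `γ`: positively oriented, contains `1`, does not contain `ν⁻¹` (which is `∞` when
`ν = 0`), and contains its own image under the multiplication by `q`. -/
structure IsSpectralContour (q ν : ℝ) (γ : ℝ → ℂ) : Prop where
  contour : IsPositiveContour γ
  one_mem : (1 : ℂ) ∈ inside γ
  inv_mem : ν ≠ 0 → (ν : ℂ)⁻¹ ∈ outside γ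
  image_subset : trace (fun t => (q : ℂ) * γ t) ⊆ inside γ

/-- The contour `γ'` attached to `γ`: positively oriented, contains `γ`, is contained inside
`q⁻¹ γ`, does not contain `ν⁻¹`, and `|xi z| < |xi w|` for all `z` on `γ` and `w` on `γ'`. -/
structure IsGapContour (q ν : ℝ) (γ γ' : ℝ → ℂ) : Prop where
  contour : IsPositiveContour γ'
  contains : trace γ ⊆ inside γ'
  subset_inside : trace γ' ⊆ inside (fun t => (q : ℂ)⁻¹ * γ t)
  inv_mem : ν ≠ 0 → (ν : ℂ)⁻¹ ∈ outside γ'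
  gap : ∀ z ∈ trace γ, ∀ w ∈ trace γ', ‖xi ν z‖ < ‖xi ν w‖

/-- The pull-back to the parameters `t ∈ [0, 1]^k` of `f(z₁, …, z_k) dz₁ ⋯ dz_k`, with every
variable on `γ`. -/
def pullback {k : ℕ} (γ : ℝ → ℂ) (f : (Fin k → ℂ) → ℂ) (t : Fin k → ℝ) : ℂ :=
  (∏ j, deriv γ (t j)) * f (fun j => γ (t j))

/-- Absolute integrability of `f` over `γ × ⋯ × γ`. -/
def ContourIntegrable {k : ℕ} (γ : ℝ → ℂ) (f : (Fin k → ℂ) → ℂ) : Prop :=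
  IntegrableOn (pullback γ f) (Icc (0 : Fin k → ℝ) 1)

/-- The `k`-fold contour integral `∮_γ ⋯ ∮_γ f(z) dz₁ ⋯ dz_k / (2πi)^k`. -/
def contourIntegral {k : ℕ} (γ : ℝ → ℂ) (f : (Fin k → ℂ) → ℂ) : ℂ :=
  ((2 * Real.pi * Complex.I) ^ k)⁻¹ * ∫ t in Icc (0 : Fin k → ℝ) 1, pullback γ f t

/-! ### Holomorphic functions of several variables on closed regions

A function is holomorphic on a closed set if it has a holomorphic extension to a neighborhood.
The functions to which this is applied are given by formulas that have no meaning on the diagonals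
`z_i = z_j`, so that agreement with the holomorphic function is required at the points with
pairwise distinct coordinates only. -/

/-- The closed exterior of `γ`, without the point at infinity. -/
def closedExterior (γ : ℝ → ℂ) : Set ℂ := trace γ ∪ outside γ

/-- The closed region between `γ` and `γ'`. -/
def closedBetween (γ γ' : ℝ → ℂ) : Set ℂ := (trace γ ∪ outside γ) ∩ (trace γ' ∪ inside γ')

/-- The closed exterior of `γ` together with the point at infinity, in the coordinate
`u = 1 / (z - c)` of the Riemann sphere punctured at `c`; the point at infinity is `u = 0`. -/
def exteriorChart (γ : ℝ → ℂ) (c : ℂ) : Set ℂ :=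
  insert 0 ((fun z => (z - c)⁻¹) '' closedExterior γ)

/-- `f` is holomorphic in all its variables in (a neighborhood of) the closed exterior of `γ`,
including infinity. The points of `D` are those at which the formula for `f` is meaningful. -/
def HolomorphicOnExterior {k : ℕ} (γ : ℝ → ℂ) (D : Set ℂ) (f : (Fin k → ℂ) → ℂ) : Prop :=
  ∃ c ∈ inside γ, ∃ (W : Set (Fin k → ℂ)) (H : (Fin k → ℂ) → ℂ), IsOpen W ∧
    {u | ∀ j, u j ∈ exteriorChart γ c} ⊆ W ∧ DifferentiableOn ℂ H W ∧
    ∀ z : Fin k → ℂ, (∀ j, z j ∈ closedExterior γ) → (∀ j, z j ∈ D) → Function.Injective z →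
      f z = H (fun j => (z j - c)⁻¹)

/-- `f` is holomorphic in all its variables in a neighborhood of `A`. -/
def HolomorphicNear {k : ℕ} (A : Set ℂ) (f : (Fin k → ℂ) → ℂ) : Prop :=
  ∃ (W : Set (Fin k → ℂ)) (H : (Fin k → ℂ) → ℂ), IsOpen W ∧
    {w | ∀ j, w j ∈ A} ⊆ W ∧ DifferentiableOn ℂ H W ∧
    ∀ w : Fin k → ℂ, (∀ j, w j ∈ A) → Function.Injective w → f w = H w

/-! ### Eigenfunctions -/

/-- The Weyl chamber `n₁ ≥ ⋯ ≥ n_k`. -/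
abbrev Weyl (k : ℕ) : Type := {n : Fin k → ℤ // Antitone n}

/-- The Vandermonde determinant `∏_{i < j} (z_i - z_j)`. -/
def vandermonde {k : ℕ} (z : Fin k → ℂ) : ℂ := ∏ i, ∏ j ∈ Finset.Ioi i, (z i - z j)

/-- The sign of a permutation as a complex number. -/
def sgn {k : ℕ} (σ : Equiv.Perm (Fin k)) : ℂ := ((Equiv.Perm.sign σ : ℤ) : ℂ)

/-- The `q`-Pochhammer symbol `(a; q)_n`. -/
def qPoch (a q : ℝ) (n : ℕ) : ℝ := ∏ i ∈ Finset.range n, (1 - a * q ^ i)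

/-- The product of `(ν; q)_c / (q; q)_c` over the sizes `c` of the clusters of equal coordinates
of `n`. -/
def stat (q ν : ℝ) {k : ℕ} (n : Weyl k) : ℝ :=
  ∏ v ∈ Finset.univ.image n.1,
    qPoch ν q (Finset.univ.filter fun j => n.1 j = v).card /
      qPoch q q (Finset.univ.filter fun j => n.1 j = v).card

/-- The left eigenfunction `Ψ^ℓ_z(n)`. -/
def PsiL (q ν : ℝ) {k : ℕ} (n : Weyl k) (z : Fin k → ℂ) : ℂ :=
  ∑ σ : Equiv.Perm (Fin k),
    (∏ A, ∏ B ∈ Finset.Iio A, (z (σ A) - q * z (σ B)) / (z (σ A) - z (σ B))) *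
      ∏ j, xi ν (z (σ j)) ^ (-n.1 j)

/-- The right eigenfunction `Ψ^r_z(n)`. -/
def PsiR (q ν : ℝ) {k : ℕ} (n : Weyl k) (z : Fin k → ℂ) : ℂ :=
  (-1) ^ k * (1 - q) ^ k * q ^ (k * (k - 1) / 2) * stat q ν n *
    ∑ σ : Equiv.Perm (Fin k),
      (∏ A, ∏ B ∈ Finset.Iio A, (z (σ A) - (q : ℂ)⁻¹ * z (σ B)) / (z (σ A) - z (σ B))) *
        ∏ j, xi ν (z (σ j)) ^ (n.1 j)

/-- The cross term `S_{q,ν}(ξ₁, ξ₂)`. -/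
def crossS (q ν : ℝ) (x y : ℂ) : ℂ :=
  (1 - q) / (1 - q * ν) + (q - ν) / (1 - q * ν) * y + ν * (1 - q) / (1 - q * ν) * x * y - x

/-- The left eigenfunction `Φ^ℓ_ξ(n)` in the variables `ξ`, times a Vandermonde determinant. -/
def PhiL (q ν : ℝ) {k : ℕ} (n : Weyl k) (x : Fin k → ℂ) : ℂ :=
  ∑ σ : Equiv.Perm (Fin k),
    sgn σ * (∏ A, ∏ B ∈ Finset.Iio A, crossS q ν (x (σ A)) (x (σ B))) *
      ∏ j, x (σ j) ^ (-n.1 j)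

/-- The right eigenfunction `Φ^r_ξ(n)` in the variables `ξ`, times a Vandermonde determinant. -/
def PhiR (q ν : ℝ) {k : ℕ} (n : Weyl k) (x : Fin k → ℂ) : ℂ :=
  stat q ν n * ((1 - q) / (1 - ν)) ^ k *
    ∑ σ : Equiv.Perm (Fin k),
      sgn σ * (∏ A, ∏ B ∈ Finset.Iio A, crossS q ν (x (σ B)) (x (σ A))) *
        ∏ j, x (σ j) ^ (n.1 j)

/-! ### Test functions and the two identities -/

/-- Test functions `F(z)`: for some (equivalently, every large) `M`, the function
`V(z) F(z) ∏ (xi z_j)^{-M}` is holomorphic in the closed exterior of `γ`, including infinity. -/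
def TestFZ (ν : ℝ) {k : ℕ} (γ : ℝ → ℂ) (F : (Fin k → ℂ) → ℂ) : Prop :=
  ∃ M : ℕ, HolomorphicOnExterior γ {z | 1 - ν * z ≠ 0}
    fun z => vandermonde z * F z * ∏ j, (xi ν (z j) ^ M)⁻¹

/-- Test functions `F(ξ)`: for some (equivalently, every large) `M`, the function
`V(ξ) F(ξ) ∏ ξ_j^{-M}` is holomorphic in the closed exterior of the contour, including infinity. -/
def TestFXi {k : ℕ} (γ : ℝ → ℂ) (F : (Fin k → ℂ) → ℂ) : Prop :=
  ∃ M : ℕ, HolomorphicOnExterior γ univ fun x => vandermonde x * F x * ∏ j, (x j ^ M)⁻¹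

/-- Test functions `G`: the function `V(w) G(w)` is holomorphic in a neighborhood of the closed
region between the two contours. -/
def TestG {k : ℕ} (γ γ' : ℝ → ℂ) (G : (Fin k → ℂ) → ℂ) : Prop :=
  HolomorphicNear (closedBetween γ γ') fun w => vandermonde w * G w

/-- The integrand on the right-hand side, in the variables `z`. -/
def rhsZ (q ν : ℝ) {k : ℕ} (F G : (Fin k → ℂ) → ℂ) (z : Fin k → ℂ) : ℂ :=
  (-1) ^ (k * (k - 1) / 2) * (∏ j, (1 - z j) * (1 - ν * z j)) *
    (∏ A, ∏ B ∈ Finset.univ.erase A, (z A - q * z B)) *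
      ∑ σ : Equiv.Perm (Fin k), sgn σ * F z * G (fun j => z (σ j))

/-- The integrand on the right-hand side, in the variables `ξ`. -/
def rhsXi (q ν : ℝ) {k : ℕ} (F G : (Fin k → ℂ) → ℂ) (x : Fin k → ℂ) : ℂ :=
  (∏ j, x j) * (∏ A, ∏ B ∈ Finset.univ.erase A, crossS q ν (x A) (x B)) *
    ∑ σ : Equiv.Perm (Fin k), sgn σ * F x * G (fun j => x (σ j))

/-- The spectral biorthogonality identity in the variables `z` for the test functions `F`, `G`:
the series over the Weyl chamber converges (absolutely) to the right-hand side. -/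
def BiorthogonalityZ (q ν : ℝ) {k : ℕ} (γ : ℝ → ℂ) (F G : (Fin k → ℂ) → ℂ) : Prop :=
  HasSum (fun n : Weyl k =>
      contourIntegral γ (fun z => PsiR q ν n z * vandermonde z * F z) *
        contourIntegral γ (fun w => PsiL q ν n w * vandermonde w * G w))
    (contourIntegral γ (rhsZ q ν F G))

/-- The spectral biorthogonality identity in the variables `ξ` (integrals over `γ`). -/
def BiorthogonalityXi (q ν : ℝ) {k : ℕ} (γ : ℝ → ℂ) (F G : (Fin k → ℂ) → ℂ) : Prop :=
  HasSum (fun n : Weyl k =>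
      contourIntegral γ (fun x => PhiR q ν n x * F x) *
        contourIntegral γ (fun x => PhiL q ν n x * G x))
    (contourIntegral γ (rhsXi q ν F G))

/-- The change of variables `ξ = xi z` on test functions:
`F(ξ)` becomes `∏ (1 - ν ξ_j)^{k+1} F(ξ)` at `ξ_j = xi z_j`. -/
def changeVar (ν : ℝ) {k : ℕ} (F : (Fin k → ℂ) → ℂ) (z : Fin k → ℂ) : ℂ :=
  (∏ j, (1 - ν * xi ν (z j)) ^ (k + 1)) * F (fun j => xi ν (z j))

end QHahn

end

/-! The map `Ξ` is its own inverse and turns the factors `z_A - q z_B` into the cross terms `S(ξ_A,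
ξ_B)`. Under `ξ = Ξ(z)` every integrand changes by the Jacobian and by powers of `1 - ν z_j`; the
exponent `k + 1 = 2 + (k - 1)` in the test functions absorbs these, so the two identities differ
termwise by one nonzero constant (`biorthogonalityXi_iff`), and the work is done in the variables
`ξ`.

Geometry. Because `q γ` lies inside `γ`, some point of `γ` has `|Ξ| ≥ 1`; because `1` is inside `γ`
and `γ` is inside `γ'`, some point of `γ'` has `ν |Ξ| ≤ 1`. With the gap condition and compactness
this leaves radii `1 < R₀ < R`, `ν R < 1`, between `Ξ(γ)` and `Ξ(γ')` (`exists_region`). Between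
`Ξ(γ)` and these circles the test functions are holomorphic up to a Vandermonde factor, so a winding
number form of Cauchy's theorem (`IsLoop.lineIntegral_eq_circ`) moves every variable to a circle.

Circles. On a thin annulus around such a radius `S` has no zeros (`exists_goodAnnulus`). There the
pairing of `Φ^r(m)` with `∏ x_j ^ (-n_j - 1)` divided by the cross terms is `δ_{mn}`
(`pairing_PhiR`): a permutation contributes only if no variable can be shrunk to `0` or expanded to
`∞`, which forces `m = n` and a permutation that preserves the clusters. The sum over these
permutations collapses by a Hall–Littlewood type identity (`sum_young`), residues at the points
`Ξ(q^s)` evaluate the integral (`multiIntegral_nodes`), and `𝔪(n)` is the normalization that makes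
the result `1`. By a count of dimensions the `Φ^r` span all alternating sums of Laurent monomials
(`alt_mem_span_PhiR`). An antisymmetric holomorphic function is an absolutely convergent series of
such sums; hence it expands in the `Φ^r` with its pairings as coefficients (`hasSum_pairing`).

Diagonals. Only `H = V F` and `K = V G` are holomorphic. With `K_sym` the sum of `K` over all
permutations of its variables, the right-hand integrand is a nonvanishing weight times `H K_sym /
V²`. Integrability forces `H K_sym` to vanish on each diagonal (`eq_zero_of_integrable_div_sq`),
hence one of the two factors, as holomorphic functions on a connected domain have no zero divisors.
If `K_sym` vanishes on one diagonal, it does so on all by symmetry and is divisible by `V²`; the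
integrals of `Φ^ℓ` are then pairings with an antisymmetric holomorphic function and the statement on
circles applies. Otherwise `H` vanishes on all diagonals, and reversing the coordinates of `n`
exchanges `Φ^ℓ` with `Φ^r` and the roles of `F` and `G`. -/

namespace QHahn

/-! ### Iterated integrals along curves -/

/-- The integral of `g` along the curve `c`. -/
noncomputable def lineIntegral (c : ℝ → ℂ) (g : ℂ → ℂ) : ℂ :=
  ∫ t in Icc (0 : ℝ) 1, deriv c t * g (c t)

/-- The iterated integral of `f`, normalized by `(2πi)^k`, with the `j`-th variable on `c j`. -/
noncomputable def multiIntegral {k : ℕ} (c : Fin k → ℝ → ℂ) (f : (Fin k → ℂ) → ℂ) : ℂ :=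
  ((2 * Real.pi * Complex.I) ^ k)⁻¹ *
    ∫ t in Icc (0 : Fin k → ℝ) 1, (∏ j, deriv (c j) (t j)) * f (fun j => c j (t j))

/-- Curves along which continuous functions can be integrated. -/
structure IsPath (c : ℝ → ℂ) : Prop where
  cont : ContinuousOn c (Icc 0 1)
  int : IntegrableOn (deriv c) (Icc 0 1)

/-- The product of the traces of a family of curves. -/
def box {k : ℕ} (c : Fin k → ℝ → ℂ) : Set (Fin k → ℂ) := {x | ∀ j, x j ∈ trace (c j)}

theorem restrict_cube (k : ℕ) : (volume : Measure (Fin k → ℝ)).restrict (Icc 0 1) =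
    Measure.pi fun _ => (volume : Measure ℝ).restrict (Icc 0 1) := by
  rw [← Measure.restrict_pi_pi, ← volume_pi, Set.pi_univ_Icc]; rfl

theorem IsPath.isCompact_trace {c : ℝ → ℂ} (hc : IsPath c) : IsCompact (trace c) :=
  isCompact_Icc.image_of_continuousOn hc.cont

theorem mem_box {k : ℕ} {c : Fin k → ℝ → ℂ} {t : Fin k → ℝ} (ht : t ∈ Icc (0 : Fin k → ℝ) 1) :
    (fun j => c j (t j)) ∈ box c := fun j => mem_image_of_mem _ ⟨ht.1 j, ht.2 j⟩

theorem integrableOn_of_continuousOn_box {k : ℕ} {c : Fin k → ℝ → ℂ} (hc : ∀ j, IsPath (c j))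
    {f : (Fin k → ℂ) → ℂ} (hf : ContinuousOn f (box c)) :
    IntegrableOn (fun t : Fin k → ℝ => (∏ j, deriv (c j) (t j)) * f (fun j => c j (t j)))
      (Icc 0 1) := by
  have h1 : ContinuousOn (fun t : Fin k → ℝ => f (fun j => c j (t j))) (Icc 0 1) := by
    refine hf.comp ?_ fun t ht => mem_box ht
    refine continuousOn_pi.2 fun j => (hc j).cont.comp (continuous_apply j).continuousOn ?_
    exact fun t ht => ⟨ht.1 j, ht.2 j⟩
  obtain ⟨C, hC⟩ := isCompact_Icc.exists_bound_of_continuousOn h1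
  have h2 : Integrable (fun t : Fin k → ℝ => ∏ j, deriv (c j) (t j))
      (volume.restrict (Icc 0 1)) := by
    rw [restrict_cube]
    exact Integrable.fintype_prod_dep fun j => (hc j).int
  exact h2.mul_bdd (c := C) (h1.aestronglyMeasurable measurableSet_Icc)
    ((ae_restrict_iff' measurableSet_Icc).2 (ae_of_all _ hC))

theorem integral_cube_succAbove {n : ℕ} (j : Fin (n + 1)) {Φ : (Fin (n + 1) → ℝ) → ℂ}
    (h : IntegrableOn Φ (Icc 0 1)) :
    ∫ t in Icc 0 1, Φ t = ∫ s in Icc (0 : Fin n → ℝ) 1, ∫ x in Icc (0 : ℝ) 1,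
      Φ (j.insertNth x s) := by
  rw [IntegrableOn, restrict_cube] at h
  have hp := (measurePreserving_piFinSuccAbove
    (fun _ : Fin (n + 1) => (volume : Measure ℝ).restrict (Icc 0 1)) j).symm
  rw [restrict_cube, restrict_cube, ← hp.integral_comp']
  have h' := (hp.integrable_comp_emb (MeasurableEquiv.measurableEmbedding _)).2 h
  exact integral_prod_symm _ h'

theorem cube_section_integrable {n : ℕ} (j : Fin (n + 1)) {Φ : (Fin (n + 1) → ℝ) → ℂ}
    (h : IntegrableOn Φ (Icc 0 1)) :
    ∀ᵐ s ∂(volume.restrict (Icc (0 : Fin n → ℝ) 1)),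
      IntegrableOn (fun x => Φ (j.insertNth x s)) (Icc (0 : ℝ) 1) := by
  rw [IntegrableOn, restrict_cube] at h
  have hp := (measurePreserving_piFinSuccAbove
    (fun _ : Fin (n + 1) => (volume : Measure ℝ).restrict (Icc 0 1)) j).symm
  rw [restrict_cube]
  exact ((hp.integrable_comp_emb (MeasurableEquiv.measurableEmbedding _)).2 h).prod_left_ae

/-- Fubini singles out the `j`-th variable and leaves it one factor `(2πi)⁻¹`, so that the inner
integral carries Cauchy's normalization. -/
theorem multiIntegral_succAbove {n : ℕ} (j : Fin (n + 1)) {c : Fin (n + 1) → ℝ → ℂ}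
    (hc : ∀ j, IsPath (c j)) {f : (Fin (n + 1) → ℂ) → ℂ} (hf : ContinuousOn f (box c)) :
    multiIntegral c f = multiIntegral (fun i => c (j.succAbove i)) fun ξ =>
      (2 * Real.pi * Complex.I)⁻¹ * lineIntegral (c j) fun w => f (j.insertNth w ξ) := by
  rw [multiIntegral, multiIntegral, integral_cube_succAbove j (integrableOn_of_continuousOn_box hc hf)]
  rw [pow_succ, mul_inv, mul_assoc]
  congr 1
  rw [← integral_const_mul]
  refine integral_congr_ae (ae_of_all _ fun s => ?_)
  simp only
  rw [lineIntegral, mul_left_comm]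
  congr 1
  rw [← integral_const_mul]
  refine integral_congr_ae (ae_of_all _ fun x => ?_)
  simp only
  rw [Fin.prod_univ_succAbove _ j]
  simp only [Fin.insertNth_apply_same, Fin.insertNth_apply_succAbove]
  have : (fun i => c i ((j.insertNth x s : Fin (n + 1) → ℝ) i)) =
      (j.insertNth (c j x) fun i => c (j.succAbove i) (s i) : Fin (n + 1) → ℂ) := by
    ext i
    refine j.succAboveCases ?_ (fun i => ?_) i <;> simp
  rw [this]; ring

theorem multiIntegral_congr {k : ℕ} {c : Fin k → ℝ → ℂ} {f g : (Fin k → ℂ) → ℂ}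
    (h : ∀ x ∈ box c, f x = g x) : multiIntegral c f = multiIntegral c g := by
  rw [multiIntegral, multiIntegral]
  congr 1
  refine setIntegral_congr_fun measurableSet_Icc fun t ht => ?_
  simp only [h _ (mem_box ht)]

theorem insertNth_mem_box {n : ℕ} {c : Fin (n + 1) → ℝ → ℂ} {j : Fin (n + 1)} {w : ℂ}
    {ξ : Fin n → ℂ} (hw : w ∈ trace (c j)) (hξ : ξ ∈ box fun i => c (j.succAbove i)) :
    (j.insertNth w ξ : Fin (n + 1) → ℂ) ∈ box c := by
  intro i
  refine j.succAboveCases ?_ (fun i => ?_) i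
  · simpa using hw
  · simpa using hξ i

theorem trace_nonempty (c : ℝ → ℂ) : (trace c).Nonempty := ⟨c 0, mem_image_of_mem _ (by simp)⟩

/-- One of the curves can be replaced if this does not change the integrals in one variable. -/
theorem multiIntegral_update {k : ℕ} {c : Fin k → ℝ → ℂ} (j : Fin k) {c' : ℝ → ℂ}
    (hc : ∀ j, IsPath (c j)) (hc' : IsPath c') {f : (Fin k → ℂ) → ℂ}
    (hf : ContinuousOn f (box c)) (hf' : ContinuousOn f (box (Function.update c j c')))
    (h : ∀ x ∈ box c, lineIntegral (c j) (fun w => f (Function.update x j w)) =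
      lineIntegral c' fun w => f (Function.update x j w)) :
    multiIntegral c f = multiIntegral (Function.update c j c') f := by
  obtain ⟨n, rfl⟩ : ∃ n, k = n + 1 := ⟨k - 1, by have := j.pos; omega⟩
  have hu : ∀ i, IsPath (Function.update c j c' i) := fun i => by
    by_cases hi : i = j
    · subst hi; simpa using hc'
    · simpa [hi] using hc i
  rw [multiIntegral_succAbove j hc hf, multiIntegral_succAbove j hu hf']
  have h1 : (fun i => Function.update c j c' (j.succAbove i)) = fun i => c (j.succAbove i) := by
    ext i; simp [Fin.succAbove_ne]
  rw [h1]
  refine multiIntegral_congr fun ξ hξ => ?_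
  -- The hypothesis `h` speaks of points of the full box although their `j`-th coordinate is
  -- overwritten; any point of the curve can fill that slot.
  obtain ⟨w, hw⟩ := trace_nonempty (c j)
  have := h _ (insertNth_mem_box hw hξ)
  simp only [Fin.update_insertNth] at this
  rw [this, Function.update_self]

theorem multiIntegral_eq_zero {k : ℕ} {c : Fin k → ℝ → ℂ} (j : Fin k)
    (hc : ∀ j, IsPath (c j)) {f : (Fin k → ℂ) → ℂ} (hf : ContinuousOn f (box c))
    (h : ∀ x ∈ box c, lineIntegral (c j) (fun w => f (Function.update x j w)) = 0) :
    multiIntegral c f = 0 := by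
  obtain ⟨n, rfl⟩ : ∃ n, k = n + 1 := ⟨k - 1, by have := j.pos; omega⟩
  rw [multiIntegral_succAbove j hc hf]
  rw [multiIntegral_congr (g := fun _ => 0)]
  · simp [multiIntegral]
  intro ξ hξ
  obtain ⟨w, hw⟩ := trace_nonempty (c j)
  have := h _ (insertNth_mem_box hw hξ)
  simp only [Fin.update_insertNth] at this
  rw [this, mul_zero]

theorem multiIntegral_const_mul {k : ℕ} (c : Fin k → ℝ → ℂ) (a : ℂ) (f : (Fin k → ℂ) → ℂ) :
    multiIntegral c (fun x => a * f x) = a * multiIntegral c f := by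
  simp only [multiIntegral, mul_left_comm _ a, integral_const_mul]

theorem multiIntegral_sum {k : ℕ} {c : Fin k → ℝ → ℂ} (hc : ∀ j, IsPath (c j)) {ι : Type*}
    (s : Finset ι) {f : ι → (Fin k → ℂ) → ℂ} (hf : ∀ i ∈ s, ContinuousOn (f i) (box c)) :
    multiIntegral c (fun x => ∑ i ∈ s, f i x) = ∑ i ∈ s, multiIntegral c (f i) := by
  simp only [multiIntegral, Finset.mul_sum]
  rw [integral_finsetSum _ fun i hi => integrableOn_of_continuousOn_box hc (hf i hi),
    Finset.mul_sum]

theorem cube_perm {k : ℕ} (σ : Equiv.Perm (Fin k)) :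
    MeasurePreserving (fun t : Fin k → ℝ => fun j => t (σ j)) (volume.restrict (Icc 0 1))
      (volume.restrict (Icc 0 1)) := by
  rw [restrict_cube]
  have := measurePreserving_piCongrLeft
    (fun _ : Fin k => (volume : Measure ℝ).restrict (Icc 0 1)) σ.symm
  convert! this using 1
  ext t j
  have := MeasurableEquiv.piCongrLeft_apply_apply (β := fun _ : Fin k => ℝ) σ.symm t (σ j)
  simpa using this.symm

theorem cube_perm_emb {k : ℕ} (σ : Equiv.Perm (Fin k)) :
    MeasurableEmbedding (fun t : Fin k → ℝ => fun j => t (σ j)) := by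
  have := (MeasurableEquiv.piCongrLeft (fun _ : Fin k => ℝ) σ.symm).measurableEmbedding
  convert! this using 1
  ext t j
  have := MeasurableEquiv.piCongrLeft_apply_apply (β := fun _ : Fin k => ℝ) σ.symm t (σ j)
  simpa using this.symm

theorem contourIntegral_perm {k : ℕ} (γ : ℝ → ℂ) (f : (Fin k → ℂ) → ℂ) (σ : Equiv.Perm (Fin k)) :
    contourIntegral γ (fun x => f fun j => x (σ j)) = contourIntegral γ f := by
  rw [contourIntegral, contourIntegral,
    ← (cube_perm σ).integral_comp (cube_perm_emb σ) (pullback γ f)]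
  congr 1
  refine integral_congr_ae (ae_of_all _ fun t => ?_)
  simp only [pullback]
  rw [Equiv.prod_comp σ fun j => deriv γ (t j)]

theorem ContourIntegrable.perm {k : ℕ} {γ : ℝ → ℂ} {f : (Fin k → ℂ) → ℂ}
    (h : ContourIntegrable γ f) (σ : Equiv.Perm (Fin k)) :
    ContourIntegrable γ fun x => f fun j => x (σ j) := by
  have := ((cube_perm σ).integrable_comp_emb (cube_perm_emb σ)).2 h
  refine this.congr (ae_of_all _ fun t => ?_)
  simp only [Function.comp, pullback]
  rw [Equiv.prod_comp σ fun j => deriv γ (t j)]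

/-- End points and coincidences of parameters are null sets. For a simple curve this makes the
diagonals `z_i = z_j` negligible, which is why integrands need to be known at points with distinct
coordinates only. -/
theorem ae_cube_interior (k : ℕ) : ∀ᵐ t ∂(volume.restrict (Icc (0 : Fin k → ℝ) 1)),
    (∀ j, t j ∈ Ioo (0 : ℝ) 1) ∧ Function.Injective t := by
  have h1 : ∀ᵐ t ∂(volume : Measure (Fin k → ℝ)), ∀ j, t j ≠ 0 ∧ t j ≠ 1 := by
    refine ae_all_iff.2 fun j => ?_
    have h (x : ℝ) : ∀ᵐ t ∂(volume : Measure (Fin k → ℝ)), t j ≠ x := by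
      rw [ae_iff, volume_pi]; simpa using Measure.pi_hyperplane (fun _ : Fin k => (volume : Measure ℝ)) j x
    exact (h 0).and (h 1)
  have h2 : ∀ᵐ t ∂(volume : Measure (Fin k → ℝ)), ∀ i j, i ≠ j → t i ≠ t j := by
    refine ae_all_iff.2 fun i => ae_all_iff.2 fun j => ?_
    by_cases hij : i = j
    · simp [hij]
    let s : Submodule ℝ (Fin k → ℝ) :=
      LinearMap.ker (LinearMap.proj (R := ℝ) (φ := fun _ : Fin k => ℝ) i - LinearMap.proj j)
    have hs : s ≠ ⊤ := by
      intro h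
      have : (Pi.single i 1 : Fin k → ℝ) ∈ s := h ▸ Submodule.mem_top
      simp [s, Ne.symm hij] at this
    have := Measure.addHaar_submodule volume s hs
    rw [ae_iff]
    convert! this using 2
    ext t
    simp [s, hij, sub_eq_zero]
  filter_upwards [ae_restrict_of_ae h1, ae_restrict_of_ae h2, ae_restrict_mem measurableSet_Icc]
    with t h1 h2 h3
  refine ⟨fun j => ⟨lt_of_le_of_ne (h3.1 j) (Ne.symm (h1 j).1), lt_of_le_of_ne (h3.2 j) (h1 j).2⟩,
    fun i j hij => ?_⟩
  by_contra h
  exact h2 i j h hij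

theorem contourIntegral_congr_ae {k : ℕ} {γ : ℝ → ℂ} (hγ : InjOn γ (Ico 0 1))
    {f g : (Fin k → ℂ) → ℂ}
    (h : ∀ x : Fin k → ℂ, (∀ j, x j ∈ trace γ) → Function.Injective x → f x = g x) :
    pullback γ f =ᵐ[volume.restrict (Icc 0 1)] pullback γ g := by
  filter_upwards [ae_cube_interior k] with t ht
  rw [pullback, pullback, h]
  · exact fun j => mem_image_of_mem _ (Ioo_subset_Icc_self (ht.1 j))
  · exact fun i j hij => ht.2 (hγ (Ioo_subset_Ico_self (ht.1 i)) (Ioo_subset_Ico_self (ht.1 j)) hij)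

theorem contourIntegral_congr {k : ℕ} {γ : ℝ → ℂ} (hγ : InjOn γ (Ico 0 1))
    {f g : (Fin k → ℂ) → ℂ}
    (h : ∀ x : Fin k → ℂ, (∀ j, x j ∈ trace γ) → Function.Injective x → f x = g x) :
    contourIntegral γ f = contourIntegral γ g := by
  rw [contourIntegral, contourIntegral, integral_congr_ae (contourIntegral_congr_ae hγ h)]

theorem ContourIntegrable.congr {k : ℕ} {γ : ℝ → ℂ} (hγ : InjOn γ (Ico 0 1))
    {f g : (Fin k → ℂ) → ℂ} (hf : ContourIntegrable γ f)
    (h : ∀ x : Fin k → ℂ, (∀ j, x j ∈ trace γ) → Function.Injective x → f x = g x) :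
    ContourIntegrable γ g :=
  Integrable.congr hf (contourIntegral_congr_ae hγ h)

theorem contourIntegrable_of_continuousOn {k : ℕ} {γ : ℝ → ℂ} (hγ : IsPath γ)
    {f : (Fin k → ℂ) → ℂ} (hf : ContinuousOn f {x | ∀ j, x j ∈ trace γ}) :
    ContourIntegrable γ f :=
  integrableOn_of_continuousOn_box (c := fun _ => γ) (fun _ => hγ) hf

/-! ### The Cauchy–Pompeiu formula -/

/-- Twice the Wirtinger derivative `∂u/∂z̄`. -/
noncomputable def dbar (u : ℂ → ℂ) (z : ℂ) : ℂ :=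
  fderiv ℝ u z 1 + Complex.I * fderiv ℝ u z Complex.I

theorem continuous_dbar {u : ℂ → ℂ} (hu : ContDiff ℝ 1 u) : Continuous (dbar u) := by
  have h := hu.continuous_fderiv (by norm_num)
  unfold dbar; fun_prop

/-- For a unit vector `w` the right-hand side is the radial derivative plus `i` times the angular
one, the form in which the Cauchy–Pompeiu integrand appears in polar coordinates. -/
theorem dbar_polar (u : ℂ → ℂ) (z w : ℂ) :
    dbar u z * (starRingEnd ℂ) w = fderiv ℝ u z w + Complex.I * fderiv ℝ u z (Complex.I * w) := by
  have h1 : w = w.re • (1 : ℂ) + w.im • Complex.I := by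
    simp [Complex.re_add_im]
  have h2 : Complex.I * w = (-w.im) • (1 : ℂ) + w.re • Complex.I := by
    apply Complex.ext <;> simp
  have h3 : (starRingEnd ℂ) w = w.re - w.im * Complex.I := by
    apply Complex.ext <;> simp
  have h4 : fderiv ℝ u z w = w.re * fderiv ℝ u z 1 + w.im * fderiv ℝ u z Complex.I := by
    conv_lhs => rw [h1, map_add, map_smul, map_smul, Complex.real_smul, Complex.real_smul]
  rw [h2, map_add, map_smul, map_smul, h3, h4, dbar, Complex.real_smul, Complex.real_smul]
  push_cast
  linear_combination (-(w.im : ℂ)) * (fderiv ℝ u z Complex.I) * Complex.I_sq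

theorem bddSupport {u : ℂ → ℂ} (hs : HasCompactSupport u) (z : ℂ) :
    ∃ M > 0, ∀ w, M ≤ ‖w‖ → u (z + w) = 0 ∧ fderiv ℝ u (z + w) = 0 := by
  obtain ⟨M, hM⟩ := hs.isCompact.isBounded.subset_ball z
  refine ⟨max M 1, by positivity, fun w hw => ?_⟩
  have h : z + w ∉ tsupport u := fun h => by
    have := hM h
    simp at this
    exact absurd (le_trans (le_max_left _ _) hw) (not_le.2 this)
  exact ⟨image_eq_zero_of_notMem_tsupport h, image_eq_zero_of_notMem_tsupport
    fun h' => h (tsupport_fderiv_subset ℝ h')⟩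

/-- In polar coordinates about `z` the Jacobian `r` cancels the modulus of the kernel. What remains
is `∂u/∂r`, whose integral along each ray is `-u z`, plus `i / r` times `∂u/∂θ`, whose integral over
each circle vanishes by periodicity. -/
theorem cauchyPompeiu {u : ℂ → ℂ} (hu : ContDiff ℝ 1 u) (hs : HasCompactSupport u) (z : ℂ) :
    ∫ ζ, dbar u ζ / (ζ - z) = -(2 * Real.pi) * u z := by
  obtain ⟨M, hM0, hM⟩ := bddSupport hs z
  let e : ℝ → ℂ := fun θ => Complex.exp (θ * Complex.I)
  have he : ∀ θ, ‖e θ‖ = 1 := fun θ => Complex.norm_exp_ofReal_mul_I θ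
  have hd := hu.continuous_fderiv (by norm_num)
  let A : ℝ × ℝ → ℂ := fun p => fderiv ℝ u (z + p.1 * e p.2) (e p.2)
  let B : ℝ × ℝ → ℂ := fun p => fderiv ℝ u (z + p.1 * e p.2) (Complex.I * e p.2)
  have hec : Continuous e := by fun_prop
  have hA : Continuous A := by fun_prop
  have hB : Continuous B := by fun_prop
  let T : Set (ℝ × ℝ) := Ioi 0 ×ˢ Ioo (-Real.pi) Real.pi
  have hout : ∀ p : ℝ × ℝ, M ≤ p.1 → fderiv ℝ u (z + p.1 * e p.2) = 0 := fun p hp => by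
    refine (hM _ ?_).2
    rw [norm_mul, he, mul_one, Complex.norm_real]
    exact hp.trans (le_abs_self _)
  have hint : ∀ f : ℝ × ℝ → ℂ, Continuous f → (∀ p : ℝ × ℝ, M ≤ p.1 → f p = 0) →
      IntegrableOn f T := by
    intro f hf h0
    have h1 : IntegrableOn f (Icc (0, -Real.pi) (M, Real.pi)) :=
      hf.continuousOn.integrableOn_compact isCompact_Icc
    refine h1.of_forall_sdiff_eq_zero (measurableSet_Ioi.prod measurableSet_Ioo) fun p hp => ?_
    refine h0 p ?_
    by_contra! h
    exact hp.2 ⟨⟨hp.1.1.le, hp.1.2.1.le⟩, ⟨h.le, hp.1.2.2.le⟩⟩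
  have hAi := hint A hA fun p hp => by simp [A, hout p hp]
  have hBi := hint B hB fun p hp => by simp [B, hout p hp]
  have h1 : ∫ ζ, dbar u ζ / (ζ - z) = ∫ p in T, (A p + Complex.I * B p) := by
    rw [← integral_add_right_eq_self _ z, ← Complex.integral_comp_polarCoord_symm]
    refine setIntegral_congr_fun (measurableSet_Ioi.prod measurableSet_Ioo) fun p hp => ?_
    have hp0 : (p.1 : ℂ) ≠ 0 := Complex.ofReal_ne_zero.2 (ne_of_gt hp.1)
    have hee : (p.1 * (Real.cos p.2 + Real.sin p.2 * Complex.I) : ℂ) = p.1 * e p.2 := by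
      simp only [e]; rw [Complex.exp_mul_I]; push_cast; rfl
    have hne : e p.2 ≠ 0 := Complex.exp_ne_zero _
    simp only [Complex.polarCoord_symm_apply, hee, A, B]
    rw [← dbar_polar u, add_comm _ z, add_sub_cancel_left, Complex.real_smul]
    have : (starRingEnd ℂ) (e p.2) = (e p.2)⁻¹ := by
      rw [Complex.inv_def, Complex.normSq_eq_norm_sq, he]; simp
    rw [this]; field_simp
  have hder : ∀ θ r : ℝ, HasDerivAt (fun r : ℝ => u (z + r * e θ)) (A (r, θ)) r := fun θ r => by
    have h := (hu.differentiable (by norm_num) (z + r * e θ)).hasFDerivAt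
    have h' : HasDerivAt (fun r : ℝ => z + r * e θ) (e θ) r := by
      simpa using ((Complex.ofRealCLM.hasDerivAt (x := r)).mul_const (e θ)).const_add z
    exact h.comp_hasDerivAt r h'
  have hder2 : ∀ r θ : ℝ, HasDerivAt (fun θ : ℝ => u (z + r * e θ)) (r * B (r, θ)) θ :=
    fun r θ => by
    have h := (hu.differentiable (by norm_num) (z + r * e θ)).hasFDerivAt
    have h' : HasDerivAt (fun θ : ℝ => z + r * e θ) (r • (Complex.I * e θ)) θ := by
      have h3 : HasDerivAt (fun θ : ℝ => (θ * Complex.I : ℂ)) Complex.I θ := by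
        simpa using (Complex.ofRealCLM.hasDerivAt (x := θ)).mul_const Complex.I
      have := ((h3.cexp).const_mul (r : ℂ)).const_add z
      rw [Complex.real_smul, mul_comm Complex.I]
      exact this
    have := h.comp_hasDerivAt θ h'
    rw [map_smul, Complex.real_smul] at this
    exact this
  have hIA : ∫ p in T, A p = -(2 * Real.pi) * u z := by
    have hAi' := hAi
    rw [IntegrableOn, Measure.volume_eq_prod, ← Measure.prod_restrict] at hAi'
    rw [Measure.volume_eq_prod, ← Measure.prod_restrict, integral_prod_symm _ hAi']
    have : ∀ᵐ θ ∂(volume.restrict (Ioo (-Real.pi) Real.pi)),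
        ∫ r in Ioi (0 : ℝ), A (r, θ) = - u z := by
      filter_upwards [hAi'.prod_left_ae] with θ hθ
      rw [integral_Ioi_of_hasDerivAt_of_tendsto' (fun r _ => hder θ r) hθ (m := 0)]
      · simp
      · refine tendsto_const_nhds.congr' ?_
        filter_upwards [Filter.eventually_ge_atTop M] with r hr
        refine ((hM _ ?_).1).symm
        rw [norm_mul, he, mul_one, Complex.norm_real]
        exact hr.trans (le_abs_self _)
    rw [integral_congr_ae this]
    simp only [integral_const, MeasurableSet.univ, measureReal_restrict_apply, univ_inter,
      Real.volume_real_Ioo, Complex.real_smul]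
    rw [max_eq_left (by linarith [Real.pi_pos])]
    push_cast; ring
  have hIB : ∫ p in T, B p = 0 := by
    rw [Measure.volume_eq_prod, setIntegral_prod _ (by rw [← Measure.volume_eq_prod]; exact hBi)]
    refine setIntegral_eq_zero_of_forall_eq_zero fun r hr => ?_
    have hr0 : (r : ℂ) ≠ 0 := Complex.ofReal_ne_zero.2 (ne_of_gt hr)
    rw [← integral_Ioc_eq_integral_Ioo, ← intervalIntegral.integral_of_le
      (by linarith [Real.pi_pos])]
    have := intervalIntegral.integral_eq_sub_of_hasDerivAt (a := -Real.pi) (b := Real.pi)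
      (fun θ _ => hder2 r θ) (by apply Continuous.intervalIntegrable; fun_prop)
    rw [intervalIntegral.integral_const_mul] at this
    have h2 : e Real.pi = e (-Real.pi) := by
      simp only [e]
      rw [Complex.exp_mul_I, Complex.exp_mul_I]
      push_cast
      simp
    rw [h2, sub_self] at this
    exact (mul_eq_zero.1 this).resolve_left hr0
  rw [h1, integral_add hAi (hBi.const_mul _), hIA, integral_const_mul, hIB, mul_zero, add_zero]

/-! ### Circles -/

/-- The circle of radius `ρ` about the origin. -/
noncomputable def circ (ρ : ℝ) (t : ℝ) : ℂ := ρ * Complex.exp (2 * Real.pi * t * Complex.I)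

theorem circ_eq_circleMap (ρ t : ℝ) : circ ρ t = circleMap 0 ρ (2 * Real.pi * t) := by
  simp [circ, circleMap]

theorem hasDerivAt_circ (ρ t : ℝ) :
    HasDerivAt (circ ρ) (2 * Real.pi * Complex.I * circ ρ t) t := by
  have h3 : HasDerivAt (fun t : ℝ => (2 * Real.pi * t * Complex.I : ℂ))
      (2 * Real.pi * Complex.I) t := by
    simpa using ((Complex.ofRealCLM.hasDerivAt (x := t)).const_mul
      (2 * Real.pi : ℂ)).mul_const Complex.I
  refine ((h3.cexp).const_mul (ρ : ℂ)).congr_deriv ?_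
  rw [circ]; ring

theorem deriv_circ (ρ t : ℝ) : deriv (circ ρ) t = 2 * Real.pi * Complex.I * circ ρ t :=
  (hasDerivAt_circ ρ t).deriv

theorem continuous_circ (ρ : ℝ) : Continuous (circ ρ) := by unfold circ; fun_prop

theorem isPath_circ (ρ : ℝ) : IsPath (circ ρ) where
  cont := (continuous_circ ρ).continuousOn
  int := by
    have : deriv (circ ρ) = fun t => 2 * Real.pi * Complex.I * circ ρ t := funext (deriv_circ ρ)
    rw [this]
    exact (continuous_const.mul (continuous_circ ρ)).integrableOn_Icc

theorem norm_circ {ρ : ℝ} (hρ : 0 ≤ ρ) (t : ℝ) : ‖circ ρ t‖ = ρ := by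
  rw [circ_eq_circleMap]; simp [abs_of_nonneg hρ]

theorem norm_of_mem_trace_circ {ρ : ℝ} (hρ : 0 ≤ ρ) {z : ℂ} (hz : z ∈ trace (circ ρ)) :
    ‖z‖ = ρ := by
  obtain ⟨t, -, rfl⟩ := hz; exact norm_circ hρ t

theorem lineIntegral_circ (ρ : ℝ) (g : ℂ → ℂ) :
    lineIntegral (circ ρ) g = ∮ z in C(0, ρ), g z := by
  rw [lineIntegral, integral_Icc_eq_integral_Ioc,
    ← intervalIntegral.integral_of_le zero_le_one, circleIntegral]
  have := intervalIntegral.smul_integral_comp_mul_left (a := 0) (b := 1)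
    (fun θ => deriv (circleMap 0 ρ) θ • g (circleMap 0 ρ θ)) (2 * Real.pi)
  rw [mul_zero, mul_one] at this
  rw [← this, ← intervalIntegral.integral_smul]
  congr 1
  ext t
  rw [deriv_circ, deriv_circleMap, circ_eq_circleMap]
  simp only [circleMap_zero, smul_eq_mul, Complex.real_smul]
  push_cast; ring

/-! ### Loops and winding numbers -/

/-- Closed curves for which the fundamental theorem of calculus holds. -/
structure IsLoop (c : ℝ → ℂ) : Prop extends IsPath c where
  closed : c 0 = c 1
  diff : ∃ s : Set ℝ, s.Countable ∧ ∀ t ∈ Ioo (0 : ℝ) 1 \ s, DifferentiableAt ℝ c t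

theorem lineIntegral_eq_intervalIntegral (c : ℝ → ℂ) (g : ℂ → ℂ) :
    lineIntegral c g = ∫ t in (0 : ℝ)..1, deriv c t * g (c t) := by
  rw [lineIntegral, integral_Icc_eq_integral_Ioc, intervalIntegral.integral_of_le zero_le_one]

theorem winding_eq_lineIntegral (c : ℝ → ℂ) (p : ℂ) :
    winding c p = (2 * Real.pi * Complex.I)⁻¹ * lineIntegral c fun w => (w - p)⁻¹ := by
  rw [winding, lineIntegral_eq_intervalIntegral]; rfl

theorem IsPath.integrableOn {c : ℝ → ℂ} (hc : IsPath c) {g : ℂ → ℂ}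
    (hg : ContinuousOn g (trace c)) :
    IntegrableOn (fun t => deriv c t * g (c t)) (Icc 0 1) := by
  have h1 : ContinuousOn (fun t => g (c t)) (Icc 0 1) :=
    hg.comp hc.cont fun t ht => mem_image_of_mem _ ht
  obtain ⟨C, hC⟩ := isCompact_Icc.exists_bound_of_continuousOn h1
  exact hc.int.mul_bdd (c := C) (h1.aestronglyMeasurable measurableSet_Icc)
    ((ae_restrict_iff' measurableSet_Icc).2 (ae_of_all _ hC))

theorem IsLoop.lineIntegral_eq_zero {c : ℝ → ℂ} (hc : IsLoop c) {G g : ℂ → ℂ} {U : Set ℂ}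
    (hcU : trace c ⊆ U) (hG : ∀ z ∈ U, HasDerivAt G (g z) z) (hg : ContinuousOn g U) :
    lineIntegral c g = 0 := by
  obtain ⟨s, hs, hd⟩ := hc.diff
  rw [lineIntegral_eq_intervalIntegral]
  rw [integral_eq_of_hasDerivAt_off_countable (fun t => G (c t)) _ hs, hc.closed, sub_self]
  · rw [uIcc_of_le zero_le_one]
    refine ContinuousOn.comp (t := U) (fun z hz => (hG z hz).continuousAt.continuousWithinAt)
      hc.cont fun t ht => hcU (mem_image_of_mem _ ht)
  · intro t ht
    rw [min_eq_left zero_le_one, max_eq_right zero_le_one] at ht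
    have h1 := hG _ (hcU (mem_image_of_mem c (Ioo_subset_Icc_self ht.1)))
    rw [mul_comm]
    exact h1.comp_of_eq t (hd t ht).hasDerivAt rfl
  · rw [intervalIntegrable_iff_integrableOn_Icc_of_le zero_le_one]
    exact hc.integrableOn (hg.mono hcU)

/-- On the disc `|z| < |p|` the function `1 - z / p` has positive real part, so its logarithm is a
primitive of `(z - p)⁻¹` there. -/
theorem IsLoop.winding_eq_zero_of_lt {c : ℝ → ℂ} (hc : IsLoop c) {p : ℂ}
    (h : ∀ z ∈ trace c, ‖z‖ < ‖p‖) : winding c p = 0 := by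
  have hp : p ≠ 0 := by
    rintro rfl
    obtain ⟨z, hz⟩ := trace_nonempty c
    exact absurd (h z hz) (by simp)
  have key : ∀ z ∈ Metric.ball (0 : ℂ) ‖p‖, 1 - z / p ∈ Complex.slitPlane := by
    intro z hz
    left
    have : ‖z / p‖ < 1 := by
      rw [norm_div, div_lt_one (norm_pos_iff.2 hp)]; simpa using hz
    have := (Complex.re_le_norm (z / p)).trans_lt this
    simpa using this
  rw [winding_eq_lineIntegral, hc.lineIntegral_eq_zero (U := Metric.ball 0 ‖p‖)
    (G := fun z => Complex.log (1 - z / p)), mul_zero]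
  · intro z hz; simpa using h z hz
  · intro z hz
    have h1 : HasDerivAt (fun z => 1 - z / p) (-(1 / p)) z :=
      ((hasDerivAt_id z).div_const p).const_sub 1
    refine (h1.clog (key z hz)).congr_deriv ?_
    have h2 := Complex.slitPlane_ne_zero (key z hz)
    have h3 : z - p ≠ 0 := fun h => h2 (by rw [sub_eq_zero.1 h, div_self hp, sub_self])
    have h4 : p - z ≠ 0 := fun h => h3 (by rw [← neg_sub, h, neg_zero])
    field_simp
    ring
  · intro z hz
    have h2 := Complex.slitPlane_ne_zero (key z hz)
    have h3 : z - p ≠ 0 := fun h => h2 (by rw [sub_eq_zero.1 h, div_self hp, sub_self])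
    have h4 : ContinuousAt (fun w : ℂ => w - p) z := by fun_prop
    exact (h4.inv₀ h3).continuousWithinAt

/-- Differentiation under the integral sign produces `∮ (w - p)⁻² dw`, whose integrand has the
primitive `-(w - p)⁻¹` along the curve. Local constancy thus follows without knowing that winding
numbers are integers. -/
theorem IsLoop.hasDerivAt_winding {c : ℝ → ℂ} (hc : IsLoop c) {p : ℂ} (hp : p ∉ trace c) :
    HasDerivAt (winding c) 0 p := by
  obtain ⟨ε, hε, hball⟩ := Metric.isOpen_iff.1 hc.isCompact_trace.isClosed.isOpen_compl p hp
  -- On the half-size ball the distance to the curve stays at least `ε / 2`, which bounds the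
  -- differentiated kernel uniformly in `x`.
  have hfar : ∀ x ∈ Metric.ball p (ε / 2), ∀ z ∈ trace c, ε / 2 ≤ ‖z - x‖ := by
    intro x hx z hz
    have h1 : ε ≤ dist z p := by
      by_contra! h
      exact hball h hz
    have h2 : dist x p < ε / 2 := hx
    have h3 := dist_triangle z x p
    rw [← dist_eq_norm]; linarith
  have hcont : ∀ x ∈ Metric.ball p (ε / 2), ∀ n : ℕ,
      ContinuousOn (fun z => ((z - x) ^ n)⁻¹) (trace c) := fun x hx n => by
    refine ContinuousOn.inv₀ (by fun_prop) fun z hz => pow_ne_zero _ fun h => ?_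
    have := hfar x hx z hz
    rw [h, norm_zero] at this; linarith
  have hmem : p ∈ Metric.ball p (ε / 2) := Metric.mem_ball_self (by linarith)
  have hder := hasDerivAt_integral_of_dominated_loc_of_deriv_le
    (μ := volume.restrict (Icc (0 : ℝ) 1))
    (F := fun x t => deriv c t * (c t - x)⁻¹) (F' := fun x t => deriv c t * ((c t - x) ^ 2)⁻¹)
    (x₀ := p) (s := Metric.ball p (ε / 2)) (bound := fun t => ‖deriv c t‖ * ((ε / 2) ^ 2)⁻¹)
    (Metric.ball_mem_nhds p (by linarith))
    (by
      filter_upwards [Metric.ball_mem_nhds p (show (0 : ℝ) < ε / 2 by linarith)] with x hx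
      simpa using (hc.integrableOn (hcont x hx 1)).aestronglyMeasurable)
    (by simpa [IntegrableOn] using hc.integrableOn (hcont p hmem 1))
    (hc.integrableOn (hcont p hmem 2)).aestronglyMeasurable
    (by
      refine (ae_restrict_iff' measurableSet_Icc).2 (ae_of_all _ fun t ht x hx => ?_)
      rw [norm_mul, norm_inv, norm_pow]
      gcongr
      exact hfar x hx _ (mem_image_of_mem _ ht))
    (hc.int.norm.mul_const _)
    (by
      refine (ae_restrict_iff' measurableSet_Icc).2 (ae_of_all _ fun t ht x hx => ?_)
      have hne : c t - x ≠ 0 := fun h => by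
        have := hfar x hx _ (mem_image_of_mem _ ht)
        rw [h, norm_zero] at this; linarith
      have h1 : HasDerivAt (fun x => (c t - x)⁻¹) (((c t - x) ^ 2)⁻¹) x := by
        refine (((hasDerivAt_id x).const_sub (c t)).inv hne).congr_deriv ?_
        simp [div_eq_mul_inv]
      exact h1.const_mul _)
  have h0 : ∫ t in Icc (0 : ℝ) 1, deriv c t * ((c t - p) ^ 2)⁻¹ = 0 := by
    refine hc.lineIntegral_eq_zero (U := trace c) (G := fun z => -(z - p)⁻¹)
      (g := fun z => ((z - p) ^ 2)⁻¹) subset_rfl ?_ (hcont p hmem 2)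
    intro z hz
    have hne : z - p ≠ 0 := fun h => by
      have := hfar p hmem z hz
      rw [h, norm_zero] at this; linarith
    refine ((((hasDerivAt_id z).sub_const p).inv hne).neg).congr_deriv ?_
    simp [div_eq_mul_inv]
  have h3 := hder.2
  rw [h0] at h3
  have h4 : winding c = fun x => (2 * Real.pi * Complex.I)⁻¹ *
      ∫ t in Icc (0 : ℝ) 1, deriv c t * (c t - x)⁻¹ := by
    ext x; rw [winding_eq_lineIntegral]; rfl
  rw [h4]
  simpa using h3.const_mul (2 * Real.pi * Complex.I)⁻¹

/-- The winding number is constant on the component of `p`, and an unbounded component reaches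
points farther from the origin than the whole curve, where it vanishes. -/
theorem IsLoop.winding_eq_zero {c : ℝ → ℂ} (hc : IsLoop c) {p : ℂ} (hp : p ∈ outside c) :
    winding c p = 0 := by
  have ho : IsOpen (trace c)ᶜ := hc.isCompact_trace.isClosed.isOpen_compl
  obtain ⟨M, hM⟩ := hc.isCompact_trace.isBounded.exists_norm_le
  set U := connectedComponentIn (trace c)ᶜ p
  have hU : U ⊆ (trace c)ᶜ := connectedComponentIn_subset _ _
  obtain ⟨x, hx, hxM⟩ : ∃ x ∈ U, M < ‖x‖ := by
    by_contra! h
    exact hp.2 (isBounded_iff_forall_norm_le.2 ⟨M, h⟩)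
  have hconst := ho.connectedComponentIn (x := p) |>.is_const_of_deriv_eq_zero (𝕜 := ℂ)
    (f := winding c) isPreconnected_connectedComponentIn
    (fun z hz => (hc.hasDerivAt_winding (hU hz)).differentiableAt.differentiableWithinAt)
    (fun z hz => (hc.hasDerivAt_winding (hU hz)).deriv)
    (mem_connectedComponentIn hp.1) hx
  rw [hconst, hc.winding_eq_zero_of_lt fun z hz => (hM z hz).trans_lt hxM]

/-! ### Deformation of a loop to a circle -/

/-- The Cauchy–Pompeiu formula is inserted for `u` on the curve and the integrals are exchanged; the
inner integral of the kernel along the curve is a winding number. The curve avoids the support of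
`dbar u`, so the kernel is bounded. -/
theorem IsPath.lineIntegral_eq_dbar {c : ℝ → ℂ} (hc : IsPath c) {u : ℂ → ℂ}
    (hu : ContDiff ℝ 1 u) (hs : HasCompactSupport u) (hd : Disjoint (tsupport (dbar u)) (trace c)) :
    lineIntegral c u = Complex.I * ∫ ζ, dbar u ζ * winding c ζ := by
  have hK : IsCompact (tsupport (dbar u)) := by
    refine hs.isCompact.of_isClosed_subset (isClosed_tsupport _) ?_
    refine closure_minimal (fun z hz => ?_) (isClosed_tsupport _)
    by_contra h
    have : fderiv ℝ u z = 0 := image_eq_zero_of_notMem_tsupport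
      fun h' => h (tsupport_fderiv_subset ℝ h')
    exact hz (by simp [dbar, this])
  have hb := continuous_dbar hu
  let K := tsupport (dbar u)
  have hcont : ContinuousOn (fun x : ℝ × ℂ => (x.2 - c x.1)⁻¹) (Icc 0 1 ×ˢ K) := by
    refine ContinuousOn.inv₀ ?_ ?_
    · refine continuousOn_snd.sub (hc.cont.comp continuousOn_fst fun x hx => hx.1)
    · intro x hx h
      refine (Set.disjoint_left.1 hd hx.2) ?_
      rw [sub_eq_zero.1 h]; exact mem_image_of_mem _ hx.1
  obtain ⟨C, hC⟩ := (isCompact_Icc.prod hK).exists_bound_of_continuousOn hcont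
  have hint : Integrable (fun x : ℝ × ℂ => deriv c x.1 * (dbar u x.2 * (x.2 - c x.1)⁻¹))
      ((volume.restrict (Icc 0 1)).prod (volume.restrict K)) := by
    have h1 : Integrable (fun x : ℝ × ℂ => deriv c x.1 * dbar u x.2)
        ((volume.restrict (Icc 0 1)).prod (volume.restrict K)) :=
      hc.int.mul_prod (hb.continuousOn.integrableOn_compact hK)
    have h2 : Integrable (fun x : ℝ × ℂ => deriv c x.1 * dbar u x.2 * (x.2 - c x.1)⁻¹)
        ((volume.restrict (Icc 0 1)).prod (volume.restrict K)) := by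
      rw [Measure.prod_restrict] at h1 ⊢
      refine h1.mul_bdd (c := C) (hcont.aestronglyMeasurable (measurableSet_Icc.prod
        hK.measurableSet)) ?_
      exact (ae_restrict_iff' (measurableSet_Icc.prod hK.measurableSet)).2 (ae_of_all _ hC)
    simpa only [mul_assoc] using h2
  have hz : ∀ ζ ∉ K, dbar u ζ = 0 := fun ζ hζ => image_eq_zero_of_notMem_tsupport hζ
  have hpi : (Real.pi : ℂ) ≠ 0 := Complex.ofReal_ne_zero.2 Real.pi_ne_zero
  have hpomp : ∀ z, u z = -(2 * Real.pi : ℂ)⁻¹ * ∫ ζ in K, dbar u ζ * (ζ - z)⁻¹ := by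
    intro z
    rw [setIntegral_eq_integral_of_forall_compl_eq_zero fun ζ hζ => by rw [hz ζ hζ, zero_mul]]
    have := cauchyPompeiu hu hs z
    simp only [div_eq_mul_inv] at this
    rw [this]; field_simp
  have h1 : lineIntegral c u = -(2 * Real.pi : ℂ)⁻¹ *
      ∫ t in Icc (0 : ℝ) 1, ∫ ζ in K, deriv c t * (dbar u ζ * (ζ - c t)⁻¹) := by
    rw [lineIntegral, ← integral_const_mul]
    refine integral_congr_ae (ae_of_all _ fun t => ?_)
    simp only
    rw [hpomp (c t), integral_const_mul]; ring
  rw [h1, integral_integral_swap hint,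
    ← setIntegral_eq_integral_of_forall_compl_eq_zero (s := K)
      (f := fun ζ => dbar u ζ * winding c ζ) fun ζ hζ => by rw [hz ζ hζ, zero_mul],
    ← integral_const_mul, ← integral_const_mul]
  refine integral_congr_ae (ae_of_all _ fun ζ => ?_)
  simp only
  have h2 : ∫ t in Icc (0 : ℝ) 1, deriv c t * (dbar u ζ * (ζ - c t)⁻¹) =
      -dbar u ζ * lineIntegral c fun w => (w - ζ)⁻¹ := by
    rw [lineIntegral, ← integral_const_mul]
    refine integral_congr_ae (ae_of_all _ fun t => ?_)
    simp only
    rw [← neg_sub (c t) ζ, inv_neg]; ring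
  rw [h2, winding_eq_lineIntegral]
  field_simp

theorem winding_circ_of_lt {r : ℝ} {p : ℂ} (hp : ‖p‖ < r) : winding (circ r) p = 1 := by
  rw [winding_eq_lineIntegral, lineIntegral_circ,
    circleIntegral.integral_sub_inv_of_mem_ball (by simpa using hp)]
  exact inv_mul_cancel₀ Complex.two_pi_I_ne_zero

theorem isLoop_circ (r : ℝ) : IsLoop (circ r) where
  toIsPath := isPath_circ r
  closed := by
    simp only [circ]
    have : (2 * Real.pi * (1 : ℝ) * Complex.I : ℂ) = 2 * Real.pi * Complex.I := by simp
    rw [this, Complex.exp_two_pi_mul_I]; simp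
  diff := ⟨∅, countable_empty, fun t _ => (hasDerivAt_circ r t).differentiableAt⟩

/-- A homology form of Cauchy's theorem. With a smooth cutoff `χ` equal to `1` near `B`, the product
`χ f` agrees with `f` on both curves, and its `dbar` lives off `B`, where the two curves have the
same winding numbers. Both integrals are therefore the same area integral. -/
theorem IsLoop.lineIntegral_eq_circ {c : ℝ → ℂ} (hc : IsLoop c) {O B : Set ℂ} (hO : IsOpen O)
    (hB : IsCompact B) (hBO : B ⊆ O) {r : ℝ} (hr : 0 < r) (hcB : trace c ⊆ B)
    (hrB : ∀ z : ℂ, ‖z‖ = r → z ∈ B) (hcr : ∀ z ∈ trace c, ‖z‖ < r)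
    (hw : ∀ p ∉ B, ‖p‖ < r → winding c p = 1) {f : ℂ → ℂ} (hf : DifferentiableOn ℂ f O) :
    lineIntegral c f = lineIntegral (circ r) f := by
  obtain ⟨L, hL, hBL, hLO⟩ := exists_compact_between hB hO hBO
  obtain ⟨χ, hχ1, hχ0, -⟩ := exists_contMDiffMap_one_nhds_of_subset_interior
    (modelWithCornersSelf ℝ ℂ) (n := 1) hB.isClosed hBL
  have hχ : ContDiff ℝ 1 χ := χ.contMDiff.contDiff
  let u : ℂ → ℂ := fun z => χ z * f z
  have hsub : tsupport u ⊆ L := by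
    refine closure_minimal (fun z hz => ?_) hL.isClosed
    by_contra h
    exact hz (by simp [u, hχ0 z h])
  have hs : HasCompactSupport u := hL.of_isClosed_subset (isClosed_tsupport _) hsub
  have hu : ContDiff ℝ 1 u := by
    refine contDiff_iff_contDiffAt.2 fun z => ?_
    by_cases hz : z ∈ tsupport u
    swap
    · exact contDiffAt_const.congr_of_eventuallyEq (notMem_tsupport_iff_eventuallyEq.1 hz)
    have h1 : ContDiffAt ℂ 1 f z := (hf.contDiffOn hO).contDiffAt (hO.mem_nhds (hLO (hsub hz)))
    exact (Complex.ofRealCLM.contDiff.contDiffAt.comp z hχ.contDiffAt).mul (h1.restrict_scalars ℝ)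
  have hBz : ∀ᶠ z in nhdsSet B, dbar u z = 0 := by
    have h1 : ∀ᶠ z in nhdsSet B, u =ᶠ[nhds z] f := by
      filter_upwards [hχ1.eventually_nhdsSet] with z hz
      filter_upwards [hz] with w hw
      simp [u, hw]
    filter_upwards [h1, hO.mem_nhdsSet.2 hBO] with z hz hzO
    have h2 := (hf.differentiableAt (hO.mem_nhds hzO)).hasFDerivAt
    have h3 := (h2.restrictScalars ℝ).congr_of_eventuallyEq hz
    rw [dbar, h3.fderiv]
    simp only [ContinuousLinearMap.coe_restrictScalars']
    have : fderiv ℂ f z Complex.I = Complex.I * fderiv ℂ f z 1 := by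
      rw [← smul_eq_mul, ← map_smul]; simp
    rw [this, ← mul_assoc, Complex.I_mul_I]; ring
  have hdisj : ∀ T ⊆ B, Disjoint (tsupport (dbar u)) T := by
    intro T hT
    rw [Set.disjoint_right]
    intro z hz
    rw [notMem_tsupport_iff_eventuallyEq]
    exact nhds_le_nhdsSet (hT hz) hBz
  have hrt : trace (circ r) ⊆ B := fun z hz => hrB z (norm_of_mem_trace_circ hr.le hz)
  have hcong : ∀ {d : ℝ → ℂ}, trace d ⊆ B → lineIntegral d f = lineIntegral d u := by
    intro d hd
    refine setIntegral_congr_fun measurableSet_Icc fun t ht => ?_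
    have : χ (d t) = 1 := hχ1.self_of_nhdsSet _ (hd (mem_image_of_mem _ ht))
    simp [u, this]
  rw [hcong hcB, hcong hrt, hc.lineIntegral_eq_dbar hu hs (hdisj _ hcB),
    (isPath_circ r).lineIntegral_eq_dbar hu hs (hdisj _ hrt)]
  congr 2
  ext p
  -- In `B` the factor `dbar u` vanishes. Off `B` both winding numbers are `1` inside the circle and
  -- `0` outside it, and the circle itself belongs to `B`.
  by_cases hp : p ∈ B
  · rw [hBz.self_of_nhdsSet p hp]; simp
  rcases lt_trichotomy ‖p‖ r with h | h | h
  · rw [hw p hp h, winding_circ_of_lt h]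
  · exact absurd (hrB p h) hp
  · rw [hc.winding_eq_zero_of_lt fun z hz => (hcr z hz).trans h,
      (isLoop_circ r).winding_eq_zero_of_lt fun z hz => by
        rwa [norm_of_mem_trace_circ hr.le hz]]

/-! ### Separately holomorphic functions -/

/-- The set of points with all coordinates in `O`. -/
def poly (k : ℕ) (O : Set ℂ) : Set (Fin k → ℂ) := {x | ∀ j, x j ∈ O}

/-- Continuous functions that are holomorphic in each variable. -/
structure SepHolo {k : ℕ} (f : (Fin k → ℂ) → ℂ) (O : Set ℂ) : Prop where
  cont : ContinuousOn f (poly k O)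
  diff : ∀ x ∈ poly k O, ∀ j, DifferentiableAt ℂ (fun w => f (Function.update x j w)) (x j)

variable {k : ℕ} {O : Set ℂ} {f g : (Fin k → ℂ) → ℂ}

theorem isOpen_poly (hO : IsOpen O) : IsOpen (poly k O) := by
  have : poly k O = ⋂ j, (fun x : Fin k → ℂ => x j) ⁻¹' O := by ext; simp [poly]
  rw [this]
  exact isOpen_iInter_of_finite fun j => hO.preimage (continuous_apply j)

theorem update_mem_poly {x : Fin k → ℂ} (hx : x ∈ poly k O) (j : Fin k) {w : ℂ} (hw : w ∈ O) :
    Function.update x j w ∈ poly k O := fun i => by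
  by_cases h : i = j
  · subst h; simpa
  · simpa [h] using hx i

theorem SepHolo.line (hf : SepHolo f O) {x : Fin k → ℂ} (hx : x ∈ poly k O) (j : Fin k) :
    DifferentiableOn ℂ (fun w => f (Function.update x j w)) O := fun w hw => by
  have := hf.diff _ (update_mem_poly hx j hw) j
  simp only [Function.update_idem, Function.update_self] at this
  exact this.differentiableWithinAt

theorem SepHolo.mono (hf : SepHolo f O) {O' : Set ℂ} (h : O' ⊆ O) : SepHolo f O' where
  cont := hf.cont.mono fun _ hx j => h (hx j)
  diff := fun x hx => hf.diff x fun j => h (hx j)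

theorem sepHolo_of_differentiableOn (hO : IsOpen O) (hf : DifferentiableOn ℂ f (poly k O)) :
    SepHolo f O where
  cont := hf.continuousOn
  diff := fun x hx j => by
    have h1 : DifferentiableAt ℂ f (Function.update x j (x j)) := by
      rw [Function.update_eq_self]
      exact hf.differentiableAt ((isOpen_poly hO).mem_nhds hx)
    exact DifferentiableAt.comp (x j) h1 (hasDerivAt_update x j (x j)).differentiableAt

theorem SepHolo.mul (hf : SepHolo f O) (hg : SepHolo g O) : SepHolo (fun x => f x * g x) O where
  cont := hf.cont.mul hg.cont
  diff := fun x hx j => (hf.diff x hx j).mul (hg.diff x hx j)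

theorem SepHolo.inv (hf : SepHolo f O) (h : ∀ x ∈ poly k O, f x ≠ 0) :
    SepHolo (fun x => (f x)⁻¹) O where
  cont := hf.cont.inv₀ h
  diff := fun x hx j => (hf.diff x hx j).inv (by simpa using h x hx)

theorem SepHolo.sum {ι : Type*} {s : Finset ι} {F : ι → (Fin k → ℂ) → ℂ}
    (hF : ∀ i ∈ s, SepHolo (F i) O) : SepHolo (fun x => ∑ i ∈ s, F i x) O where
  cont := continuousOn_finsetSum _ fun i hi => (hF i hi).cont
  diff := fun x hx j => DifferentiableAt.fun_sum fun i hi => (hF i hi).diff x hx j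

theorem SepHolo.prod {ι : Type*} {s : Finset ι} {F : ι → (Fin k → ℂ) → ℂ}
    (hF : ∀ i ∈ s, SepHolo (F i) O) : SepHolo (fun x => ∏ i ∈ s, F i x) O where
  cont := continuousOn_finsetProd _ fun i hi => (hF i hi).cont
  diff := fun x hx j => DifferentiableAt.fun_finsetProd fun i hi => (hF i hi).diff x hx j

theorem sepHolo_of_differentiable (hf : Differentiable ℂ f) : SepHolo f O where
  cont := hf.continuous.continuousOn
  diff := fun x _ j => DifferentiableAt.comp (x j) (hf _) (hasDerivAt_update x j (x j)).differentiableAt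

theorem sepHolo_const (a : ℂ) : SepHolo (fun _ : Fin k → ℂ => a) O :=
  sepHolo_of_differentiable (differentiable_const a)

theorem sepHolo_coord (j : Fin k) : SepHolo (fun x : Fin k → ℂ => x j) O :=
  sepHolo_of_differentiable (by fun_prop)

theorem sepHolo_zpow (h0 : (0 : ℂ) ∉ O) (j : Fin k) (m : ℤ) :
    SepHolo (fun x : Fin k → ℂ => x j ^ m) O where
  cont := (continuous_apply j).continuousOn.zpow₀ m fun x hx => Or.inl fun h => h0 (h ▸ hx j)
  diff := fun x hx i => by
    refine DifferentiableAt.zpow ((sepHolo_coord j).diff x hx i) (Or.inl fun h => h0 ?_)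
    rw [← h]; simpa using hx j

theorem SepHolo.perm (hf : SepHolo f O) (σ : Equiv.Perm (Fin k)) :
    SepHolo (fun x => f fun j => x (σ j)) O where
  cont := hf.cont.comp (by fun_prop) fun x hx j => hx (σ j)
  diff := fun x hx j => by
    have h := hf.diff (fun i => x (σ i)) (fun i => hx (σ i)) (σ.symm j)
    simp only [Equiv.apply_symm_apply] at h
    convert h using 3 with w
    ext i
    by_cases hi : i = σ.symm j
    · subst hi; simp
    · have : σ i ≠ j := fun h => hi (by rw [← h]; simp)
      simp [hi, this]

/-- The variables are moved one at a time: `s` is the set of those already moved, and each move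
changes a one-variable integral of a function holomorphic on `O`, the other variables being frozen
on curves in `O`. -/
theorem multiIntegral_deform {c c' : Fin k → ℝ → ℂ} (hc : ∀ j, IsPath (c j))
    (hc' : ∀ j, IsPath (c' j)) (hcO : ∀ j, trace (c j) ⊆ O) (hcO' : ∀ j, trace (c' j) ⊆ O)
    (h : ∀ j (g : ℂ → ℂ), DifferentiableOn ℂ g O → lineIntegral (c j) g = lineIntegral (c' j) g)
    (hf : SepHolo f O) : multiIntegral c f = multiIntegral c' f := by
  classical
  have key : ∀ s : Finset (Fin k),
      multiIntegral c f = multiIntegral (fun j => if j ∈ s then c' j else c j) f := by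
    intro s
    induction s using Finset.induction_on with
    | empty => simp
    | insert j s hj ih =>
      have hp : ∀ (s : Finset (Fin k)) i, IsPath (if i ∈ s then c' i else c i) := fun s i => by
        split_ifs; exacts [hc' i, hc i]
      have hb : ∀ s : Finset (Fin k), box (fun j => if j ∈ s then c' j else c j) ⊆ poly k O := by
        intro s x hx i
        have := hx i
        simp only at this
        split_ifs at this
        exacts [hcO' i this, hcO i this]
      have hu : Function.update (fun j => if j ∈ s then c' j else c j) j (c' j) =
          fun i => if i ∈ insert j s then c' i else c i := by
        ext i : 1
        by_cases hi : i = j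
        · subst hi; simp
        · simp [hi]
      rw [ih, multiIntegral_update j (c' := c' j) (hp s) (hc' j) (hf.cont.mono (hb s))
        (by rw [hu]; exact hf.cont.mono (hb _)), hu]
      intro x hx
      simp only [hj, if_false]
      exact h j _ (hf.line (hb s hx) j)
  simpa using key Finset.univ

/-! ### Division by differences of coordinates -/

/-- The quotient is the difference quotient of `f` in `x_i` with base point `x_j`, which makes sense
on the diagonal as well. Off the diagonal it is a plain quotient. What needs proof is joint
continuity at the diagonal, obtained from a Cauchy integral, and holomorphy there in each variable.
-/
theorem SepHolo.exists_eq_sub_mul (hO : IsOpen O) (hf : SepHolo f O) {i j : Fin k} (hij : i ≠ j)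
    (h0 : ∀ x ∈ poly k O, x i = x j → f x = 0) :
    ∃ g, SepHolo g O ∧ ∀ x ∈ poly k O, f x = (x i - x j) * g x := by
  let g : (Fin k → ℂ) → ℂ := fun x => dslope (fun w => f (Function.update x i w)) (x j) (x i)
  have hbase : ∀ x ∈ poly k O, f (Function.update x i (x j)) = 0 := fun x hx =>
    h0 _ (update_mem_poly hx i (hx j)) (by simp [Ne.symm hij])
  have hgne : ∀ x ∈ poly k O, x i ≠ x j → g x = (x i - x j)⁻¹ * f x := by
    intro x hx hne
    simp only [g]
    rw [dslope_of_ne _ hne, slope_def_field, hbase x hx, Function.update_eq_self]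
    rw [sub_zero, div_eq_inv_mul]
  have hmul : ∀ x ∈ poly k O, f x = (x i - x j) * g x := by
    intro x hx
    by_cases hne : x i = x j
    · rw [h0 x hx hne, hne, sub_self, zero_mul]
    · rw [hgne x hx hne, mul_inv_cancel_left₀ (sub_ne_zero.2 hne)]
  have hoff : ∀ x ∈ poly k O, x i ≠ x j → (g =ᶠ[nhds x] fun x => (x i - x j)⁻¹ * f x) := by
    intro x hx hne
    have h1 : ∀ᶠ y in nhds x, y i - y j ≠ 0 :=
      (show ContinuousAt (fun y : Fin k → ℂ => y i - y j) x by fun_prop).eventually_ne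
        (sub_ne_zero.2 hne)
    filter_upwards [h1, (isOpen_poly hO).mem_nhds hx] with y hy hyO
    exact hgne y hyO (sub_ne_zero.1 hy)
  have hcont : ContinuousOn g (poly k O) := by
    intro p hp
    refine ContinuousAt.continuousWithinAt ?_
    have hfc : ∀ y ∈ poly k O, ContinuousAt f y := fun y hy =>
      hf.cont.continuousAt ((isOpen_poly hO).mem_nhds hy)
    by_cases hne : p i = p j
    swap
    · refine ContinuousAt.congr ?_ (hoff p hp hne).symm
      exact ((show ContinuousAt (fun y : Fin k → ℂ => y i - y j) p by fun_prop).inv₀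
        (sub_ne_zero.2 hne)).mul (hfc p hp)
    obtain ⟨ε, hε, hεO⟩ := Metric.isOpen_iff.1 (isOpen_poly hO) p hp
    have hcb : ∀ y ∈ Metric.closedBall p (ε / 4), ∀ w ∈ Metric.closedBall (p i) (ε / 2),
        Function.update y i w ∈ Metric.ball p ε := by
      intro y hy w hw
      rw [Metric.mem_ball, dist_pi_lt_iff hε]
      intro l
      by_cases hl : l = i
      · subst hl
        rw [Function.update_self]
        exact lt_of_le_of_lt hw (by linarith)
      · rw [Function.update_of_ne hl]
        exact lt_of_le_of_lt ((dist_le_pi_dist y p l).trans hy) (by linarith)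
    have hballO : Metric.closedBall (p i) (ε / 2) ⊆ O := fun w hw => by
      have := hεO (hcb p (Metric.mem_closedBall_self (by linarith)) w hw) i
      simpa using this
    have hnear : ∀ y ∈ Metric.closedBall p (ε / 4), ∀ l, dist (y l) (p l) ≤ ε / 4 :=
      fun y hy l => (dist_le_pi_dist y p l).trans hy
    -- Cauchy's formula for the difference quotient on the circle of radius `ε / 2` about `p i = p
    -- j`. Points `y` within `ε / 4` of `p` keep both denominators away from zero, so the integral
    -- is continuous in `y`.
    let Q : (Fin k → ℂ) → ℂ → ℂ := fun y w =>
      (w - y i)⁻¹ * ((w - y j)⁻¹ * f (Function.update y i w))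
    have hform : ∀ y ∈ Metric.ball p (ε / 4),
        g y = (2 * Real.pi * Complex.I)⁻¹ * ∮ w in C(p i, ε / 2), Q y w := by
      intro y hy
      have hyc := Metric.ball_subset_closedBall hy
      have hyO : y ∈ poly k O := hεO (Metric.ball_subset_ball (by linarith) hy)
      have hl := (hf.line hyO i)
      have hds : DifferentiableOn ℂ (dslope (fun w => f (Function.update y i w)) (y j)) O :=
        (Complex.differentiableOn_dslope (hO.mem_nhds (hyO j))).2 hl
      have hmem : y i ∈ Metric.ball (p i) (ε / 2) :=
        lt_of_le_of_lt (hnear y hyc i) (by linarith)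
      have hC := (hds.mono hballO).circleIntegral_sub_inv_smul hmem
      have : g y = (2 * Real.pi * Complex.I)⁻¹ * ((2 * Real.pi * Complex.I) •
          dslope (fun w => f (Function.update y i w)) (y j) (y i)) := by
        rw [smul_eq_mul, inv_mul_cancel_left₀ Complex.two_pi_I_ne_zero]
      rw [this, ← hC]
      congr 1
      refine circleIntegral.integral_congr (by linarith) fun w hw => ?_
      have hwj : w ≠ y j := by
        rintro rfl
        have h1 : dist (y j) (p i) = ε / 2 := hw
        have h2 := hnear y hyc j
        rw [← hne, h1] at h2; linarith
      simp only [Q, smul_eq_mul]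
      rw [dslope_of_ne _ hwj, slope_def_field, hbase y hyO, sub_zero, div_eq_inv_mul]
    have hQ : ContinuousOn (fun z : (Fin k → ℂ) × ℂ => Q z.1 z.2)
        (Metric.closedBall p (ε / 4) ×ˢ Metric.sphere (p i) (ε / 2)) := by
      have hne2 : ∀ z ∈ Metric.closedBall p (ε / 4) ×ˢ Metric.sphere (p i) (ε / 2),
          ∀ l, p l = p i → z.2 - z.1 l ≠ 0 := by
        intro z hz l hl h
        have h1 : dist z.2 (p i) = ε / 2 := hz.2
        have h2 := hnear z.1 hz.1 l
        rw [hl, ← sub_eq_zero.1 h, h1] at h2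
        linarith
      refine ContinuousOn.mul (ContinuousOn.inv₀ (by fun_prop) fun z hz => hne2 z hz i rfl)
        (ContinuousOn.mul (ContinuousOn.inv₀ (by fun_prop) fun z hz => hne2 z hz j hne.symm) ?_)
      refine hf.cont.comp (Continuous.continuousOn ?_) fun z hz => hεO (hcb z.1 hz.1 z.2
        (Metric.sphere_subset_closedBall hz.2))
      exact Continuous.update continuous_fst i continuous_snd
    have hK : IsCompact (Metric.closedBall p (ε / 4) ×ˢ Metric.sphere (p i) (ε / 2)) :=
      (isCompact_closedBall p _).prod (isCompact_sphere _ _)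
    obtain ⟨C, hC⟩ := hK.exists_bound_of_continuousOn hQ
    have hsph : ∀ θ, circleMap (p i) (ε / 2) θ ∈ Metric.sphere (p i) (ε / 2) := fun θ =>
      circleMap_mem_sphere _ (by linarith) θ
    have hcont2 : ContinuousAt (fun y => ∮ w in C(p i, ε / 2), Q y w) p := by
      refine intervalIntegral.continuousAt_of_dominated_interval
        (bound := fun _ => |ε / 2| * C) ?_ ?_ (by simp) ?_
      · filter_upwards [Metric.ball_mem_nhds p (show 0 < ε / 4 by linarith)] with y hy
        have h1 : Continuous (deriv (circleMap (p i) (ε / 2))) := by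
          rw [show deriv (circleMap (p i) (ε / 2)) = fun θ => circleMap 0 (ε / 2) θ * Complex.I from
            funext fun θ => deriv_circleMap _ _ θ]
          fun_prop
        have h2 : Continuous fun θ => Q y (circleMap (p i) (ε / 2) θ) :=
          hQ.comp_continuous (f := fun θ => (y, circleMap (p i) (ε / 2) θ)) (by fun_prop)
            fun θ => ⟨Metric.ball_subset_closedBall hy, hsph θ⟩
        exact (h1.smul h2).aestronglyMeasurable
      · filter_upwards [Metric.ball_mem_nhds p (show 0 < ε / 4 by linarith)] with y hy
        refine ae_of_all _ fun θ _ => ?_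
        rw [norm_smul, deriv_circleMap]
        simp only [norm_mul, norm_circleMap_zero, Complex.norm_I, mul_one]
        gcongr
        exact hC (y, circleMap (p i) (ε / 2) θ) ⟨Metric.ball_subset_closedBall hy, hsph θ⟩
      · refine ae_of_all _ fun θ _ => ?_
        have h1 : ContinuousWithinAt (fun z : (Fin k → ℂ) × ℂ => Q z.1 z.2)
          (Metric.closedBall p (ε / 4) ×ˢ Metric.sphere (p i) (ε / 2))
          (p, circleMap (p i) (ε / 2) θ) := hQ _ ⟨Metric.mem_closedBall_self (by linarith), hsph θ⟩
        have h2 : ContinuousWithinAt (fun y => Q y (circleMap (p i) (ε / 2) θ))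
            (Metric.closedBall p (ε / 4)) p :=
          h1.comp (f := fun y => (y, circleMap (p i) (ε / 2) θ)) (by fun_prop)
            fun y hy => ⟨hy, hsph θ⟩
        exact (h2.continuousAt (Metric.closedBall_mem_nhds p (by linarith))).const_smul
          (deriv (circleMap (p i) (ε / 2)) θ)
    refine (hcont2.const_mul (2 * Real.pi * Complex.I)⁻¹).congr ?_
    filter_upwards [Metric.ball_mem_nhds p (show 0 < ε / 4 by linarith)] with y hy
    exact (hform y hy).symm
  have hdoff : ∀ x ∈ poly k O, x i ≠ x j → ∀ l,
      DifferentiableAt ℂ (fun w => g (Function.update x l w)) (x l) := by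
    intro x hx hne l
    have hc : ContinuousAt (fun w => Function.update x l w) (x l) :=
      (hasDerivAt_update x l (x l)).continuousAt
    have h1 := hc.eventually (p := fun y => g y = (y i - y j)⁻¹ * f y)
      (by simp only [Function.update_eq_self]; exact hoff x hx hne)
    refine DifferentiableAt.congr_of_eventuallyEq ?_ h1
    refine DifferentiableAt.mul (DifferentiableAt.inv ?_ ?_) (hf.diff x hx l)
    · exact ((sepHolo_coord i).diff x hx l).sub ((sepHolo_coord j).diff x hx l)
    · simpa [sub_ne_zero] using hne
  refine ⟨g, ⟨hcont, fun x hx l => ?_⟩, hmul⟩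
  by_cases hne : x i = x j
  swap
  · exact hdoff x hx hne l
  by_cases hli : l = i
  · subst hli
    have : (fun w => g (Function.update x l w)) =
        dslope (fun w => f (Function.update x l w)) (x j) := by
      ext w
      simp only [g, Function.update_idem, Function.update_self, Function.update_of_ne (Ne.symm hij)]
    rw [this]
    exact ((Complex.differentiableOn_dslope (hO.mem_nhds (hx j))).2
      (hf.line hx l)).differentiableAt (hO.mem_nhds (hx l))
  have hgc : ∀ y ∈ poly k O, ContinuousAt g y := fun y hy =>
      hcont.continuousAt ((isOpen_poly hO).mem_nhds hy)
  by_cases hlj : l = j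
  · subst hlj
    -- As a function of `x_j` alone, the quotient has an isolated singularity on the diagonal,
    -- removable by continuity.
    refine (Complex.analyticAt_of_differentiable_on_punctured_nhds_of_continuousAt ?_
      ?_).differentiableAt
    · filter_upwards [self_mem_nhdsWithin, mem_nhdsWithin_of_mem_nhds (hO.mem_nhds (hx l))]
        with w hw hwO
      have := hdoff _ (update_mem_poly hx l hwO) (by
        rw [Function.update_self, Function.update_of_ne hij, hne]; exact fun h => hw h.symm) l
      simpa only [Function.update_idem, Function.update_self] using this
    · exact ContinuousAt.comp (g := g) (f := fun w => Function.update x l w)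
        (by simp only [Function.update_eq_self]; exact hgc x hx)
        (hasDerivAt_update x l (x l)).continuousAt
  obtain ⟨ε, hε, hεO⟩ := Metric.isOpen_iff.1 (isOpen_poly hO) x hx
  -- For the remaining variables, `x_i` is pushed off the diagonal by `s`. The resulting functions
  -- of `x_l` are holomorphic for `s ≠ 0` and converge locally uniformly as `s → 0`.
  let φ : ℂ → ℂ → ℂ := fun s w => g (Function.update (Function.update x i (x i + s)) l w)
  have hφm : ∀ s ∈ Metric.ball (0 : ℂ) ε, ∀ w ∈ Metric.ball (x l) ε,
      Function.update (Function.update x i (x i + s)) l w ∈ poly k O := by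
    intro s hs w hw
    refine hεO ?_
    rw [Metric.mem_ball, dist_pi_lt_iff hε]
    intro m
    by_cases hm : m = l
    · subst hm; simpa using hw
    rw [Function.update_of_ne hm]
    by_cases hm2 : m = i
    · subst hm2; simpa using hs
    · rw [Function.update_of_ne hm2]; simpa using hε
  have hφc : ContinuousOn (Function.uncurry φ) (Metric.ball 0 ε ×ˢ Metric.ball (x l) ε) := by
    refine hcont.comp (Continuous.continuousOn ?_) fun z hz => hφm z.1 hz.1 z.2 hz.2
    exact Continuous.update (Continuous.update continuous_const i (by fun_prop)) l continuous_snd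
  have hlim : TendstoLocallyUniformlyOn φ (φ 0) (nhdsWithin 0 {0}ᶜ) (Metric.ball (x l) ε) := by
    rw [tendstoLocallyUniformlyOn_iff_forall_isCompact Metric.isOpen_ball]
    intro K hK hKc u hu
    obtain ⟨v, hv, hvu⟩ := hKc.mem_uniformity_of_prod (f := φ) (s := Metric.ball 0 ε) (q := 0)
      (hφc.mono (prod_mono_right hK)) (Metric.mem_ball_self hε) (symm_le_uniformity hu)
    rw [(Metric.isOpen_ball.mem_nhds (Metric.mem_ball_self hε) |> nhdsWithin_eq_nhds.2)] at hv
    filter_upwards [mem_nhdsWithin_of_mem_nhds hv] with s hs w hw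
    exact hvu s hs w hw
  have hd : DifferentiableOn ℂ (φ 0) (Metric.ball (x l) ε) := by
    refine hlim.differentiableOn ?_ Metric.isOpen_ball
    filter_upwards [self_mem_nhdsWithin, mem_nhdsWithin_of_mem_nhds (Metric.ball_mem_nhds 0 hε)]
      with s hs hsε w hw
    have := hdoff _ (hφm s hsε w hw) (by
      rw [Function.update_of_ne (Ne.symm hli), Function.update_self,
        Function.update_of_ne (Ne.symm hlj), Function.update_of_ne (Ne.symm hij), hne]
      intro h; exact hs (by simpa using h)) l
    simp only [Function.update_idem, Function.update_self] at this
    exact this.differentiableWithinAt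
  have h3 := hd.differentiableAt (Metric.ball_mem_nhds (x l) hε)
  simpa [φ] using h3

/-- The factors are divided out one by one. The partial quotient still vanishes on the next
diagonal: a point of it is a limit of points of the same diagonal at which no earlier factor
vanishes, and there the quotient is zero because `f` is. -/
theorem SepHolo.exists_eq_vandermonde_mul (hO : IsOpen O) (hf : SepHolo f O)
    (h0 : ∀ i j, i ≠ j → ∀ x ∈ poly k O, x i = x j → f x = 0) :
    ∃ g, SepHolo g O ∧ ∀ x ∈ poly k O, f x = vandermonde x * g x := by
  classical
  have key : ∀ s : Finset (Σ _ : Fin k, Fin k), (∀ p ∈ s, p.1 < p.2) →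
      ∃ g, SepHolo g O ∧ ∀ x ∈ poly k O, f x = (∏ p ∈ s, (x p.1 - x p.2)) * g x := by
    intro s
    induction s using Finset.induction_on with
    | empty => exact fun _ => ⟨f, hf, by simp⟩
    | insert p s hps ih =>
      intro hs
      obtain ⟨g, hg, hfg⟩ := ih fun q hq => hs q (Finset.mem_insert_of_mem hq)
      obtain ⟨i, j⟩ := p
      have hij : i < j := hs ⟨i, j⟩ (Finset.mem_insert_self _ _)
      obtain ⟨g', hg', hgg⟩ := hg.exists_eq_sub_mul hO hij.ne (by
        intro x hx hxij
        -- A direction with `v i = v j` and all other coincidences excluded: `x + t v` stays on the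
        -- diagonal `x_i = x_j` and leaves the other diagonals for small `t ≠ 0`.
        let v : Fin k → ℂ := fun l => if l = i then (j : ℕ) else (l : ℕ)
        have hv : ∀ a b, a ≠ b → v a = v b → (a = i ∧ b = j) ∨ (a = j ∧ b = i) := by
          intro a b hab h
          simp only [v] at h
          split_ifs at h with h1 h2 h2
          · exact absurd (h1.trans h2.symm) hab
          · left; exact ⟨h1, (Fin.ext (by exact_mod_cast h)).symm⟩
          · right; exact ⟨Fin.ext (by exact_mod_cast h), h2⟩
          · exact absurd (Fin.ext (by exact_mod_cast h)) hab
        have hcurve : Filter.Tendsto (fun t : ℂ => x + t • v) (nhdsWithin 0 {0}ᶜ) (nhds x) := by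
          have h1 : Continuous fun t : ℂ => x + t • v := by fun_prop
          have h2 := h1.tendsto 0
          rw [zero_smul, add_zero] at h2
          exact h2.mono_left nhdsWithin_le_nhds
        have hne : ∀ q ∈ s, ∀ᶠ t in nhdsWithin (0 : ℂ) {0}ᶜ,
            (x + t • v) q.1 - (x + t • v) q.2 ≠ 0 := by
          intro q hq
          have hq' := hs q (Finset.mem_insert_of_mem hq)
          have hvq : v q.1 - v q.2 ≠ 0 := by
            intro h
            rcases hv q.1 q.2 hq'.ne (sub_eq_zero.1 h) with ⟨h1, h2⟩ | ⟨h1, h2⟩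
            · exact hps (by rw [← h1, ← h2]; exact hq)
            · rw [h1, h2] at hq'; exact absurd hij (not_lt.2 hq'.le)
          have hfun : ∀ t : ℂ, (x + t • v) q.1 - (x + t • v) q.2 =
              (x q.1 - x q.2) + t * (v q.1 - v q.2) := fun t => by
            simp only [Pi.add_apply, Pi.smul_apply, smul_eq_mul]; ring
          simp only [hfun]
          by_cases hxq : x q.1 - x q.2 = 0
          · filter_upwards [self_mem_nhdsWithin] with t ht
            rw [hxq, zero_add]; exact mul_ne_zero ht hvq
          · have h1 : ContinuousAt (fun t : ℂ => (x q.1 - x q.2) + t * (v q.1 - v q.2)) 0 := by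
              fun_prop
            exact (h1.eventually_ne (by simpa using hxq)).filter_mono nhdsWithin_le_nhds
        have hzero : ∀ᶠ t in nhdsWithin (0 : ℂ) {0}ᶜ, g (x + t • v) = 0 := by
          filter_upwards [(Finset.eventually_all s).2 hne,
            hcurve ((isOpen_poly hO).mem_nhds hx)] with t ht htO
          have h1 := hfg _ htO
          rw [h0 i j hij.ne _ htO (by simp [v, hij.ne', hxij])] at h1
          exact (mul_eq_zero.1 h1.symm).resolve_left (Finset.prod_ne_zero_iff.2 ht)
        have hgc := (hg.cont.continuousAt ((isOpen_poly hO).mem_nhds hx)).tendsto.comp hcurve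
        exact tendsto_nhds_unique hgc (tendsto_const_nhds.congr' (hzero.mono fun t ht => ht.symm)))
      refine ⟨g', hg', fun x hx => ?_⟩
      rw [hfg x hx, hgg x hx, Finset.prod_insert hps]; ring
  obtain ⟨g, hg, h⟩ := key (Finset.univ.sigma fun i => Finset.Ioi i) (by simp)
  refine ⟨g, hg, fun x hx => ?_⟩
  rw [h x hx, vandermonde, Finset.prod_sigma]

/-! ### The identity theorem -/

/-- The one-variable identity theorem is applied coordinate by coordinate; `s` collects the
coordinates already freed from the sets `J j`. -/
theorem SepHolo.eq_zero_of_frequently (hO : IsOpen O) (hOc : IsPreconnected O) (hf : SepHolo f O)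
    {J : Fin k → Set ℂ} (hJO : ∀ j, J j ⊆ O)
    (hJ : ∀ j, ∃ z ∈ O, ∃ᶠ w in nhdsWithin z {z}ᶜ, w ∈ J j)
    (h0 : ∀ x : Fin k → ℂ, (∀ j, x j ∈ J j) → f x = 0) : ∀ x ∈ poly k O, f x = 0 := by
  classical
  have key : ∀ s : Finset (Fin k), ∀ x : Fin k → ℂ, (∀ j ∈ s, x j ∈ O) → (∀ j ∉ s, x j ∈ J j) →
      f x = 0 := by
    intro s
    induction s using Finset.induction_on with
    | empty => exact fun x _ h => h0 x fun j => h j (by simp)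
    | insert j s hj ih =>
      intro x hx hxJ
      obtain ⟨z, hz, hfr⟩ := hJ j
      have hxO : x ∈ poly k O := fun i => by
        by_cases hi : i ∈ insert j s
        exacts [hx i hi, hJO i (hxJ i hi)]
      have han := (hf.line hxO j).analyticOnNhd hO
      have hfr' : ∃ᶠ w in nhdsWithin z {z}ᶜ, f (Function.update x j w) = 0 := by
        refine hfr.mono fun w hw => ih _ (fun i hi => ?_) fun i hi => ?_
        · rw [Function.update_of_ne (by rintro rfl; exact hj hi)]
          exact hx i (Finset.mem_insert_of_mem hi)
        · by_cases hij : i = j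
          · subst hij; simpa using hw
          · rw [Function.update_of_ne hij]; exact hxJ i (by simp [hij, hi])
      have := han.eqOn_zero_of_preconnected_of_frequently_eq_zero hOc hz hfr' (hxO j)
      simpa using this
  exact fun x hx => key Finset.univ x (fun j _ => hx j) (by simp)

/-! ### The Möbius map and the cross term -/

section Mobius

variable {q ν : ℝ}

theorem one_sub_mul_pos (hq0 : 0 < q) (hq1 : q < 1) (hν1 : ν < 1) :
    0 < 1 - q * ν := by nlinarith

theorem one_sub_nu_ne (hν1 : ν < 1) : (1 : ℂ) - ν ≠ 0 := by
  rw [sub_ne_zero]; exact_mod_cast hν1.ne'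

theorem one_sub_mul_ne (hq0 : 0 < q) (hq1 : q < 1) (hν1 : ν < 1) :
    (1 : ℂ) - q * ν ≠ 0 := by
  have := (one_sub_mul_pos hq0 hq1 hν1).ne'
  exact_mod_cast this

theorem one_sub_nu_xi {z : ℂ} (hz : 1 - ν * z ≠ 0) :
    1 - ν * xi ν z = (1 - ν) / (1 - ν * z) := by
  rw [xi]; field_simp; ring

theorem one_sub_nu_xi_ne (hν1 : ν < 1) {z : ℂ} (hz : 1 - ν * z ≠ 0) : 1 - ν * xi ν z ≠ 0 := by
  rw [one_sub_nu_xi hz]; exact div_ne_zero (one_sub_nu_ne hν1) hz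

theorem xi_xi (hν1 : ν < 1) {z : ℂ} (hz : 1 - ν * z ≠ 0) : xi ν (xi ν z) = z := by
  have h1 := one_sub_nu_ne hν1
  have h2 : 1 - xi ν z = (1 - ν) * z / (1 - ν * z) := by
    rw [xi, eq_div_iff hz, sub_mul, div_mul_cancel₀ _ hz]; ring
  rw [xi, one_sub_nu_xi hz, h2, div_div_div_cancel_right₀ hz, mul_div_cancel_left₀ _ h1]

theorem xi_sub_xi {z w : ℂ} (hz : 1 - ν * z ≠ 0) (hw : 1 - ν * w ≠ 0) :
    xi ν z - xi ν w = -(1 - ν) * (z - w) / ((1 - ν * z) * (1 - ν * w)) := by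
  rw [xi, xi, div_sub_div _ _ hz hw]; congr 1; ring

/-- In the variables `z` the cross term is `z - q w`, up to a constant and factors of one variable
each. Its zeros are thus the pairs `x, y` with `Ξ x = q Ξ y`. -/
theorem crossS_xi (hq0 : 0 < q) (hq1 : q < 1) (hν1 : ν < 1) {z w : ℂ}
    (hz : 1 - ν * z ≠ 0) (hw : 1 - ν * w ≠ 0) :
    crossS q ν (xi ν z) (xi ν w) =
      (1 - ν) ^ 2 * (z - q * w) / ((1 - q * ν) * ((1 - ν * z) * (1 - ν * w))) := by
  have := one_sub_mul_ne hq0 hq1 hν1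
  rw [crossS, xi, xi]; field_simp; ring

/-- The points `xi (q ^ s)`. -/
noncomputable def node (q ν : ℝ) (s : ℕ) : ℂ := xi ν ((q : ℂ) ^ s)

theorem one_sub_nu_pow_pos (hq0 : 0 < q) (hq1 : q < 1) (hν0 : 0 ≤ ν) (hν1 : ν < 1) (s : ℕ) :
    0 < 1 - ν * q ^ s := by
  have := pow_le_one₀ (n := s) hq0.le hq1.le
  nlinarith

theorem one_sub_nu_pow_ne (hq0 : 0 < q) (hq1 : q < 1) (hν0 : 0 ≤ ν) (hν1 : ν < 1) (s : ℕ) :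
    (1 : ℂ) - ν * q ^ s ≠ 0 := by
  have := (one_sub_nu_pow_pos hq0 hq1 hν0 hν1 s).ne'
  exact_mod_cast this

theorem norm_node_le (hq0 : 0 < q) (hq1 : q < 1) (hν0 : 0 ≤ ν) (hν1 : ν < 1) (s : ℕ) :
    ‖node q ν s‖ ≤ 1 := by
  have h : node q ν s = ((1 - q ^ s) / (1 - ν * q ^ s) : ℝ) := by
    rw [node, xi]; push_cast; rfl
  have h1 := one_sub_nu_pow_pos hq0 hq1 hν0 hν1 s
  have h2 := pow_le_one₀ (n := s) hq0.le hq1.le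
  have h3 := pow_nonneg hq0.le s
  rw [h, Complex.norm_real, Real.norm_of_nonneg (div_nonneg (by linarith) h1.le), div_le_one h1]
  nlinarith

/-- For `y = Ξ(q^s)` the zero in `x` lies at `Ξ(q^(s+1))`. A residue taken at one node therefore
moves the poles of the other variables of its cluster to the next node. -/
theorem crossS_node (hq0 : 0 < q) (hq1 : q < 1) (hν0 : 0 ≤ ν) (hν1 : ν < 1) (s : ℕ) (x : ℂ) :
    crossS q ν x (node q ν s) = (1 - ν) * (1 - ν * q ^ (s + 1)) /
      ((1 - q * ν) * (1 - ν * q ^ s)) * (node q ν (s + 1) - x) := by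
  have h0 := one_sub_mul_ne hq0 hq1 hν1
  have h1 := one_sub_nu_pow_ne hq0 hq1 hν0 hν1 s
  have h2 := one_sub_nu_pow_ne hq0 hq1 hν0 hν1 (s + 1)
  rw [crossS, node, node, xi, xi]
  field_simp
  rw [pow_succ]
  ring

end Mobius

/-! ### Products over pairs and permutations -/

section Pairs

variable {k : ℕ}

theorem prod_Iio_eq_prod_ite (F : Fin k → Fin k → ℂ) (p : Fin k → Fin k → Prop)
    [∀ A B, Decidable (p A B)] :
    ∏ A, ∏ B ∈ Finset.Iio A with p A B, F A B =
      ∏ x : Fin k × Fin k, if x.2 < x.1 ∧ p x.1 x.2 then F x.1 x.2 else 1 := by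
  rw [Fintype.prod_prod_type]
  refine Finset.prod_congr rfl fun A _ => ?_
  rw [← Finset.prod_filter]
  refine Finset.prod_congr ?_ fun _ _ => rfl
  ext B; simp

theorem prod_pairs_perm (G : Fin k → Fin k → ℂ) (σ : Equiv.Perm (Fin k)) :
    ∏ x : Fin k × Fin k, G (σ x.1) (σ x.2) = ∏ x : Fin k × Fin k, G x.1 x.2 :=
  Equiv.prod_comp (Equiv.prodCongr σ σ) fun x => G x.1 x.2

theorem prod_pairs_eq_prod_lt (G : Fin k → Fin k → ℂ) (hG : ∀ a, G a a = 1) :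
    ∏ x : Fin k × Fin k, G x.1 x.2 = ∏ A, ∏ B ∈ Finset.Iio A, G A B * G B A := by
  have h1 : ∀ x : Fin k × Fin k, G x.1 x.2 =
      (if x.2 < x.1 then G x.1 x.2 else 1) * (if x.1 < x.2 then G x.1 x.2 else 1) := by
    rintro ⟨a, b⟩
    rcases lt_trichotomy a b with h | h | h
    · simp [h, h.le]
    · subst h; simp [hG]
    · simp [h, h.le]
  have h2 := prod_Iio_eq_prod_ite G (fun _ _ => True)
  have h3 := prod_Iio_eq_prod_ite (fun A B => G B A) (fun _ _ => True)
  simp only [Finset.filter_true, and_true] at h2 h3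
  rw [Finset.prod_congr rfl fun x _ => h1 x, Finset.prod_mul_distrib, ← h2]
  simp only [Finset.prod_mul_distrib]
  congr 1
  rw [h3]
  exact Equiv.prod_comp (Equiv.prodComm (Fin k) (Fin k)) fun x : Fin k × Fin k =>
    if x.2 < x.1 then G x.2 x.1 else 1

/-- Relabelling by `σ` runs through every unordered pair once; the order of its two entries is kept
exactly when `σ⁻¹` keeps it. -/
theorem prod_pairs_comp_perm (F : Fin k → Fin k → ℂ) (σ : Equiv.Perm (Fin k)) :
    ∏ A, ∏ B ∈ Finset.Iio A, F (σ B) (σ A) =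
      ∏ A, ∏ B ∈ Finset.Iio A, if σ.symm B < σ.symm A then F B A else F A B := by
  have h2 := prod_Iio_eq_prod_ite (fun A B => F (σ B) (σ A)) (fun _ _ => True)
  simp only [Finset.filter_true, and_true] at h2
  rw [h2]
  have h4 := prod_pairs_perm (fun a b => if σ.symm b < σ.symm a then F b a else 1) σ
  simp only [Equiv.symm_apply_apply] at h4
  rw [h4, prod_pairs_eq_prod_lt
    (fun a b => if σ.symm b < σ.symm a then F b a else 1) (by simp)]
  refine Finset.prod_congr rfl fun A _ => Finset.prod_congr rfl fun B hB => ?_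
  have : σ.symm B ≠ σ.symm A := σ.symm.injective.ne (Finset.mem_Iio.1 hB).ne
  rcases lt_or_gt_of_ne this with h | h
  · simp [h, h.le]
  · simp [h.not_gt, h]

/-- As `n` is antitone, the pairs `B < A` from different clusters are those with `n A < n B`, a
condition that does not change under a permutation preserving `n`. -/
theorem prod_cross_perm (F : Fin k → Fin k → ℂ) {n : Fin k → ℤ} (hn : Antitone n)
    {σ : Equiv.Perm (Fin k)} (hσ : ∀ i, n (σ i) = n i) :
    ∏ A, ∏ B ∈ Finset.Iio A with ¬ n B = n A, F (σ B) (σ A) =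
      ∏ A, ∏ B ∈ Finset.Iio A with ¬ n B = n A, F B A := by
  have h : ∀ A B : Fin k, (B < A ∧ ¬ n B = n A) ↔ n A < n B := fun A B =>
    ⟨fun h => lt_of_le_of_ne (hn h.1.le) (Ne.symm h.2),
      fun h => ⟨not_le.1 fun h' => absurd (hn h') (not_le.2 h), h.ne'⟩⟩
  rw [prod_Iio_eq_prod_ite (fun A B => F (σ B) (σ A)) fun A B => ¬ n B = n A,
    prod_Iio_eq_prod_ite (fun A B => F B A) fun A B => ¬ n B = n A]
  simp only [h]
  have := prod_pairs_perm (fun a b => if n a < n b then F b a else 1) σ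
  simpa only [hσ] using this

theorem vandermonde_eq_prod_Iio (x : Fin k → ℂ) :
    vandermonde x = ∏ A, ∏ B ∈ Finset.Iio A, (x B - x A) := by
  rw [vandermonde]
  exact Finset.prod_comm' (by simp)

theorem prod_sub_perm (x : Fin k → ℂ) (σ : Equiv.Perm (Fin k)) :
    ∏ A, ∏ B ∈ Finset.Iio A, (x (σ B) - x (σ A)) =
      sgn σ * ∏ A, ∏ B ∈ Finset.Iio A, (x B - x A) := by
  have := Equiv.Perm.prod_Iio_comp_eq_sign_mul_prod (R := ℂ) σ (f := fun i j => x i - x j)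
    (fun _ _ => by ring)
  rw [this, sgn]

theorem vandermonde_perm (x : Fin k → ℂ) (σ : Equiv.Perm (Fin k)) :
    vandermonde (fun j => x (σ j)) = sgn σ * vandermonde x := by
  rw [vandermonde_eq_prod_Iio, vandermonde_eq_prod_Iio, prod_sub_perm]

theorem sgn_mul_self (σ : Equiv.Perm (Fin k)) : sgn σ * sgn σ = 1 := by
  rw [sgn]; rcases Int.units_eq_one_or (Equiv.Perm.sign σ) with h | h <;> simp [h]

theorem sgn_mul (σ τ : Equiv.Perm (Fin k)) : sgn (σ * τ) = sgn σ * sgn τ := by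
  simp [sgn]

theorem vandermonde_ne_zero {x : Fin k → ℂ} (hx : Function.Injective x) : vandermonde x ≠ 0 :=
  Finset.prod_ne_zero_iff.2 fun _ _ => Finset.prod_ne_zero_iff.2 fun _ hj =>
    sub_ne_zero.2 (hx.ne (Finset.mem_Ioi.1 hj).ne)

theorem vandermonde_eq_zero {x : Fin k → ℂ} {i j : Fin k} (hij : i ≠ j) (h : x i = x j) :
    vandermonde x = 0 := by
  rcases lt_or_gt_of_ne hij with hlt | hlt
  · exact Finset.prod_eq_zero (Finset.mem_univ i) (Finset.prod_eq_zero (Finset.mem_Ioi.2 hlt)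
      (sub_eq_zero.2 h))
  · exact Finset.prod_eq_zero (Finset.mem_univ j) (Finset.prod_eq_zero (Finset.mem_Ioi.2 hlt)
      (sub_eq_zero.2 h.symm))

end Pairs

/-! ### Sums over Young subgroups -/

/-- Lagrange interpolation of `P = ∏ (X - q z_l) - ∏ (X - z_l)`, whose leading terms cancel, at the
points `z_l`, evaluated at `0`. At the nodes `P(z_p) = (1 - q) z_p ∏ (z_p - q z_l)` over `l ≠ p`,
while `P(0)` is `q^|s| - 1` times `∏ z_l` up to sign. -/
theorem sum_prod_div_sub {ι : Type*} [DecidableEq ι] (s : Finset ι) {z : ι → ℂ}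
    (hz : Set.InjOn z s) (h0 : ∀ i ∈ s, z i ≠ 0) {q : ℂ} (hq : q ≠ 1) :
    ∑ p ∈ s, ∏ l ∈ s.erase p, (z p - q * z l) / (z p - z l) = (1 - q ^ s.card) / (1 - q) := by
  have hq' : 1 - q ≠ 0 := sub_ne_zero.2 hq.symm
  let P : Polynomial ℂ := ∏ l ∈ s, (Polynomial.X - Polynomial.C (q * z l)) -
    ∏ l ∈ s, (Polynomial.X - Polynomial.C (z l))
  have hdeg : P.degree < s.card := by
    rcases s.eq_empty_or_nonempty with rfl | hs
    · simp [P]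
    have h1 : (∏ l ∈ s, (Polynomial.X - Polynomial.C (q * z l))).degree = (s.card : WithBot ℕ) := by
      rw [Polynomial.degree_prod, Finset.sum_congr rfl fun l _ => Polynomial.degree_X_sub_C _]
      simp
    have h2 : (∏ l ∈ s, (Polynomial.X - Polynomial.C (z l))).degree = (s.card : WithBot ℕ) := by
      rw [Polynomial.degree_prod]; simp
    rw [← h1]
    refine Polynomial.degree_sub_lt_left (h1.trans h2.symm) ?_ ?_
    · exact (Polynomial.monic_prod_of_monic _ _ fun l _ => Polynomial.monic_X_sub_C _).ne_zero
    · rw [(Polynomial.monic_prod_of_monic _ _ fun l _ => Polynomial.monic_X_sub_C _).leadingCoeff,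
        (Polynomial.monic_prod_of_monic _ _ fun l _ => Polynomial.monic_X_sub_C _).leadingCoeff]
  have hinterp := Lagrange.eq_interpolate hz hdeg
  have hev := congrArg (Polynomial.eval 0) hinterp
  rw [Lagrange.interpolate_apply, Polynomial.eval_finsetSum] at hev
  have hP0 : P.eval 0 = (-1) ^ s.card * (q ^ s.card - 1) * ∏ l ∈ s, z l := by
    simp only [P, Polynomial.eval_sub, Polynomial.eval_prod, Polynomial.eval_X, Polynomial.eval_C,
      zero_sub]
    rw [Finset.prod_congr rfl fun l _ => (neg_one_mul (q * z l)).symm,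
      Finset.prod_congr rfl fun l _ => (neg_one_mul (z l)).symm, Finset.prod_mul_distrib,
      Finset.prod_mul_distrib, Finset.prod_mul_distrib, Finset.prod_const, Finset.prod_const]
    ring
  have hterm : ∀ p ∈ s, Polynomial.eval 0
      (Polynomial.C (P.eval (z p)) * Lagrange.basis s z p) =
      (1 - q) * (-1) ^ (s.card - 1) * (∏ l ∈ s, z l) *
        ∏ l ∈ s.erase p, (z p - q * z l) / (z p - z l) := by
    intro p hp
    have h1 : P.eval (z p) = (1 - q) * z p * ∏ l ∈ s.erase p, (z p - q * z l) := by
      simp only [P, Polynomial.eval_sub, Polynomial.eval_prod, Polynomial.eval_X,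
        Polynomial.eval_C]
      rw [Finset.prod_eq_zero (f := fun l => z p - z l) hp (sub_self _), sub_zero,
        ← Finset.mul_prod_erase s _ hp]
      ring
    rw [Polynomial.eval_mul, Polynomial.eval_C, h1, Lagrange.basis, Polynomial.eval_prod,
      ← Finset.mul_prod_erase s z hp]
    have h2 : ∏ l ∈ s.erase p, Polynomial.eval 0 (Lagrange.basisDivisor (z p) (z l)) =
        (-1) ^ (s.card - 1) * ((∏ l ∈ s.erase p, z l) * ∏ l ∈ s.erase p, (z p - z l)⁻¹) := by
      rw [← Finset.card_erase_of_mem hp, ← Finset.prod_const, ← Finset.prod_mul_distrib,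
        ← Finset.prod_mul_distrib]
      refine Finset.prod_congr rfl fun l _ => ?_
      simp [Lagrange.basisDivisor]; ring
    rw [h2]
    simp only [div_eq_mul_inv, Finset.prod_mul_distrib]
    ring
  rw [Finset.sum_congr rfl hterm, ← Finset.mul_sum, hP0] at hev
  rcases s.eq_empty_or_nonempty with rfl | hs
  · simp
  have hprod : ∏ l ∈ s, z l ≠ 0 := Finset.prod_ne_zero_iff.2 h0
  obtain ⟨c, hc⟩ : ∃ c, s.card = c + 1 := ⟨s.card - 1, by have := hs.card_pos; omega⟩
  rw [hc] at hev ⊢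
  rw [eq_div_iff hq']
  have hm : ((-1 : ℂ)) ^ c ≠ 0 := pow_ne_zero _ (by norm_num)
  refine mul_left_cancel₀ (mul_ne_zero hm hprod) ?_
  rw [Nat.add_sub_cancel, pow_succ] at hev
  linear_combination (-1 : ℂ) * hev

/-- The number of coordinates after the `A`-th one that are equal to it. -/
def countAfter {k : ℕ} (n : Fin k → ℤ) (A : Fin k) : ℕ :=
  (Finset.univ.filter fun B => A < B ∧ n B = n A).card

/-- The number of coordinates before the `A`-th one that are equal to it. -/
def countBefore {k : ℕ} (n : Fin k → ℤ) (A : Fin k) : ℕ :=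
  (Finset.univ.filter fun B => B < A ∧ n B = n A).card

/-- Induction on `k` by the image `p` of the first coordinate. The pairs that contain coordinate `0`
give the summand of `sum_prod_div_sub` for its cluster; the remaining pairs give the same sum over
the other `k` variables, whose value does not depend on which variables are left. -/
theorem sum_young (k : ℕ) (n : Fin k → ℤ) {z : Fin k → ℂ} (hz : Function.Injective z)
    (h0 : ∀ i, z i ≠ 0) {q : ℂ} (hq : q ≠ 1) :
    ∑ σ : Equiv.Perm (Fin k) with ∀ i, n (σ i) = n i,
      ∏ A, ∏ B ∈ Finset.Iio A with n B = n A,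
        (z (σ B) - q * z (σ A)) / (z (σ B) - z (σ A)) =
      ∏ A, (1 - q ^ (countAfter n A + 1)) / (1 - q) := by
  classical
  induction k with
  | zero => simp
  | succ k ih =>
    rw [Finset.sum_filter, ← Equiv.sum_comp Equiv.Perm.decomposeFin.symm, Fintype.sum_prod_type]
    have hterm : ∀ p : Fin (k + 1), ∑ e : Equiv.Perm (Fin k),
        (if ∀ i, n (Equiv.Perm.decomposeFin.symm (p, e) i) = n i then
          ∏ A, ∏ B ∈ Finset.Iio A with n B = n A,
            (z (Equiv.Perm.decomposeFin.symm (p, e) B) -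
              q * z (Equiv.Perm.decomposeFin.symm (p, e) A)) /
            (z (Equiv.Perm.decomposeFin.symm (p, e) B) -
              z (Equiv.Perm.decomposeFin.symm (p, e) A)) else 0) =
        if n p = n 0 then (∏ l ∈ (Finset.univ.filter fun l => n l = n 0).erase p,
          (z p - q * z l) / (z p - z l)) *
            ∏ A : Fin k, (1 - q ^ (countAfter (fun i => n i.succ) A + 1)) / (1 - q) else 0 := by
      intro p
      split_ifs with hp
      swap
      · refine Finset.sum_eq_zero fun e _ => if_neg fun h => hp ?_
        have := h 0
        rwa [Equiv.Perm.decomposeFin_symm_apply_zero] at this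
      have hz' : Function.Injective fun i : Fin k => z (Equiv.swap 0 p i.succ) := fun i j hij =>
        Fin.succ_injective _ ((Equiv.swap 0 p).injective (hz hij))
      have hn : ∀ i, n (Equiv.swap 0 p i) = n i := by
        intro i
        by_cases h1 : i = 0
        · subst h1; simpa using hp
        by_cases h2 : i = p
        · subst h2; simpa using hp.symm
        · rw [Equiv.swap_apply_of_ne_of_ne h1 h2]
      rw [← ih (fun i => n i.succ) hz' (fun i => h0 _), Finset.sum_filter, Finset.mul_sum]
      refine Finset.sum_congr rfl fun e _ => ?_
      -- Preserving `n` means `n p = n 0` together with the same condition on `e`, since the swap of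
      -- `0` and `p` stays within a cluster.
      have hcond : (∀ i, n (Equiv.Perm.decomposeFin.symm (p, e) i) = n i) ↔
          ∀ i, n (e i).succ = n i.succ := by
        rw [Fin.forall_fin_succ]
        simp [Equiv.Perm.decomposeFin_symm_apply_zero, Equiv.Perm.decomposeFin_symm_apply_succ,
          hn, hp]
      simp only [hcond]
      split_ifs with he
      swap
      · simp
      rw [prod_Iio_eq_prod_ite (fun A B => (z (Equiv.Perm.decomposeFin.symm (p, e) B) -
              q * z (Equiv.Perm.decomposeFin.symm (p, e) A)) /
            (z (Equiv.Perm.decomposeFin.symm (p, e) B) -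
              z (Equiv.Perm.decomposeFin.symm (p, e) A))) fun A B => n B = n A,
        Fintype.prod_prod_type, Fin.prod_univ_succ]
      have h1 : ∏ y : Fin (k + 1), (if y < 0 ∧ n y = n 0 then
          (z (Equiv.Perm.decomposeFin.symm (p, e) y) -
              q * z (Equiv.Perm.decomposeFin.symm (p, e) 0)) /
            (z (Equiv.Perm.decomposeFin.symm (p, e) y) -
              z (Equiv.Perm.decomposeFin.symm (p, e) 0)) else 1) = 1 :=
        Finset.prod_eq_one fun y _ => if_neg fun h => by simp at h
      rw [h1, one_mul]
      simp only [Fin.prod_univ_succ (n := k), Finset.prod_mul_distrib]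
      congr 1
      · simp only [Fin.succ_pos, true_and, Equiv.Perm.decomposeFin_symm_apply_zero,
          Equiv.Perm.decomposeFin_symm_apply_succ]
        have h2 : ∀ l : Fin k, (n 0 = n l.succ) ↔ n (Equiv.swap 0 p (e l).succ) = n 0 := by
          intro l; rw [hn, he]; exact eq_comm
        simp only [h2]
        rw [Equiv.prod_comp e fun l => if n (Equiv.swap 0 p l.succ) = n 0 then
          (z p - q * z (Equiv.swap 0 p l.succ)) / (z p - z (Equiv.swap 0 p l.succ)) else 1]
        have h3 : (Finset.univ.filter fun l => n l = n 0).erase p =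
            (Finset.univ.erase p).filter fun l => n l = n 0 := by
          ext l; simp
        rw [h3, Finset.prod_filter]
        have h4 : (Finset.univ.erase p : Finset (Fin (k + 1))) =
            (Finset.univ : Finset (Fin k)).image fun l => Equiv.swap 0 p l.succ := by
          ext l
          simp only [Finset.mem_erase, Finset.mem_univ, and_true, Finset.mem_image, true_and]
          constructor
          · intro hl
            have : Equiv.swap 0 p l ≠ 0 := fun h => hl (by
              rw [← Equiv.swap_apply_self 0 p l, h, Equiv.swap_apply_left])
            obtain ⟨m, hm⟩ := Fin.exists_succ_eq.2 this
            exact ⟨m, by rw [hm, Equiv.swap_apply_self]⟩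
          · rintro ⟨m, rfl⟩ h
            have : m.succ = 0 := by
              rw [← Equiv.swap_apply_self 0 p m.succ, h, Equiv.swap_apply_right]
            exact Fin.succ_ne_zero m this
        rw [h4, Finset.prod_image]
        intro i _ j _ hij
        exact Fin.succ_injective _ ((Equiv.swap 0 p).injective hij)
      · rw [prod_Iio_eq_prod_ite (fun A B => (z (Equiv.swap 0 p (e B).succ) -
              q * z (Equiv.swap 0 p (e A).succ)) /
            (z (Equiv.swap 0 p (e B).succ) - z (Equiv.swap 0 p (e A).succ)))
            fun A B => n B.succ = n A.succ, Fintype.prod_prod_type]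
        refine Finset.prod_congr rfl fun A _ => Finset.prod_congr rfl fun B _ => ?_
        simp only [Fin.succ_lt_succ_iff, Equiv.Perm.decomposeFin_symm_apply_succ]
    rw [Finset.sum_congr rfl fun p _ => hterm p, ← Finset.sum_filter, ← Finset.sum_mul,
      sum_prod_div_sub _ hz.injOn (fun i _ => h0 i) hq, Fin.prod_univ_succ]
    congr 1
    · have : countAfter n 0 + 1 = (Finset.univ.filter fun l => n l = n 0).card := by
        rw [countAfter, ← Finset.card_erase_add_one (s := Finset.univ.filter fun l => n l = n 0)
          (a := 0) (by simp)]
        congr 2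
        ext l
        simp [Fin.pos_iff_ne_zero]
      rw [this]
    · refine Finset.prod_congr rfl fun A _ => ?_
      have : countAfter n A.succ = countAfter (fun i => n i.succ) A := by
        rw [countAfter, countAfter, ← Finset.card_map (Fin.succEmb k)]
        congr 1
        ext l
        simp only [Finset.mem_filter, Finset.mem_univ, true_and, Finset.mem_map]
        constructor
        · rintro ⟨h1, h2⟩
          obtain ⟨m, rfl⟩ := Fin.exists_succ_eq.2 ((Fin.zero_le _).trans_lt h1).ne'
          exact ⟨m, ⟨Fin.succ_lt_succ_iff.1 h1, h2⟩, rfl⟩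
        · rintro ⟨m, ⟨h1, h2⟩, rfl⟩
          exact ⟨Fin.succ_lt_succ_iff.2 h1, h2⟩
      rw [this]

/-! ### The weight of the clusters -/

/-- The index `j ≤ i` is the one at which `π` is largest on the initial segment. The values of `π`
there are distinct and at most `π j`, so `i ≤ π j` by counting. -/
theorem exists_prefix_max {k : ℕ} (π : Equiv.Perm (Fin k)) (i : Fin k) :
    ∃ j ≤ i, (∀ l < j, π l < π j) ∧ i ≤ π j ∧ π i ≤ π j := by
  obtain ⟨j, hj, hmax⟩ := Finset.exists_max_image (Finset.Iic i) π ⟨i, by simp⟩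
  rw [Finset.mem_Iic] at hj
  refine ⟨j, hj, fun l hl => ?_, ?_, hmax i (by simp)⟩
  · exact lt_of_le_of_ne (hmax l (Finset.mem_Iic.2 (hl.le.trans hj))) (π.injective.ne hl.ne)
  · have h := Finset.card_le_card_of_injOn (s := Finset.Iic i) (t := Finset.Iic (π j)) π
      (fun l hl => Finset.mem_Iic.2 (hmax l hl)) π.injective.injOn
    rw [Fin.card_Iic, Fin.card_Iic] at h
    exact Fin.le_def.2 (by omega)

theorem exists_suffix_min {k : ℕ} (π : Equiv.Perm (Fin k)) (i : Fin k) :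
    ∃ j, i ≤ j ∧ (∀ l, j < l → π j < π l) ∧ π j ≤ i ∧ π j ≤ π i := by
  obtain ⟨j, hj, hmin⟩ := Finset.exists_min_image (Finset.Ici i) π ⟨i, by simp⟩
  rw [Finset.mem_Ici] at hj
  refine ⟨j, hj, fun l hl => ?_, ?_, hmin i (by simp)⟩
  · exact lt_of_le_of_ne (hmin l (Finset.mem_Ici.2 (hj.trans hl.le))) (π.injective.ne hl.ne)
  · have h := Finset.card_le_card_of_injOn (s := Finset.Ici i) (t := Finset.Ici (π j)) π
      (fun l hl => Finset.mem_Ici.2 (hmin l hl)) π.injective.injOn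
    rw [Fin.card_Ici, Fin.card_Ici] at h
    exact Fin.le_def.2 (by omega)

/-- For the prefix maximum `j ≤ i ≤ π j` monotonicity gives `n i ≤ n j ≤ m (π j) ≤ m i`, and for the
suffix minimum `π l ≤ i ≤ l` it gives `m i ≤ m (π l) ≤ n l ≤ n i`. The bounds `π i ≤ π j` and `π l ≤
π i` give the same for `m (π i)`. -/
theorem eq_of_chain {k : ℕ} {n m : Fin k → ℤ} (hn : Antitone n) (hm : Antitone m)
    (π : Equiv.Perm (Fin k)) (h1 : ∀ j, (∀ l < j, π l < π j) → n j ≤ m (π j))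
    (h2 : ∀ j, (∀ l, j < l → π j < π l) → m (π j) ≤ n j) :
    m = n ∧ ∀ i, n (π i) = n i := by
  have key : ∀ i, m i = n i ∧ m (π i) = n i := by
    intro i
    obtain ⟨j, hji, hj, hj', hj''⟩ := exists_prefix_max π i
    obtain ⟨l, hil, hl, hl', hl''⟩ := exists_suffix_min π i
    have a1 := h1 j hj
    have a2 := h2 l hl
    have a3 := hn hji
    have a4 := hn hil
    have a5 := hm hj'
    have a6 := hm hl'
    have a7 := hm hj''
    have a8 := hm hl''
    constructor <;> omega
  have h := funext fun i => (key i).1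
  exact ⟨h, fun i => by rw [← h, (key i).2, ← (key i).1]⟩

theorem prod_card_gt {k : ℕ} (C : Finset (Fin k)) (ψ : ℕ → ℝ) :
    ∏ A ∈ C, ψ (C.filter fun B => A < B).card = ∏ s ∈ Finset.range C.card, ψ s := by
  induction C using Finset.induction_on_min with
  | empty => simp
  | insert a s ha ih =>
    have has : a ∉ s := fun h => lt_irrefl _ (ha a h)
    rw [Finset.prod_insert has, Finset.card_insert_of_notMem has, Finset.prod_range_succ, ← ih,
      mul_comm]
    congr 1
    · refine Finset.prod_congr rfl fun A hA => ?_
      rw [Finset.filter_insert, if_neg (ha A hA).not_gt]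
    · rw [Finset.filter_insert, if_neg (lt_irrefl _), Finset.filter_true_of_mem ha]

theorem card_cluster {k : ℕ} (n : Fin k → ℤ) (A : Fin k) :
    (Finset.univ.filter fun B => n B = n A).card = countBefore n A + countAfter n A + 1 := by
  rw [countBefore, countAfter, ← Finset.card_union_of_disjoint]
  · rw [← Finset.card_insert_of_notMem (a := A)]
    · congr 1
      ext B
      simp only [Finset.mem_filter, Finset.mem_univ, true_and, Finset.mem_insert,
        Finset.mem_union]
      rcases lt_trichotomy B A with h | h | h
      · simp [h, h.ne]
      · simp [h]
      · simp [h, h.ne']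
    · simp
  · rw [Finset.disjoint_left]
    intro B hB hB'
    simp only [Finset.mem_filter, Finset.mem_univ, true_and] at hB hB'
    exact lt_asymm hB.1 hB'.1

/-- Within a cluster of size `c` the number of later members takes each value `0, …, c - 1` once,
and the number of earlier members is complementary to it. -/
theorem prod_count_eq {k : ℕ} (n : Fin k → ℤ) (φ : ℕ → ℕ → ℝ) :
    ∏ A, φ (countAfter n A) (countBefore n A) = ∏ v ∈ Finset.univ.image n,
      ∏ s ∈ Finset.range (Finset.univ.filter fun j => n j = v).card,
        φ s ((Finset.univ.filter fun j => n j = v).card - 1 - s) := by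
  rw [← Finset.prod_fiberwise_of_maps_to (g := n) (t := Finset.univ.image n)
    (fun A hA => Finset.mem_image_of_mem n hA)]
  refine Finset.prod_congr rfl fun v _ => ?_
  rw [← prod_card_gt (Finset.univ.filter fun j => n j = v) fun s =>
    φ s ((Finset.univ.filter fun j => n j = v).card - 1 - s)]
  refine Finset.prod_congr rfl fun A hA => ?_
  have hv : n A = v := (Finset.mem_filter.1 hA).2
  subst hv
  have h1 : ((Finset.univ.filter fun j => n j = n A).filter fun B => A < B).card =
      countAfter n A := by
    rw [countAfter, Finset.filter_filter]
    congr 1; ext B; simp [and_comm]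
  rw [h1, card_cluster]
  congr 1
  omega

variable {q ν : ℝ}

/-- Passing from `c` to `c + 1` raises each exponent by one, which multiplies the product by the
telescoping quotient `u 0 / u c`. -/
theorem prod_range_ratio_pow (u : ℕ → ℝ) (hu : ∀ s, u s ≠ 0) (c : ℕ) :
    ∏ s ∈ Finset.range c, (u s / u (s + 1)) ^ (c - 1 - s) =
      u 0 ^ c / ∏ s ∈ Finset.range c, u s := by
  induction c with
  | zero => simp
  | succ c ih =>
    rw [Finset.prod_range_succ, Finset.prod_range_succ]
    have h1 : ∏ s ∈ Finset.range c, (u s / u (s + 1)) ^ (c + 1 - 1 - s) =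
        (∏ s ∈ Finset.range c, (u s / u (s + 1)) ^ (c - 1 - s)) *
          ∏ s ∈ Finset.range c, u s / u (s + 1) := by
      rw [← Finset.prod_mul_distrib]
      refine Finset.prod_congr rfl fun s hs => ?_
      rw [← pow_succ]; congr 1
      have := Finset.mem_range.1 hs
      omega
    have h3 : ∏ s ∈ Finset.range c, u s / u (s + 1) = u 0 / u c := by
      clear ih h1
      induction c with
      | zero => simp [hu 0]
      | succ c ih =>
        have := hu c
        have := hu (c + 1)
        rw [Finset.prod_range_succ, ih]; field_simp
    rw [h1, ih, h3]
    have h2 : ∏ s ∈ Finset.range c, u s ≠ 0 := Finset.prod_ne_zero_iff.2 fun s _ => hu s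
    have := hu c
    simp only [Nat.add_sub_cancel, Nat.sub_self, pow_zero, mul_one]
    field_simp
    rw [pow_succ]

theorem qPoch_pos {a : ℝ} (ha : a < 1) (hq0 : 0 < q) (hq1 : q < 1) (c : ℕ) :
    0 < qPoch a q c := by
  refine Finset.prod_pos fun i _ => ?_
  have h1 := pow_le_one₀ (n := i) hq0.le hq1.le
  have h2 : 0 < q ^ i := pow_pos hq0 i
  nlinarith

theorem stat_pos (hq0 : 0 < q) (hq1 : q < 1) (hν1 : ν < 1) {k : ℕ} (n : Weyl k) :
    0 < stat q ν n :=
  Finset.prod_pos fun _ _ => div_pos (qPoch_pos hν1 hq0 hq1 _) (qPoch_pos hq1 hq0 hq1 _)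

/-- This is why `𝔪(n)` is the right weight. In a cluster of size `c` the first factors multiply to
`(q;q)_c / (1-q)^c`, the second ones telescope to `(1-ν)^c / (ν;q)_c`. They arise from the sum over
cluster permutations and from the residues at the nodes. -/
theorem stat_mul_prod_count (hq0 : 0 < q) (hq1 : q < 1) (hν0 : 0 ≤ ν) (hν1 : ν < 1) {k : ℕ}
    (n : Weyl k) :
    stat q ν n * ((1 - q) / (1 - ν)) ^ k *
      ∏ A, ((1 - q ^ (countAfter n.1 A + 1)) / (1 - q) *
        ((1 - ν * q ^ countAfter n.1 A) / (1 - ν * q ^ (countAfter n.1 A + 1))) ^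
          countBefore n.1 A) = 1 := by
  rw [prod_count_eq n.1 fun a b => (1 - q ^ (a + 1)) / (1 - q) *
    ((1 - ν * q ^ a) / (1 - ν * q ^ (a + 1))) ^ b]
  have hk : ((1 - q) / (1 - ν)) ^ k = ∏ v ∈ Finset.univ.image n.1,
      ((1 - q) / (1 - ν)) ^ (Finset.univ.filter fun j => n.1 j = v).card := by
    rw [Finset.prod_pow_eq_pow_sum, ← Finset.card_eq_sum_card_image, Finset.card_univ,
      Fintype.card_fin]
  rw [hk, stat, ← Finset.prod_mul_distrib, ← Finset.prod_mul_distrib]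
  refine Finset.prod_eq_one fun v _ => ?_
  set c := (Finset.univ.filter fun j => n.1 j = v).card
  have h1 := prod_range_ratio_pow (fun s => 1 - ν * q ^ s)
    (fun s => (one_sub_nu_pow_pos hq0 hq1 hν0 hν1 s).ne') c
  have h2 : ∏ s ∈ Finset.range c, (1 - q ^ (s + 1)) / (1 - q) =
      qPoch q q c / (1 - q) ^ c := by
    rw [Finset.prod_div_distrib, Finset.prod_const, Finset.card_range, qPoch]
    congr 1
    exact Finset.prod_congr rfl fun s _ => by rw [pow_succ']
  have h3 := (qPoch_pos hν1 hq0 hq1 c).ne'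
  have h4 := (qPoch_pos hq1 hq0 hq1 c).ne'
  have h5 : 1 - q ≠ 0 := by linarith
  have h6 : 1 - ν ≠ 0 := by linarith
  rw [Finset.prod_mul_distrib, h1, h2, pow_zero, mul_one]
  change qPoch ν q c / qPoch q q c * ((1 - q) / (1 - ν)) ^ c *
    (qPoch q q c / (1 - q) ^ c * ((1 - ν) ^ c / qPoch ν q c)) = 1
  rw [div_pow]
  have h7 := pow_ne_zero c h5
  have h8 := pow_ne_zero c h6
  field_simp

/-! ### Integrals over tori -/

/-- The annulus `ρm ≤ |x| ≤ ρp` avoids the zeros of the cross term. -/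
structure IsGoodAnnulus (q ν ρm ρp : ℝ) : Prop where
  one_lt : 1 < ρm
  le : ρm ≤ ρp
  lt : ν * ρp < 1
  cross_ne : ∀ x y : ℂ, ρm ≤ ‖x‖ → ‖y‖ ≤ ρp → crossS q ν x y ≠ 0

/-- The product of the circles of radii `r j`. -/
noncomputable def torus {k : ℕ} (r : Fin k → ℝ) : Fin k → ℝ → ℂ := fun j => circ (r j)

theorem isPath_torus {k : ℕ} (r : Fin k → ℝ) (j : Fin k) : IsPath (torus r j) := isPath_circ _

theorem norm_of_mem_box_torus {k : ℕ} {r : Fin k → ℝ} (hr : ∀ j, 0 ≤ r j) {x : Fin k → ℂ}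
    (hx : x ∈ box (torus r)) (j : Fin k) : ‖x j‖ = r j :=
  norm_of_mem_trace_circ (hr j) (hx j)

theorem lineIntegral_circ_eq_zero {r : ℝ} (hr : 0 ≤ r) {g : ℂ → ℂ}
    (hg : ∀ w, ‖w‖ ≤ r → DifferentiableAt ℂ g w) : lineIntegral (circ r) g = 0 := by
  rw [lineIntegral_circ]
  refine DiffContOnCl.circleIntegral_eq_zero hr ?_
  refine DifferentiableOn.diffContOnCl_ball (U := Metric.closedBall 0 r) (fun w hw => ?_) le_rfl
  exact (hg w (by simpa using hw)).differentiableWithinAt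

theorem lineIntegral_circ_cauchy {r : ℝ} {p : ℂ} (hp : ‖p‖ < r) {g : ℂ → ℂ}
    (hg : ∀ w, ‖w‖ ≤ r → DifferentiableAt ℂ g w) :
    (2 * Real.pi * Complex.I)⁻¹ * lineIntegral (circ r) (fun w => (w - p)⁻¹ * g w) = g p := by
  rw [lineIntegral_circ]
  refine DiffContOnCl.two_pi_i_inv_smul_circleIntegral_sub_inv_smul ?_ (by simpa using hp)
  refine DifferentiableOn.diffContOnCl_ball (U := Metric.closedBall 0 r) (fun w hw => ?_) le_rfl
  exact (hg w (by simpa using hw)).differentiableWithinAt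

/-- The circle is contracted to infinity: `u = w⁻¹` takes it to the circle of radius `r⁻¹`, and the
decay `w ^ (-2)` compensates `dw = -u⁻² du`, so the new integrand is holomorphic in the whole disc.
-/
theorem lineIntegral_circ_eq_zero_of_inv {r : ℝ} (hr : 0 < r) {g h : ℂ → ℂ}
    (hh : ∀ u, ‖u‖ ≤ r⁻¹ → DifferentiableAt ℂ h u)
    (hg : ∀ w, ‖w‖ = r → g w = w ^ (-2 : ℤ) * h w⁻¹) : lineIntegral (circ r) g = 0 := by
  have h1 := lineIntegral_circ_eq_zero (inv_pos.2 hr).le hh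
  -- Inversion reverses the orientation, whence the parameter `1 - t`.
  have hinv : ∀ t : ℝ, circ r⁻¹ (1 - t) = (circ r t)⁻¹ := by
    intro t
    have : (2 * Real.pi * (1 - t : ℝ) * Complex.I : ℂ) =
        -(2 * Real.pi * t * Complex.I) + 2 * Real.pi * Complex.I := by push_cast; ring
    rw [circ, circ, this, Complex.exp_add, Complex.exp_two_pi_mul_I, mul_one, Complex.exp_neg,
      mul_inv]
    push_cast; rfl
  rw [lineIntegral_eq_intervalIntegral] at h1 ⊢
  have h2 := intervalIntegral.integral_comp_sub_left (a := 0) (b := 1)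
    (fun t => deriv (circ r⁻¹) t * h (circ r⁻¹ t)) 1
  rw [sub_zero, sub_self, h1] at h2
  rw [← h2]
  refine intervalIntegral.integral_congr fun t _ => ?_
  have h3 : ‖circ r t‖ = r := norm_circ hr.le t
  have h4 : circ r t ≠ 0 := norm_ne_zero_iff.1 (by rw [h3]; exact hr.ne')
  simp only [deriv_circ, hinv]
  rw [hg _ h3, zpow_neg]
  field_simp

theorem differentiableAt_update {k : ℕ} (x : Fin k → ℂ) (j i : Fin k) (w : ℂ) :
    DifferentiableAt ℂ (fun w => Function.update x j w i) w := by
  by_cases h : i = j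
  · subst h; simp
  · simp [h]

section Cross

variable {q ν ρm ρp : ℝ} {k : ℕ}

theorem differentiableAt_crossS {f g : ℂ → ℂ} {w : ℂ} (hf : DifferentiableAt ℂ f w)
    (hg : DifferentiableAt ℂ g w) : DifferentiableAt ℂ (fun w => crossS q ν (f w) (g w)) w := by
  simp only [crossS]
  exact (((differentiableAt_const _).add (hg.const_mul _)).add
    ((hf.const_mul _).mul hg)).sub hf

theorem continuous_crossS : Continuous fun p : ℂ × ℂ => crossS q ν p.1 p.2 := by
  simp only [crossS]; fun_prop

/-- Up to sign this is the leading coefficient of `crossS` in its first variable, which governs the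
cross term at infinity. It is nonzero because `(1 - q) / (1 - q ν) ≤ 1`. -/
theorem one_sub_mul_ne_zero_of_norm_lt (hq0 : 0 < q) (hq1 : q < 1) (hν0 : 0 ≤ ν) (hν1 : ν < 1)
    {y : ℂ} (hy : ν * ‖y‖ < 1) : 1 - (ν * (1 - q) / (1 - q * ν) : ℂ) * y ≠ 0 := by
  intro h
  have h0 := one_sub_mul_pos hq0 hq1 hν1
  have h1 : ‖(ν * (1 - q) / (1 - q * ν) : ℂ) * y‖ = 1 := by
    rw [← sub_eq_zero.1 h, norm_one]
  have h2 : (ν * (1 - q) / (1 - q * ν) : ℂ) = ((ν * (1 - q) / (1 - q * ν) : ℝ) : ℂ) := by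
    push_cast; rfl
  rw [norm_mul, h2, Complex.norm_real, Real.norm_eq_abs, abs_of_nonneg
    (div_nonneg (mul_nonneg hν0 (by linarith)) h0.le), div_mul_eq_mul_div, div_eq_one_iff_eq h0.ne']
    at h1
  have h3 : ν * (1 - q) * ‖y‖ ≤ ν * ‖y‖ * (1 - q) := le_of_eq (by ring)
  have h4 : ν * ‖y‖ * (1 - q) ≤ 1 * (1 - q) := by gcongr
  have h5 : q * ν < q := by nlinarith
  have h6 : ν * ‖y‖ * (1 - q) < 1 - q := by nlinarith
  linarith

/-- The product of the cross terms of a right eigenfunction. -/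
noncomputable def crossProd (q ν : ℝ) (x : Fin k → ℂ) : ℂ :=
  ∏ A, ∏ B ∈ Finset.Iio A, crossS q ν (x B) (x A)

/-- The ratio of the product of the cross terms of permuted variables to `crossProd`. -/
noncomputable def crossRatio (q ν : ℝ) (π : Equiv.Perm (Fin k)) (x : Fin k → ℂ) : ℂ :=
  ∏ A, ∏ B ∈ Finset.Iio A,
    if π B < π A then 1 else crossS q ν (x A) (x B) / crossS q ν (x B) (x A)

theorem crossRatio_mul (σ : Equiv.Perm (Fin k)) {x : Fin k → ℂ}
    (hx : ∀ A B, crossS q ν (x A) (x B) ≠ 0) :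
    crossRatio q ν σ.symm x * crossProd q ν x =
      ∏ A, ∏ B ∈ Finset.Iio A, crossS q ν (x (σ B)) (x (σ A)) := by
  rw [prod_pairs_comp_perm (fun a b => crossS q ν (x a) (x b)), crossRatio, crossProd,
    ← Finset.prod_mul_distrib]
  refine Finset.prod_congr rfl fun A _ => ?_
  rw [← Finset.prod_mul_distrib]
  refine Finset.prod_congr rfl fun B _ => ?_
  split_ifs
  · rw [one_mul]
  · rw [div_mul_cancel₀ _ (hx B A)]

theorem crossProd_ne_zero {x : Fin k → ℂ} (hx : ∀ A B, crossS q ν (x A) (x B) ≠ 0) :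
    crossProd q ν x ≠ 0 :=
  Finset.prod_ne_zero_iff.2 fun _ _ => Finset.prod_ne_zero_iff.2 fun _ _ => hx _ _

/-- The general summand of the integrand in the pairing of a monomial with a right
eigenfunction. -/
noncomputable def pairTerm (q ν : ℝ) (π : Equiv.Perm (Fin k)) (e : Fin k → ℤ) (x : Fin k → ℂ) :
    ℂ := crossRatio q ν π x * ∏ j, x j ^ e j

section Vanish

variable {r : Fin k → ℝ} (h : IsGoodAnnulus q ν ρm ρp) (hr : ∀ j, ρm ≤ r j ∧ r j ≤ ρp)
include h hr

theorem torus_pos (j : Fin k) : 0 < r j := by linarith [h.one_lt, (hr j).1]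

theorem norm_of_mem_torus {x : Fin k → ℂ} (hx : x ∈ box (torus r)) (j : Fin k) : ‖x j‖ = r j :=
  norm_of_mem_box_torus (fun j => (torus_pos h hr j).le) hx j

theorem ne_zero_of_mem_torus {x : Fin k → ℂ} (hx : x ∈ box (torus r)) (j : Fin k) : x j ≠ 0 :=
  norm_ne_zero_iff.1 (by rw [norm_of_mem_torus h hr hx]; exact (torus_pos h hr j).ne')

theorem cross_ne_of_mem_torus {x : Fin k → ℂ} (hx : x ∈ box (torus r)) (A B : Fin k) :
    crossS q ν (x A) (x B) ≠ 0 :=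
  h.cross_ne _ _ (by rw [norm_of_mem_torus h hr hx]; exact (hr A).1)
    (by rw [norm_of_mem_torus h hr hx]; exact (hr B).2)

theorem continuousOn_pairTerm (π : Equiv.Perm (Fin k)) (e : Fin k → ℤ) :
    ContinuousOn (pairTerm q ν π e) (box (torus r)) := by
  refine ContinuousOn.mul ?_ ?_
  · refine continuousOn_finsetProd _ fun A _ => continuousOn_finsetProd _ fun B _ => ?_
    split_ifs
    · exact continuousOn_const
    · refine ContinuousOn.div ?_ ?_ fun x hx => cross_ne_of_mem_torus h hr hx B A
      · exact (continuous_crossS.comp (by fun_prop : Continuous fun x : Fin k → ℂ =>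
          (x A, x B))).continuousOn
      · exact (continuous_crossS.comp (by fun_prop : Continuous fun x : Fin k → ℂ =>
          (x B, x A))).continuousOn
  · refine continuousOn_finsetProd _ fun j _ => ?_
    exact (continuous_apply j).continuousOn.zpow₀ _ fun x hx =>
      Or.inl (ne_zero_of_mem_torus h hr hx j)

/-- If no later index has a smaller value of `π`, then `x_j` occurs in the denominators only as the
second argument of `S`, where any modulus up to `ρp` is allowed. With `e j ≥ 0` the integrand is
holomorphic in the full disc of `x_j`. -/
theorem multiIntegral_pairTerm_eq_zero_of_nonneg (π : Equiv.Perm (Fin k)) {e : Fin k → ℤ}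
    {j : Fin k} (hπ : ∀ l, j < l → π j < π l) (he : 0 ≤ e j) :
    multiIntegral (torus r) (pairTerm q ν π e) = 0 := by
  refine multiIntegral_eq_zero j (isPath_torus r) (continuousOn_pairTerm h hr π e) fun x hx => ?_
  refine lineIntegral_circ_eq_zero (torus_pos h hr j).le fun w hw => ?_
  have hnorm : ∀ A, ‖Function.update x j w A‖ ≤ ρp := fun A => by
    by_cases hA : A = j
    · subst hA; simpa using hw.trans (hr A).2
    · rw [Function.update_of_ne hA, norm_of_mem_torus h hr hx]; exact (hr A).2
  simp only [pairTerm]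
  refine DifferentiableAt.mul ?_ ?_
  · refine DifferentiableAt.fun_finsetProd fun A _ =>
      DifferentiableAt.fun_finsetProd fun B hB => ?_
    split_ifs with hAB
    · exact differentiableAt_const _
    · refine DifferentiableAt.div
        (differentiableAt_crossS (differentiableAt_update x j _ w) (differentiableAt_update x j _ w))
        (differentiableAt_crossS (differentiableAt_update x j _ w) (differentiableAt_update x j _ w))
        ?_
      have hBj : B ≠ j := by
        rintro rfl
        exact hAB (hπ A (Finset.mem_Iio.1 hB))
      refine h.cross_ne _ _ ?_ (hnorm A)
      rw [Function.update_of_ne hBj, norm_of_mem_torus h hr hx]; exact (hr B).1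
  · refine DifferentiableAt.fun_finsetProd fun i _ => ?_
    refine DifferentiableAt.zpow (differentiableAt_update x j i w) ?_
    by_cases hi : i = j
    · subst hi; exact Or.inr he
    · rw [Function.update_of_ne hi]; exact Or.inl (ne_zero_of_mem_torus h hr hx i)

/-- The dual case: `x_j` occurs in the denominators only as the first argument of `S`, where any
modulus from `ρm` on is allowed. The ratios of cross terms stay bounded at infinity, so with `e j ≤
-2` the circle of `x_j` can be expanded to infinity. -/
theorem multiIntegral_pairTerm_eq_zero_of_le (hq0 : 0 < q) (hq1 : q < 1) (hν0 : 0 ≤ ν)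
    (hν1 : ν < 1) (π : Equiv.Perm (Fin k)) {e : Fin k → ℤ}
    {j : Fin k} (hπ : ∀ l, l < j → π l < π j) (he : e j ≤ -2) :
    multiIntegral (torus r) (pairTerm q ν π e) = 0 := by
  classical
  refine multiIntegral_eq_zero j (isPath_torus r) (continuousOn_pairTerm h hr π e) fun x hx => ?_
  -- Numerator and denominator of the ratio in the coordinate `u = 1 / x_j`, both multiplied by `u`,
  -- so that they are polynomial at `u = 0`.
  let num : ℂ → ℂ → ℂ := fun y u => (1 - q) / (1 - q * ν) * u + (q - ν) / (1 - q * ν) +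
    ν * (1 - q) / (1 - q * ν) * y - y * u
  let den : ℂ → ℂ → ℂ := fun y u => (1 - q) / (1 - q * ν) * u + (q - ν) / (1 - q * ν) * y * u +
    ν * (1 - q) / (1 - q * ν) * y - 1
  have hnum : ∀ y w : ℂ, w ≠ 0 → num y w⁻¹ = w⁻¹ * crossS q ν y w := fun y w hw => by
    simp only [num, crossS]; field_simp
  have hden : ∀ y w : ℂ, w ≠ 0 → den y w⁻¹ = w⁻¹ * crossS q ν w y := fun y w hw => by
    simp only [den, crossS]; field_simp
  refine lineIntegral_circ_eq_zero_of_inv (torus_pos h hr j) (h := fun u =>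
    (∏ A, ∏ B ∈ Finset.Iio A, if π B < π A then 1 else
      if B = j then num (x A) u / den (x A) u else
        crossS q ν (x A) (x B) / crossS q ν (x B) (x A)) *
      (u ^ (-e j - 2) * ∏ i ∈ Finset.univ.erase j, x i ^ e i)) ?_ ?_
  · intro u hu
    refine DifferentiableAt.mul ?_ (DifferentiableAt.mul_const (differentiableAt_zpow.2
      (Or.inr (by omega))) _)
    refine DifferentiableAt.fun_finsetProd fun A _ =>
      DifferentiableAt.fun_finsetProd fun B hB => ?_
    split_ifs with hAB hBj
    · exact differentiableAt_const _
    · refine DifferentiableAt.div (by fun_prop) (by fun_prop) ?_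
      -- At `u = 0`, that is at `x_j = ∞`, the denominator reduces to the leading coefficient of the
      -- cross term, nonzero since `ν ρp < 1`.
      by_cases hu0 : u = 0
      · subst hu0
        have := one_sub_mul_ne_zero_of_norm_lt hq0 hq1 hν0 hν1 (y := x A) (by
          rw [norm_of_mem_torus h hr hx]
          exact (mul_le_mul_of_nonneg_left (hr A).2 hν0).trans_lt h.lt)
        simp only [den, mul_zero, zero_add]
        rw [← neg_ne_zero, neg_sub]; exact this
      · have := hden (x A) u⁻¹ (inv_ne_zero hu0)
        rw [inv_inv] at this
        rw [this]
        refine mul_ne_zero hu0 (h.cross_ne _ _ ?_ ?_)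
        · rw [norm_inv]
          refine (hr j).1.trans ?_
          rw [le_inv_comm₀ (torus_pos h hr j) (norm_pos_iff.2 hu0)]; exact hu
        · rw [norm_of_mem_torus h hr hx]; exact (hr A).2
    · exact differentiableAt_const _
  · intro w hw
    have hw0 : w ≠ 0 := norm_ne_zero_iff.1 (by rw [hw]; exact (torus_pos h hr j).ne')
    have h1 : ∏ i, Function.update x j w i ^ e i =
        w ^ (-2 : ℤ) * (w⁻¹ ^ (-e j - 2) * ∏ i ∈ Finset.univ.erase j, x i ^ e i) := by
      rw [← Finset.mul_prod_erase _ _ (Finset.mem_univ j), Function.update_self, ← mul_assoc,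
        inv_zpow', ← zpow_add₀ hw0]
      congr 1
      · congr 1; ring
      · refine Finset.prod_congr rfl fun i hi => ?_
        rw [Function.update_of_ne (Finset.ne_of_mem_erase hi)]
    rw [pairTerm, h1, mul_left_comm, crossRatio]
    congr 2
    refine Finset.prod_congr rfl fun A _ => Finset.prod_congr rfl fun B hB => ?_
    split_ifs with hAB hBj
    · rfl
    · subst hBj
      rw [Function.update_self, Function.update_of_ne (Finset.mem_Iio.1 hB).ne', hnum _ _ hw0,
        hden _ _ hw0, mul_div_mul_left _ _ (inv_ne_zero hw0)]
    · have hAj : A ≠ j := by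
        rintro rfl
        exact hAB (hπ B (Finset.mem_Iio.1 hB))
      rw [Function.update_of_ne hAj, Function.update_of_ne hBj]

/-- With `π = σ⁻¹` and `e j = m (π j) - n j - 1`, a nonzero integral requires `m (π j) ≥ n j` at
prefix maxima and `m (π j) ≤ n j` at suffix minima of `π`. These are the hypotheses of
`eq_of_chain`. -/
theorem multiIntegral_pairTerm_eq_zero (hq0 : 0 < q) (hq1 : q < 1) (hν0 : 0 ≤ ν)
    (hν1 : ν < 1) {n m : Fin k → ℤ} (hn : Antitone n) (hm : Antitone m) (σ : Equiv.Perm (Fin k))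
    (hσ : ¬ (m = n ∧ ∀ i, n (σ i) = n i)) :
    multiIntegral (torus r) (pairTerm q ν σ.symm fun j => m (σ.symm j) - n j - 1) = 0 := by
  by_contra hne
  refine hσ ?_
  have := eq_of_chain hn hm σ.symm (fun j hj => ?_) fun j hj => ?_
  · refine ⟨this.1, fun i => ?_⟩
    have := this.2 (σ i)
    rw [Equiv.symm_apply_apply] at this
    exact this.symm
  · by_contra! hlt
    exact hne (multiIntegral_pairTerm_eq_zero_of_le h hr hq0 hq1 hν0 hν1 _ hj (by omega))
  · by_contra! hlt
    exact hne (multiIntegral_pairTerm_eq_zero_of_nonneg h hr _ hj (by omega))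

end Vanish

end Cross

/-! ### Iterated residues at the points `Ξ(q^s)`. -/

section Value

variable {q ν ρm ρp : ℝ}

/-- The coefficient `c` of `x y` in the cross term. -/
noncomputable def coefXY (q ν : ℝ) : ℂ := ν * (1 - q) / (1 - q * ν)

theorem one_sub_coef_node (hq0 : 0 < q) (hq1 : q < 1) (hν0 : 0 ≤ ν) (hν1 : ν < 1) (s : ℕ) :
    1 - coefXY q ν * node q ν s =
      (1 - ν) * (1 - ν * q ^ (s + 1)) / ((1 - q * ν) * (1 - ν * q ^ s)) := by
  have h0 := one_sub_mul_ne hq0 hq1 hν1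
  have h1 := one_sub_nu_pow_ne hq0 hq1 hν0 hν1 s
  rw [coefXY, node, xi, div_mul_div_comm, eq_div_iff (mul_ne_zero h0 h1), sub_mul,
    div_mul_cancel₀ _ (mul_ne_zero h0 h1), pow_succ]
  ring

/-- The variables are integrated out from the last one. Its only pole inside the circle is its node
`s`; the residue cancels the pole at that node of every earlier variable of the cluster and creates
one at node `s + 1`, at the cost of a constant per variable. The function `ι` records the current
node of each cluster, so the induction has to be uniform in `ι`. -/
theorem multiIntegral_nodes (hq0 : 0 < q) (hq1 : q < 1) (hν0 : 0 ≤ ν) (hν1 : ν < 1)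
    (h : IsGoodAnnulus q ν ρm ρp) {k : ℕ} {r : Fin k → ℝ} (hr : ∀ j, ρm ≤ r j ∧ r j ≤ ρp)
    (n : Fin k → ℤ) (ι : ℤ → ℕ) :
    multiIntegral (torus r) (fun x => (∏ j, (x j - node q ν (ι (n j)))⁻¹) *
      ∏ A, ∏ B ∈ Finset.Iio A with n B = n A, (x B - x A) / crossS q ν (x B) (x A)) =
    ∏ A, (-(1 - coefXY q ν * node q ν (ι (n A) + countAfter n A))⁻¹) ^ countBefore n A := by
  classical
  induction k generalizing ι with
  | zero =>
    simp [multiIntegral, measureReal_def]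
  | succ k ih =>
    have hpos := torus_pos h hr
    have hx1 : ∀ x ∈ box (torus r), ∀ j s, x j - node q ν s ≠ 0 := fun x hx j s => by
      rw [sub_ne_zero]; rintro hxs
      have h1 := norm_of_mem_torus h hr hx j
      have h2 := norm_node_le hq0 hq1 hν0 hν1 s
      rw [← hxs, h1] at h2
      linarith [h.one_lt, (hr j).1]
    rw [multiIntegral_succAbove (Fin.last k) (isPath_torus r)]
    swap
    · refine ContinuousOn.mul ?_ ?_
      · refine continuousOn_finsetProd _ fun j _ => ContinuousOn.inv₀ (by fun_prop)
          fun x hx => hx1 x hx j _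
      · refine continuousOn_finsetProd _ fun A _ => continuousOn_finsetProd _ fun B _ => ?_
        refine ContinuousOn.div (by fun_prop) ?_ fun x hx => cross_ne_of_mem_torus h hr hx B A
        exact (continuous_crossS.comp (by fun_prop : Continuous fun x : Fin (k + 1) → ℂ =>
          (x B, x A))).continuousOn
    set s := ι (n (Fin.last k)) with hs
    have hstep : ∀ ξ ∈ box (fun i => torus r ((Fin.last k).succAbove i)),
        (2 * Real.pi * Complex.I)⁻¹ * lineIntegral (torus r (Fin.last k)) (fun w =>
          (fun x : Fin (k + 1) → ℂ => (∏ j, (x j - node q ν (ι (n j)))⁻¹) *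
            ∏ A, ∏ B ∈ Finset.Iio A with n B = n A, (x B - x A) / crossS q ν (x B) (x A))
            ((Fin.last k).insertNth w ξ)) =
        (-(1 - coefXY q ν * node q ν s)⁻¹) ^ countBefore n (Fin.last k) *
          ((∏ j, (ξ j - node q ν (Function.update ι (n (Fin.last k)) (s + 1)
            (n j.castSucc)))⁻¹) *
          ∏ A, ∏ B ∈ Finset.Iio A with n (Fin.castSucc B) = n (Fin.castSucc A),
            (ξ B - ξ A) / crossS q ν (ξ B) (ξ A)) := by
      intro ξ hξ
      have hξn : ∀ j, ‖ξ j‖ = r j.castSucc := fun j => by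
        have := norm_of_mem_trace_circ (hpos _).le (hξ j)
        rwa [Fin.succAbove_last] at this
      have hξ1 : ∀ j s, ξ j - node q ν s ≠ 0 := fun j s => by
        rw [sub_ne_zero]; rintro hxs
        have h1 := hξn j
        have h2 := norm_node_le hq0 hq1 hν0 hν1 s
        rw [← hxs, h1] at h2
        linarith [h.one_lt, (hr j.castSucc).1]
      set g : ℂ → ℂ := fun w => ∏ B, if n (Fin.castSucc B) = n (Fin.last k) then
        (ξ B - w) / crossS q ν (ξ B) w else 1 with hg
      set P := ∏ A, ∏ B ∈ Finset.Iio A with n (Fin.castSucc B) = n (Fin.castSucc A),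
            (ξ B - ξ A) / crossS q ν (ξ B) (ξ A) with hP
      have hint : ∀ w, (fun x : Fin (k + 1) → ℂ => (∏ j, (x j - node q ν (ι (n j)))⁻¹) *
            ∏ A, ∏ B ∈ Finset.Iio A with n B = n A, (x B - x A) / crossS q ν (x B) (x A))
            ((Fin.last k).insertNth w ξ) =
          (w - node q ν s)⁻¹ * (g w * ((∏ j, (ξ j - node q ν (ι (n j.castSucc)))⁻¹) * P)) := by
        intro w
        simp only [Fin.insertNth_last']
        rw [prod_Iio_eq_prod_ite (fun A B => (Fin.snoc (α := fun _ => ℂ) ξ w B -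
          Fin.snoc (α := fun _ => ℂ) ξ w A) /
          crossS q ν (Fin.snoc (α := fun _ => ℂ) ξ w B) (Fin.snoc (α := fun _ => ℂ) ξ w A))
          fun A B => n B = n A, Fintype.prod_prod_type]
        rw [hP, prod_Iio_eq_prod_ite (fun A B => (ξ B - ξ A) / crossS q ν (ξ B) (ξ A))
          fun A B => n (Fin.castSucc B) = n (Fin.castSucc A), Fintype.prod_prod_type]
        simp only [Fin.prod_univ_castSucc, Fin.snoc_castSucc, Fin.snoc_last,
          Fin.castSucc_lt_castSucc_iff, Fin.castSucc_lt_last, true_and, lt_irrefl, false_and,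
          if_false, mul_one, (Fin.castSucc_lt_last _).not_gt]
        rw [hg]
        ring
      simp only [hint]
      rw [torus, lineIntegral_circ_cauchy]
      · have hSne : ∀ B : Fin k, crossS q ν (ξ B) (node q ν s) ≠ 0 := fun B => by
          refine h.cross_ne _ _ (by rw [hξn]; exact (hr _).1) ?_
          linarith [norm_node_le hq0 hq1 hν0 hν1 s, h.one_lt, h.le]
        have hc0 : 1 - coefXY q ν * node q ν s ≠ 0 := by
          refine one_sub_mul_ne_zero_of_norm_lt hq0 hq1 hν0 hν1 ?_
          have := mul_le_mul_of_nonneg_left (norm_node_le hq0 hq1 hν0 hν1 s) hν0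
          linarith
        have hcount : countBefore n (Fin.last k) =
            (Finset.univ.filter fun B : Fin k => n B.castSucc = n (Fin.last k)).card := by
          rw [countBefore, ← Finset.card_map (Fin.castSuccEmb (n := k))]
          congr 1
          ext l
          simp only [Finset.mem_filter, Finset.mem_univ, true_and, Finset.mem_map]
          constructor
          · rintro ⟨h1, h2⟩
            exact ⟨l.castPred h1.ne, by simpa using h2, by simp⟩
          · rintro ⟨m, hm, rfl⟩
            exact ⟨Fin.castSucc_lt_last m, hm⟩
        rw [← mul_assoc, ← mul_assoc]
        congr 1
        rw [hcount, ← Finset.prod_const, Finset.prod_filter, ← Finset.prod_mul_distrib,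
          ← Finset.prod_mul_distrib]
        refine Finset.prod_congr rfl fun B _ => ?_
        split_ifs with hB
        · rw [hB, Function.update_self, ← hs]
          -- Here the pole of `ξ B` moves: the denominator is a multiple of `node (s + 1) - ξ B`,
          -- while the numerator `ξ B - node s` cancels the old pole.
          have h1 : crossS q ν (ξ B) (node q ν s) =
              (1 - coefXY q ν * node q ν s) * (node q ν (s + 1) - ξ B) := by
            rw [crossS_node hq0 hq1 hν0 hν1, one_sub_coef_node hq0 hq1 hν0 hν1]
          rw [h1]
          have h2 := hξ1 B s
          have h3 := hξ1 B (s + 1)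
          have h4 : node q ν (s + 1) - ξ B ≠ 0 := by rw [← neg_sub]; exact neg_ne_zero.2 h3
          rw [← neg_sub (ξ B) (node q ν (s + 1))]
          field_simp
        · rw [Function.update_of_ne hB]
      · linarith [norm_node_le hq0 hq1 hν0 hν1 s, h.one_lt, (hr (Fin.last k)).1]
      · intro w hw
        refine DifferentiableAt.mul_const ?_ _
        refine DifferentiableAt.fun_finsetProd fun B _ => ?_
        split_ifs
        · refine DifferentiableAt.div (by fun_prop)
            (differentiableAt_crossS (differentiableAt_const _) differentiableAt_id) ?_
          exact h.cross_ne _ _ (by rw [hξn]; exact (hr _).1) (hw.trans (hr _).2)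
        · exact differentiableAt_const _
    rw [multiIntegral_congr hstep, multiIntegral_const_mul]
    simp only [Fin.succAbove_last]
    change _ * multiIntegral (torus fun i => r (Fin.castSucc i)) _ = _
    rw [ih (r := fun i => r (Fin.castSucc i)) (fun j => hr j.castSucc)
      (fun i => n i.castSucc) (Function.update ι (n (Fin.last k)) (s + 1)),
      Fin.prod_univ_castSucc, mul_comm]
    have hlast : countAfter n (Fin.last k) = 0 := by
      rw [countAfter, Finset.card_eq_zero, Finset.filter_eq_empty_iff]
      intro B _ hB
      exact absurd hB.1 (Fin.le_last B).not_gt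
    rw [hlast, add_zero, ← hs]
    congr 1
    refine Finset.prod_congr rfl fun A _ => ?_
    have h1 : countBefore n A.castSucc = countBefore (fun i => n i.castSucc) A := by
      rw [countBefore, countBefore, ← Finset.card_map (Fin.castSuccEmb (n := k))]
      congr 1
      ext l
      simp only [Finset.mem_filter, Finset.mem_univ, true_and, Finset.mem_map]
      constructor
      · rintro ⟨h1, h2⟩
        exact ⟨l.castPred (h1.trans (Fin.castSucc_lt_last A)).ne, by
          refine ⟨?_, by simpa using h2⟩
          rw [Fin.lt_def] at h1 ⊢; simpa using h1, by simp⟩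
      · rintro ⟨m, hm, rfl⟩
        exact ⟨Fin.castSucc_lt_castSucc_iff.2 hm.1, hm.2⟩
    have h2 : countAfter n A.castSucc = countAfter (fun i => n i.castSucc) A +
        if n A.castSucc = n (Fin.last k) then 1 else 0 := by
      rw [countAfter, countAfter, Finset.card_filter, Finset.card_filter, Fin.sum_univ_castSucc]
      congr 1
      simp [Fin.castSucc_lt_last, eq_comm]
    rw [h1, h2]
    congr 5
    by_cases hA : n A.castSucc = n (Fin.last k)
    · rw [if_pos hA, hA, Function.update_self, hs]; ring_nf
    · rw [if_neg hA, Function.update_of_ne hA, add_zero]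

end Value

/-! ### Biorthogonality of the right eigenfunctions with monomials. -/

section Orthogonality

variable {q ν ρm ρp : ℝ} {k : ℕ}

/-- The pairing of a function with the monomial `x ^ (-n - 1)` divided by `crossProd`. -/
noncomputable def pairing (q ν : ℝ) (r : Fin k → ℝ) (n : Fin k → ℤ) (f : (Fin k → ℂ) → ℂ) : ℂ :=
  multiIntegral (torus r) fun x => (∏ j, x j ^ (-n j - 1)) * (crossProd q ν x)⁻¹ * f x

/-- Separating `x - y` from the cross term leaves the Hall–Littlewood factor in the variables `Ξ x`,
`Ξ y`, to which `sum_young` applies. -/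
theorem crossS_eq_of_xi (hq0 : 0 < q) (hq1 : q < 1) (hν1 : ν < 1) {x y : ℂ}
    (hx : 1 - ν * x ≠ 0) (hy : 1 - ν * y ≠ 0) (hxy : x ≠ y) :
    crossS q ν x y = -(1 - ν) / (1 - q * ν) * (x - y) *
      ((xi ν x - q * xi ν y) / (xi ν x - xi ν y)) := by
  have hzx := one_sub_nu_xi_ne hν1 hx
  have hzy := one_sub_nu_xi_ne hν1 hy
  have h1 := one_sub_nu_ne hν1
  have h2 := one_sub_mul_ne hq0 hq1 hν1
  have h3 : xi ν x - xi ν y ≠ 0 := by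
    rw [xi_sub_xi hx hy]
    exact div_ne_zero (mul_ne_zero (neg_ne_zero.2 h1) (sub_ne_zero.2 hxy)) (mul_ne_zero hx hy)
  have h4 := crossS_xi hq0 hq1 hν1 hzx hzy
  have h5 := xi_sub_xi hzx hzy
  rw [xi_xi hν1 hx, xi_xi hν1 hy] at h4 h5
  rw [h4, h5]
  field_simp

/-- Pairs from different clusters are merely permuted by `σ` and drop out of the ratio. Within
clusters each cross term is a constant times a difference times a Hall–Littlewood factor; the
differences absorb the sign of `σ`, and `sum_young` sums the remaining factors. -/
theorem sum_young_cross (hq0 : 0 < q) (hq1 : q < 1) (hν1 : ν < 1)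
    {n : Fin k → ℤ} (hn : Antitone n) {x : Fin k → ℂ} (hx : Function.Injective x)
    (hx1 : ∀ j, 1 - ν * x j ≠ 0) (hx2 : ∀ j, x j ≠ 1)
    (hS : ∀ A B, crossS q ν (x A) (x B) ≠ 0) :
    ∑ σ : Equiv.Perm (Fin k) with ∀ i, n (σ i) = n i, sgn σ * crossRatio q ν σ.symm x =
      (∏ A, (-(1 - ν) / (1 - q * ν) : ℂ) ^ countBefore n A) *
        (∏ A, (1 - (q : ℂ) ^ (countAfter n A + 1)) / (1 - q)) *
        ∏ A, ∏ B ∈ Finset.Iio A with n B = n A, (x B - x A) / crossS q ν (x B) (x A) := by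
  have hz : Function.Injective fun j => xi ν (x j) := fun i j hij => hx (by
    have := congrArg (xi ν) hij
    simpa only [xi_xi hν1 (hx1 i), xi_xi hν1 (hx1 j)] using this)
  have hz0 : ∀ j, xi ν (x j) ≠ 0 := fun j =>
    div_ne_zero (sub_ne_zero.2 (hx2 j).symm) (hx1 j)
  have hq : (q : ℂ) ≠ 1 := by exact_mod_cast hq1.ne
  rw [← sum_young k n hz hz0 hq, Finset.mul_sum, Finset.sum_mul]
  refine Finset.sum_congr rfl fun σ hσ => ?_
  have hσ' : ∀ i, n (σ i) = n i := (Finset.mem_filter.1 hσ).2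
  have hsplit : ∀ F : Fin k → Fin k → ℂ, ∏ A, ∏ B ∈ Finset.Iio A, F B A =
      (∏ A, ∏ B ∈ Finset.Iio A with n B = n A, F B A) *
        ∏ A, ∏ B ∈ Finset.Iio A with ¬ n B = n A, F B A := fun F => by
    rw [← Finset.prod_mul_distrib]
    exact Finset.prod_congr rfl fun A _ => (Finset.prod_filter_mul_prod_filter_not _ _ _).symm
  have hratio : crossRatio q ν σ.symm x *
      (∏ A, ∏ B ∈ Finset.Iio A with n B = n A, crossS q ν (x B) (x A)) =
      ∏ A, ∏ B ∈ Finset.Iio A with n B = n A, crossS q ν (x (σ B)) (x (σ A)) := by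
    have h1 := crossRatio_mul σ hS
    rw [crossProd, hsplit fun B A => crossS q ν (x B) (x A),
      hsplit fun B A => crossS q ν (x (σ B)) (x (σ A)),
      prod_cross_perm (fun a b => crossS q ν (x a) (x b)) hn hσ', ← mul_assoc] at h1
    refine mul_right_cancel₀ ?_ h1
    exact Finset.prod_ne_zero_iff.2 fun _ _ => Finset.prod_ne_zero_iff.2 fun _ _ => hS _ _
  -- The full Vandermonde product acquires the sign of `σ`. Its part between different clusters is
  -- invariant, so the part within clusters carries the whole sign.
  have hvdm : sgn σ * ∏ A, ∏ B ∈ Finset.Iio A with n B = n A, (x (σ B) - x (σ A)) =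
      ∏ A, ∏ B ∈ Finset.Iio A with n B = n A, (x B - x A) := by
    have h1 := prod_sub_perm x σ
    rw [hsplit fun B A => x (σ B) - x (σ A), hsplit fun B A => x B - x A,
      prod_cross_perm (fun a b => x a - x b) hn hσ', ← mul_assoc] at h1
    have h2 := mul_right_cancel₀ (Finset.prod_ne_zero_iff.2 fun A _ =>
      Finset.prod_ne_zero_iff.2 fun B hB => sub_ne_zero.2 (hx.ne
        (Finset.mem_Iio.1 (Finset.mem_filter.1 hB).1).ne)) h1
    rw [h2, ← mul_assoc, sgn_mul_self, one_mul]
  have hSn : (∏ A, ∏ B ∈ Finset.Iio A with n B = n A, crossS q ν (x B) (x A)) ≠ 0 :=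
    Finset.prod_ne_zero_iff.2 fun _ _ => Finset.prod_ne_zero_iff.2 fun _ _ => hS _ _
  have hexp : ∏ A, ∏ B ∈ Finset.Iio A with n B = n A, crossS q ν (x (σ B)) (x (σ A)) =
      (∏ A, (-(1 - ν) / (1 - q * ν) : ℂ) ^ countBefore n A) *
      (∏ A, ∏ B ∈ Finset.Iio A with n B = n A, (x (σ B) - x (σ A))) *
      ∏ A, ∏ B ∈ Finset.Iio A with n B = n A,
        (xi ν (x (σ B)) - q * xi ν (x (σ A))) / (xi ν (x (σ B)) - xi ν (x (σ A))) := by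
    rw [← Finset.prod_mul_distrib, ← Finset.prod_mul_distrib]
    refine Finset.prod_congr rfl fun A _ => ?_
    have : countBefore n A = (Finset.Iio A |>.filter fun B => n B = n A).card := by
      rw [countBefore]; congr 1; ext B; simp
    rw [this, ← Finset.prod_const, ← Finset.prod_mul_distrib, ← Finset.prod_mul_distrib]
    refine Finset.prod_congr rfl fun B hB => ?_
    refine crossS_eq_of_xi hq0 hq1 hν1 (hx1 _) (hx1 _) (hx.ne (σ.injective.ne ?_))
    exact (Finset.mem_Iio.1 (Finset.mem_filter.1 hB).1).ne
  simp only [Finset.prod_div_distrib] at hexp hratio ⊢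
  rw [← mul_left_inj' hSn, mul_assoc, hratio, hexp, ← hvdm]
  field_simp

theorem continuousOn_monomial {r : Fin k → ℝ} (h : IsGoodAnnulus q ν ρm ρp)
    (hr : ∀ j, ρm ≤ r j ∧ r j ≤ ρp) (e : Fin k → ℤ) :
    ContinuousOn (fun x : Fin k → ℂ => ∏ j, x j ^ e j) (box (torus r)) :=
  continuousOn_finsetProd _ fun j _ => (continuous_apply j).continuousOn.zpow₀ _ fun _ hx =>
    Or.inl (ne_zero_of_mem_torus h hr hx j)

theorem norm_nu_mul_lt (hν0 : 0 ≤ ν) {r : Fin k → ℝ} (h : IsGoodAnnulus q ν ρm ρp)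
    (hr : ∀ j, ρm ≤ r j ∧ r j ≤ ρp) {x : Fin k → ℂ} (hx : x ∈ box (torus r)) (j : Fin k) :
    1 - ν * x j ≠ 0 := by
  intro h0
  have h1 : ‖(ν : ℂ) * x j‖ = 1 := by rw [← sub_eq_zero.1 h0, norm_one]
  rw [norm_mul, Complex.norm_real, Real.norm_of_nonneg hν0, norm_of_mem_torus h hr hx] at h1
  have := mul_le_mul_of_nonneg_left (hr j).2 hν0
  linarith [h.lt]

/-- Expanding the eigenfunction over permutations, only `m = n` and the permutations that preserve
its clusters survive. These are summed under the integral sign, the nodes evaluate what is left, and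
the weight normalizes it to `1`. Distinct radii keep the coordinates distinct on the torus, so that
the quotients in `sum_young` make sense. -/
theorem pairing_PhiR (hq0 : 0 < q) (hq1 : q < 1) (hν0 : 0 ≤ ν) (hν1 : ν < 1)
    (h : IsGoodAnnulus q ν ρm ρp) {r : Fin k → ℝ} (hr : ∀ j, ρm ≤ r j ∧ r j ≤ ρp)
    (hri : Function.Injective r) (n m : Weyl k) :
    pairing q ν r n.1 (PhiR q ν m) = if m = n then 1 else 0 := by
  set C : ℂ := stat q ν m * ((1 - q) / (1 - ν)) ^ k with hC
  have h1 : pairing q ν r n.1 (PhiR q ν m) = C * ∑ σ : Equiv.Perm (Fin k), sgn σ *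
      multiIntegral (torus r) (pairTerm q ν σ.symm fun j => m.1 (σ.symm j) - n.1 j - 1) := by
    have : ∀ σ : Equiv.Perm (Fin k), sgn σ * multiIntegral (torus r)
        (pairTerm q ν σ.symm fun j => m.1 (σ.symm j) - n.1 j - 1) = multiIntegral (torus r)
        fun x => sgn σ * pairTerm q ν σ.symm (fun j => m.1 (σ.symm j) - n.1 j - 1) x :=
      fun σ => (multiIntegral_const_mul _ _ _).symm
    simp only [this]
    rw [← multiIntegral_sum (f := fun σ x => sgn σ *
      pairTerm q ν σ.symm (fun j => m.1 (σ.symm j) - n.1 j - 1) x) (isPath_torus r) _ fun σ _ =>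
      continuousOn_const.mul (continuousOn_pairTerm h hr _ _), ← multiIntegral_const_mul, pairing]
    refine multiIntegral_congr fun x hx => ?_
    have hS := cross_ne_of_mem_torus h hr hx
    have hS0 := crossProd_ne_zero hS
    rw [PhiR, ← hC, mul_left_comm, Finset.mul_sum]
    congr 1
    refine Finset.sum_congr rfl fun σ _ => ?_
    rw [← crossRatio_mul σ hS, pairTerm]
    have h2 : ∏ j, x (σ j) ^ m.1 j = ∏ j, x j ^ m.1 (σ.symm j) := by
      rw [← Equiv.prod_comp σ fun j => x j ^ m.1 (σ.symm j)]
      simp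
    have h3 : ∏ j, x j ^ (m.1 (σ.symm j) - n.1 j - 1) =
        (∏ j, x j ^ (-n.1 j - 1)) * ∏ j, x j ^ m.1 (σ.symm j) := by
      rw [← Finset.prod_mul_distrib]
      refine Finset.prod_congr rfl fun j _ => ?_
      rw [← zpow_add₀ (ne_zero_of_mem_torus h hr hx j)]
      congr 1; ring
    rw [h2, h3]
    field_simp
  rw [h1]
  split_ifs with hmn
  swap
  · rw [Finset.sum_eq_zero, mul_zero]
    intro σ _
    rw [multiIntegral_pairTerm_eq_zero h hr hq0 hq1 hν0 hν1 n.2 m.2 σ, mul_zero]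
    exact fun h' => hmn (Subtype.ext h'.1)
  subst hmn
  have h2 : ∑ σ : Equiv.Perm (Fin k), sgn σ *
      multiIntegral (torus r) (pairTerm q ν σ.symm fun j => m.1 (σ.symm j) - m.1 j - 1) =
      ∑ σ : Equiv.Perm (Fin k) with ∀ i, m.1 (σ i) = m.1 i, multiIntegral (torus r)
        fun x => sgn σ * pairTerm q ν σ.symm (fun _ => -1) x := by
    rw [Finset.sum_filter]
    refine Finset.sum_congr rfl fun σ _ => ?_
    split_ifs with hσ
    · rw [multiIntegral_const_mul]
      congr 3
      funext j
      have := hσ (σ.symm j)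
      rw [Equiv.apply_symm_apply] at this
      omega
    · rw [multiIntegral_pairTerm_eq_zero h hr hq0 hq1 hν0 hν1 m.2 m.2 σ, mul_zero]
      exact fun h' => hσ h'.2
  rw [h2, ← multiIntegral_sum (f := fun σ x => sgn σ * pairTerm q ν σ.symm (fun _ => -1) x)
    (isPath_torus r) _ fun σ _ =>
      continuousOn_const.mul (continuousOn_pairTerm h hr _ _)]
  set D : ℂ := (∏ A, (-(1 - ν) / (1 - q * ν) : ℂ) ^ countBefore m.1 A) *
        (∏ A, (1 - (q : ℂ) ^ (countAfter m.1 A + 1)) / (1 - q)) with hD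
  have h3 : multiIntegral (torus r) (fun x => ∑ σ : Equiv.Perm (Fin k) with
      ∀ i, m.1 (σ i) = m.1 i, sgn σ * pairTerm q ν σ.symm (fun _ => -1) x) =
      multiIntegral (torus r) fun x => D * ((∏ j, (x j - node q ν ((fun _ => 0) (m.1 j)))⁻¹) *
      ∏ A, ∏ B ∈ Finset.Iio A with m.1 B = m.1 A, (x B - x A) / crossS q ν (x B) (x A)) := by
    refine multiIntegral_congr fun x hx => ?_
    have hnorm := norm_of_mem_torus h hr hx
    simp only [pairTerm, ← mul_assoc]
    rw [← Finset.sum_mul, sum_young_cross hq0 hq1 hν1 m.2 (fun i j hij => hri ?_)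
      (norm_nu_mul_lt hν0 h hr hx) (fun j hj => ?_) (cross_ne_of_mem_torus h hr hx), ← hD]
    -- The starting node is `Ξ(1) = 0`: the factors `x_j⁻¹` are poles at node `0` for every cluster.
    · have : node q ν 0 = 0 := by simp [node, xi]
      simp only [this, sub_zero, zpow_neg_one]
      ring
    · rw [← hnorm, ← hnorm, hij]
    · have := hnorm j
      rw [hj, norm_one] at this
      linarith [h.one_lt, (hr j).1]
  rw [h3, multiIntegral_const_mul, multiIntegral_nodes hq0 hq1 hν0 hν1 h hr m.1 (fun _ => 0), hC, hD,
    ← Finset.prod_mul_distrib, ← Finset.prod_mul_distrib]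
  have h4 := stat_mul_prod_count hq0 hq1 hν0 hν1 m
  have h5 := congrArg (fun y : ℝ => (y : ℂ)) h4
  push_cast at h5
  refine Eq.trans ?_ h5
  congr 1
  refine Finset.prod_congr rfl fun A _ => ?_
  rw [mul_comm (_ ^ _) (_ / _), mul_assoc, ← mul_pow, zero_add,
    one_sub_coef_node hq0 hq1 hν0 hν1]
  congr 2
  have a1 := one_sub_nu_ne hν1
  have a2 : 1 - (ν : ℂ) * q ≠ 0 := by
    rw [mul_comm]; exact one_sub_mul_ne hq0 hq1 hν1
  have a3 := one_sub_nu_pow_ne hq0 hq1 hν0 hν1 (countAfter m.1 A)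
  have a4 := one_sub_nu_pow_ne hq0 hq1 hν0 hν1 (countAfter m.1 A + 1)
  field_simp

end Orthogonality

/-! ### Laurent expansions -/

/-- The maximum of `t ^ n` over `t ∈ [a, b]`. -/
noncomputable def wt (a b : ℝ) (n : ℤ) : ℝ := (if 0 ≤ n then b else a) ^ n

theorem wt_pos {a b : ℝ} (ha : 0 < a) (hab : a ≤ b) (n : ℤ) : 0 < wt a b n := by
  rw [wt]; split_ifs
  · exact zpow_pos (ha.trans_le hab) _
  · exact zpow_pos ha _

theorem zpow_le_wt {a b t : ℝ} (ha : 0 < a) (hat : a ≤ t) (htb : t ≤ b) (n : ℤ) :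
    t ^ n ≤ wt a b n := by
  rw [wt]; split_ifs with h
  · exact zpow_le_zpow_left₀ h (ha.le.trans hat) htb
  · obtain ⟨m, rfl⟩ : ∃ m : ℕ, n = -m := ⟨n.natAbs, by omega⟩
    rw [zpow_neg, zpow_neg, zpow_natCast, zpow_natCast]
    gcongr

theorem summable_wt_div {a b A B : ℝ} (hA : 0 < A) (hAa : A < a) (hab : a ≤ b) (hbB : b < B) :
    Summable fun n : ℤ => wt a b n / wt A B n := by
  have ha : 0 < a := hA.trans hAa
  have hb : 0 < b := ha.trans_le hab
  refine Summable.of_nat_of_neg ?_ ?_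
  · refine (summable_geometric_of_lt_one (div_nonneg hb.le (hb.trans hbB).le)
      ((div_lt_one (hb.trans hbB)).2 hbB)).congr fun n => ?_
    simp [wt, div_pow]
  · refine (summable_geometric_of_lt_one (div_nonneg hA.le ha.le)
      ((div_lt_one ha).2 hAa)).congr fun n => ?_
    rcases Nat.eq_zero_or_pos n with rfl | hn
    · simp [wt]
    · have : ¬ (0 : ℤ) ≤ -(n : ℤ) := by omega
      rw [wt, wt, if_neg this, if_neg this, zpow_neg, zpow_neg, zpow_natCast, zpow_natCast,
        inv_div_inv, div_pow]

theorem summable_prod_apply {f : ℤ → ℝ} (h0 : ∀ n, 0 ≤ f n) (hf : Summable f) (k : ℕ) :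
    Summable fun n : Fin k → ℤ => ∏ j, f (n j) := by
  induction k with
  | zero => exact (hasSum_fintype _).summable
  | succ k ih =>
    have := hf.mul_of_nonneg ih h0 fun n => Finset.prod_nonneg fun j _ => h0 _
    refine ((Fin.consEquiv fun _ : Fin (k + 1) => ℤ).symm.summable_iff.2 this).congr fun n => ?_
    rw [Fin.prod_univ_succ]; rfl

/-- The open annulus. -/
def annulus (A B : ℝ) : Set ℂ := {z | A < ‖z‖ ∧ ‖z‖ < B}

theorem isOpen_annulus (A B : ℝ) : IsOpen (annulus A B) :=
  (isOpen_lt continuous_const continuous_norm).inter (isOpen_lt continuous_norm continuous_const)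

theorem zero_notMem_annulus {A B : ℝ} (hA : 0 ≤ A) : (0 : ℂ) ∉ annulus A B := fun h => by
  have := h.1; rw [norm_zero] at this; linarith

theorem lineIntegral_circ_annulus {A B : ℝ} (hA : 0 ≤ A) {a b : ℝ} (ha : A < a) (ha' : a < B)
    (hb : A < b) (hb' : b < B) {g : ℂ → ℂ} (hg : DifferentiableOn ℂ g (annulus A B)) :
    lineIntegral (circ a) g = lineIntegral (circ b) g := by
  wlog hab : a ≤ b
  · exact (this hA hb hb' ha ha' hg (le_of_not_ge hab)).symm
  rw [lineIntegral_circ, lineIntegral_circ]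
  refine (Complex.circleIntegral_eq_of_differentiable_on_annulus_off_countable (hA.trans_lt ha) hab
    countable_empty (hg.continuousOn.mono fun z hz => ?_) fun z hz => ?_).symm
  · have h1 : ‖z‖ ≤ b := by simpa using hz.1
    have h2 : a ≤ ‖z‖ := by simpa using hz.2
    exact ⟨ha.trans_le h2, h1.trans_lt hb'⟩
  · have h1 : ‖z‖ < b := by simpa using hz.1.1
    have h2 : a < ‖z‖ := by simpa using hz.1.2
    exact hg.differentiableAt ((isOpen_annulus A B).mem_nhds ⟨ha.trans h2, h1.trans hb'⟩)

section

variable {k : ℕ} {A B : ℝ}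

theorem trace_circ_subset_annulus (hA : 0 ≤ A) {r : ℝ} (hr : A < r ∧ r < B) :
    trace (circ r) ⊆ annulus A B := fun z hz => by
  have := norm_of_mem_trace_circ (hA.trans hr.1.le) hz
  exact ⟨this ▸ hr.1, this ▸ hr.2⟩

theorem multiIntegral_torus_eq (hA : 0 ≤ A) {r s : Fin k → ℝ} (hr : ∀ j, A < r j ∧ r j < B)
    (hs : ∀ j, A < s j ∧ s j < B) {f : (Fin k → ℂ) → ℂ} (hf : SepHolo f (annulus A B)) :
    multiIntegral (torus r) f = multiIntegral (torus s) f :=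
  multiIntegral_deform (isPath_torus r) (isPath_torus s)
    (fun j => trace_circ_subset_annulus hA (hr j)) (fun j => trace_circ_subset_annulus hA (hs j))
    (fun j _ hg => lineIntegral_circ_annulus hA (hr j).1 (hr j).2 (hs j).1 (hs j).2 hg) hf

theorem multiIntegral_torus (s : Fin k → ℝ) (f : (Fin k → ℂ) → ℂ) :
    multiIntegral (torus s) f = ∫ t in Icc (0 : Fin k → ℝ) 1,
      (∏ j, circ (s j) (t j)) * f fun j => circ (s j) (t j) := by
  rw [multiIntegral, ← integral_const_mul]
  refine integral_congr_ae (ae_of_all _ fun t => ?_)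
  simp only [torus, deriv_circ]
  rw [Finset.prod_mul_distrib, Finset.prod_const, Finset.card_univ, Fintype.card_fin,
    mul_assoc (_ ^ k), inv_mul_cancel_left₀ (pow_ne_zero _ Complex.two_pi_I_ne_zero)]

theorem norm_multiIntegral_torus_le {s : Fin k → ℝ} (hs : ∀ j, 0 ≤ s j) {f : (Fin k → ℂ) → ℂ}
    {M : ℝ} (hM : ∀ x, (∀ j, ‖x j‖ = s j) → ‖f x‖ ≤ M) :
    ‖multiIntegral (torus s) f‖ ≤ (∏ j, s j) * M := by
  rw [multiIntegral_torus]
  have hv : (volume (Icc (0 : Fin k → ℝ) 1)).toReal = 1 := by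
    rw [Real.volume_Icc_pi]; simp
  have := norm_setIntegral_le_of_norm_le_const (μ := volume) (s := Icc (0 : Fin k → ℝ) 1)
    (f := fun t => (∏ j, circ (s j) (t j)) * f fun j => circ (s j) (t j)) (C := (∏ j, s j) * M)
    isCompact_Icc.measure_lt_top fun t _ => ?_
  · rwa [measureReal_def, hv, mul_one] at this
  · rw [norm_mul, norm_prod]
    simp only [fun j => norm_circ (hs j)]
    gcongr
    · exact Finset.prod_nonneg fun j _ => hs j
    · exact hM _ fun j => norm_circ (hs j) _

/-- The coefficients of the Laurent expansion. -/
noncomputable def laurentCoeff (r : Fin k → ℝ) (f : (Fin k → ℂ) → ℂ) (n : Fin k → ℤ) : ℂ :=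
  multiIntegral (torus r) fun x => (∏ j, x j ^ (-n j - 1)) * f x

theorem sepHolo_monomial {O : Set ℂ} (h0 : (0 : ℂ) ∉ O) (e : Fin k → ℤ) :
    SepHolo (fun x : Fin k → ℂ => ∏ j, x j ^ e j) O :=
  SepHolo.prod fun j _ => sepHolo_zpow h0 j (e j)

theorem laurentCoeff_eq (hA : 0 ≤ A) {r s : Fin k → ℝ} (hr : ∀ j, A < r j ∧ r j < B)
    (hs : ∀ j, A < s j ∧ s j < B) {f : (Fin k → ℂ) → ℂ} (hf : SepHolo f (annulus A B))
    (n : Fin k → ℤ) : laurentCoeff r f n = laurentCoeff s f n :=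
  multiIntegral_torus_eq hA hr hs ((sepHolo_monomial (zero_notMem_annulus hA) _).mul hf)

/-- Cauchy's estimate on the torus with radius `b` where `n j ≥ 0` and `a` where `n j < 0`, the
better choice for each sign. -/
theorem norm_laurentCoeff_le (hA : 0 ≤ A) {r : Fin k → ℝ} (hr : ∀ j, A < r j ∧ r j < B)
    {a b : ℝ} (ha : A < a) (hab : a ≤ b) (hb : b < B) {f : (Fin k → ℂ) → ℂ}
    (hf : SepHolo f (annulus A B)) {M : ℝ}
    (hM : ∀ x : Fin k → ℂ, (∀ j, a ≤ ‖x j‖ ∧ ‖x j‖ ≤ b) → ‖f x‖ ≤ M) (n : Fin k → ℤ) :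
    ‖laurentCoeff r f n‖ ≤ M / ∏ j, wt a b (n j) := by
  let s : Fin k → ℝ := fun j => if 0 ≤ n j then b else a
  have hs : ∀ j, a ≤ s j ∧ s j ≤ b := fun j => by
    by_cases h : 0 ≤ n j <;> simp [s, h, hab]
  have ha0 : 0 < a := hA.trans_lt ha
  have hs0 : ∀ j, 0 < s j := fun j => ha0.trans_le (hs j).1
  rw [laurentCoeff_eq hA hr (s := s) (fun j => ⟨ha.trans_le (hs j).1, (hs j).2.trans_lt hb⟩) hf]
  refine (norm_multiIntegral_torus_le (fun j => (hs0 j).le)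
    (M := (∏ j, s j ^ (-n j - 1)) * M) fun x hx => ?_).trans (le_of_eq ?_)
  · rw [norm_mul, norm_prod]
    simp only [norm_zpow, hx]
    gcongr
    · exact Finset.prod_nonneg fun j _ => zpow_nonneg (hs0 j).le _
    · exact hM x fun j => by rw [hx]; exact hs j
  · rw [← mul_assoc, ← Finset.prod_mul_distrib, div_eq_inv_mul, ← Finset.prod_inv_distrib]
    congr 1
    refine Finset.prod_congr rfl fun j _ => ?_
    rw [wt]
    change s j * s j ^ (-n j - 1) = (s j ^ n j)⁻¹
    rw [zpow_sub_one₀ (hs0 j).ne', mul_comm, mul_assoc, inv_mul_cancel₀ (hs0 j).ne', mul_one,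
      zpow_neg]

theorem exists_bound_annulus {a b : ℝ} (ha : A < a) (hb : b < B)
    {f : (Fin k → ℂ) → ℂ} (hf : ContinuousOn f (poly k (annulus A B))) :
    ∃ M, 0 ≤ M ∧ ∀ x : Fin k → ℂ, (∀ j, a ≤ ‖x j‖ ∧ ‖x j‖ ≤ b) → ‖f x‖ ≤ M := by
  have hc : IsCompact {z : ℂ | a ≤ ‖z‖ ∧ ‖z‖ ≤ b} := by
    refine Metric.isCompact_of_isClosed_isBounded ((isClosed_le continuous_const
      continuous_norm).inter (isClosed_le continuous_norm continuous_const)) ?_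
    exact Metric.isBounded_closedBall.subset (t := Metric.closedBall (0 : ℂ) b)
      fun z hz => by simpa using hz.2
  obtain ⟨M, hM⟩ := (isCompact_univ_pi fun _ : Fin k => hc).exists_bound_of_continuousOn
    (hf.mono fun x hx j => ⟨ha.trans_le (hx j trivial).1, (hx j trivial).2.trans_lt hb⟩)
  refine ⟨max M 0, le_max_right _ _, fun x hx => (hM x fun j _ => hx j).trans (le_max_left _ _)⟩

theorem summable_laurentCoeff (hA : 0 ≤ A) {r : Fin k → ℝ} (hr : ∀ j, A < r j ∧ r j < B)
    {a b : ℝ} (ha : A < a) (hab : a ≤ b) (hb : b < B) {f : (Fin k → ℂ) → ℂ}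
    (hf : SepHolo f (annulus A B)) :
    Summable fun n : Fin k → ℤ => ‖laurentCoeff r f n‖ * ∏ j, wt a b (n j) := by
  obtain ⟨a', h1, h2⟩ := exists_between ha
  obtain ⟨b', h3, h4⟩ := exists_between hb
  have ha' : 0 < a' := hA.trans_lt h1
  obtain ⟨M, hM0, hM⟩ := exists_bound_annulus h1 h4 hf.cont
  have hab' : a' ≤ b' := by linarith
  have := (summable_prod_apply (fun n => (div_pos (wt_pos (ha'.trans h2) hab n)
    (wt_pos ha' hab' n)).le) (summable_wt_div ha' h2 hab h3) k).mul_left M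
  refine Summable.of_nonneg_of_le (fun n => mul_nonneg (norm_nonneg _)
    (Finset.prod_nonneg fun j _ => (wt_pos (ha'.trans h2) hab _).le)) (fun n => ?_) this
  rw [Finset.prod_div_distrib, ← mul_div_assoc, mul_comm M, mul_div_assoc, mul_comm]
  gcongr
  · exact Finset.prod_nonneg fun j _ => (wt_pos (ha'.trans h2) hab _).le
  · exact norm_laurentCoeff_le hA hr h1 hab' h4 hf hM n

/-- On the torus through `x` the Laurent coefficients, times powers of the radii, are the Fourier
coefficients of a continuous function. Cauchy's estimates make them absolutely summable, so the
Fourier series converges to the function at every point. -/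
theorem hasSum_laurentCoeff (hA : 0 ≤ A) {r : Fin k → ℝ} (hr : ∀ j, A < r j ∧ r j < B)
    {f : (Fin k → ℂ) → ℂ} (hf : SepHolo f (annulus A B)) {x : Fin k → ℂ}
    (hx : x ∈ poly k (annulus A B)) :
    HasSum (fun n : Fin k → ℤ => laurentCoeff r f n * ∏ j, x j ^ n j) (f x) := by
  -- Without variables there is no smallest or largest radius to work with, and the series has a
  -- single term.
  rcases isEmpty_or_nonempty (Fin k) with hk | hk
  · have h1 : ∀ n, laurentCoeff r f n * ∏ j, x j ^ n j = f x := fun n => by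
      rw [laurentCoeff, multiIntegral_torus, Fintype.prod_empty, mul_one]
      have hv : (volume : Measure (Fin k → ℝ)).real (Icc 0 1) = 1 := by
        rw [measureReal_def, Real.volume_Icc_pi]; simp
      have : ∀ t : Fin k → ℝ, (∏ j, circ (r j) (t j)) * ((∏ j, circ (r j) (t j) ^ (-n j - 1)) *
          f fun j => circ (r j) (t j)) = f x := fun t => by
        rw [Fintype.prod_empty, Fintype.prod_empty, one_mul, one_mul]
        congr 1; exact Subsingleton.elim _ _
      simp only [this, integral_const, measureReal_restrict_apply_univ, hv, one_smul]
    simp only [h1]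
    exact hasSum_unique _
  obtain ⟨j0⟩ := hk
  let s : Fin k → ℝ := fun j => ‖x j‖
  have hs : ∀ j, A < s j ∧ s j < B := fun j => hx j
  have hs0 : ∀ j, 0 < s j := fun j => hA.trans_lt (hs j).1
  let F : C(UnitAddTorus (Fin k), ℂ) :=
    ⟨fun t => f fun j => s j * (AddCircle.toCircle (t j) : ℂ), by
      refine hf.cont.comp_continuous ?_ fun t j => ?_
      · exact continuous_pi fun j => continuous_const.mul
          (continuous_subtype_val.comp (AddCircle.continuous_toCircle.comp (continuous_apply j)))
      · change A < ‖_‖ ∧ ‖_‖ < B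
        rw [norm_mul, Circle.norm_coe, mul_one, Complex.norm_real, Real.norm_of_nonneg (hs0 j).le]
        exact hs j⟩
  have hcirc : ∀ j (t : ℝ), (s j : ℂ) * (AddCircle.toCircle (t : UnitAddCircle) : ℂ) =
      circ (s j) t := fun j t => by
    rw [AddCircle.toCircle_apply_mk, circ, Circle.coe_exp]
    push_cast; congr 2; ring
  have hfour : ∀ (n : ℤ) j (t : ℝ), (fourier n (t : UnitAddCircle) : ℂ) =
      (circ (s j) t / s j) ^ n := fun n j t => by
    have h0 : (s j : ℂ) ≠ 0 := by exact_mod_cast (hs0 j).ne'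
    rw [fourier_coe_apply, circ, mul_div_cancel_left₀ _ h0, ← Complex.exp_int_mul]
    congr 1; push_cast; ring
  have hcoef : ∀ n, UnitAddTorus.mFourierCoeff F n =
      laurentCoeff r f n * ∏ j, (s j : ℂ) ^ n j := by
    intro n
    rw [laurentCoeff_eq hA hr hs hf, laurentCoeff, multiIntegral_torus,
      UnitAddTorus.mFourierCoeff_eq_integral _ _ 0, ← integral_mul_const]
    have hset : (Icc (0 : Fin k → ℝ) 1) =ᵐ[volume]
        {t : Fin k → ℝ | ∀ i, t i ∈ Ioc ((0 : Fin k → ℝ) i) ((0 : Fin k → ℝ) i + 1)} := by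
      have h1 := Measure.univ_pi_Ioc_ae_eq_Icc (μ := fun _ : Fin k => (volume : Measure ℝ))
        (f := 0) (g := 1)
      refine h1.symm.trans (Filter.EventuallyEq.of_eq ?_)
      ext t
      exact ⟨fun h i => by simpa using h i trivial, fun h i _ => by simpa using h i⟩
    rw [setIntegral_congr_set hset]
    refine integral_congr_ae (ae_of_all _ fun t => ?_)
    simp only [UnitAddTorus.mFourier, ContinuousMap.coe_mk, Pi.neg_apply, F, hcirc, smul_eq_mul]
    suffices h : ∏ j, (fourier (-n j) (t j : UnitAddCircle) : ℂ) = (∏ j, circ (s j) (t j)) *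
        ((∏ j, circ (s j) (t j) ^ (-n j - 1)) * ∏ j, (s j : ℂ) ^ n j) by rw [h]; ring
    rw [Finset.prod_congr rfl fun j _ => hfour (-n j) j (t j), ← Finset.prod_mul_distrib,
      ← Finset.prod_mul_distrib]
    refine Finset.prod_congr rfl fun j _ => ?_
    have h0 : (s j : ℂ) ≠ 0 := by exact_mod_cast (hs0 j).ne'
    have h1 : circ (s j) (t j) ≠ 0 := norm_ne_zero_iff.1 (by
      rw [norm_circ (hs0 j).le]; exact (hs0 j).ne')
    rw [div_zpow, zpow_sub_one₀ h1, zpow_neg, zpow_neg]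
    field_simp
  obtain ⟨ja, -, hja⟩ := Finset.exists_min_image Finset.univ s ⟨j0, Finset.mem_univ _⟩
  obtain ⟨jb, -, hjb⟩ := Finset.exists_max_image Finset.univ s ⟨j0, Finset.mem_univ _⟩
  have hsum := summable_laurentCoeff hA hr (hs ja).1 (hja jb (Finset.mem_univ _)) (hs jb).2 hf
  have hsum' : Summable (UnitAddTorus.mFourierCoeff F) := by
    refine Summable.of_norm_bounded hsum fun n => ?_
    rw [hcoef, norm_mul, norm_prod]
    gcongr with j
    rw [norm_zpow, Complex.norm_real, Real.norm_of_nonneg (hs0 j).le]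
    exact zpow_le_wt (hs0 _) (hja j (Finset.mem_univ _)) (hjb j (Finset.mem_univ _)) _
  have hmem : ∀ j, ∃ t : ℝ, circ (s j) t = x j := fun j => by
    refine ⟨(x j).arg / (2 * Real.pi), ?_⟩
    rw [circ]
    have h1 : (2 * Real.pi * ((x j).arg / (2 * Real.pi) : ℝ) * Complex.I : ℂ) =
        (x j).arg * Complex.I := by
      push_cast
      have : (Real.pi : ℂ) ≠ 0 := by exact_mod_cast Real.pi_ne_zero
      field_simp
    rw [h1]; exact Complex.norm_mul_exp_arg_mul_I (x j)
  choose t ht using hmem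
  have := UnitAddTorus.hasSum_mFourier_series_apply_of_summable hsum'
    fun j => (t j : UnitAddCircle)
  have hval : F (fun j => (t j : UnitAddCircle)) = f x := by
    simp only [F, ContinuousMap.coe_mk, hcirc, ht]
  rw [hval] at this
  refine this.congr_fun fun n => ?_
  rw [hcoef, smul_eq_mul, mul_assoc]
  congr 1
  simp only [UnitAddTorus.mFourier, ContinuousMap.coe_mk]
  rw [Finset.prod_congr rfl fun j _ => hfour (n j) j (t j), ← Finset.prod_mul_distrib]
  refine Finset.prod_congr rfl fun j _ => ?_
  have h0 : (s j : ℂ) ≠ 0 := by exact_mod_cast (hs0 j).ne'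
  rw [← mul_zpow, ht, mul_div_cancel₀ _ h0]

theorem hasSum_multiIntegral {c : Fin k → ℝ → ℂ} (hc : ∀ j, IsPath (c j)) {ι : Type*}
    [Countable ι] {f : ι → (Fin k → ℂ) → ℂ} {g : (Fin k → ℂ) → ℂ} {u : ι → ℝ}
    (hf : ∀ i, ContinuousOn (f i) (box c)) (hu : Summable u)
    (hfu : ∀ i, ∀ x ∈ box c, ‖f i x‖ ≤ u i) (hg : ∀ x ∈ box c, HasSum (fun i => f i x) (g x)) :
    HasSum (fun i => multiIntegral c (f i)) (multiIntegral c g) := by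
  refine HasSum.mul_left _ ?_
  have h2 : Integrable (fun t : Fin k → ℝ => ‖∏ j, deriv (c j) (t j)‖)
      (volume.restrict (Icc 0 1)) := by
    have := (integrableOn_of_continuousOn_box (f := fun _ => 1) hc continuousOn_const).norm
    simpa using this
  refine hasSum_integral_of_dominated_convergence
    (fun i t => ‖∏ j, deriv (c j) (t j)‖ * u i)
    (fun i => (integrableOn_of_continuousOn_box hc (hf i)).aestronglyMeasurable) (fun i => ?_)
    (ae_of_all _ fun t => hu.mul_left _) ?_ ?_
  · refine (ae_restrict_iff' measurableSet_Icc).2 (ae_of_all _ fun t ht => ?_)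
    rw [norm_mul]
    gcongr
    exact hfu i _ (mem_box ht)
  · simp only [tsum_mul_left]
    exact h2.mul_const _
  · refine (ae_restrict_iff' measurableSet_Icc).2 (ae_of_all _ fun t ht => ?_)
    exact (hg _ (mem_box ht)).mul_left _

end

/-! ### Completeness of the right eigenfunctions -/

section Completeness

variable {k : ℕ}

/-- The alternating sum of the permutations of a monomial. -/
noncomputable def alt (l : Fin k → ℤ) (x : Fin k → ℂ) : ℂ :=
  ∑ σ : Equiv.Perm (Fin k), sgn σ * ∏ j, x (σ j) ^ l j

theorem alt_perm (l : Fin k → ℤ) (τ : Equiv.Perm (Fin k)) (x : Fin k → ℂ) :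
    alt (fun j => l (τ j)) x = sgn τ * alt l x := by
  rw [alt, alt, Finset.mul_sum, ← Equiv.sum_comp (Equiv.mulRight τ)]
  refine Finset.sum_congr rfl fun σ _ => ?_
  rw [Equiv.coe_mulRight, sgn_mul, ← Equiv.prod_comp τ fun j => x (σ j) ^ l j]
  simp only [Equiv.Perm.mul_apply]
  ring

theorem alt_eq_zero {l : Fin k → ℤ} (hl : ¬ Function.Injective l) (x : Fin k → ℂ) :
    alt l x = 0 := by
  obtain ⟨i, j, hij, hne⟩ := Function.not_injective_iff.1 hl
  have h := alt_perm l (Equiv.swap i j) x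
  have h1 : (fun a => l (Equiv.swap i j a)) = l := by
    funext a
    rw [Equiv.swap_apply_def]
    split_ifs with h1 h2
    · rw [h1, hij]
    · rw [h2, hij]
    · rfl
  have h2 : sgn (Equiv.swap i j) = -1 := by
    rw [sgn, Equiv.Perm.sign_swap hne]; simp
  rw [h1, h2] at h
  have : (2 : ℂ) * alt l x = 0 := by linear_combination h
  simpa using this

theorem exists_strictAnti_perm {l : Fin k → ℤ} (hl : Function.Injective l) :
    ∃ τ : Equiv.Perm (Fin k), StrictAnti fun j => l (τ j) := by
  let f : Fin k → ℤ := fun j => -l j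
  refine ⟨Tuple.sort f, ?_⟩
  have h1 : Monotone (f ∘ Tuple.sort f) := Tuple.monotone_sort f
  have h2 : StrictMono (f ∘ Tuple.sort f) := h1.strictMono_of_injective
    ((neg_injective.comp hl).comp (Tuple.sort f).injective)
  intro i j hij
  have := h2 hij
  simp only [Function.comp_apply, f] at this
  simpa using this

/-- Each variable enters `k - 1` of the factors, with degree at most one. The bound `k - 1` on the
exponents is exactly the height of the staircase `k - 1 - j`, which the count of dimensions below
relies on. -/
theorem crossProd_eq_sum_monomial (q ν : ℝ) : ∃ (E : Finset (Fin k →₀ ℕ)) (s : (Fin k →₀ ℕ) → ℂ),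
    (∀ e ∈ E, ∀ j, e j + 1 ≤ k) ∧
      ∀ x : Fin k → ℂ, crossProd q ν x = ∑ e ∈ E, s e * ∏ j, x j ^ e j := by
  let fac : Fin k → Fin k → MvPolynomial (Fin k) ℂ := fun A B =>
    MvPolynomial.C ((1 - q) / (1 - q * ν) : ℂ) +
      MvPolynomial.C ((q - ν) / (1 - q * ν) : ℂ) * MvPolynomial.X A +
      MvPolynomial.C (ν * (1 - q) / (1 - q * ν) : ℂ) * MvPolynomial.X B * MvPolynomial.X A -
      MvPolynomial.X B
  let p : MvPolynomial (Fin k) ℂ := ∏ A, ∏ B ∈ Finset.Iio A, fac A B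
  have hX : ∀ i j : Fin k, MvPolynomial.degreeOf j (MvPolynomial.X i : MvPolynomial (Fin k) ℂ) =
      if j = i then 1 else 0 := fun i j => MvPolynomial.degreeOf_X j i
  have hfac : ∀ A B j, B < A → MvPolynomial.degreeOf j (fac A B) ≤
      if j = A then 1 else if j = B then 1 else 0 := by
    intro A B j hBA
    have hb : (if j = A then 1 else 0) + (if j = B then 1 else 0) ≤
        if j = A then 1 else if j = B then 1 else 0 := by
      by_cases h1 : j = A
      · have : ¬ A = B := hBA.ne'
        simp [h1, this]
      · simp [h1]
    refine (MvPolynomial.degreeOf_sub_le _ _ _).trans (max_le ?_ ?_)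
    · refine (MvPolynomial.degreeOf_add_le _ _ _).trans (max_le
        ((MvPolynomial.degreeOf_add_le _ _ _).trans (max_le ?_ ?_)) ?_)
      · rw [MvPolynomial.degreeOf_C]; exact Nat.zero_le _
      · refine (MvPolynomial.degreeOf_mul_le _ _ _).trans ?_
        rw [MvPolynomial.degreeOf_C, hX]; omega
      · refine (MvPolynomial.degreeOf_mul_le _ _ _).trans ((add_le_add_left
          (MvPolynomial.degreeOf_mul_le _ _ _) _).trans ?_)
        rw [MvPolynomial.degreeOf_C, hX, hX]; omega
    · rw [hX]; omega
  have hp : ∀ j, MvPolynomial.degreeOf j p + 1 ≤ k := by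
    intro j
    have h1 : MvPolynomial.degreeOf j p ≤ ∑ A, ∑ B ∈ Finset.Iio A,
        if j = A then 1 else if j = B then 1 else 0 := by
      refine (MvPolynomial.degreeOf_prod_le _ _ _).trans (Finset.sum_le_sum fun A _ => ?_)
      refine (MvPolynomial.degreeOf_prod_le _ _ _).trans (Finset.sum_le_sum fun B hB => ?_)
      exact hfac A B j (Finset.mem_Iio.1 hB)
    have h2 : ∀ A, ∑ B ∈ Finset.Iio A, (if j = A then 1 else if j = B then 1 else 0) =
        if j = A then (j : ℕ) else if j < A then 1 else 0 := by
      intro A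
      by_cases hA : j = A
      · simp [hA]
      · simp [hA]
    have h3 : ∀ A, (if j = A then (j : ℕ) else if j < A then 1 else 0) =
        (if j = A then (j : ℕ) else 0) + if j < A then 1 else 0 := by
      intro A
      by_cases hA : j = A
      · simp [hA]
      · simp [hA]
    simp only [h2, h3, Finset.sum_add_distrib] at h1
    rw [Finset.sum_ite_eq, if_pos (Finset.mem_univ _), ← Finset.card_filter] at h1
    have h4 : (Finset.univ.filter fun A => j < A) = Finset.Ioi j := by ext; simp
    rw [h4, Fin.card_Ioi] at h1
    have := j.2
    omega
  refine ⟨p.support, fun e => p.coeff e, fun e he j => ?_, fun x => ?_⟩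
  · have := MvPolynomial.monomial_le_degreeOf j he
    have := hp j
    omega
  · rw [← MvPolynomial.eval_eq']
    simp only [p, MvPolynomial.eval_prod, fac, MvPolynomial.eval_add, MvPolynomial.eval_sub,
      MvPolynomial.eval_mul, MvPolynomial.eval_C, MvPolynomial.eval_X]
    rfl

/-- Points with nonzero coordinates. -/
abbrev NonzeroPts (k : ℕ) : Type := {x : Fin k → ℂ // ∀ j, x j ≠ 0}

/-- The part of the Weyl chamber in a box. -/
abbrev WeylBox (k : ℕ) (p L : ℤ) : Type :=
  {n : Fin k → ℤ // Antitone n ∧ ∀ j, p ≤ n j ∧ n j ≤ p + L}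

theorem finite_weylBox (k : ℕ) (p L : ℤ) : Finite (WeylBox k p L) := by
  have : Set.Finite {n : Fin k → ℤ | Antitone n ∧ ∀ j, p ≤ n j ∧ n j ≤ p + L} := by
    refine (Set.Finite.pi' fun _ : Fin k => Set.finite_Icc p (p + L)).subset ?_
    exact fun n hn j => ⟨(hn.2 j).1, (hn.2 j).2⟩
  exact this.to_subtype

/-- The alternating sum that belongs to a point of the Weyl chamber. -/
noncomputable def altWeyl (n : Fin k → ℤ) (x : NonzeroPts k) : ℂ :=
  alt (fun j => n j + (k - 1 - j)) x

/-- Up to sign the exponents can be sorted into strictly decreasing order, unless two coincide and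
the alternating sum vanishes. Removing the staircase `k - 1 - j` leaves a point of the Weyl chamber
in the box. -/
theorem alt_mem_span {p L : ℤ} {l : Fin k → ℤ}
    (hl : ∀ j, p ≤ l j ∧ l j ≤ p + L + (k - 1)) :
    (fun x : NonzeroPts k => alt l x) ∈
      Submodule.span ℂ (Set.range fun n : WeylBox k p L => altWeyl n.1) := by
  by_cases hinj : Function.Injective l
  swap
  · have : (fun x : NonzeroPts k => alt l x) = 0 := funext fun x => alt_eq_zero hinj x
    rw [this]; exact Submodule.zero_mem _
  obtain ⟨τ, hτ⟩ := exists_strictAnti_perm hinj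
  have h1 : (fun x : NonzeroPts k => alt l x) =
      sgn τ • fun x : NonzeroPts k => alt (fun j => l (τ j)) x := by
    funext x
    simp only [Pi.smul_apply, smul_eq_mul, alt_perm, ← mul_assoc, sgn_mul_self, one_mul]
  rw [h1]
  refine Submodule.smul_mem _ _ (Submodule.subset_span ?_)
  set m : Fin k → ℤ := fun j => l (τ j) - (k - 1 - j) with hm
  have hanti : Antitone m := by
    have : ∀ i j : Fin k, i ≤ j → l (τ j) + (j - i : ℤ) ≤ l (τ i) := by
      intro i j hij
      obtain ⟨d, hd⟩ : ∃ d : ℕ, (j : ℕ) = i + d := ⟨j - i, by have := Fin.le_def.1 hij; omega⟩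
      induction d generalizing j with
      | zero =>
        have : j = i := Fin.ext (by omega)
        rw [this]; simp
      | succ d ih =>
        have hlt : (i : ℕ) + d < k := by omega
        have h2 := ih ⟨i + d, hlt⟩ (Fin.le_def.2 (by simp)) rfl
        have h3 := hτ (show (⟨i + d, hlt⟩ : Fin k) < j from Fin.lt_def.2 (by simp; omega))
        simp only [Nat.cast_add] at h2 h3
        have : ((j : ℕ) : ℤ) = i + d + 1 := by rw [hd]; push_cast; ring
        omega
    intro i j hij
    have := this i j hij
    simp only [hm]; omega
  have hbd : ∀ j, p ≤ m j ∧ m j ≤ p + L := by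
    intro j
    have hk : 0 < k := j.pos
    constructor
    · have h2 := hanti (show j ≤ ⟨k - 1, by omega⟩ from Fin.le_def.2 (by simp; omega))
      have h3 := (hl (τ ⟨k - 1, by omega⟩)).1
      refine le_trans ?_ h2
      simp only [hm]
      have : ((k - 1 : ℕ) : ℤ) = k - 1 := by omega
      omega
    · have h2 := hanti (show (⟨0, hk⟩ : Fin k) ≤ j from Fin.le_def.2 (by simp))
      have h3 := (hl (τ ⟨0, hk⟩)).2
      refine h2.trans ?_
      simp only [hm]
      omega
  refine ⟨⟨m, hanti, hbd⟩, ?_⟩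
  funext x
  simp only [altWeyl, hm, sub_add_cancel]

variable {q ν : ℝ}

theorem PhiR_eq_sum_alt {E : Finset (Fin k →₀ ℕ)} {s : (Fin k →₀ ℕ) → ℂ}
    (hs : ∀ x : Fin k → ℂ, crossProd q ν x = ∑ e ∈ E, s e * ∏ j, x j ^ e j) (m : Weyl k)
    (x : NonzeroPts k) :
    PhiR q ν m x = stat q ν m * ((1 - q) / (1 - ν)) ^ k *
      ∑ e ∈ E, s e * alt (fun j => m.1 j + e j) x := by
  rw [PhiR]
  congr 1
  simp only [alt, Finset.mul_sum]
  rw [Finset.sum_comm]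
  refine Finset.sum_congr rfl fun σ _ => ?_
  have := hs fun j => x.1 (σ j)
  rw [crossProd] at this
  rw [this, Finset.mul_sum, Finset.sum_mul]
  refine Finset.sum_congr rfl fun e _ => ?_
  have h1 : ∏ j, x.1 (σ j) ^ (m.1 j + e j) = (∏ j, x.1 (σ j) ^ m.1 j) * ∏ j, x.1 (σ j) ^ e j := by
    rw [← Finset.prod_mul_distrib]
    refine Finset.prod_congr rfl fun j _ => ?_
    rw [zpow_add₀ (x.2 _), zpow_natCast]
  rw [h1]; ring

/-- The cross terms raise an exponent by at most `k - 1`, so an eigenfunction of a box involves only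
alternating sums of the same box. -/
theorem PhiR_mem_span {p L : ℤ} (m : WeylBox k p L) :
    (fun x : NonzeroPts k => PhiR q ν ⟨m.1, m.2.1⟩ x) ∈
      Submodule.span ℂ (Set.range fun n : WeylBox k p L => altWeyl n.1) := by
  obtain ⟨E, s, hE, hs⟩ := crossProd_eq_sum_monomial (k := k) q ν
  have h1 : (fun x : NonzeroPts k => PhiR q ν ⟨m.1, m.2.1⟩ x) =
      (stat q ν (⟨m.1, m.2.1⟩ : Weyl k) * ((1 - q) / (1 - ν)) ^ k : ℂ) •
      ∑ e ∈ E, s e • fun x : NonzeroPts k => alt (fun j => m.1 j + e j) x := by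
    funext x
    rw [PhiR_eq_sum_alt hs]
    simp
  rw [h1]
  refine Submodule.smul_mem _ _ (Submodule.sum_mem _ fun e he => Submodule.smul_mem _ _ ?_)
  refine alt_mem_span fun j => ?_
  have h2 := hE e he j
  have h3 := m.2.2 j
  constructor <;> omega

variable {ρm ρp : ℝ}

theorem continuousOn_PhiR {O : Set (Fin k → ℂ)} (hO : ∀ x ∈ O, ∀ j, x j ≠ 0) (n : Weyl k) :
    ContinuousOn (PhiR q ν n) O := by
  unfold PhiR
  refine continuousOn_const.mul (continuousOn_finsetSum _ fun σ _ => ContinuousOn.mul ?_ ?_)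
  · refine Continuous.continuousOn ?_
    simp only [crossS]
    fun_prop
  · exact continuousOn_finsetProd _ fun j _ => (continuous_apply _).continuousOn.zpow₀ _
      fun x hx => Or.inl (hO x hx _)

theorem continuousOn_crossProd_inv {r : Fin k → ℝ} (h : IsGoodAnnulus q ν ρm ρp)
    (hr : ∀ j, ρm ≤ r j ∧ r j ≤ ρp) :
    ContinuousOn (fun x : Fin k → ℂ => (crossProd q ν x)⁻¹) (box (torus r)) := by
  refine ContinuousOn.inv₀ (Continuous.continuousOn ?_) fun x hx =>
    crossProd_ne_zero (cross_ne_of_mem_torus h hr hx)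
  unfold crossProd
  simp only [crossS]
  fun_prop

theorem pairing_sum {r : Fin k → ℝ} (h : IsGoodAnnulus q ν ρm ρp)
    (hr : ∀ j, ρm ≤ r j ∧ r j ≤ ρp) (n : Fin k → ℤ) {ι : Type*} (s : Finset ι) (a : ι → ℂ)
    {f : ι → (Fin k → ℂ) → ℂ} (hf : ∀ i ∈ s, ContinuousOn (f i) (box (torus r))) :
    pairing q ν r n (fun x => ∑ i ∈ s, a i * f i x) = ∑ i ∈ s, a i * pairing q ν r n (f i) := by
  simp only [pairing, ← multiIntegral_const_mul]
  rw [← multiIntegral_sum (f := fun i x => a i * ((∏ j, x j ^ (-n j - 1)) *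
    (crossProd q ν x)⁻¹ * f i x)) (isPath_torus r) s fun i hi => continuousOn_const.mul
    (((continuousOn_monomial h hr _).mul (continuousOn_crossProd_inv h hr)).mul (hf i hi))]
  refine multiIntegral_congr fun x _ => ?_
  rw [Finset.mul_sum]
  exact Finset.sum_congr rfl fun i _ => by ring

/-- The pairings are dual functionals: applied to a linear relation, they isolate each coefficient.
-/
theorem linearIndependent_PhiR (hq0 : 0 < q) (hq1 : q < 1) (hν0 : 0 ≤ ν) (hν1 : ν < 1)
    (h : IsGoodAnnulus q ν ρm ρp) {r : Fin k → ℝ} (hr : ∀ j, ρm ≤ r j ∧ r j ≤ ρp)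
    (hri : Function.Injective r) :
    LinearIndependent ℂ fun (n : Weyl k) (x : NonzeroPts k) => PhiR q ν n x := by
  classical
  rw [linearIndependent_iff']
  intro s g hg i hi
  have h1 : pairing q ν r i.1 (fun x => ∑ n ∈ s, g n * PhiR q ν n x) = 0 := by
    rw [pairing, multiIntegral_congr (g := fun _ => 0)]
    · simp [multiIntegral]
    · intro x hx
      have := congrFun hg ⟨x, ne_zero_of_mem_torus h hr hx⟩
      simp only [Finset.sum_apply, Pi.smul_apply, smul_eq_mul, Pi.zero_apply] at this
      rw [this, mul_zero]
  rw [pairing_sum h hr _ _ _ fun n _ =>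
    continuousOn_PhiR (fun x hx => ne_zero_of_mem_torus h hr hx) n] at h1
  simpa [pairing_PhiR hq0 hq1 hν0 hν1 h hr hri, hi] using h1

/-- The eigenfunctions of a box are independent and lie in the span of equally many alternating sums
of the same box, so the two spans coincide. No change of basis needs to be inverted. -/
theorem alt_mem_span_PhiR (hq0 : 0 < q) (hq1 : q < 1) (hν0 : 0 ≤ ν) (hν1 : ν < 1)
    (h : IsGoodAnnulus q ν ρm ρp) {r : Fin k → ℝ} (hr : ∀ j, ρm ≤ r j ∧ r j ≤ ρp)
    (hri : Function.Injective r) (l : Fin k → ℤ) :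
    (fun x : NonzeroPts k => alt l x) ∈
      Submodule.span ℂ (Set.range fun (n : Weyl k) (x : NonzeroPts k) => PhiR q ν n x) := by
  classical
  obtain ⟨p, L, hl⟩ : ∃ p L : ℤ, ∀ j, p ≤ l j ∧ l j ≤ p + L + (k - 1) := by
    refine ⟨-∑ j, |l j|, 2 * ∑ j, |l j|, fun j => ?_⟩
    have h1 := Finset.single_le_sum (f := fun j => |l j|) (fun i _ => abs_nonneg _)
      (Finset.mem_univ j)
    have h2 := abs_le.1 (le_refl |l j|)
    have h3 := j.pos
    constructor <;> omega
  have := finite_weylBox k p L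
  have := Fintype.ofFinite (WeylBox k p L)
  let v : WeylBox k p L → NonzeroPts k → ℂ := fun m x => PhiR q ν ⟨m.1, m.2.1⟩ x
  have hv : LinearIndependent ℂ v :=
    (linearIndependent_PhiR hq0 hq1 hν0 hν1 h hr hri).comp
      (fun m : WeylBox k p L => (⟨m.1, m.2.1⟩ : Weyl k)) fun m m' hmm => by
        simpa [Subtype.ext_iff] using hmm
  have hle : Submodule.span ℂ (Set.range v) ≤
      Submodule.span ℂ (Set.range fun n : WeylBox k p L => altWeyl n.1) := by
    rw [Submodule.span_le]
    rintro _ ⟨m, rfl⟩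
    exact PhiR_mem_span m
  have hfin : FiniteDimensional ℂ
      (Submodule.span ℂ (Set.range fun n : WeylBox k p L => altWeyl n.1)) :=
    FiniteDimensional.span_of_finite ℂ (Set.finite_range _)
  have heq := Submodule.eq_of_le_of_finrank_le hle (by
    rw [finrank_span_eq_card hv]
    exact finrank_range_le_card _)
  have hmem := alt_mem_span hl
  rw [← heq] at hmem
  refine Submodule.span_mono ?_ hmem
  rintro _ ⟨m, rfl⟩
  exact ⟨⟨m.1, m.2.1⟩, rfl⟩

/-- The expansion of an alternating sum in the right eigenfunctions. -/
theorem exists_alt_eq_sum (hq0 : 0 < q) (hq1 : q < 1) (hν0 : 0 ≤ ν) (hν1 : ν < 1)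
    (h : IsGoodAnnulus q ν ρm ρp) {r : Fin k → ℝ} (hr : ∀ j, ρm ≤ r j ∧ r j ≤ ρp)
    (hri : Function.Injective r) (l : Fin k → ℤ) :
    ∃ s : Finset (Weyl k), (∀ n ∉ s, pairing q ν r n.1 (alt l) = 0) ∧
      ∀ x ∈ box (torus r), alt l x = ∑ n ∈ s, pairing q ν r n.1 (alt l) * PhiR q ν n x := by
  classical
  obtain ⟨c, hc⟩ := (Finsupp.mem_span_range_iff_exists_finsupp).1
    (alt_mem_span_PhiR hq0 hq1 hν0 hν1 h hr hri l)
  have h1 : ∀ x ∈ box (torus r), alt l x = ∑ n ∈ c.support, c n * PhiR q ν n x := by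
    intro x hx
    have := congrFun hc ⟨x, ne_zero_of_mem_torus h hr hx⟩
    rw [← this, Finsupp.sum]
    simp
  have h2 : ∀ n : Weyl k, pairing q ν r n.1 (alt l) = c n := by
    intro n
    have : pairing q ν r n.1 (alt l) =
        pairing q ν r n.1 fun x => ∑ n ∈ c.support, c n * PhiR q ν n x :=
      multiIntegral_congr fun x hx => by rw [h1 x hx]
    rw [this, pairing_sum h hr _ _ _ fun n _ =>
      continuousOn_PhiR (fun x hx => ne_zero_of_mem_torus h hr hx) n]
    simp only [pairing_PhiR hq0 hq1 hν0 hν1 h hr hri, mul_ite, mul_one, mul_zero]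
    rw [Finset.sum_ite_eq']
    split_ifs with hn
    · rfl
    · exact (Finsupp.notMem_support_iff.1 hn).symm
  refine ⟨c.support, fun n hn => ?_, fun x hx => ?_⟩
  · rw [h2]; exact Finsupp.notMem_support_iff.1 hn
  · simp only [h2]; exact h1 x hx

end Completeness

/-! ### Expansion of antisymmetric functions on the torus. -/

section TorusIdentity

variable {q ν ρm ρp : ℝ} {k : ℕ}

theorem exists_stat_le (hq0 : 0 < q) (hq1 : q < 1) (hν1 : ν < 1) (k : ℕ) :
    ∃ C : ℝ, 0 ≤ C ∧ ∀ n : Weyl k, stat q ν n ≤ C := by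
  have hpos : ∀ c, 0 < qPoch ν q c / qPoch q q c := fun c =>
    div_pos (qPoch_pos hν1 hq0 hq1 _) (qPoch_pos hq1 hq0 hq1 _)
  set K := 1 + ∑ c ∈ Finset.range (k + 1), qPoch ν q c / qPoch q q c with hK
  have hK1 : 1 ≤ K := by
    rw [hK]; linarith [Finset.sum_nonneg fun c (_ : c ∈ Finset.range (k + 1)) => (hpos c).le]
  refine ⟨K ^ k, by positivity, fun n => ?_⟩
  have h1 : stat q ν n ≤ ∏ _v ∈ Finset.univ.image n.1, K := by
    refine Finset.prod_le_prod (fun v _ => (hpos _).le) fun v _ => ?_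
    have hc : (Finset.univ.filter fun j => n.1 j = v).card ∈ Finset.range (k + 1) := by
      rw [Finset.mem_range]
      have := Finset.card_filter_le (Finset.univ : Finset (Fin k)) fun j => n.1 j = v
      rw [Finset.card_univ, Fintype.card_fin] at this
      omega
    have := Finset.single_le_sum (f := fun c => qPoch ν q c / qPoch q q c)
      (fun c _ => (hpos c).le) hc
    linarith
  refine h1.trans ?_
  rw [Finset.prod_const]
  refine pow_le_pow_right₀ hK1 (Finset.card_image_le.trans ?_)
  rw [Finset.card_univ, Fintype.card_fin]

theorem norm_sgn (σ : Equiv.Perm (Fin k)) : ‖sgn σ‖ = 1 := by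
  rw [sgn]; rcases Int.units_eq_one_or (Equiv.Perm.sign σ) with h | h <;> simp [h]

theorem norm_monomial_le {a b : ℝ} (ha : 0 < a) {x : Fin k → ℂ}
    (hx : ∀ j, a ≤ ‖x j‖ ∧ ‖x j‖ ≤ b) (l : Fin k → ℤ) (σ : Equiv.Perm (Fin k)) :
    ‖∏ j, x (σ j) ^ l j‖ ≤ ∏ j, wt a b (l j) := by
  rw [norm_prod]
  refine Finset.prod_le_prod (fun _ _ => norm_nonneg _) fun j _ => ?_
  rw [norm_zpow]
  exact zpow_le_wt ha (hx _).1 (hx _).2 _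

theorem norm_alt_le {a b : ℝ} (ha : 0 < a) {x : Fin k → ℂ}
    (hx : ∀ j, a ≤ ‖x j‖ ∧ ‖x j‖ ≤ b) (l : Fin k → ℤ) :
    ‖alt l x‖ ≤ k.factorial * ∏ j, wt a b (l j) := by
  refine (norm_sum_le_of_le _ fun σ _ => ?_ : _ ≤ ∑ _σ : Equiv.Perm (Fin k),
    ∏ j, wt a b (l j)).trans (le_of_eq ?_)
  · rw [norm_mul, norm_sgn, one_mul]; exact norm_monomial_le ha hx l σ
  · rw [Finset.sum_const, Finset.card_univ, Fintype.card_perm, Fintype.card_fin, nsmul_eq_mul]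

theorem mem_box_torus {r : Fin k → ℝ} {x : Fin k → ℂ} (hx : ∀ j, ‖x j‖ = r j) :
    x ∈ box (torus r) := fun j => by
  refine ⟨(x j).arg / (2 * Real.pi) - ⌊(x j).arg / (2 * Real.pi)⌋,
    ⟨Int.fract_nonneg _, (Int.fract_lt_one _).le⟩, ?_⟩
  rw [torus, circ]
  have h1 : (2 * Real.pi * ((x j).arg / (2 * Real.pi) -
      ⌊(x j).arg / (2 * Real.pi)⌋ : ℝ) * Complex.I : ℂ) =
      (x j).arg * Complex.I - ⌊(x j).arg / (2 * Real.pi)⌋ * (2 * Real.pi * Complex.I) := by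
    push_cast
    have : (Real.pi : ℂ) ≠ 0 := by exact_mod_cast Real.pi_ne_zero
    field_simp
  rw [h1, Complex.exp_sub, Complex.exp_int_mul_two_pi_mul_I, div_one, ← hx j]
  exact Complex.norm_mul_exp_arg_mul_I (x j)

theorem continuous_crossProd : Continuous fun x : Fin k → ℂ => crossProd q ν x := by
  unfold crossProd
  simp only [crossS]
  fun_prop

theorem exists_norm_PhiR_le (hq0 : 0 < q) (hq1 : q < 1) (hν1 : ν < 1)
    {a b : ℝ} (ha : 0 < a) :
    ∃ C : ℝ, 0 ≤ C ∧ ∀ (n : Weyl k) (x : Fin k → ℂ), (∀ j, a ≤ ‖x j‖ ∧ ‖x j‖ ≤ b) →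
      ‖PhiR q ν n x‖ ≤ C * ∏ j, wt a b (n.1 j) := by
  obtain ⟨C1, hC1, hstat⟩ := exists_stat_le hq0 hq1 hν1 k
  obtain ⟨C2, hC2, hcross⟩ := exists_bound_annulus (k := k) (A := a - 1) (B := b + 1) (a := a)
    (b := b) (by linarith) (by linarith) (continuous_crossProd (q := q) (ν := ν)).continuousOn
  refine ⟨C1 * ‖((1 - q) / (1 - ν) : ℂ)‖ ^ k * (k.factorial * C2), by positivity,
    fun n x hx => ?_⟩
  have h1 : ‖∑ σ : Equiv.Perm (Fin k), sgn σ * (∏ A, ∏ B ∈ Finset.Iio A,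
      crossS q ν (x (σ B)) (x (σ A))) * ∏ j, x (σ j) ^ (n.1 j)‖ ≤
      k.factorial * C2 * ∏ j, wt a b (n.1 j) := by
    refine (norm_sum_le_of_le _ fun σ _ => ?_ : _ ≤ ∑ _σ : Equiv.Perm (Fin k),
      C2 * ∏ j, wt a b (n.1 j)).trans (le_of_eq ?_)
    · rw [norm_mul, norm_mul, norm_sgn, one_mul]
      exact mul_le_mul (hcross (fun j => x (σ j)) fun j => hx _) (norm_monomial_le ha hx n.1 σ)
        (norm_nonneg _) hC2
    · rw [Finset.sum_const, Finset.card_univ, Fintype.card_perm, Fintype.card_fin, nsmul_eq_mul,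
        mul_assoc]
  rw [PhiR, norm_mul, norm_mul, norm_pow, Complex.norm_real, Real.norm_of_nonneg
    (stat_pos hq0 hq1 hν1 n).le, mul_assoc (C1 * _)]
  gcongr
  exact hstat n

theorem continuousOn_alt {O : Set (Fin k → ℂ)} (hO : ∀ x ∈ O, ∀ j, x j ≠ 0) (l : Fin k → ℤ) :
    ContinuousOn (alt l) O := by
  unfold alt
  refine continuousOn_finsetSum _ fun σ _ => continuousOn_const.mul ?_
  exact continuousOn_finsetProd _ fun j _ => (continuous_apply _).continuousOn.zpow₀ _
      fun x hx => Or.inl (hO x hx _)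

theorem sepHolo_crossProd {O : Set ℂ} : SepHolo (fun x : Fin k → ℂ => crossProd q ν x) O := by
  refine sepHolo_of_differentiable ?_
  unfold crossProd
  simp only [crossS]
  fun_prop

theorem sepHolo_crossProd_inv (h : IsGoodAnnulus q ν ρm ρp) :
    SepHolo (fun x : Fin k → ℂ => (crossProd q ν x)⁻¹) (annulus ρm ρp) :=
  sepHolo_crossProd.inv fun _ hx => crossProd_ne_zero fun A B =>
    h.cross_ne _ _ (hx A).1.le (hx B).2.le

theorem sepHolo_alt {O : Set ℂ} (h0 : (0 : ℂ) ∉ O) (l : Fin k → ℤ) : SepHolo (alt l) O := by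
  unfold alt
  exact SepHolo.sum fun σ _ => (sepHolo_const _).mul ((sepHolo_monomial h0 l).perm σ)

theorem pairing_eq_laurentCoeff (r : Fin k → ℝ) (n : Fin k → ℤ) (f : (Fin k → ℂ) → ℂ) :
    pairing q ν r n f = laurentCoeff r (fun x => (crossProd q ν x)⁻¹ * f x) n := by
  simp only [pairing, laurentCoeff, mul_assoc]

/-- The integral against `PhiR n` grows at most like the weight of `[a, b]`, which contains the
radii. The pairing, estimated on the wider interval `[a', b']`, decays like the inverse of its
weight. The ratio is summable over `n`, and the remaining factor in `l` is summable by `hsum`. -/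
theorem summable_pairing (hq0 : 0 < q) (hq1 : q < 1) (hν1 : ν < 1)
    (h : IsGoodAnnulus q ν ρm ρp) {a b a' b' : ℝ} (ha : ρm < a) (ha2 : a' < a) (hab : a ≤ b)
    (hb1 : b < b') (hb : b < ρp) {r : Fin k → ℝ} (hr : ∀ j, a ≤ r j ∧ r j ≤ b)
    (ha1 : ρm < a') (hb2 : b' < ρp) {p : (Fin k → ℤ) → ℂ}
    (hsum : Summable fun l : Fin k → ℤ => ‖p l‖ * ∏ j, wt a' b' (l j))
    {F : (Fin k → ℂ) → ℂ} (hF : ContinuousOn F (box (torus r))) :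
    Summable fun y : (Fin k → ℤ) × Weyl k => p y.1 / k.factorial *
      ((multiIntegral (torus r) fun x => PhiR q ν y.2 x * F x) *
        pairing q ν r y.2.1 (alt y.1)) := by
  have hρ : 0 < ρm := by linarith [h.one_lt]
  have ha0 : 0 < a := hρ.trans ha
  have hr' : ∀ j, ρm < r j ∧ r j < ρp := fun j => ⟨ha.trans_le (hr j).1, (hr j).2.trans_lt hb⟩
  have h0 : (0 : ℂ) ∉ annulus ρm ρp := zero_notMem_annulus hρ.le
  have ha'0 : 0 < a' := hρ.trans ha1
  have hab' : a' ≤ b' := by linarith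
  have hbox1 : ∀ x ∈ box (torus r), ∀ j, a ≤ ‖x j‖ ∧ ‖x j‖ ≤ b := fun x hx j => by
    rw [norm_of_mem_torus h (fun j => ⟨(hr' j).1.le, (hr' j).2.le⟩) hx]; exact hr j
  have hfact' : ‖(k.factorial : ℂ)‖ = k.factorial := by simp
  set R : Weyl k → ℂ := fun n => multiIntegral (torus r) fun x => PhiR q ν n x * F x with hR
  obtain ⟨C1, hC1, hPhi⟩ := exists_norm_PhiR_le (k := k) hq0 hq1 hν1 (a := a) (b := b) ha0
  obtain ⟨C2, hC2, hcr⟩ := exists_bound_annulus ha1 hb2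
    (sepHolo_crossProd_inv (k := k) h).cont
  obtain ⟨C3, hC3⟩ := (isCompact_univ_pi fun j : Fin k =>
    (isPath_torus r j).isCompact_trace).exists_bound_of_continuousOn
    (hF.mono fun x hx j => hx j trivial)
  have hC3' : ∀ x : Fin k → ℂ, x ∈ box (torus r) → ‖F x‖ ≤ |C3| := fun x hx =>
    (hC3 x fun j _ => hx j).trans (le_abs_self _)
  set C4 := (∏ j, r j) * (C1 * |C3|) with hC4
  have hC4' : 0 ≤ C4 := mul_nonneg (Finset.prod_nonneg fun j _ => (ha0.trans_le (hr j).1).le)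
    (by positivity)
  have hRn : ∀ n : Weyl k, ‖R n‖ ≤ C4 * ∏ j, wt a b (n.1 j) := by
    intro n
    refine (norm_multiIntegral_torus_le (fun j => (ha0.trans_le (hr j).1).le)
      (M := C1 * (∏ j, wt a b (n.1 j)) * |C3|) fun x hx => ?_).trans (le_of_eq ?_)
    · have hxb := mem_box_torus hx
      rw [norm_mul]
      exact mul_le_mul (hPhi n x (hbox1 x hxb)) (hC3' x hxb) (norm_nonneg _)
        (mul_nonneg hC1 (Finset.prod_nonneg fun j _ => (wt_pos ha0 hab _).le))
    · rw [hC4]; ring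
  have hpair : ∀ (n : Weyl k) (l : Fin k → ℤ), ‖pairing q ν r n.1 (alt l)‖ ≤
      C2 * (k.factorial * ∏ j, wt a' b' (l j)) / ∏ j, wt a' b' (n.1 j) := by
    intro n l
    rw [pairing_eq_laurentCoeff]
    refine norm_laurentCoeff_le hρ.le hr' ha1 hab' hb2
      ((sepHolo_crossProd_inv h).mul (sepHolo_alt h0 l)) (fun x hx => ?_) n.1
    rw [norm_mul]
    exact mul_le_mul (hcr x hx) (norm_alt_le ha'0 hx l) (norm_nonneg _) hC2
  have hs1 : Summable fun n : Weyl k => ∏ j, wt a b (n.1 j) / wt a' b' (n.1 j) :=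
    (summable_prod_apply (fun n => (div_pos (wt_pos ha0 hab n) (wt_pos ha'0 hab' n)).le)
      (summable_wt_div ha'0 ha2 hab hb1) k).comp_injective Subtype.val_injective
  have hs2 := (hsum.mul_of_nonneg hs1 (fun l => mul_nonneg (norm_nonneg _)
    (Finset.prod_nonneg fun j _ => (wt_pos ha'0 hab' _).le)) (fun n =>
    Finset.prod_nonneg fun j _ => (div_pos (wt_pos ha0 hab _) (wt_pos ha'0 hab' _)).le)).mul_left
    (C4 * C2)
  refine Summable.of_norm_bounded hs2 fun y => ?_
  obtain ⟨l, n⟩ := y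
  have hw : 0 < ∏ j, wt a' b' (n.1 j) := Finset.prod_pos fun j _ => wt_pos ha'0 hab' _
  have hw' : 0 ≤ ∏ j, wt a b (n.1 j) := Finset.prod_nonneg fun j _ => (wt_pos ha0 hab _).le
  have h2 : (0 : ℝ) < k.factorial := by exact_mod_cast k.factorial_pos
  change ‖p l / k.factorial * (R n * pairing q ν r n.1 (alt l))‖ ≤ _
  rw [norm_mul, norm_mul, norm_div, hfact', Finset.prod_div_distrib]
  calc ‖p l‖ / k.factorial * (‖R n‖ * ‖pairing q ν r n.1 (alt l)‖)
      ≤ ‖p l‖ / k.factorial * ((C4 * ∏ j, wt a b (n.1 j)) *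
        (C2 * (k.factorial * ∏ j, wt a' b' (l j)) / ∏ j, wt a' b' (n.1 j))) := by
        gcongr
        · exact hRn n
        · exact hpair n l
    _ = _ := by field_simp

/-- Antisymmetry turns the Laurent series of `P` into a series of alternating sums, each a finite
combination of eigenfunctions. The double series converges absolutely, and its two orders of
summation give the two sides. -/
theorem hasSum_pairing (hq0 : 0 < q) (hq1 : q < 1) (hν0 : 0 ≤ ν) (hν1 : ν < 1)
    (h : IsGoodAnnulus q ν ρm ρp) {a b : ℝ} (ha : ρm < a) (hab : a ≤ b) (hb : b < ρp)
    {r : Fin k → ℝ} (hr : ∀ j, a ≤ r j ∧ r j ≤ b) (hri : Function.Injective r)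
    {P : (Fin k → ℂ) → ℂ} (hP : SepHolo P (annulus ρm ρp))
    (hPa : ∀ x ∈ poly k (annulus ρm ρp), ∀ σ : Equiv.Perm (Fin k),
      P (fun j => x (σ j)) = sgn σ * P x)
    {F : (Fin k → ℂ) → ℂ} (hF : ContinuousOn F (box (torus r))) :
    HasSum (fun n : Weyl k => multiIntegral (torus r) (fun x => PhiR q ν n x * F x) *
      pairing q ν r n.1 P) (multiIntegral (torus r) fun x => F x * P x) := by
  have hρ : 0 < ρm := by linarith [h.one_lt]
  have ha0 : 0 < a := hρ.trans ha
  have hr' : ∀ j, ρm < r j ∧ r j < ρp := fun j => ⟨ha.trans_le (hr j).1, (hr j).2.trans_lt hb⟩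
  have hr'' : ∀ j, ρm ≤ r j ∧ r j ≤ ρp := fun j => ⟨(hr' j).1.le, (hr' j).2.le⟩
  have h0 : (0 : ℂ) ∉ annulus ρm ρp := zero_notMem_annulus hρ.le
  obtain ⟨a', ha1, ha2⟩ := exists_between ha
  obtain ⟨b', hb1, hb2⟩ := exists_between hb
  have ha'0 : 0 < a' := hρ.trans ha1
  have hab' : a' ≤ b' := by linarith
  have hbox : ∀ x ∈ box (torus r), ∀ j, ‖x j‖ = r j := fun x hx =>
    norm_of_mem_torus h hr'' hx
  have hbox0 : ∀ x ∈ box (torus r), ∀ j, x j ≠ 0 := fun x hx => ne_zero_of_mem_torus h hr'' hx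
  have hbox1 : ∀ x ∈ box (torus r), ∀ j, a ≤ ‖x j‖ ∧ ‖x j‖ ≤ b := fun x hx j => by
    rw [hbox x hx]; exact hr j
  have hbox2 : ∀ x ∈ box (torus r), ∀ j, a' ≤ ‖x j‖ ∧ ‖x j‖ ≤ b' := fun x hx j =>
    ⟨ha2.le.trans (hbox1 x hx j).1, (hbox1 x hx j).2.trans hb1.le⟩
  have hboxP : ∀ x ∈ box (torus r), x ∈ poly k (annulus ρm ρp) := fun x hx j => by
    change ρm < ‖x j‖ ∧ ‖x j‖ < ρp
    rw [hbox x hx]; exact hr' j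
  set p := laurentCoeff r P with hp
  have hsum := summable_laurentCoeff hρ.le hr' ha1 hab' hb2 hP
  have hfact : (k.factorial : ℂ) ≠ 0 := by exact_mod_cast k.factorial_ne_zero
  have hfact' : ‖(k.factorial : ℂ)‖ = k.factorial := by simp
  -- the expansion of `P`
  have hexp : ∀ x ∈ box (torus r),
      HasSum (fun l => p l / k.factorial * alt l x) (P x) := by
    intro x hx
    have h1 : ∀ σ ∈ (Finset.univ : Finset (Equiv.Perm (Fin k))),
        HasSum (fun l => sgn σ * (p l * ∏ j, x (σ j) ^ l j)) (sgn σ * (sgn σ * P x)) := by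
      intro σ _
      rw [← hPa x (hboxP x hx) σ]
      exact (hasSum_laurentCoeff hρ.le hr' hP (x := fun j => x (σ j))
        fun j => hboxP x hx (σ j)).mul_left _
    have h2 := (hasSum_sum h1).mul_left (k.factorial : ℂ)⁻¹
    simp only [← mul_assoc, sgn_mul_self, one_mul, Finset.sum_const, Finset.card_univ,
      Fintype.card_perm, Fintype.card_fin, nsmul_eq_mul] at h2
    rw [inv_mul_cancel₀ hfact, one_mul] at h2
    refine h2.congr_fun fun l => ?_
    rw [alt, Finset.mul_sum, Finset.mul_sum]
    exact Finset.sum_congr rfl fun σ _ => by ring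
  have hterm : ∀ l, ∀ x ∈ box (torus r),
      ‖p l / k.factorial * alt l x‖ ≤ ‖p l‖ * ∏ j, wt a' b' (l j) := by
    intro l x hx
    have h1 := norm_alt_le ha'0 (hbox2 x hx) l
    have h2 : (0 : ℝ) < k.factorial := by exact_mod_cast k.factorial_pos
    rw [norm_mul, norm_div, hfact', div_mul_eq_mul_div, div_le_iff₀ h2]
    calc ‖p l‖ * ‖alt l x‖ ≤ ‖p l‖ * (k.factorial * ∏ j, wt a' b' (l j)) := by gcongr
      _ = _ := by ring
  have hexpG : ∀ G : (Fin k → ℂ) → ℂ, ContinuousOn G (box (torus r)) →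
      HasSum (fun l => p l / k.factorial * multiIntegral (torus r) fun x => G x * alt l x)
        (multiIntegral (torus r) fun x => G x * P x) := by
    intro G hG
    obtain ⟨M, hM⟩ := (isCompact_univ_pi fun j : Fin k =>
      (isPath_torus r j).isCompact_trace).exists_bound_of_continuousOn
      (hG.mono fun x hx j => hx j trivial)
    have h1 := hasSum_multiIntegral (isPath_torus r) (u := fun l =>
      M * (‖p l‖ * ∏ j, wt a' b' (l j))) (f := fun l x => G x * (p l / k.factorial * alt l x))
      (g := fun x => G x * P x)
      (fun l => hG.mul (continuousOn_const.mul (continuousOn_alt hbox0 l))) (hsum.mul_left M)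
      (fun l x hx => ?_) (fun x hx => (hexp x hx).mul_left _)
    · refine h1.congr_fun fun l => ?_
      rw [← multiIntegral_const_mul]
      exact multiIntegral_congr fun x _ => by ring
    · rw [norm_mul]
      have h2 := hM x fun j _ => hx j
      exact mul_le_mul h2 (hterm l x hx) (norm_nonneg _) ((norm_nonneg _).trans h2)
  set R : Weyl k → ℂ := fun n => multiIntegral (torus r) fun x => PhiR q ν n x * F x with hR
  let T : (Fin k → ℤ) × Weyl k → ℂ := fun y =>
    p y.1 / k.factorial * (R y.2 * pairing q ν r y.2.1 (alt y.1))
  -- Summed over `n` first, the inner sum is finite by completeness and reassembles `alt l`.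
  have hT1 : ∀ l, HasSum (fun n => T (l, n)) (p l / k.factorial *
      multiIntegral (torus r) fun x => F x * alt l x) := by
    intro l
    suffices hR' : HasSum (fun n : Weyl k => R n * pairing q ν r n.1 (alt l))
        (multiIntegral (torus r) fun x => F x * alt l x) from hR'.mul_left (p l / k.factorial)
    obtain ⟨s, hs0, hs⟩ := exists_alt_eq_sum hq0 hq1 hν0 hν1 h hr'' hri l
    have h1 : (multiIntegral (torus r) fun x => F x * alt l x) =
        ∑ n ∈ s, R n * pairing q ν r n.1 (alt l) := by
      have h2 : ∀ n, R n * pairing q ν r n.1 (alt l) = multiIntegral (torus r) fun x =>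
          pairing q ν r n.1 (alt l) * (PhiR q ν n x * F x) := fun n => by
        rw [multiIntegral_const_mul, mul_comm]
      simp only [h2]
      rw [← multiIntegral_sum (f := fun n x => pairing q ν r n.1 (alt l) * (PhiR q ν n x * F x))
        (isPath_torus r) s fun n _ =>
        continuousOn_const.mul ((continuousOn_PhiR hbox0 n).mul hF)]
      refine multiIntegral_congr fun x hx => ?_
      rw [hs x hx, Finset.mul_sum]
      exact Finset.sum_congr rfl fun n _ => by ring
    rw [h1]
    exact hasSum_sum_of_ne_finset_zero fun n hn => by rw [hs0 n hn, mul_zero]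
  -- Summed over `l` first, the Laurent series of `P` is reassembled inside the pairing.
  have hT2 : ∀ n : Weyl k, HasSum (fun l => T (l, n)) (R n * pairing q ν r n.1 P) := by
    intro n
    have h1 := (hexpG (fun x => (∏ j, x j ^ (-n.1 j - 1)) * (crossProd q ν x)⁻¹)
      ((continuousOn_monomial h hr'' _).mul (continuousOn_crossProd_inv h hr''))).mul_left (R n)
    refine h1.congr_fun fun l => ?_
    simp only [T, pairing]
    ring
  have hT : Summable T := summable_pairing hq0 hq1 hν1 h ha ha2 hab hb1 hb hr ha1 hb2 hsum hF
  obtain ⟨S, hS⟩ := hT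
  have hS1 := (hS.prod_fiberwise hT1).unique (hexpG F hF)
  rw [← hS1]
  exact ((Equiv.prodComm _ _).hasSum_iff.2 hS).prod_fiberwise fun n => hT2 n

end TorusIdentity

/-! ### Annuli on which the cross term has no zeros. -/

section GoodAnnulus

variable {q ν : ℝ}

/-- A zero would mean `x (1 - c y) = a + b y`, so it suffices that `ρm² |1 - c y|² - |a + b y|²` is
positive. For fixed `|y| = s` this is affine in `Re y`, so only `y = ±s` matter. There it is a
product of two factors affine in `s`, and the four hypotheses make them positive up to `s = ρp`. -/
theorem crossS_ne_zero_of_lt {a b c ρm ρp : ℝ} (hρm : 0 < ρm)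
    (h1 : 0 < ρm - a - (ρm * c + b) * ρp) (h2 : 0 < ρm - a + (ρm * c + b) * ρp)
    (h3 : 0 < ρm + a - (ρm * c - b) * ρp) (h4 : 0 < ρm + a + (ρm * c - b) * ρp)
    {x y : ℂ} (hx : ρm ≤ ‖x‖) (hy : ‖y‖ ≤ ρp) : (a : ℂ) + b * y + c * x * y - x ≠ 0 := by
  intro h
  have hxy : x * (1 - c * y) = a + b * y := by linear_combination -h
  have hn : ‖x‖ ^ 2 * Complex.normSq (1 - c * y) = Complex.normSq (a + b * y) := by
    rw [← hxy, Complex.normSq_mul, Complex.sq_norm]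
  set s := ‖y‖ with hs
  have hs0 : 0 ≤ s := norm_nonneg y
  have hs2 : s ^ 2 = y.re ^ 2 + y.im ^ 2 := by rw [hs, Complex.sq_norm, Complex.normSq_apply]; ring
  have hre : |y.re| ≤ s := Complex.abs_re_le_norm y
  rw [abs_le] at hre
  have hρp : 0 ≤ ρp := hs0.trans hy
  have key : ∀ α β : ℝ, 0 < α - β * ρp → 0 < α + β * ρp → 0 < α - β * s ∧ 0 < α + β * s := by
    intro α β hα hβ
    have : |β| * ρp < α := by
      rcases abs_cases β with ⟨h, _⟩ | ⟨h, _⟩ <;> rw [h] <;> linarith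
    have h5 : |β| * s ≤ |β| * ρp := mul_le_mul_of_nonneg_left hy (abs_nonneg β)
    have h6 : |β * s| < α := by rw [abs_mul, abs_of_nonneg hs0]; linarith
    rw [abs_lt] at h6
    constructor <;> linarith
  obtain ⟨k1, k2⟩ := key _ _ h1 h2
  obtain ⟨k3, k4⟩ := key _ _ h3 h4
  have e1 := mul_pos k1 k3
  have e2 := mul_pos k2 k4
  have hid : ρm ^ 2 * Complex.normSq (1 - c * y) - Complex.normSq (a + b * y) =
      (ρm - a) * (ρm + a) - ((ρm - a) * (ρm * c - b) + (ρm * c + b) * (ρm + a)) * y.re +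
        (ρm * c + b) * (ρm * c - b) * s ^ 2 := by
    rw [hs2, Complex.normSq_apply, Complex.normSq_apply]
    simp
    ring
  have hpos : 0 < ρm ^ 2 * Complex.normSq (1 - c * y) - Complex.normSq (a + b * y) := by
    rw [hid]
    rcases hs0.eq_or_lt with h0 | h0
    · rw [← h0] at hre e1 ⊢
      have : y.re = 0 := by linarith
      rw [this]; nlinarith
    -- Affine interpolation between the values at `y = s` and `y = -s`, with weights `s + Re y` and
    -- `s - Re y`.
    · have hsum : 0 < (s + y.re) * ((ρm - a - (ρm * c + b) * s) * (ρm + a - (ρm * c - b) * s)) +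
          (s - y.re) * ((ρm - a + (ρm * c + b) * s) * (ρm + a + (ρm * c - b) * s)) := by
        rcases hre.2.eq_or_lt with h' | h'
        · rw [h']
          have : 0 < (s + s) * ((ρm - a - (ρm * c + b) * s) * (ρm + a - (ρm * c - b) * s)) :=
            mul_pos (by linarith) e1
          linarith
        · have t1 := mul_nonneg (by linarith : 0 ≤ s + y.re) e1.le
          have t2 := mul_pos (by linarith : 0 < s - y.re) e2
          linarith
      have : 0 < 2 * s * ((ρm - a) * (ρm + a) - ((ρm - a) * (ρm * c - b) +
          (ρm * c + b) * (ρm + a)) * y.re + (ρm * c + b) * (ρm * c - b) * s ^ 2) := by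
        refine hsum.trans_le (le_of_eq ?_); ring
      exact pos_of_mul_pos_right this (by linarith)
  have hx2 : ρm ^ 2 ≤ ‖x‖ ^ 2 := pow_le_pow_left₀ hρm.le hx 2
  have := mul_le_mul_of_nonneg_right hx2 (Complex.normSq_nonneg (1 - c * y))
  linarith

/-- On the single circle `ρm = ρp = r` the four inequalities have explicit positive values when `1 <
r` and `ν r < 1`. All conditions are open, so they persist for radii `r ± ε`. -/
theorem exists_goodAnnulus (hq0 : 0 < q) (hq1 : q < 1) (hν0 : 0 ≤ ν) (hν1 : ν < 1) {r l u : ℝ}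
    (hr1 : 1 < r) (hrν : ν * r < 1) (hl : l < r) (hu : r < u) :
    ∃ ρm ρp, l < ρm ∧ ρm < r ∧ r < ρp ∧ ρp < u ∧ IsGoodAnnulus q ν ρm ρp := by
  set D := 1 - q * ν with hD
  have hD0 : 0 < D := one_sub_mul_pos hq0 hq1 hν1
  set a := (1 - q) / D with ha
  set b := (q - ν) / D with hb
  set c := ν * (1 - q) / D with hc
  have hev : ∀ f : ℝ → ℝ, Continuous f → 0 < f 0 → ∀ᶠ ε in nhds (0 : ℝ), 0 < f ε := fun f hf h =>
    hf.continuousAt.eventually (lt_mem_nhds h)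
  have e1 := hev (fun ε => (r - ε) - a - ((r - ε) * c + b) * (r + ε)) (by fun_prop) (by
    have : r - 0 - a - ((r - 0) * c + b) * (r + 0) = (1 - q) * (r - 1) * (1 - ν * r) / D := by
      rw [ha, hb, hc]; field_simp; rw [hD]; ring
    simp only [this]
    have h1 : 0 < 1 - q := by linarith
    have h2 : 0 < r - 1 := by linarith
    have h3 : 0 < 1 - ν * r := by linarith
    positivity)
  have e2 := hev (fun ε => (r - ε) - a + ((r - ε) * c + b) * (r + ε)) (by fun_prop) (by
    have : r - 0 - a + ((r - 0) * c + b) * (r + 0) =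
        ((r - 1) * ((1 + q) * (1 - ν) + ν * (1 - q) * (r + 1)) + 2 * q * (1 - ν)) / D := by
      rw [ha, hb, hc]; field_simp; rw [hD]; ring
    simp only [this]
    have h1 : 0 < 1 - q := by linarith
    have h2 : 0 < r - 1 := by linarith
    have h3 : 0 < 1 - ν := by linarith
    positivity)
  have e3 := hev (fun ε => (r - ε) + a - ((r - ε) * c - b) * (r + ε)) (by fun_prop) (by
    have : r - 0 + a - ((r - 0) * c - b) * (r + 0) =
        (2 * q * (r - 1) + (1 + q) * (1 - ν * r) + (1 - q) * r * (1 - ν * r)) / D := by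
      rw [ha, hb, hc]; field_simp; rw [hD]; ring
    simp only [this]
    have h1 : 0 < 1 - q := by linarith
    have h2 : 0 < r - 1 := by linarith
    have h3 : 0 < 1 - ν * r := by linarith
    positivity)
  have e4 := hev (fun ε => (r - ε) + a + ((r - ε) * c - b) * (r + ε)) (by fun_prop) (by
    have : r - 0 + a + ((r - 0) * c - b) * (r + 0) =
        (1 - q) * (ν * r ^ 2 + (1 + ν) * r + 1) / D := by
      rw [ha, hb, hc]; field_simp; rw [hD]; ring
    simp only [this]
    have h1 : 0 < 1 - q := by linarith
    have h2 : 0 < r := by linarith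
    positivity)
  have e5 := hev (fun ε => (r - ε) - 1) (by fun_prop) (by linarith)
  have e6 := hev (fun ε => 1 - ν * (r + ε)) (by fun_prop) (by simp; linarith)
  have e7 := hev (fun ε => (r - ε) - l) (by fun_prop) (by linarith)
  have e8 := hev (fun ε => u - (r + ε)) (by fun_prop) (by linarith)
  have hall := ((((((e1.and e2).and e3).and e4).and e5).and e6).and e7).and e8
  obtain ⟨ε, hε, hε0⟩ := ((hall.filter_mono nhdsWithin_le_nhds).and
    (self_mem_nhdsWithin (s := Ioi (0 : ℝ)))).exists
  obtain ⟨⟨⟨⟨⟨⟨⟨h1, h2⟩, h3⟩, h4⟩, h5⟩, h6⟩, h7⟩, h8⟩ := hε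
  have hε0' : 0 < ε := hε0
  refine ⟨r - ε, r + ε, by linarith, by linarith, by linarith, by linarith, by linarith,
    by linarith, by linarith, fun x y hx hy => ?_⟩
  have := crossS_ne_zero_of_lt (by linarith : 0 < r - ε) h1 h2 h3 h4 hx hy
  rw [ha, hb, hc, hD] at this
  push_cast at this
  rw [crossS]; exact this

end GoodAnnulus

/-! ### The exterior of a curve -/

section Exterior

variable {c : ℝ → ℂ}

theorem mem_outside_of_subset {S : Set ℂ} (hS : IsPreconnected S) (hd : Disjoint S (trace c))
    (hb : ¬ Bornology.IsBounded S) {p : ℂ} (hp : p ∈ S) : p ∈ outside c :=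
  ⟨disjoint_left.1 hd hp, fun h => hb (h.subset (hS.subset_connectedComponentIn hp
    fun _ hz => disjoint_left.1 hd hz))⟩

theorem connectedComponentIn_eq_of_subset {S : Set ℂ} (hS : IsPreconnected S)
    (hd : Disjoint S (trace c)) {p y : ℂ} (hp : p ∈ S) (hy : y ∈ S) :
    connectedComponentIn (trace c)ᶜ p = connectedComponentIn (trace c)ᶜ y :=
  connectedComponentIn_eq (hS.subset_connectedComponentIn hp
    (fun _ hz => disjoint_left.1 hd hz) hy)

theorem mem_inside_of_subset {S : Set ℂ} (hS : IsPreconnected S) (hd : Disjoint S (trace c))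
    {p y : ℂ} (hp : p ∈ S) (hpi : p ∈ inside c) (hy : y ∈ S) : y ∈ inside c :=
  ⟨disjoint_left.1 hd hy, by
    rw [← connectedComponentIn_eq_of_subset hS hd hp hy]; exact hpi.2⟩

theorem isPreconnected_le_norm (M : ℝ) : IsPreconnected {z : ℂ | M ≤ ‖z‖} := by
  have h : {z : ℂ | M ≤ ‖z‖} = (fun p : ℝ × ℝ => (p.1 : ℂ) * Complex.exp (p.2 * Complex.I)) ''
      (Ici (max M 0) ×ˢ univ) := by
    ext z
    simp only [mem_ofPred_eq, mem_image, mem_prod, mem_Ici, mem_univ, and_true, Prod.exists]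
    constructor
    · intro hz
      exact ⟨‖z‖, z.arg, max_le hz (norm_nonneg z), Complex.norm_mul_exp_arg_mul_I z⟩
    · rintro ⟨r, θ, hr, rfl⟩
      rw [norm_mul, Complex.norm_exp_ofReal_mul_I, mul_one, Complex.norm_real,
        Real.norm_of_nonneg ((le_max_right _ _).trans hr)]
      exact (le_max_left _ _).trans hr
  rw [h]
  refine ((isPreconnected_Ici).prod isPreconnected_univ).image _ (Continuous.continuousOn ?_)
  fun_prop

theorem not_isBounded_le_norm (M : ℝ) : ¬ Bornology.IsBounded {z : ℂ | M ≤ ‖z‖} := by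
  intro h
  obtain ⟨C, hC⟩ := h.exists_norm_le
  have := hC ((|M| + |C| + 1 : ℝ) : ℂ) (by
    rw [mem_ofPred_eq, Complex.norm_real, Real.norm_of_nonneg (by positivity)]
    linarith [le_abs_self M, abs_nonneg C])
  rw [Complex.norm_real, Real.norm_of_nonneg (by positivity)] at this
  linarith [le_abs_self C, abs_nonneg M]

theorem mem_outside_of_norm_lt {p : ℂ} (h : ∀ z ∈ trace c, ‖z‖ < ‖p‖) : p ∈ outside c :=
  mem_outside_of_subset (isPreconnected_le_norm ‖p‖)
    (disjoint_left.2 fun z hz hz' => absurd (h z hz') (not_lt.2 hz)) (not_isBounded_le_norm _)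
    (le_refl ‖p‖)

theorem mem_outside_of_re_le {s : ℝ} (h : ∀ z ∈ trace c, s < z.re) {p : ℂ} (hp : p.re ≤ s) :
    p ∈ outside c := by
  refine mem_outside_of_subset (S := {z | z.re ≤ s}) (convex_halfSpace_re_le s).isPreconnected
    (disjoint_left.2 fun z hz hz' => absurd (h z hz') (not_lt.2 hz)) (fun hb => ?_) hp
  obtain ⟨C, hC⟩ := hb.exists_norm_le
  have := hC ((-(|s| + |C| + 1) : ℝ) : ℂ) (by
    rw [mem_ofPred_eq, Complex.ofReal_re]; linarith [neg_abs_le s, abs_nonneg C])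
  rw [Complex.norm_real, norm_neg, Real.norm_of_nonneg (by positivity)] at this
  linarith [le_abs_self C, abs_nonneg s]

theorem notMem_inside_of_mem_outside {p : ℂ} (h : p ∈ outside c) : p ∉ inside c :=
  fun h' => h.2 h'.2

theorem trace_or_inside_or_outside (c : ℝ → ℂ) (p : ℂ) :
    p ∈ trace c ∨ p ∈ inside c ∨ p ∈ outside c := by
  by_cases h : p ∈ trace c
  · exact Or.inl h
  by_cases h' : Bornology.IsBounded (connectedComponentIn (trace c)ᶜ p)
  · exact Or.inr (Or.inl ⟨h, h'⟩)
  · exact Or.inr (Or.inr ⟨h, h'⟩)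

theorem mem_inside_iff {p : ℂ} : p ∈ inside c ↔ p ∉ closedExterior c := by
  constructor
  · rintro h (h' | h')
    · exact h.1 h'
    · exact h'.2 h.2
  · intro h
    rcases trace_or_inside_or_outside c p with h' | h' | h'
    · exact absurd (Or.inl h') h
    · exact h'
    · exact absurd (Or.inr h') h

/-- The complement of a large disc is connected and misses the curve, so there is only one unbounded
component. -/
theorem exists_outside_eq (hK : IsCompact (trace c)) :
    ∃ p ∈ (trace c)ᶜ, outside c = connectedComponentIn (trace c)ᶜ p := by
  obtain ⟨M, hM⟩ := hK.isBounded.exists_norm_le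
  set p : ℂ := ((|M| + 1 : ℝ) : ℂ) with hp
  have hpn : ‖p‖ = |M| + 1 := by
    rw [hp, Complex.norm_real, Real.norm_of_nonneg (by positivity)]
  have hlt : ∀ z ∈ trace c, ‖z‖ < ‖p‖ := fun z hz => by
    rw [hpn]; linarith [hM z hz, le_abs_self M]
  have hpo := mem_outside_of_norm_lt hlt
  have hd : Disjoint {z : ℂ | ‖p‖ ≤ ‖z‖} (trace c) :=
    disjoint_left.2 fun z hz hz' => absurd (hlt z hz') (not_lt.2 hz)
  refine ⟨p, hpo.1, Subset.antisymm (fun x hx => ?_) fun x hx => ?_⟩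
  · obtain ⟨y, hy, hyn⟩ : ∃ y ∈ connectedComponentIn (trace c)ᶜ x, ‖p‖ < ‖y‖ := by
      by_contra! h
      exact hx.2 (Metric.isBounded_closedBall.subset (t := Metric.closedBall 0 ‖p‖)
        fun y hy => by simpa using h y hy)
    rw [connectedComponentIn_eq_of_subset (isPreconnected_le_norm ‖p‖) hd (le_refl ‖p‖) hyn.le,
      ← connectedComponentIn_eq hy]
    exact mem_connectedComponentIn hx.1
  · refine ⟨connectedComponentIn_subset _ _ hx, ?_⟩
    rw [← connectedComponentIn_eq hx]
    exact hpo.2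

theorem isPreconnected_outside (hK : IsCompact (trace c)) : IsPreconnected (outside c) := by
  obtain ⟨p, -, hp⟩ := exists_outside_eq hK
  rw [hp]; exact isPreconnected_connectedComponentIn

theorem isOpen_outside (hK : IsCompact (trace c)) : IsOpen (outside c) := by
  obtain ⟨p, -, hp⟩ := exists_outside_eq hK
  rw [hp]; exact hK.isClosed.isOpen_compl.connectedComponentIn

theorem isOpen_inside (hK : IsCompact (trace c)) : IsOpen (inside c) := by
  rw [isOpen_iff_mem_nhds]
  intro p hp
  refine Filter.mem_of_superset (hK.isClosed.isOpen_compl.connectedComponentIn.mem_nhds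
    (mem_connectedComponentIn hp.1)) fun x hx => ?_
  refine ⟨connectedComponentIn_subset _ _ hx, ?_⟩
  rw [← connectedComponentIn_eq hx]; exact hp.2

theorem isClosed_closedExterior (hK : IsCompact (trace c)) : IsClosed (closedExterior c) := by
  have : closedExterior c = (inside c)ᶜ := by
    ext p; rw [mem_compl_iff, mem_inside_iff, not_not]
  rw [this]; exact (isOpen_inside hK).isClosed_compl

/-- The curve and its exterior are connected and touch: were the closure of the exterior disjoint
from the curve, the exterior would be closed and open in the plane. -/
theorem isPreconnected_closedExterior (hc : IsPath c) : IsPreconnected (closedExterior c) := by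
  have hK := hc.isCompact_trace
  have htr : IsPreconnected (trace c) := isPreconnected_Icc.image _ hc.cont
  obtain ⟨p, hp, ho⟩ := exists_outside_eq hK
  obtain ⟨z, hz, hz'⟩ : ∃ z ∈ trace c, z ∈ closure (outside c) := by
    by_contra! h
    have hcl : IsClosed (outside c) := by
      refine isClosed_of_closure_subset fun x hx => ?_
      have h1 : IsPreconnected (closure (outside c)) := (isPreconnected_outside hK).closure
      have h2 := h1.subset_connectedComponentIn (x := p) (F := (trace c)ᶜ)
        (subset_closure (by rw [ho]; exact mem_connectedComponentIn hp)) fun y hy hy' => h y hy' hy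
      rw [ho]; exact h2 hx
    have huniv := IsClopen.eq_univ ⟨hcl, isOpen_outside hK⟩
      ⟨p, by rw [ho]; exact mem_connectedComponentIn hp⟩
    obtain ⟨w, hw⟩ := trace_nonempty c
    exact (huniv ▸ mem_univ w : w ∈ outside c).1 hw
  have h1 : IsPreconnected (insert z (outside c)) :=
    (isPreconnected_outside hK).subset_closure (subset_insert _ _)
      (insert_subset hz' subset_closure)
  have : closedExterior c = trace c ∪ insert z (outside c) := by
    ext y
    simp only [closedExterior, mem_union, mem_insert_iff]
    constructor
    · rintro (h | h)
      · exact Or.inl h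
      · exact Or.inr (Or.inr h)
    · rintro (h | rfl | h)
      · exact Or.inl h
      · exact Or.inl hz
      · exact Or.inr h
  rw [this]
  exact htr.union z hz (mem_insert _ _) h1

/-- The radial retraction onto the disc of radius `R` maps the closed exterior onto the set in
question, since the circle of radius `R` lies outside the curve. -/
theorem isPreconnected_closedExterior_inter (hc : IsPath c) {R : ℝ} (hR0 : 0 < R)
    (hR : ∀ z ∈ trace c, ‖z‖ < R) :
    IsPreconnected (closedExterior c ∩ {z | ‖z‖ ≤ R}) := by
  let ρ : ℂ → ℂ := fun z => ((min 1 (R / ‖z‖) : ℝ) : ℂ) * z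
  have hρ1 : ∀ z, ‖z‖ ≤ R → ρ z = z := fun z hz => by
    by_cases h0 : z = 0
    · simp [ρ, h0]
    · have : 1 ≤ R / ‖z‖ := by rwa [one_le_div (norm_pos_iff.2 h0)]
      simp only [ρ, min_eq_left this, Complex.ofReal_one, one_mul]
  have hρ2 : ∀ z, R ≤ ‖z‖ → ‖ρ z‖ = R := fun z hz => by
    have h0 : 0 < ‖z‖ := hR0.trans_le hz
    have : R / ‖z‖ ≤ 1 := by rwa [div_le_one h0]
    simp only [ρ, min_eq_right this]
    rw [norm_mul, Complex.norm_real, Real.norm_of_nonneg (by positivity), div_mul_cancel₀ _ h0.ne']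
  have hcont : Continuous ρ := by
    have : ρ = fun z => ((R / max R ‖z‖ : ℝ) : ℂ) * z := by
      funext z
      rcases le_total ‖z‖ R with h | h
      · rw [hρ1 z h, max_eq_left h, div_self hR0.ne', Complex.ofReal_one, one_mul]
      · have h0 : 0 < ‖z‖ := hR0.trans_le h
        have : R / ‖z‖ ≤ 1 := by rwa [div_le_one h0]
        simp only [ρ, min_eq_right this, max_eq_right h]
    rw [this]
    refine (Complex.continuous_ofReal.comp (continuous_const.div
      (continuous_const.max continuous_norm) fun z => ?_)).mul continuous_id
    exact (hR0.trans_le (le_max_left _ _)).ne'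
  have himg : closedExterior c ∩ {z | ‖z‖ ≤ R} = ρ '' closedExterior c := by
    ext z
    constructor
    · rintro ⟨h1, h2⟩
      exact ⟨z, h1, hρ1 z h2⟩
    · rintro ⟨y, hy, rfl⟩
      rcases le_total ‖y‖ R with h | h
      · rw [hρ1 y h]; exact ⟨hy, h⟩
      · refine ⟨Or.inr (mem_outside_of_norm_lt fun z hz => ?_), (hρ2 y h).le⟩
        rw [hρ2 y h]; exact hR z hz
  rw [himg]
  exact (isPreconnected_closedExterior hc).image _ hcont.continuousOn

theorem isPreconnected_thickening {B : Set ℂ} (hB : IsPreconnected B) (δ : ℝ) :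
    IsPreconnected (Metric.thickening δ B) := by
  rcases le_or_gt δ 0 with hδ | hδ
  · rw [Metric.thickening_of_nonpos hδ]; exact isPreconnected_empty
  rcases B.eq_empty_or_nonempty with rfl | ⟨b, hb⟩
  · rw [Metric.thickening_empty]; exact isPreconnected_empty
  refine isPreconnected_of_forall b fun y hy => ?_
  obtain ⟨z, hz, hyz⟩ := Metric.mem_thickening_iff.1 hy
  refine ⟨B ∪ Metric.ball z δ, union_subset (Metric.self_subset_thickening hδ B)
    (Metric.ball_subset_thickening hz δ), Or.inl hb, Or.inr hyz, ?_⟩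
  exact hB.union z hz (Metric.mem_ball_self hδ) Metric.isPreconnected_ball

theorem exists_thickening_poly_subset {k : ℕ} {B : Set ℂ} (hB : IsCompact B)
    {W : Set (Fin k → ℂ)} (hW : IsOpen W) (hBW : {x | ∀ j, x j ∈ B} ⊆ W) :
    ∃ δ > 0, poly k (Metric.thickening δ B) ⊆ W := by
  have hc : IsCompact {x : Fin k → ℂ | ∀ j, x j ∈ B} := isCompact_pi_infinite fun _ => hB
  obtain ⟨δ, hδ, h⟩ := hc.exists_thickening_subset_open hW hBW
  refine ⟨δ, hδ, fun x hx => h (Metric.mem_thickening_iff.2 ?_)⟩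
  choose b hb hbx using fun j => Metric.mem_thickening_iff.1 (hx j)
  exact ⟨b, hb, (dist_pi_lt_iff hδ).2 hbx⟩

end Exterior

/-! ### Piecewise smooth curves -/

section Piecewise

variable {c : ℝ → ℂ}

theorem integrableOn_deriv_of_contDiffOn {a b : ℝ} (h : ContDiffOn ℝ 1 c (Icc a b)) :
    IntegrableOn (deriv c) (Icc a b) := by
  rcases le_or_gt b a with hab | hab
  · refine IntegrableOn.of_measure_zero ?_
    rw [Real.volume_Icc]; simpa using hab
  have h1 : ContinuousOn (derivWithin c (Icc a b)) (Icc a b) :=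
    h.continuousOn_derivWithin (uniqueDiffOn_Icc hab) le_rfl
  rw [integrableOn_Icc_iff_integrableOn_Ioo]
  refine (h1.integrableOn_Icc.mono_set Ioo_subset_Icc_self).congr_fun (fun t ht => ?_)
    measurableSet_Ioo
  exact derivWithin_of_mem_nhds (Icc_mem_nhds ht.1 ht.2)

theorem PiecewiseC1.isPath_and_diff (h : PiecewiseC1 c) : IsPath c ∧
    ∃ s : Set ℝ, s.Countable ∧ ∀ t ∈ Ioo (0 : ℝ) 1 \ s, DifferentiableAt ℝ c t := by
  obtain ⟨m, p, hp0, hpm, hmono, hC⟩ := h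
  have key : ∀ i ≤ m, ContinuousOn c (Icc 0 (p i)) ∧ IntegrableOn (deriv c) (Icc 0 (p i)) ∧
      ∃ s : Set ℝ, s.Countable ∧ ∀ t ∈ Ioo 0 (p i) \ s, DifferentiableAt ℝ c t := by
    intro i
    induction i with
    | zero =>
      intro _
      rw [hp0]
      refine ⟨by simp, ?_, ∅, countable_empty, fun t ht => ?_⟩
      · exact IntegrableOn.of_measure_zero (by simp)
      · simp at ht
    | succ i ih =>
      intro hi
      obtain ⟨h1, h2, s, hs, h3⟩ := ih (by omega)
      have hp : p i ≤ p (i + 1) := hmono (Nat.le_succ i)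
      have hp' : 0 ≤ p i := hp0 ▸ hmono (Nat.zero_le i)
      have hCi := hC i (by omega)
      have hun : Icc 0 (p (i + 1)) = Icc 0 (p i) ∪ Icc (p i) (p (i + 1)) :=
        (Icc_union_Icc_eq_Icc hp' hp).symm
      refine ⟨?_, ?_, insert (p i) s, hs.insert _, fun t ht => ?_⟩
      · rw [hun]
        exact h1.union_of_isClosed hCi.continuousOn isClosed_Icc isClosed_Icc
      · rw [hun]
        exact h2.union (integrableOn_deriv_of_contDiffOn hCi)
      · obtain ⟨ht1, ht2⟩ := ht
        rw [mem_insert_iff, not_or] at ht2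
        rcases lt_or_gt_of_ne ht2.1 with hlt | hlt
        · exact h3 t ⟨⟨ht1.1, hlt⟩, ht2.2⟩
        · exact (hCi.differentiableOn one_ne_zero).differentiableAt (Icc_mem_nhds hlt ht1.2)
  obtain ⟨h1, h2, h3⟩ := key m le_rfl
  rw [hpm] at h1 h2 h3
  exact ⟨⟨h1, h2⟩, h3⟩

theorem PiecewiseC1.isLoop (h : PiecewiseC1 c) (hc : c 0 = c 1) : IsLoop c where
  toIsPath := h.isPath_and_diff.1
  closed := hc
  diff := h.isPath_and_diff.2

/-- An injective piecewise smooth curve has a regular arc. -/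
theorem PiecewiseC1.exists_regular (h : PiecewiseC1 c) (hinj : InjOn c (Ico 0 1)) :
    ∃ a b, 0 ≤ a ∧ a < b ∧ b ≤ 1 ∧ (∀ t ∈ Ioo a b, DifferentiableAt ℝ c t ∧ deriv c t ≠ 0) ∧
      ContinuousOn (deriv c) (Ioo a b) := by
  obtain ⟨m, p, hp0, hpm, hmono, hC⟩ := h
  obtain ⟨i, hi, hpi⟩ : ∃ i < m, p i < p (i + 1) := by
    by_contra! hle
    have : ∀ i ≤ m, p i ≤ 0 := by
      intro i
      induction i with
      | zero => intro _; rw [hp0]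
      | succ i ih => intro hi; exact (hle i (by omega)).trans (ih (by omega))
    have := this m le_rfl
    rw [hpm] at this; linarith
  have h0 : 0 ≤ p i := hp0 ▸ hmono (Nat.zero_le i)
  have h1 : p (i + 1) ≤ 1 := hpm ▸ hmono (by omega)
  have hCi := hC i hi
  have hdiff : ∀ t ∈ Ioo (p i) (p (i + 1)), DifferentiableAt ℝ c t := fun t ht =>
    (hCi.differentiableOn one_ne_zero).differentiableAt (Icc_mem_nhds ht.1 ht.2)
  have hcont : ContinuousOn (deriv c) (Ioo (p i) (p (i + 1))) := by
    have h2 : ContinuousOn (derivWithin c (Icc (p i) (p (i + 1)))) (Icc (p i) (p (i + 1))) :=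
      hCi.continuousOn_derivWithin (uniqueDiffOn_Icc hpi) le_rfl
    refine (h2.mono Ioo_subset_Icc_self).congr fun t ht => ?_
    exact (derivWithin_of_mem_nhds (Icc_mem_nhds ht.1 ht.2)).symm
  -- If the derivative vanished on the whole piece, the curve would be constant there, against
  -- injectivity.
  obtain ⟨t, ht, htd⟩ : ∃ t ∈ Ioo (p i) (p (i + 1)), deriv c t ≠ 0 := by
    by_contra! hz
    obtain ⟨s, hs1, hs2⟩ := exists_between hpi
    obtain ⟨u, hu1, hu2⟩ := exists_between hs2
    have := (convex_Ioo (p i) (p (i + 1))).is_const_of_fderivWithin_eq_zero (𝕜 := ℝ) (f := c)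
      (fun t ht => (hdiff t ht).differentiableWithinAt) (fun t ht => by
        rw [fderivWithin_of_isOpen isOpen_Ioo ht]
        ext
        simpa using hz t ht) ⟨hs1, hs2⟩ ⟨hs1.trans hu1, hu2⟩
    exact hu1.ne (hinj ⟨h0.trans hs1.le, hs2.trans_le h1⟩
      ⟨h0.trans (hs1.trans hu1).le, hu2.trans_le h1⟩ this)
  have hne : ∀ᶠ s in nhds t, deriv c s ≠ 0 :=
    (hcont.continuousAt (Ioo_mem_nhds ht.1 ht.2)).eventually_ne htd
  obtain ⟨ε, hε, hball⟩ := Metric.eventually_nhds_iff.1 hne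
  refine ⟨max (p i) (t - ε), min (p (i + 1)) (t + ε), h0.trans (le_max_left _ _),
    max_lt (lt_min hpi (by linarith [ht.1])) (lt_min (by linarith [ht.2]) (by linarith)),
    (min_le_left _ _).trans h1, fun s hs => ?_, hcont.mono fun s hs => ?_⟩
  · have hs1 := max_lt_iff.1 hs.1
    have hs2 := lt_min_iff.1 hs.2
    refine ⟨hdiff s ⟨hs1.1, hs2.1⟩, hball ?_⟩
    rw [Real.dist_eq, abs_lt]; constructor <;> linarith
  · exact ⟨(le_max_left _ _).trans_lt hs.1, hs.2.trans_le (min_le_left _ _)⟩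

end Piecewise

/-! ### The images of contours under the Möbius map -/

section MobiusImage

variable {q ν : ℝ} {c : ℝ → ℂ}

theorem one_sub_nu_ne_zero_of_mem {A : Set ℂ} (h : ν ≠ 0 → (ν : ℂ)⁻¹ ∉ A) {z : ℂ} (hz : z ∈ A) :
    1 - ν * z ≠ 0 := by
  intro h0
  have hν : ν ≠ 0 := by rintro rfl; simp at h0
  have hν' : (ν : ℂ) ≠ 0 := by exact_mod_cast hν
  refine h hν ?_
  rwa [← eq_inv_of_mul_eq_one_right (sub_eq_zero.1 h0).symm]

theorem hasDerivAt_xi {z : ℂ} (hz : 1 - ν * z ≠ 0) :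
    HasDerivAt (xi ν) (-(1 - ν) / (1 - ν * z) ^ 2) z := by
  have h1 : HasDerivAt (fun z : ℂ => 1 - z) (-1) z := by simpa using (hasDerivAt_id z).const_sub 1
  have h2 : HasDerivAt (fun z : ℂ => 1 - ν * z) (-ν) z := by
    simpa using ((hasDerivAt_id z).const_mul (ν : ℂ)).const_sub 1
  refine (h1.div h2 hz).congr_deriv ?_
  congr 1; ring

theorem trace_xi_comp : trace (xi ν ∘ c) = xi ν '' trace c := image_comp _ _ _

theorem injOn_xi_comp (hν1 : ν < 1) (hc : ∀ z ∈ trace c, 1 - ν * z ≠ 0)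
    (hi : InjOn c (Ico 0 1)) : InjOn (xi ν ∘ c) (Ico 0 1) := by
  intro s hs t ht h
  refine hi hs ht ?_
  have := congrArg (xi ν) h
  simpa [xi_xi hν1 (hc _ (mem_image_of_mem _ (Ico_subset_Icc_self hs))),
    xi_xi hν1 (hc _ (mem_image_of_mem _ (Ico_subset_Icc_self ht)))] using this

theorem PiecewiseC1.xi_comp (h : PiecewiseC1 c) (hc : ∀ z ∈ trace c, 1 - ν * z ≠ 0) :
    PiecewiseC1 (xi ν ∘ c) := by
  obtain ⟨m, p, hp0, hpm, hmono, hC⟩ := h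
  refine ⟨m, p, hp0, hpm, hmono, fun i hi => ?_⟩
  have hne : ∀ t ∈ Icc (p i) (p (i + 1)), 1 - ν * c t ≠ 0 := fun t ht =>
    hc _ (mem_image_of_mem _ ⟨(hp0 ▸ hmono (Nat.zero_le i)).trans ht.1,
      ht.2.trans (hpm ▸ hmono hi)⟩)
  exact ((contDiffOn_const (c := (1 : ℂ))).sub (hC i hi)).mul
    (((contDiffOn_const (c := (1 : ℂ))).sub (contDiffOn_const.mul (hC i hi))).inv hne)

theorem deriv_xi_comp {t : ℝ} (hc : DifferentiableAt ℝ c t) (h : 1 - ν * c t ≠ 0) :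
    deriv (xi ν ∘ c) t = -(1 - ν) / (1 - ν * c t) ^ 2 * deriv c t := by
  have := (hasDerivAt_xi h).scomp t hc.hasDerivAt
  rw [this.deriv, smul_eq_mul, mul_comm]

theorem IsLoop.ae_differentiableAt (hc : IsLoop c) :
    ∀ᵐ t ∂(volume.restrict (Icc (0 : ℝ) 1)), DifferentiableAt ℝ c t := by
  obtain ⟨s, hs, hd⟩ := hc.diff
  rw [← restrict_Ioo_eq_restrict_Icc, ae_restrict_iff' measurableSet_Ioo]
  filter_upwards [hs.ae_notMem volume] with t ht ht'
  exact hd t ⟨ht', ht⟩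

theorem IsLoop.lineIntegral_xi (hc : IsLoop c) (h : ∀ z ∈ trace c, 1 - ν * z ≠ 0) (g : ℂ → ℂ) :
    lineIntegral (xi ν ∘ c) g = lineIntegral c fun z => -(1 - ν) / (1 - ν * z) ^ 2 * g (xi ν z) := by
  rw [lineIntegral, lineIntegral]
  refine integral_congr_ae ?_
  filter_upwards [hc.ae_differentiableAt, ae_restrict_mem measurableSet_Icc] with t ht ht'
  rw [deriv_xi_comp ht (h _ (mem_image_of_mem _ ht')), Function.comp]
  ring

/-- The logarithmic derivative of `Ξ(z) - Ξ(p)` is `1 / (z - p) + ν / (1 - ν z)`. The second term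
has its pole at `ν⁻¹`, outside the curve, and integrates to zero. -/
theorem IsLoop.winding_xi (hν1 : ν < 1) (hc : IsLoop c) (hinv : ν ≠ 0 → (ν : ℂ)⁻¹ ∈ outside c)
    {p : ℂ} (hp : p ∉ trace c) (hp0 : 1 - ν * p ≠ 0) :
    winding (xi ν ∘ c) (xi ν p) = winding c p := by
  have hne : ∀ z ∈ trace c, 1 - ν * z ≠ 0 := fun z hz =>
    one_sub_nu_ne_zero_of_mem (fun hν => (hinv hν).1) hz
  have h1 := one_sub_nu_ne hν1
  have hz0 : ∀ z ∈ trace c, z - p ≠ 0 := fun z hz h => hp (sub_eq_zero.1 h ▸ hz)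
  have hpole : lineIntegral c (fun z => ν / (1 - ν * z)) = 0 := by
    by_cases hν : ν = 0
    · subst hν; simp [lineIntegral]
    have hν' : (ν : ℂ) ≠ 0 := by exact_mod_cast hν
    have hw := hc.winding_eq_zero (hinv hν)
    rw [winding_eq_lineIntegral] at hw
    have hw' := (mul_eq_zero.1 hw).resolve_left (inv_ne_zero Complex.two_pi_I_ne_zero)
    have he : (fun z => (ν : ℂ) / (1 - ν * z)) = fun z => -(z - (ν : ℂ)⁻¹)⁻¹ := by
      ext z
      have : 1 - ν * z = -(ν * (z - (ν : ℂ)⁻¹)) := by rw [mul_sub, mul_inv_cancel₀ hν']; ring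
      rw [this, div_neg, div_mul_eq_div_div, div_self hν', one_div]
    rw [he]
    rw [lineIntegral] at hw' ⊢
    simp only [mul_neg]
    rw [integral_neg, hw', neg_zero]
  rw [winding_eq_lineIntegral, winding_eq_lineIntegral, hc.lineIntegral_xi hne]
  congr 1
  have hI1 : IntegrableOn (fun t => deriv c t * (c t - p)⁻¹) (Icc 0 1) :=
    hc.toIsPath.integrableOn (g := fun z => (z - p)⁻¹)
      ((continuousOn_id.sub continuousOn_const).inv₀ hz0)
  have hI2 : IntegrableOn (fun t => deriv c t * (ν / (1 - ν * c t))) (Icc 0 1) :=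
    hc.toIsPath.integrableOn (g := fun z => ν / (1 - ν * z))
      (continuousOn_const.div (by fun_prop) hne)
  rw [← add_zero (lineIntegral c fun w => (w - p)⁻¹), ← hpole, lineIntegral, lineIntegral,
    lineIntegral, ← integral_add hI1 hI2]
  refine setIntegral_congr_fun measurableSet_Icc fun t ht => ?_
  have hz := hne _ (mem_image_of_mem c ht)
  have hzp := hz0 _ (mem_image_of_mem c ht)
  rw [xi_sub_xi hz hp0]
  rw [← mul_add]
  congr 1
  have h1' : (-1 + ν : ℂ) ≠ 0 := by intro h; apply h1; linear_combination -h
  field_simp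
  ring

/-- For `ν = 0` the map is an isometry. For `ν ≠ 0` a path in the exterior leads from `z` to `ν⁻¹`;
before its first arrival at this pole of `Ξ` its image is connected, misses the image curve and is
unbounded. -/
theorem xi_mem_outside (hν1 : ν < 1) (hc : IsPath c) (hinv : ν ≠ 0 → (ν : ℂ)⁻¹ ∈ outside c)
    {z : ℂ} (hz : z ∈ outside c) (hz0 : 1 - ν * z ≠ 0) : xi ν z ∈ outside (xi ν ∘ c) := by
  have hne : ∀ z ∈ trace c, 1 - ν * z ≠ 0 := fun z hz =>
    one_sub_nu_ne_zero_of_mem (fun hν => (hinv hν).1) hz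
  have hdisj : ∀ w : ℂ, 1 - ν * w ≠ 0 → w ∈ outside c → xi ν w ∉ trace (xi ν ∘ c) := by
    rintro w hw0 hw ⟨t, ht, h⟩
    have := congrArg (xi ν) h
    rw [Function.comp, xi_xi hν1 (hne _ (mem_image_of_mem c ht)), xi_xi hν1 hw0] at this
    exact hw.1 (this ▸ mem_image_of_mem c ht)
  by_cases hν : ν = 0
  · subst hν
    have hx : xi 0 = fun w : ℂ => 1 - w := by ext w; simp [xi]
    refine mem_outside_of_subset (S := xi 0 '' outside c)
      ((isPreconnected_outside hc.isCompact_trace).image _ (by rw [hx]; fun_prop))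
      (disjoint_left.2 ?_) (fun hb => hz.2 ?_) (mem_image_of_mem _ hz)
    · rintro _ ⟨w, hw, rfl⟩
      exact hdisj w (by simp) hw
    · obtain ⟨C, hC⟩ := hb.exists_norm_le
      refine isBounded_iff_forall_norm_le.2 ⟨C + 1, fun w hw => ?_⟩
      have hwo : w ∈ outside c :=
        ⟨connectedComponentIn_subset _ _ hw, by rw [← connectedComponentIn_eq hw]; exact hz.2⟩
      have h := hC _ (mem_image_of_mem _ hwo)
      rw [hx] at h
      calc ‖w‖ = ‖1 - (1 - w)‖ := by rw [sub_sub_cancel]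
        _ ≤ ‖(1 : ℂ)‖ + ‖1 - w‖ := norm_sub_le _ _
        _ ≤ C + 1 := by rw [norm_one]; linarith
  have hν' : (ν : ℂ) ≠ 0 := by exact_mod_cast hν
  have hpc : IsPathConnected (outside c) :=
    (isOpen_outside hc.isCompact_trace).isConnected_iff_isPathConnected.1
      ⟨⟨z, hz⟩, isPreconnected_outside hc.isCompact_trace⟩
  obtain ⟨f, hf⟩ := hpc.joinedIn z hz _ (hinv hν)
  have hfe : Continuous f.extend := f.continuous_extend
  have hfo : ∀ t, f.extend t ∈ outside c := fun t => hf (projIcc 0 1 zero_le_one t)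
  set T : Set ℝ := {t | t ∈ Icc 0 1 ∧ f.extend t = (ν : ℂ)⁻¹}
  have hTc : IsCompact T := isCompact_Icc.inter_right (isClosed_singleton.preimage hfe)
  have hTn : T.Nonempty := ⟨1, by simp, by simp⟩
  obtain ⟨⟨hτ0, hτ1⟩, hτ⟩ := hTc.sInf_mem hTn
  set τ := sInf T
  have hτpos : 0 < τ := by
    refine hτ0.lt_of_ne fun h => ?_
    rw [← h, Path.extend_zero] at hτ
    rw [hτ, mul_inv_cancel₀ hν', sub_self] at hz0
    exact hz0 rfl
  have hbefore : ∀ t ∈ Ico 0 τ, 1 - ν * f.extend t ≠ 0 := by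
    intro t ht h0
    have : f.extend t = (ν : ℂ)⁻¹ := eq_inv_of_mul_eq_one_right (sub_eq_zero.1 h0).symm
    exact absurd (csInf_le hTc.bddBelow ⟨⟨ht.1, ht.2.le.trans hτ1⟩, this⟩) (not_le.2 ht.2)
  refine mem_outside_of_subset (S := (fun t => xi ν (f.extend t)) '' Ico 0 τ)
    (isPreconnected_Ico.image _ ?_) (disjoint_left.2 ?_) (fun hb => ?_)
    ⟨0, ⟨le_rfl, hτpos⟩, by simp⟩
  · exact ContinuousOn.div (by fun_prop) (by fun_prop) hbefore
  · rintro _ ⟨t, ht, rfl⟩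
    exact hdisj _ (hbefore t ht) (hfo t)
  · obtain ⟨C, hC⟩ := hb.exists_norm_le
    -- A bound on the image, cleared of denominators, passes to the limit `t → τ`, where it reads
    -- `|1 - ν⁻¹| ≤ 0`.
    have hle : ∀ t ∈ Ico 0 τ, ‖1 - f.extend t‖ ≤ C * ‖1 - ν * f.extend t‖ := fun t ht => by
      have := hC _ (mem_image_of_mem _ ht)
      simp only [xi, norm_div] at this
      rwa [div_le_iff₀ (norm_pos_iff.2 (hbefore t ht))] at this
    have hcl : τ ∈ closure (Ico 0 τ) := by
      rw [closure_Ico hτpos.ne]; exact ⟨hτpos.le, le_rfl⟩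
    have hfin : ‖1 - f.extend τ‖ ≤ C * ‖1 - ν * f.extend τ‖ :=
      closure_minimal (t := {t | ‖1 - f.extend t‖ ≤ C * ‖1 - ν * f.extend t‖}) hle
        (isClosed_le (by fun_prop) (by fun_prop)) hcl
    rw [hτ, mul_inv_cancel₀ hν', sub_self, norm_zero, mul_zero] at hfin
    have h1 := norm_eq_zero.1 (le_antisymm hfin (norm_nonneg _))
    have h2 : (ν : ℂ) = 1 := by
      have := sub_eq_zero.1 h1
      exact inv_eq_one.1 this.symm
    exact one_sub_nu_ne hν1 (by rw [h2, sub_self])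

end MobiusImage

/-! ### The region between the two contours -/

section Region

variable {q ν : ℝ} {γ γ' : ℝ → ℂ}

/-- A compact connected region `B`, between the contour `Γ` and a circle of radius `R`. -/
structure IsRegion (ν : ℝ) (Γ : ℝ → ℂ) (B : Set ℂ) (R₀ R : ℝ) : Prop where
  compact : IsCompact B
  preconnected : IsPreconnected B
  trace_subset : trace Γ ⊆ B
  zero_notMem : (0 : ℂ) ∉ B
  one_lt : 1 < R₀
  lt : R₀ < R
  nu_mul_lt : ν * R < 1
  norm_le : ∀ z ∈ B, ‖z‖ ≤ R
  trace_lt : ∀ z ∈ trace Γ, ‖z‖ < R₀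
  mem_of_norm : ∀ z : ℂ, R₀ ≤ ‖z‖ → ‖z‖ ≤ R → z ∈ B
  winding_eq : ∀ p ∉ B, ‖p‖ < R → winding Γ p = 1

theorem one_sub_nu_ne_of_norm_le (hν0 : 0 ≤ ν) {R : ℝ} (hR : ν * R < 1) {z : ℂ} (hz : ‖z‖ ≤ R) :
    1 - ν * z ≠ 0 := by
  intro h
  have h1 : ‖(ν : ℂ) * z‖ = 1 := by rw [← sub_eq_zero.1 h, norm_one]
  rw [norm_mul, Complex.norm_real, Real.norm_of_nonneg hν0] at h1
  nlinarith [mul_le_mul_of_nonneg_left hz hν0]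

theorem norm_sq_one_sub (z : ℂ) (a : ℝ) :
    ‖1 - a * z‖ ^ 2 = 1 - 2 * a * z.re + a ^ 2 * ‖z‖ ^ 2 := by
  rw [← Complex.normSq_eq_norm_sq, ← Complex.normSq_eq_norm_sq, Complex.normSq_apply,
    Complex.normSq_apply]
  simp
  ring

theorem IsSpectralContour.isLoop (h : IsSpectralContour q ν γ) : IsLoop γ :=
  h.contour.piecewiseC1.isLoop h.contour.closed

theorem IsSpectralContour.one_sub_nu_ne (h : IsSpectralContour q ν γ) :
    ∀ z ∈ trace γ, 1 - ν * z ≠ 0 := fun _ hz =>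
  one_sub_nu_ne_zero_of_mem (fun hν => (h.inv_mem hν).1) hz

theorem IsSpectralContour.isLoop_xi (h : IsSpectralContour q ν γ) : IsLoop (xi ν ∘ γ) :=
  (h.contour.piecewiseC1.xi_comp h.one_sub_nu_ne).isLoop (by simp [h.contour.closed])

theorem IsGapContour.isLoop (h : IsGapContour q ν γ γ') : IsLoop γ' :=
  h.contour.piecewiseC1.isLoop h.contour.closed

theorem IsGapContour.one_sub_nu_ne (h : IsGapContour q ν γ γ') :
    ∀ z ∈ trace γ', 1 - ν * z ≠ 0 := fun _ hz =>
  one_sub_nu_ne_zero_of_mem (fun hν => (h.inv_mem hν).1) hz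

theorem IsGapContour.isLoop_xi (h : IsGapContour q ν γ γ') : IsLoop (xi ν ∘ γ') :=
  (h.contour.piecewiseC1.xi_comp h.one_sub_nu_ne).isLoop (by simp [h.contour.closed])

/-- If `|Ξ| < 1` on all of `γ`, then `γ` lies in `Re z > 0`. Multiplying its leftmost point by `q`
gives a point still farther left, hence outside `γ`, although `q γ` lies inside. -/
theorem IsSpectralContour.exists_one_le_norm_xi (hq0 : 0 < q) (hq1 : q < 1) (hν0 : 0 ≤ ν)
    (hν1 : ν < 1) (h : IsSpectralContour q ν γ) : ∃ z ∈ trace γ, 1 ≤ ‖xi ν z‖ := by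
  by_contra! hlt
  have hre : ∀ z ∈ trace γ, 0 < z.re := fun z hz => by
    have h1 := hlt z hz
    rw [xi, norm_div, div_lt_one (norm_pos_iff.2 (h.one_sub_nu_ne z hz))] at h1
    have h2 : ‖1 - z‖ ^ 2 < ‖1 - ν * z‖ ^ 2 := by gcongr
    have h3 := norm_sq_one_sub z 1
    rw [Complex.ofReal_one, one_mul] at h3
    rw [h3, norm_sq_one_sub] at h2
    have h4 : 0 ≤ (1 - ν ^ 2) * ‖z‖ ^ 2 := by
      have : 0 ≤ 1 - ν ^ 2 := by nlinarith
      positivity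
    by_contra! h5
    nlinarith [mul_nonneg (sub_nonneg.2 hν1.le) (neg_nonneg.2 h5)]
  obtain ⟨z, hz, hmin⟩ := h.isLoop.isCompact_trace.exists_isMinOn (trace_nonempty γ)
    Complex.continuous_re.continuousOn
  have hin : (q : ℂ) * z ∈ inside γ := by
    obtain ⟨t, ht, rfl⟩ := hz
    exact h.image_subset (mem_image_of_mem (fun t => (q : ℂ) * γ t) ht)
  refine notMem_inside_of_mem_outside (mem_outside_of_re_le (s := q * z.re) (fun w hw => ?_) ?_) hin
  · have := hmin hw
    have h0 := hre z hz
    simp only [mem_ofPred_eq] at this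
    nlinarith
  · simp

/-- Otherwise every point of `γ'` is closer to `ν⁻¹` than to `1`, so `γ'` lies to the right of their
midpoint `(1 + ν) / (2 ν)`. The same then holds for `γ`, which cannot enclose `1`. -/
theorem exists_nu_mul_norm_xi_le (hν0 : 0 ≤ ν) (hν1 : ν < 1) (h : IsSpectralContour q ν γ)
    (h' : IsGapContour q ν γ γ') : ∃ w ∈ trace γ', ν * ‖xi ν w‖ ≤ 1 := by
  by_contra! hlt
  obtain ⟨w₀, hw₀⟩ := trace_nonempty γ'
  have hν : 0 < ν := hν0.lt_of_ne (by rintro rfl; have := hlt w₀ hw₀; norm_num at this)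
  have hs : 1 ≤ (1 + ν) / (2 * ν) := by rw [one_le_div (by positivity)]; linarith
  have hre : ∀ w ∈ trace γ', (1 + ν) / (2 * ν) < w.re := fun w hw => by
    have h1 := hlt w hw
    rw [xi, norm_div, mul_div_assoc', one_lt_div (norm_pos_iff.2 (h'.one_sub_nu_ne w hw))] at h1
    have h2 : ‖1 - ν * w‖ ^ 2 < (ν * ‖1 - w‖) ^ 2 := by gcongr
    have h3 := norm_sq_one_sub w 1
    rw [Complex.ofReal_one, one_mul] at h3
    rw [mul_pow, h3, norm_sq_one_sub] at h2
    rw [div_lt_iff₀ (by positivity)]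
    by_contra! h5
    nlinarith [mul_nonneg (sub_nonneg.2 hν1.le) (sub_nonneg.2 h5)]
  refine notMem_inside_of_mem_outside (mem_outside_of_re_le (c := γ) (s := (1 + ν) / (2 * ν))
    (fun z hz => ?_) (by simpa using hs)) h.one_mem
  by_contra! hle
  exact notMem_inside_of_mem_outside (mem_outside_of_re_le hre hle) (h'.contains hz)

/-- The gap condition separates the maximum of `|Ξ|` on `γ` from its minimum on `γ'`, and `R₀ < R`
are taken in between; the two preceding lemmas give `1 < R₀` and `ν R < 1`. The region is the part
of the closed exterior of `Ξ(γ)` in the disc of radius `R`. -/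
theorem exists_region (hq0 : 0 < q) (hq1 : q < 1) (hν0 : 0 ≤ ν) (hν1 : ν < 1)
    (h : IsSpectralContour q ν γ) (h' : IsGapContour q ν γ γ') :
    ∃ (B : Set ℂ) (R₀ R : ℝ), IsRegion ν (xi ν ∘ γ) B R₀ R ∧
      B ⊆ closedBetween (xi ν ∘ γ) (xi ν ∘ γ') ∧ ∀ x ∈ B, xi ν x ∈ closedBetween γ γ' := by
  have hne := h.one_sub_nu_ne
  have hne' := h'.one_sub_nu_ne
  have hcont : ∀ A : Set ℂ, (∀ z ∈ A, 1 - ν * z ≠ 0) → ContinuousOn (xi ν) A := fun A hA z hz =>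
    (hasDerivAt_xi (hA z hz)).continuousAt.continuousWithinAt
  obtain ⟨z, hz, hzmax⟩ := h.isLoop.isCompact_trace.exists_isMaxOn (trace_nonempty γ)
    (hcont _ hne).norm
  obtain ⟨w, hw, hwmin⟩ := h'.isLoop.isCompact_trace.exists_isMinOn (trace_nonempty γ')
    (hcont _ hne').norm
  have hz1 : 1 ≤ ‖xi ν z‖ := by
    obtain ⟨z₁, hz₁, h1⟩ := h.exists_one_le_norm_xi hq0 hq1 hν0 hν1
    exact h1.trans (hzmax hz₁)
  have hw1 : ν * ‖xi ν w‖ ≤ 1 := by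
    obtain ⟨w₁, hw₁, h1⟩ := exists_nu_mul_norm_xi_le hν0 hν1 h h'
    exact (mul_le_mul_of_nonneg_left (hwmin hw₁) hν0).trans h1
  have hgap := h'.gap z hz w hw
  obtain ⟨R₀, hR₀, hR₀'⟩ := exists_between hgap
  obtain ⟨R, hR, hR'⟩ := exists_between hR₀'
  have hνR : ν * R < 1 := by
    rcases hν0.eq_or_lt with h0 | h0
    · rw [← h0]; norm_num
    · exact (mul_lt_mul_of_pos_left hR' h0).trans_le hw1
  have hnR : ∀ x : ℂ, ‖x‖ ≤ R → 1 - ν * x ≠ 0 := fun x hx => one_sub_nu_ne_of_norm_le hν0 hνR hx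
  have hlt : ∀ x ∈ trace (xi ν ∘ γ), ‖x‖ < R₀ := by
    rw [trace_xi_comp]
    rintro _ ⟨y, hy, rfl⟩
    exact (hzmax hy).trans_lt hR₀
  have hlt' : ∀ x ∈ trace (xi ν ∘ γ'), R < ‖x‖ := by
    rw [trace_xi_comp]
    rintro _ ⟨y, hy, rfl⟩
    exact hR'.trans_le (hwmin hy)
  have htr : ∀ {c : ℝ → ℂ} {x : ℂ}, 1 - ν * x ≠ 0 → xi ν x ∈ trace c → x ∈ trace (xi ν ∘ c) := by
    intro c x hx hxt
    rw [trace_xi_comp, ← xi_xi hν1 hx]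
    exact mem_image_of_mem _ hxt
  have htr' : ∀ {c : ℝ → ℂ} {x : ℂ}, (∀ z ∈ trace c, 1 - ν * z ≠ 0) → x ∈ trace (xi ν ∘ c) →
      xi ν x ∈ trace c := by
    intro c x hc hx
    rw [trace_xi_comp] at hx
    obtain ⟨y, hy, rfl⟩ := hx
    rwa [xi_xi hν1 (hc y hy)]
  have hwind : ∀ {x : ℂ}, 1 - ν * x ≠ 0 → xi ν x ∈ inside γ → winding (xi ν ∘ γ) x = 1 := by
    intro x hx hxi
    have := h.isLoop.winding_xi hν1 h.inv_mem hxi.1 (one_sub_nu_xi_ne hν1 hx)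
    rw [xi_xi hν1 hx] at this
    rw [this, h.contour.positive _ hxi]
  -- The Möbius map need not carry bounded components to bounded ones; the winding number, which it
  -- preserves here, decides on which side of the image curve a point lies.
  have hext : ∀ {x : ℂ}, 1 - ν * x ≠ 0 → xi ν x ∈ inside γ → x ∉ closedExterior (xi ν ∘ γ) := by
    rintro x hx hxi (hx' | hx')
    · exact hxi.1 (htr' hne hx')
    · have h1 := h.isLoop_xi.winding_eq_zero hx'
      rw [hwind hx hxi] at h1
      exact one_ne_zero h1
  have hxz : 1 - ν * xi ν z ≠ 0 := one_sub_nu_xi_ne hν1 (hne z hz)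
  have hzi : xi ν z ∈ inside (xi ν ∘ γ') := by
    have hzc := h'.contains hz
    rw [mem_inside_iff]
    rintro (hx' | hx')
    · have := htr' hne' hx'
      rw [xi_xi hν1 (hne z hz)] at this
      exact hzc.1 this
    · have h1 := h'.isLoop.winding_xi hν1 h'.inv_mem hzc.1 (hne z hz)
      rw [h'.isLoop_xi.winding_eq_zero hx', h'.contour.positive _ hzc] at h1
      exact zero_ne_one h1
  have hzR : xi ν z ∈ Metric.closedBall (0 : ℂ) R := by
    rw [mem_closedBall_zero_iff]; exact (hR₀.trans hR).le
  refine ⟨closedExterior (xi ν ∘ γ) ∩ {x | ‖x‖ ≤ R}, R₀, R, ?_, ?_, ?_⟩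
  · refine ⟨?_, ?_, ?_, ?_, hz1.trans_lt hR₀, hR, hνR, fun _ hx => hx.2, hlt, ?_, ?_⟩
    · refine Metric.isCompact_of_isClosed_isBounded
        ((isClosed_closedExterior h.isLoop_xi.isCompact_trace).inter
          (isClosed_le continuous_norm continuous_const)) ?_
      exact (Metric.isBounded_closedBall (x := (0 : ℂ)) (r := R)).subset fun x hx =>
        mem_closedBall_zero_iff.2 hx.2
    · exact isPreconnected_closedExterior_inter h.isLoop_xi.toIsPath
        (by linarith) fun x hx => (hlt x hx).trans hR
    · exact fun x hx => ⟨Or.inl hx, ((hlt x hx).trans hR).le⟩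
    -- The origin is `Ξ(1)`, and `1` is inside `γ`.
    · intro h0
      exact hext (x := 0) (by simp) (by simpa [xi] using h.one_mem) h0.1
    · intro x hx hx'
      exact ⟨Or.inr (mem_outside_of_norm_lt fun y hy => (hlt y hy).trans_le hx), hx'⟩
    · intro p hp hpR
      have hp0 := hnR p hpR.le
      refine hwind hp0 ?_
      have hpi : p ∈ inside (xi ν ∘ γ) := mem_inside_iff.2 fun hpe => hp ⟨hpe, hpR.le⟩
      rcases trace_or_inside_or_outside γ (xi ν p) with h1 | h1 | h1
      · exact absurd (htr hp0 h1) hpi.1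
      · exact h1
      · have := xi_mem_outside hν1 h.isLoop.toIsPath h.inv_mem h1 (one_sub_nu_xi_ne hν1 hp0)
        rw [xi_xi hν1 hp0] at this
        exact absurd hpi (notMem_inside_of_mem_outside this)
  · rintro x ⟨hx, hxR⟩
    refine ⟨hx, Or.inr (mem_inside_of_subset (S := Metric.closedBall 0 R)
      Metric.isPreconnected_closedBall (disjoint_left.2 fun y hy hy' => ?_) hzR hzi
      (mem_closedBall_zero_iff.2 hxR))⟩
    exact absurd (hlt' y hy') (not_lt.2 (mem_closedBall_zero_iff.1 hy))
  · rintro x ⟨hx, hxR⟩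
    have hb : ∀ y ∈ Metric.closedBall (0 : ℂ) R, 1 - ν * y ≠ 0 := fun y hy =>
      hnR y (mem_closedBall_zero_iff.1 hy)
    constructor
    · by_contra hxe
      exact hext (hnR x hxR) (mem_inside_iff.2 hxe) hx
    · refine Or.inr (mem_inside_of_subset (S := xi ν '' Metric.closedBall 0 R)
        (Metric.isPreconnected_closedBall.image _ (hcont _ hb)) (disjoint_left.2 ?_)
        (mem_image_of_mem _ hzR) (by rw [xi_xi hν1 (hne z hz)]; exact h'.contains hz)
        (mem_image_of_mem _ (mem_closedBall_zero_iff.2 hxR)))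
      rintro _ ⟨y, hy, rfl⟩ hy'
      exact absurd (hlt' y (htr (hb y hy) hy')) (not_lt.2 (mem_closedBall_zero_iff.1 hy))

end Region

/-! ### Symmetrization -/

section Symm

variable {q ν : ℝ} {k : ℕ}

theorem contourIntegral_const_mul (γ : ℝ → ℂ) (a : ℂ) (f : (Fin k → ℂ) → ℂ) :
    contourIntegral γ (fun x => a * f x) = a * contourIntegral γ f :=
  multiIntegral_const_mul _ a f

theorem ContourIntegrable.contourIntegral_sum_perm {γ : ℝ → ℂ} {f : (Fin k → ℂ) → ℂ}
    (h : ContourIntegrable γ f) :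
    contourIntegral γ (fun x => ∑ σ : Equiv.Perm (Fin k), f fun j => x (σ j)) =
      k.factorial * contourIntegral γ f := by
  have h1 : contourIntegral γ (fun x => ∑ σ : Equiv.Perm (Fin k), f fun j => x (σ j)) =
      ∑ σ : Equiv.Perm (Fin k), contourIntegral γ fun x => f fun j => x (σ j) := by
    simp only [contourIntegral]
    rw [← Finset.mul_sum, ← integral_finsetSum _ fun σ _ => h.perm σ]
    simp only [pullback, Finset.mul_sum]
  rw [h1]
  simp only [contourIntegral_perm]
  rw [Finset.sum_const, Finset.card_univ, Fintype.card_perm, Fintype.card_fin, nsmul_eq_mul]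

theorem sum_sgn_perm (T : (Fin k → ℂ) → ℂ) (x : Fin k → ℂ) (τ : Equiv.Perm (Fin k)) :
    ∑ σ : Equiv.Perm (Fin k), sgn σ * T (fun j => x (τ (σ j))) =
      sgn τ * ∑ σ : Equiv.Perm (Fin k), sgn σ * T fun j => x (σ j) := by
  rw [Finset.mul_sum, ← Equiv.sum_comp (Equiv.mulLeft τ)
    fun σ : Equiv.Perm (Fin k) => sgn τ * (sgn σ * T fun j => x (σ j))]
  refine Finset.sum_congr rfl fun σ _ => ?_
  rw [Equiv.coe_mulLeft, sgn_mul, ← mul_assoc, ← mul_assoc, sgn_mul_self, one_mul]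
  rfl

theorem sum_perm_perm (T : (Fin k → ℂ) → ℂ) (x : Fin k → ℂ) (τ : Equiv.Perm (Fin k)) :
    ∑ σ : Equiv.Perm (Fin k), T (fun j => x (τ (σ j))) =
      ∑ σ : Equiv.Perm (Fin k), T fun j => x (σ j) := by
  rw [← Equiv.sum_comp (Equiv.mulLeft τ) fun σ : Equiv.Perm (Fin k) => T fun j => x (σ j)]
  rfl

/-- The basic summand of the left eigenfunction. -/
noncomputable def summandL (q ν : ℝ) (n : Fin k → ℤ) (x : Fin k → ℂ) : ℂ :=
  (∏ A, ∏ B ∈ Finset.Iio A, crossS q ν (x A) (x B)) * ∏ j, x j ^ (-n j)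

theorem PhiL_eq (n : Weyl k) (x : Fin k → ℂ) :
    PhiL q ν n x = ∑ σ : Equiv.Perm (Fin k), sgn σ * summandL q ν n.1 fun j => x (σ j) := by
  simp only [PhiL, summandL, mul_assoc]

theorem PhiR_eq (n : Weyl k) (x : Fin k → ℂ) :
    PhiR q ν n x = stat q ν n * ((1 - q) / (1 - ν)) ^ k *
      ∑ σ : Equiv.Perm (Fin k), sgn σ * (fun x => crossProd q ν x * ∏ j, x j ^ n.1 j)
        fun j => x (σ j) := by
  simp only [PhiR, crossProd, mul_assoc]

theorem PhiL_perm (n : Weyl k) (x : Fin k → ℂ) (τ : Equiv.Perm (Fin k)) :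
    PhiL q ν n (fun j => x (τ j)) = sgn τ * PhiL q ν n x := by
  rw [PhiL_eq, PhiL_eq, sum_sgn_perm]

theorem PhiR_perm (n : Weyl k) (x : Fin k → ℂ) (τ : Equiv.Perm (Fin k)) :
    PhiR q ν n (fun j => x (τ j)) = sgn τ * PhiR q ν n x := by
  rw [PhiR_eq, PhiR_eq,
    sum_sgn_perm (fun x => crossProd q ν x * ∏ j, x j ^ n.1 j) x τ, mul_left_comm]

theorem sepHolo_summandL {O : Set ℂ} (h0 : (0 : ℂ) ∉ O) (n : Fin k → ℤ) :
    SepHolo (summandL q ν n) O := by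
  refine SepHolo.mul (sepHolo_of_differentiable ?_) (sepHolo_monomial h0 fun j => -n j)
  simp only [crossS]
  fun_prop

theorem sepHolo_PhiL {O : Set ℂ} (h0 : (0 : ℂ) ∉ O) (n : Weyl k) : SepHolo (PhiL q ν n) O := by
  have : PhiL q ν n = _ := funext (PhiL_eq n)
  rw [this]
  exact SepHolo.sum fun σ _ => (sepHolo_const _).mul ((sepHolo_summandL h0 _).perm σ)

theorem sepHolo_PhiR {O : Set ℂ} (h0 : (0 : ℂ) ∉ O) (n : Weyl k) : SepHolo (PhiR q ν n) O := by
  have : PhiR q ν n = _ := funext (PhiR_eq n)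
  rw [this]
  exact (sepHolo_const _).mul (SepHolo.sum fun σ _ => (sepHolo_const _).mul
    ((sepHolo_crossProd.mul (sepHolo_monomial h0 n.1)).perm σ))

theorem comp_swap_eq {x : Fin k → ℂ} {i j : Fin k} (hx : x i = x j) :
    (fun a => x (Equiv.swap i j a)) = x := by
  ext a
  rw [Equiv.swap_apply_def]
  split_ifs with h1 h2
  · rw [h1, hx]
  · rw [h2, hx]
  · rfl

theorem eq_zero_of_alt {f : (Fin k → ℂ) → ℂ} {x : Fin k → ℂ}
    (ha : ∀ σ : Equiv.Perm (Fin k), f (fun j => x (σ j)) = sgn σ * f x) {i j : Fin k} (hij : i ≠ j)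
    (hx : x i = x j) : f x = 0 := by
  have h := ha (Equiv.swap i j)
  rw [comp_swap_eq hx, sgn, Equiv.Perm.sign_swap hij] at h
  simp only [Units.val_neg, Units.val_one, Int.cast_neg, Int.cast_one, neg_mul, one_mul] at h
  exact self_eq_neg.1 h

theorem SepHolo.exists_eq_vandermonde_mul_of_alt {O : Set ℂ} {f : (Fin k → ℂ) → ℂ} (hO : IsOpen O)
    (hf : SepHolo f O)
    (ha : ∀ x, ∀ σ : Equiv.Perm (Fin k), f (fun j => x (σ j)) = sgn σ * f x) :
    ∃ g, SepHolo g O ∧ ∀ x ∈ poly k O, f x = vandermonde x * g x :=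
  hf.exists_eq_vandermonde_mul hO fun _ _ hij x _ hx => eq_zero_of_alt (ha x) hij hx

/-- The symmetric weight in the spectral biorthogonality relation. -/
noncomputable def weight (q ν : ℝ) (x : Fin k → ℂ) : ℂ :=
  (∏ j, x j) * ∏ A, ∏ B ∈ Finset.univ.erase A, crossS q ν (x A) (x B)

theorem prod_erase_eq (G : Fin k → Fin k → ℂ) :
    ∏ A, ∏ B ∈ Finset.univ.erase A, G A B =
      ∏ x : Fin k × Fin k, if x.1 = x.2 then 1 else G x.1 x.2 := by
  rw [Fintype.prod_prod_type]
  refine Finset.prod_congr rfl fun A _ => ?_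
  have h : ∏ B, (if A = B then 1 else G A B) =
      ∏ B ∈ Finset.univ.erase A, if A = B then 1 else G A B :=
    (Finset.prod_erase _ (by simp)).symm
  rw [h]
  exact Finset.prod_congr rfl fun B hB => (if_neg (Finset.ne_of_mem_erase hB).symm).symm

theorem weight_eq (x : Fin k → ℂ) : weight q ν x =
    (∏ j, x j) * ((∏ A, ∏ B ∈ Finset.Iio A, crossS q ν (x A) (x B)) * crossProd q ν x) := by
  rw [weight, prod_erase_eq fun A B => crossS q ν (x A) (x B), prod_pairs_eq_prod_lt
    (fun a b => if a = b then 1 else crossS q ν (x a) (x b)) (by simp), crossProd]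
  congr 1
  rw [← Finset.prod_mul_distrib]
  refine Finset.prod_congr rfl fun A _ => ?_
  rw [← Finset.prod_mul_distrib]
  refine Finset.prod_congr rfl fun B hB => ?_
  have := (Finset.mem_Iio.1 hB).ne
  rw [if_neg this.symm, if_neg this]

theorem weight_perm (x : Fin k → ℂ) (σ : Equiv.Perm (Fin k)) :
    weight q ν (fun j => x (σ j)) = weight q ν x := by
  rw [weight, weight, Equiv.prod_comp σ x, prod_erase_eq fun A B => crossS q ν (x (σ A)) (x (σ B)),
    prod_erase_eq fun A B => crossS q ν (x A) (x B),
    ← prod_pairs_perm (fun a b => if a = b then 1 else crossS q ν (x a) (x b)) σ]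
  simp only [EmbeddingLike.apply_eq_iff_eq]

theorem differentiable_weight : Differentiable ℂ (weight (k := k) q ν) := by
  unfold weight
  simp only [crossS]
  fun_prop

theorem rhsXi_eq (F G : (Fin k → ℂ) → ℂ) (x : Fin k → ℂ) : rhsXi q ν F G x =
    weight q ν x * ∑ σ : Equiv.Perm (Fin k), sgn σ * F x * G fun j => x (σ j) := rfl

/-- After symmetrization the integrand is the symmetric weight times the double sum of `sgn σ sgn τ
F(x_σ) G(x_τ)`, in which `F` and `G` play the same role. -/
theorem sum_rhsXi_comm (F G : (Fin k → ℂ) → ℂ) (x : Fin k → ℂ) :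
    ∑ σ : Equiv.Perm (Fin k), rhsXi q ν F G (fun j => x (σ j)) =
      ∑ σ : Equiv.Perm (Fin k), rhsXi q ν G F (fun j => x (σ j)) := by
  have key : ∀ F G : (Fin k → ℂ) → ℂ,
      ∑ σ : Equiv.Perm (Fin k), rhsXi q ν F G (fun j => x (σ j)) =
      weight q ν x * ∑ σ : Equiv.Perm (Fin k), ∑ τ : Equiv.Perm (Fin k),
        sgn σ * sgn τ * F (fun j => x (σ j)) * G fun j => x (τ j) := by
    intro F G
    rw [Finset.mul_sum]
    refine Finset.sum_congr rfl fun σ _ => ?_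
    rw [rhsXi_eq, weight_perm]
    congr 1
    rw [← Equiv.sum_comp (Equiv.mulLeft σ) fun τ : Equiv.Perm (Fin k) =>
      sgn σ * sgn τ * F (fun j => x (σ j)) * G fun j => x (τ j)]
    refine Finset.sum_congr rfl fun τ _ => ?_
    rw [Equiv.coe_mulLeft, sgn_mul, ← mul_assoc (sgn σ), sgn_mul_self, one_mul]
    rfl
  rw [key, key, Finset.sum_comm]
  congr 1
  exact Finset.sum_congr rfl fun σ _ => Finset.sum_congr rfl fun τ _ => by ring

end Symm

/-! ### The identity under a vanishing condition on the diagonals -/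

section Core

variable {q ν : ℝ} {k : ℕ} {Γ : ℝ → ℂ} {B O : Set ℂ} {R₀ R : ℝ}

theorem IsRegion.multiIntegral_eq_torus (hB : IsRegion ν Γ B R₀ R) (hΓ : IsLoop Γ) (hO : IsOpen O)
    (hBO : B ⊆ O) {r : Fin k → ℝ} (hr : ∀ j, R₀ ≤ r j ∧ r j ≤ R) {f : (Fin k → ℂ) → ℂ}
    (hf : SepHolo f O) : contourIntegral Γ f = multiIntegral (torus r) f := by
  have hr0 : ∀ j, 0 < r j := fun j => by linarith [hB.one_lt, (hr j).1]
  have hmem : ∀ j, ∀ z : ℂ, ‖z‖ = r j → z ∈ B := fun j z hz =>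
    hB.mem_of_norm z (hz ▸ (hr j).1) (hz ▸ (hr j).2)
  refine multiIntegral_deform (fun _ => hΓ.toIsPath) (isPath_torus r)
    (fun _ => hB.trace_subset.trans hBO)
    (fun j z hz => hBO (hmem j z (norm_of_mem_trace_circ (hr0 j).le hz))) (fun j g hg => ?_) hf
  exact hΓ.lineIntegral_eq_circ hO hB.compact hBO (hr0 j) hB.trace_subset (hmem j)
    (fun z hz => (hB.trace_lt z hz).trans_le (hr j).1)
    (fun p hp hpr => hB.winding_eq p hp (hpr.trans_le (hr j).2)) hg

/-- Functions that are, up to a Vandermonde determinant, holomorphic near the region `B`. -/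
structure IsRegular (Γ : ℝ → ℂ) (O : Set ℂ) (F H : (Fin k → ℂ) → ℂ) : Prop where
  holo : SepHolo H O
  eq : ∀ x : Fin k → ℂ, (∀ j, x j ∈ trace Γ) → Function.Injective x → vandermonde x * F x = H x

/-- An antisymmetric `f` is divisible by the Vandermonde determinant, so `f F = (f / V)(V F)`
extends continuously across the diagonals even where `F` does not. -/
theorem IsRegular.exists_mul (hΓ : IsLoop Γ) (hi : InjOn Γ (Ico 0 1)) (hO : IsOpen O)
    (hΓO : trace Γ ⊆ O) {F H : (Fin k → ℂ) → ℂ} (hF : IsRegular Γ O F H) {f : (Fin k → ℂ) → ℂ}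
    (hf : SepHolo f O) (ha : ∀ x, ∀ σ : Equiv.Perm (Fin k), f (fun j => x (σ j)) = sgn σ * f x) :
    ContourIntegrable Γ (fun x => f x * F x) ∧
    ∃ g, SepHolo g O ∧ (∀ x ∈ poly k O, f x = vandermonde x * g x) ∧
      contourIntegral Γ (fun x => f x * F x) = contourIntegral Γ fun x => g x * H x := by
  obtain ⟨g, hg, hfg⟩ := hf.exists_eq_vandermonde_mul_of_alt hO ha
  have hcongr : ∀ x : Fin k → ℂ, (∀ j, x j ∈ trace Γ) → Function.Injective x →
      f x * F x = g x * H x := fun x hx hxi => by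
    rw [hfg x fun j => hΓO (hx j), ← hF.eq x hx hxi]; ring
  refine ⟨ContourIntegrable.congr hi (contourIntegrable_of_continuousOn hΓ.toIsPath
    ((hg.mul hF.holo).cont.mono fun x hx j => hΓO (hx j)))
    fun x hx hxi => (hcongr x hx hxi).symm, g, hg, hfg, contourIntegral_congr hi hcongr⟩

/-- A symmetric function that vanishes on the diagonals is divisible by the square of the
Vandermonde determinant. -/
theorem SepHolo.exists_eq_vandermonde_sq_mul {S : (Fin k → ℂ) → ℂ} (hO : IsOpen O)
    (hS : SepHolo S O) (hs : ∀ x, ∀ σ : Equiv.Perm (Fin k), S (fun j => x (σ j)) = S x)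
    (h0 : ∀ i j, i ≠ j → ∀ x ∈ poly k O, x i = x j → S x = 0) :
    ∃ g₁ g₂, SepHolo g₁ O ∧ SepHolo g₂ O ∧
      (∀ x, ∀ σ : Equiv.Perm (Fin k), g₁ (fun j => x (σ j)) = sgn σ * g₁ x) ∧
      (∀ x ∈ poly k O, S x = vandermonde x * g₁ x) ∧
      ∀ x ∈ poly k O, g₁ x = vandermonde x * g₂ x := by
  obtain ⟨g, hg, hSg⟩ := hS.exists_eq_vandermonde_mul hO h0
  -- The quotient `g` is antisymmetric off the diagonals in `O` only; averaging makes the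
  -- antisymmetry hold everywhere without changing the product with `V`.
  set g₁ : (Fin k → ℂ) → ℂ := fun x => ((k.factorial : ℂ))⁻¹ *
    ∑ σ : Equiv.Perm (Fin k), sgn σ * g fun j => x (σ j) with hg₁
  have hg₁h : SepHolo g₁ O :=
    (sepHolo_const _).mul (SepHolo.sum fun σ _ => (sepHolo_const _).mul (hg.perm σ))
  have hg₁a : ∀ x, ∀ σ : Equiv.Perm (Fin k), g₁ (fun j => x (σ j)) = sgn σ * g₁ x := by
    intro x τ
    simp only [hg₁]
    rw [sum_sgn_perm, mul_left_comm]
  obtain ⟨g₂, hg₂, h12⟩ := hg₁h.exists_eq_vandermonde_mul_of_alt hO hg₁a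
  refine ⟨g₁, g₂, hg₁h, hg₂, hg₁a, fun x hx => ?_, h12⟩
  have h1 : ∀ σ : Equiv.Perm (Fin k), vandermonde x * (sgn σ * g fun j => x (σ j)) = S x := by
    intro σ
    have h2 := hSg (fun j => x (σ j)) fun j => hx (σ j)
    rw [hs, vandermonde_perm] at h2
    rw [h2]; ring
  simp only [hg₁]
  rw [mul_left_comm, Finset.mul_sum, Finset.sum_congr rfl fun σ _ => h1 σ, Finset.sum_const,
    Finset.card_univ, Fintype.card_perm, Fintype.card_fin, nsmul_eq_mul, inv_mul_cancel_left₀]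
  exact_mod_cast k.factorial_ne_zero

/-- With `PhiL = V g`, `g` symmetric, symmetrizing `∮ g K` replaces `K` by its symmetrization `V
g₁`, which gives `∮ PhiL g₁`. Both `PhiL` and `g₁` being antisymmetric, all permutations in `PhiL`
contribute equally. -/
theorem IsRegular.contourIntegral_PhiL (hΓ : IsLoop Γ) (hi : InjOn Γ (Ico 0 1)) (hO : IsOpen O)
    (hΓO : trace Γ ⊆ O) (h0 : (0 : ℂ) ∉ O) {G K : (Fin k → ℂ) → ℂ} (hG : IsRegular Γ O G K)
    {g₁ : (Fin k → ℂ) → ℂ} (hg₁ : SepHolo g₁ O)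
    (hg₁a : ∀ x, ∀ σ : Equiv.Perm (Fin k), g₁ (fun j => x (σ j)) = sgn σ * g₁ x)
    (hK : ∀ x ∈ poly k O, ∑ σ : Equiv.Perm (Fin k), K (fun j => x (σ j)) = vandermonde x * g₁ x)
    (n : Weyl k) :
    contourIntegral Γ (fun x => PhiL q ν n x * G x) =
      contourIntegral Γ fun x => summandL q ν n.1 x * g₁ x := by
  obtain ⟨-, g, hg, hfg, hval⟩ := hG.exists_mul (f := PhiL q ν n) hΓ hi hO hΓO
    (sepHolo_PhiL h0 n) (PhiL_perm n)
  have hk : (k.factorial : ℂ) ≠ 0 := by exact_mod_cast k.factorial_ne_zero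
  have hint : ∀ {f : (Fin k → ℂ) → ℂ}, SepHolo f O → ContourIntegrable Γ f := fun hf =>
    contourIntegrable_of_continuousOn hΓ.toIsPath (hf.cont.mono fun x hx j => hΓO (hx j))
  rw [hval]
  refine mul_left_cancel₀ hk ?_
  rw [← (hint (hg.mul hG.holo)).contourIntegral_sum_perm,
    ← (hint ((sepHolo_summandL h0 n.1).mul hg₁)).contourIntegral_sum_perm]
  refine contourIntegral_congr hi fun x hx hxi => ?_
  have hxO : x ∈ poly k O := fun j => hΓO (hx j)
  have hV := vandermonde_ne_zero hxi
  have hgs : ∀ σ : Equiv.Perm (Fin k), g (fun j => x (σ j)) = g x := by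
    intro σ
    have h2 := hfg (fun j => x (σ j)) fun j => hxO (σ j)
    rw [PhiL_perm, vandermonde_perm, hfg x hxO, mul_assoc] at h2
    have hs : sgn σ ≠ 0 := left_ne_zero_of_mul_eq_one (sgn_mul_self σ)
    exact (mul_left_cancel₀ hV (mul_left_cancel₀ hs h2)).symm
  simp only [hgs, hg₁a]
  rw [← Finset.mul_sum, hK x hxO, mul_left_comm, ← mul_assoc, ← hfg x hxO, PhiL_eq, Finset.sum_mul]
  exact Finset.sum_congr rfl fun σ _ => by ring

theorem exists_injective_radii {a b : ℝ} (hab : a < b) (k : ℕ) :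
    ∃ r : Fin k → ℝ, (∀ j, a ≤ r j ∧ r j ≤ b) ∧ Function.Injective r := by
  have hk : (0 : ℝ) < k + 1 := by positivity
  refine ⟨fun j => a + (b - a) * (j / (k + 1)), fun j => ⟨?_, ?_⟩, fun i j hij => ?_⟩
  · have : 0 ≤ (b - a) * ((j : ℝ) / (k + 1)) := mul_nonneg (by linarith) (by positivity)
    linarith
  · have h1 : (j : ℝ) / (k + 1) ≤ 1 := by
      rw [div_le_one hk]
      have : (j : ℝ) < k := by exact_mod_cast j.2
      linarith
    nlinarith
  · have h1 := mul_left_cancel₀ (sub_pos.2 hab).ne' (add_left_cancel hij)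
    rw [div_left_inj' hk.ne'] at h1
    exact Fin.ext (by exact_mod_cast h1)

/-- The symmetrization of `V G` is `V g₁ = V² g₂`. All integrals then have integrands holomorphic on
`O` and move to a torus with distinct radii in a good annulus. There `F` may be replaced by `H / V`,
the left integrals are pairings with `weight · g₁`, and `hasSum_pairing` applies. -/
theorem biorthogonalityXi_of_symm_eq_zero (hq0 : 0 < q) (hq1 : q < 1) (hν0 : 0 ≤ ν) (hν1 : ν < 1)
    (hB : IsRegion ν Γ B R₀ R) (hΓ : IsLoop Γ) (hi : InjOn Γ (Ico 0 1)) (hO : IsOpen O)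
    (hBO : B ⊆ O) (h0 : (0 : ℂ) ∉ O) {F H G K : (Fin k → ℂ) → ℂ} (hF : IsRegular Γ O F H)
    (hG : IsRegular Γ O G K)
    (hK : ∀ i j, i ≠ j → ∀ x ∈ poly k O, x i = x j →
      ∑ σ : Equiv.Perm (Fin k), K (fun j => x (σ j)) = 0) :
    BiorthogonalityXi q ν Γ F G ∧ ContourIntegrable Γ (rhsXi q ν F G) := by
  have hΓO := hB.trace_subset.trans hBO
  obtain ⟨g₁, g₂, hg₁, hg₂, hg₁a, hKg, h12⟩ := SepHolo.exists_eq_vandermonde_sq_mul hO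
    (SepHolo.sum fun σ (_ : σ ∈ Finset.univ) => hG.holo.perm σ)
    (fun x σ => sum_perm_perm K x σ) hK
  obtain ⟨ρm, ρp, h1, h2, h3, h4, hgood⟩ := exists_goodAnnulus hq0 hq1 hν0 hν1
    (r := (R₀ + R) / 2) (l := R₀) (u := R) (by linarith [hB.one_lt, hB.lt])
    (by nlinarith [hB.nu_mul_lt, hB.lt]) (by linarith [hB.lt]) (by linarith [hB.lt])
  obtain ⟨a, ha, hab'⟩ := exists_between (h2.trans h3)
  obtain ⟨b, hab, hb⟩ := exists_between hab'
  obtain ⟨r, hr, hri⟩ := exists_injective_radii hab k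
  have hrR : ∀ j, R₀ ≤ r j ∧ r j ≤ R := fun j => ⟨by linarith [(hr j).1], by linarith [(hr j).2]⟩
  have hrρ : ∀ j, ρm ≤ r j ∧ r j ≤ ρp := fun j => ⟨by linarith [(hr j).1], by linarith [(hr j).2]⟩
  have hdef : ∀ {f : (Fin k → ℂ) → ℂ}, SepHolo f O →
      contourIntegral Γ f = multiIntegral (torus r) f := fun hf =>
    hB.multiIntegral_eq_torus hΓ hO hBO hrR hf
  have htorO : ∀ x ∈ box (torus r), x ∈ poly k O := fun x hx j => by
    have := norm_of_mem_torus hgood hrρ hx j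
    exact hBO (hB.mem_of_norm _ (this ▸ (hrR j).1) (this ▸ (hrR j).2))
  have htorV : ∀ x ∈ box (torus r), vandermonde x ≠ 0 := fun x hx =>
    vandermonde_ne_zero fun i j hij => hri (by
      rw [← norm_of_mem_torus hgood hrρ hx i, hij, norm_of_mem_torus hgood hrρ hx j])
  have hannO : annulus ρm ρp ⊆ O := fun z hz =>
    hBO (hB.mem_of_norm z (h1.le.trans hz.1.le) (hz.2.le.trans h4.le))
  have hW : SepHolo (weight (k := k) q ν) O := sepHolo_of_differentiable differentiable_weight
  have hVc : Continuous (vandermonde (k := k)) := by unfold vandermonde; fun_prop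
  have hkey := hasSum_pairing hq0 hq1 hν0 hν1 hgood ha hab.le hb hr hri
    (P := fun x => weight q ν x * g₁ x) ((hW.mul hg₁).mono hannO)
    (fun x _ σ => by rw [weight_perm, hg₁a, mul_left_comm])
    (F := fun x => H x / vandermonde x)
    ((hF.holo.cont.mono htorO).div hVc.continuousOn htorV)
  have hR : ∀ n : Weyl k, contourIntegral Γ (fun x => PhiR q ν n x * F x) =
      multiIntegral (torus r) fun x => PhiR q ν n x * (H x / vandermonde x) := by
    intro n
    obtain ⟨-, g, hg, hfg, hval⟩ := hF.exists_mul (f := PhiR q ν n) hΓ hi hO hΓO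
      (sepHolo_PhiR h0 n) (PhiR_perm n)
    rw [hval, hdef (hg.mul hF.holo)]
    refine multiIntegral_congr fun x hx => ?_
    rw [hfg x (htorO x hx)]
    field_simp [htorV x hx]
  have hL : ∀ n : Weyl k, contourIntegral Γ (fun x => PhiL q ν n x * G x) =
      pairing q ν r n.1 fun x => weight q ν x * g₁ x := by
    intro n
    rw [hG.contourIntegral_PhiL hΓ hi hO hΓO h0 hg₁ hg₁a hKg n,
      hdef ((sepHolo_summandL h0 n.1).mul hg₁), pairing]
    refine multiIntegral_congr fun x hx => ?_
    have hc := crossProd_ne_zero (cross_ne_of_mem_torus hgood hrρ hx)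
    -- The product of the coordinates in the weight shifts the exponents to `-n j - 1`, and its
    -- second family of cross terms cancels the denominator of the pairing.
    have hp : ∏ j, x j ^ (-n.1 j) = (∏ j, x j ^ (-n.1 j - 1)) * ∏ j, x j := by
      rw [← Finset.prod_mul_distrib]
      refine Finset.prod_congr rfl fun j _ => ?_
      have hx0 := ne_zero_of_mem_torus hgood hrρ hx j
      rw [zpow_sub_one₀ hx0, inv_mul_cancel_right₀ hx0]
    rw [weight_eq, summandL, hp]
    field_simp
  have hrhs : ∀ x : Fin k → ℂ, (∀ j, x j ∈ trace Γ) → Function.Injective x →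
      H x * (weight q ν x * g₂ x) = rhsXi q ν F G x := by
    intro x hx hxi
    have hxO : x ∈ poly k O := fun j => hΓO (hx j)
    have hV := vandermonde_ne_zero hxi
    refine mul_left_cancel₀ hV ?_
    have h5 : ∀ σ : Equiv.Perm (Fin k), sgn σ * (vandermonde x * G fun j => x (σ j)) =
        K fun j => x (σ j) := by
      intro σ
      rw [← hG.eq (fun j => x (σ j)) (fun j => hx (σ j)) (hxi.comp σ.injective), vandermonde_perm]
      ring
    have h6 : vandermonde x * ∑ σ : Equiv.Perm (Fin k), sgn σ * F x * G (fun j => x (σ j)) =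
        F x * (vandermonde x * (vandermonde x * g₂ x)) := by
      rw [← h12 x hxO, ← hKg x hxO, Finset.mul_sum, Finset.mul_sum]
      exact Finset.sum_congr rfl fun σ _ => by rw [← h5 σ]; ring
    rw [rhsXi_eq, mul_left_comm (vandermonde x) (weight q ν x) (∑ σ, _), h6, ← hF.eq x hx hxi]
    ring
  have hholo := hF.holo.mul (hW.mul hg₂)
  refine ⟨?_, ContourIntegrable.congr hi (contourIntegrable_of_continuousOn hΓ.toIsPath
    (hholo.cont.mono fun x hx j => hΓO (hx j))) hrhs⟩
  unfold BiorthogonalityXi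
  simp only [hR, hL]
  rw [← contourIntegral_congr hi hrhs, hdef hholo]
  convert! hkey using 1
  refine multiIntegral_congr fun x hx => ?_
  rw [h12 x (htorO x hx)]
  field_simp [htorV x hx]

end Core

/-! ### Exchanging the roles of the two families of eigenfunctions -/

section Flip

variable {q ν : ℝ} {k : ℕ}

/-- The involution `n ↦ (-n_k, …, -n_1)` of the Weyl chamber. -/
def flip (k : ℕ) : Equiv.Perm (Weyl k) where
  toFun n := ⟨fun j => -n.1 j.rev, fun _ _ h => neg_le_neg (n.2 (Fin.rev_le_rev.2 h))⟩
  invFun n := ⟨fun j => -n.1 j.rev, fun _ _ h => neg_le_neg (n.2 (Fin.rev_le_rev.2 h))⟩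
  left_inv n := by ext j; simp
  right_inv n := by ext j; simp

theorem flip_apply (n : Weyl k) (j : Fin k) : (flip k n).1 j = -n.1 j.rev := rfl

theorem flip_flip (n : Weyl k) : flip k (flip k n) = n := (flip k).left_inv n

theorem stat_flip (n : Weyl k) : stat q ν (flip k n) = stat q ν n := by
  have hc : ∀ v : ℤ, (Finset.univ.filter fun j => (flip k n).1 j = -v).card =
      (Finset.univ.filter fun j => n.1 j = v).card := fun v =>
    Finset.card_nbij' Fin.rev Fin.rev (by intro j; simp [flip_apply])
      (by intro j; simp [flip_apply]) (by intro j; simp) (by intro j; simp)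
  rw [stat, stat]
  refine Finset.prod_nbij' (fun v => -v) (fun v => -v) ?_ ?_ (by simp) (by simp) ?_
  · intro v hv
    obtain ⟨j, -, rfl⟩ := Finset.mem_image.1 hv
    exact Finset.mem_image.2 ⟨j.rev, Finset.mem_univ _, by rw [flip_apply, neg_neg]⟩
  · intro v hv
    obtain ⟨j, -, rfl⟩ := Finset.mem_image.1 hv
    exact Finset.mem_image.2 ⟨j.rev, Finset.mem_univ _, by rw [flip_apply, Fin.rev_rev]⟩
  · intro v _
    rw [← hc (-v), neg_neg]

theorem prod_Iio_rev (f : Fin k → Fin k → ℂ) :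
    ∏ A : Fin k, ∏ B ∈ Finset.Iio A, f A.rev B.rev = ∏ A, ∏ B ∈ Finset.Iio A, f B A := by
  have h1 : ∏ A : Fin k, ∏ B ∈ Finset.Iio A, f A.rev B.rev = ∏ A, ∏ B ∈ Finset.Ioi A, f A B := by
    rw [← Equiv.prod_comp Fin.revPerm fun A => ∏ B ∈ Finset.Ioi A, f A B]
    refine Finset.prod_congr rfl fun A _ => ?_
    refine Finset.prod_nbij' Fin.rev Fin.rev ?_ ?_ (by simp) (by simp) (by simp)
    · intro B hB; simpa [Fin.rev_lt_rev] using hB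
    · intro B hB
      have : A.rev < B := by simpa using hB
      rw [Finset.mem_Iio, ← Fin.rev_lt_rev, Fin.rev_rev]
      exact this
  rw [h1]
  exact Finset.prod_comm' (by simp)

/-- Composing `σ` with the order reversal swaps the arguments of every cross term and reverses the
exponents, which is what distinguishes the two families. -/
theorem PhiR_eq_PhiL_flip (n : Weyl k) (x : Fin k → ℂ) :
    PhiR q ν n x = stat q ν n * ((1 - q) / (1 - ν)) ^ k * sgn (Fin.revPerm (n := k)) *
      PhiL q ν (flip k n) x := by
  rw [PhiR, PhiL, mul_assoc _ (sgn _)]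
  congr 1
  rw [Finset.mul_sum, ← Equiv.sum_comp (Equiv.mulRight (Fin.revPerm (n := k)))]
  refine Finset.sum_congr rfl fun σ _ => ?_
  rw [Equiv.coe_mulRight, sgn_mul, mul_comm (sgn σ), mul_assoc, mul_assoc, mul_assoc]
  congr 2
  congr 1
  · exact prod_Iio_rev fun A B => crossS q ν (x (σ B)) (x (σ A))
  · rw [← Equiv.prod_comp (Fin.revPerm (n := k))]
    refine Finset.prod_congr rfl fun j _ => ?_
    rw [flip_apply, neg_neg]
    simp

end Flip

section CoreSwap

variable {q ν : ℝ} {k : ℕ} {Γ : ℝ → ℂ} {B O : Set ℂ} {R₀ R : ℝ}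

/-- The reindexing by `flip` exchanges the two families up to the same factor on both sides, as
`stat` is invariant. The right-hand sides agree after symmetrization, for which both integrands must
be integrable. -/
theorem BiorthogonalityXi.swap {F G : (Fin k → ℂ) → ℂ} (h : BiorthogonalityXi q ν Γ G F)
    (hGF : ContourIntegrable Γ (rhsXi q ν G F)) (hFG : ContourIntegrable Γ (rhsXi q ν F G)) :
    BiorthogonalityXi q ν Γ F G := by
  have hk : (k.factorial : ℂ) ≠ 0 := by exact_mod_cast k.factorial_ne_zero
  have hrhs : contourIntegral Γ (rhsXi q ν F G) = contourIntegral Γ (rhsXi q ν G F) := by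
    refine mul_left_cancel₀ hk ?_
    rw [← hFG.contourIntegral_sum_perm, ← hGF.contourIntegral_sum_perm]
    simp only [sum_rhsXi_comm F G]
  unfold BiorthogonalityXi at h ⊢
  rw [hrhs]
  refine ((flip k).hasSum_iff.2 h).congr_fun ?_
  intro n
  have h1 : ∀ (m : Weyl k) (F : (Fin k → ℂ) → ℂ), contourIntegral Γ (fun x => PhiR q ν m x * F x) =
      stat q ν m * ((1 - q) / (1 - ν)) ^ k * sgn (Fin.revPerm (n := k)) *
        contourIntegral Γ fun x => PhiL q ν (flip k m) x * F x := by
    intro m F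
    rw [← contourIntegral_const_mul]
    simp only [PhiR_eq_PhiL_flip, mul_assoc]
  simp only [Function.comp, h1, flip_flip, stat_flip]
  ring

end CoreSwap

/-! ### The integrability condition forces one of the factors to vanish on the diagonals -/

section Dichotomy

variable {q ν : ℝ} {k : ℕ} {Γ : ℝ → ℂ} {O : Set ℂ}

/-- By the identity theorem the product vanishes on all of `O^n`. Near a point with `f₁ ≠ 0` the
other factor vanishes, hence everywhere. -/
theorem eq_zero_or_eq_zero_of_mul {n : ℕ} (hO : IsOpen O) (hOc : IsPreconnected O) {J : Set ℂ}
    (hJO : J ⊆ O) (hJ : ∃ z ∈ O, ∃ᶠ w in nhdsWithin z {z}ᶜ, w ∈ J) {f₁ f₂ : (Fin n → ℂ) → ℂ}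
    (h₁ : SepHolo f₁ O) (h₂ : SepHolo f₂ O)
    (h : ∀ x : Fin n → ℂ, (∀ j, x j ∈ J) → f₁ x * f₂ x = 0) :
    (∀ x ∈ poly n O, f₁ x = 0) ∨ ∀ x ∈ poly n O, f₂ x = 0 := by
  have h12 := (h₁.mul h₂).eq_zero_of_frequently hO hOc (fun _ => hJO) (fun _ => hJ) h
  by_contra! hne
  obtain ⟨⟨y, hy, hy1⟩, hne2⟩ := hne
  obtain ⟨z, hz, hz2⟩ := hne2
  have hnhds : {x | f₁ x ≠ 0} ∩ poly n O ∈ nhds y :=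
    Filter.inter_mem ((h₁.cont.continuousAt ((isOpen_poly hO).mem_nhds hy)).eventually_ne hy1)
      ((isOpen_poly hO).mem_nhds hy)
  obtain ⟨δ, hδ, hball⟩ := Metric.mem_nhds_iff.1 hnhds
  refine hz2 (h₂.eq_zero_of_frequently hO hOc (J := fun j => Metric.ball (y j) δ ∩ O)
    (fun j => inter_subset_right) (fun j => ⟨y j, hy j, ?_⟩) (fun x hx => ?_) z hz)
  · refine Filter.Eventually.frequently (mem_nhdsWithin_of_mem_nhds ?_)
    exact Filter.inter_mem (Metric.ball_mem_nhds _ hδ) (hO.mem_nhds (hy j))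
  · have hxy : x ∈ Metric.ball y δ := by
      rw [Metric.mem_ball, dist_pi_lt_iff hδ]
      exact fun j => (hx j).1
    obtain ⟨hx1, hx2⟩ := hball hxy
    exact (mul_eq_zero.1 (h12 x hx2)).resolve_left hx1

theorem frequently_mem_arc (hi : InjOn Γ (Ico 0 1)) {a b : ℝ} (ha : 0 ≤ a) (hab : a < b)
    (hb : b ≤ 1) (hd : ∀ t ∈ Ioo a b, DifferentiableAt ℝ Γ t ∧ deriv Γ t ≠ 0) :
    ∃ z ∈ Γ '' Ioo a b, ∃ᶠ w in nhdsWithin z {z}ᶜ, w ∈ Γ '' Ioo a b := by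
  obtain ⟨m, hm⟩ := exists_between hab
  have hev : ∀ᶠ t in nhdsWithin m {m}ᶜ, t ∈ Ioo a b :=
    mem_nhdsWithin_of_mem_nhds (isOpen_Ioo.mem_nhds hm)
  have hsub : Ioo a b ⊆ Ico 0 1 := fun t ht => ⟨ha.trans ht.1.le, ht.2.trans_le hb⟩
  have ht : Filter.Tendsto Γ (nhdsWithin m {m}ᶜ) (nhdsWithin (Γ m) {Γ m}ᶜ) := by
    refine tendsto_nhdsWithin_iff.2 ⟨(hd m hm).1.continuousAt.mono_left nhdsWithin_le_nhds, ?_⟩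
    filter_upwards [hev, self_mem_nhdsWithin] with t ht htm h
    exact htm (hi (hsub ht) (hsub hm) h)
  exact ⟨Γ m, mem_image_of_mem _ hm, ht.frequently
    (hev.mono fun t ht => mem_image_of_mem _ ht).frequently⟩

/-- If `g / V²` is integrable, then `g` vanishes on the diagonals. -/
theorem eq_zero_of_integrable_div_sq {n : ℕ} (hi : InjOn Γ (Ico 0 1)) {a b : ℝ} (ha : 0 ≤ a)
    (hb : b ≤ 1) (hd : ∀ t ∈ Ioo a b, DifferentiableAt ℝ Γ t ∧ deriv Γ t ≠ 0)
    (hc : ContinuousOn (deriv Γ) (Ioo a b)) (hO : IsOpen O) (hΓO : trace Γ ⊆ O)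
    {g : (Fin (n + 1) → ℂ) → ℂ} (hg : ContinuousOn g (poly (n + 1) O))
    (hint : ContourIntegrable Γ fun x => g x / vandermonde x ^ 2) (i : Fin (n + 1)) (j : Fin n)
    {s : Fin n → ℝ} (hs : ∀ l, s l ∈ Ioo a b) :
    g (fun l => Γ ((i.insertNth (s j) s : Fin (n + 1) → ℝ) l)) = 0 := by
  by_contra hne
  have hsub : Ioo a b ⊆ Ioo 0 1 := fun t ht => ⟨ha.trans_lt ht.1, ht.2.trans_le hb⟩
  have hΓc : ∀ t ∈ Ioo a b, ContinuousAt Γ t := fun t ht => (hd t ht).1.continuousAt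
  have hmemO : ∀ t ∈ Ioo a b, Γ t ∈ O := fun t ht =>
    hΓO (mem_image_of_mem _ (Ioo_subset_Icc_self (hsub ht)))
  have hins : ∀ (s : Fin n → ℝ) (x : ℝ), (∀ l, s l ∈ Ioo a b) → x ∈ Ioo a b →
      ∀ l, ((i.insertNth x s : Fin (n + 1) → ℝ) l) ∈ Ioo a b := by
    intro s x hs hx l
    refine i.succAboveCases ?_ (fun l => ?_) l
    · simpa using hx
    · simpa using hs l
  have hgc : ∀ t : Fin (n + 1) → ℝ, (∀ l, t l ∈ Ioo a b) →
      ContinuousAt (fun t : Fin (n + 1) → ℝ => g fun l => Γ (t l)) t := by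
    intro t ht
    refine ContinuousAt.comp (f := fun t : Fin (n + 1) → ℝ => fun l => Γ (t l))
      (hg.continuousAt ((isOpen_poly hO).mem_nhds fun l => hmemO _ (ht l))) ?_
    exact continuousAt_pi.2 fun l => ContinuousAt.comp (f := fun t : Fin (n + 1) → ℝ => t l)
      (hΓc _ (ht l)) (continuous_apply l).continuousAt
  have hU : {s' : Fin n → ℝ | (∀ l, s' l ∈ Ioo a b) ∧
      g (fun l => Γ ((i.insertNth (s' j) s' : Fin (n + 1) → ℝ) l)) ≠ 0} ∈ nhds s := by
    refine Filter.inter_mem ?_ ?_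
    · exact Filter.eventually_all.2 fun l =>
        (continuous_apply l).continuousAt.eventually_mem (isOpen_Ioo.mem_nhds (hs l))
    · have hcont : Continuous fun s' : Fin n → ℝ => (i.insertNth (s' j) s' : Fin (n + 1) → ℝ) :=
        (continuous_apply (A := fun _ : Fin n => ℝ) j).finInsertNth (A := fun _ => ℝ) i
          (g := fun s' => s') continuous_id
      exact (ContinuousAt.comp (f := fun s' : Fin n → ℝ => (i.insertNth (s' j) s' : Fin (n + 1) → ℝ))
        (hgc _ (hins s _ hs (hs j))) hcont.continuousAt).eventually_ne hne
  obtain ⟨s', ⟨hs', hgne⟩, hsi, hinj⟩ : ∃ s' : Fin n → ℝ, ((∀ l, s' l ∈ Ioo a b) ∧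
      g (fun l => Γ ((i.insertNth (s' j) s' : Fin (n + 1) → ℝ) l)) ≠ 0) ∧
      IntegrableOn (fun x => pullback Γ (fun x => g x / vandermonde x ^ 2) (i.insertNth x s'))
        (Icc (0 : ℝ) 1) ∧ Function.Injective s' := by
    -- By Fubini almost every line in direction `i` meets the integrand integrably. The bad set is
    -- open and nonempty, so it contains such a line with distinct remaining parameters.
    have hae := (cube_section_integrable i hint).and (ae_cube_interior n)
    rw [ae_restrict_iff' measurableSet_Icc] at hae
    obtain ⟨V, hVU, hVo, hsV⟩ := mem_nhds_iff.1 hU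
    by_contra! hcon
    have h0 : volume V = 0 := by
      refine measure_mono_null (fun s' hs'V => ?_) (ae_iff.1 hae)
      intro h
      have h1 := hVU hs'V
      have h2 := h ⟨fun l => (hsub (h1.1 l)).1.le, fun l => (hsub (h1.1 l)).2.le⟩
      exact hcon s' h1 h2.1 h2.2.2
    exact (hVo.measure_pos volume ⟨s, hsV⟩).ne' h0
  set p := s' j with hp
  have hpI : p ∈ Ioo a b := hs' j
  have hij : i ≠ i.succAbove j := (Fin.succAbove_ne i j).symm
  set T : ℝ → Fin (n + 1) → ℝ := fun x => i.insertNth x s' with hT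
  have hTc : Continuous T := by
    simp only [hT]
    exact (continuous_id (X := ℝ)).finInsertNth (A := fun _ => ℝ) i (g := fun _ => s') continuous_const
  have hTi : ∀ x, T x i = x := fun x => by simp [hT]
  have hTj : ∀ x l, T x (i.succAbove l) = s' l := fun x l => by simp [hT]
  have hTp : ∀ l, T p l ∈ Ioo a b := hins s' p hs' hpI
  obtain ⟨v, hv, hVv⟩ := (sepHolo_of_differentiable (O := univ)
    (f := vandermonde (k := n + 1)) (by unfold vandermonde; fun_prop)).exists_eq_sub_mul
    isOpen_univ hij fun x _ hx => vandermonde_eq_zero hij hx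
  have huniv : ∀ x : Fin (n + 1) → ℂ, x ∈ poly (n + 1) univ := fun x l => mem_univ _
  have hvc : Continuous v := by
    rw [← continuousOn_univ]
    exact hv.cont.mono fun x _ => huniv x
  have hΓT : ContinuousAt (fun x => fun l => Γ (T x l)) p :=
    continuousAt_pi.2 fun l => ContinuousAt.comp (f := fun x => T x l) (hΓc _ (hTp l))
      ((continuous_apply l).comp hTc).continuousAt
  set N := nhdsWithin p {p}ᶜ with hN
  have hNle : N ≤ nhds p := nhdsWithin_le_nhds
  have hV1 : (fun x => vandermonde fun l => Γ (T x l)) =O[N] fun x => x - p := by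
    have h1 : (fun x => Γ x - Γ p) =O[N] fun x => x - p :=
      (hd p hpI).1.hasDerivAt.isBigO_sub.mono hNle
    have h2 : (fun x => v fun l => Γ (T x l)) =O[N] fun _ => (1 : ℝ) :=
      ((hvc.continuousAt.comp hΓT).tendsto.isBigO_one ℝ).mono hNle
    have h3 := h1.mul h2
    simp only [mul_one] at h3
    refine h3.congr_left fun x => ?_
    rw [hVv _ (huniv _), hTi, hTj]
  -- The order is in fact two; first order already produces the nonintegrable singularity `(x -
  -- p)⁻¹`.
  have hV2 : (fun x => (vandermonde fun l => Γ (T x l)) ^ 2) =O[N] fun x => x - p := by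
    have h1 : (fun x => vandermonde fun l => Γ (T x l)) =O[N] fun _ => (1 : ℝ) := by
      refine hV1.trans (Filter.Tendsto.isBigO_one ℝ (c := 0) ?_)
      have : Filter.Tendsto (fun x : ℝ => x - p) (nhds p) (nhds (p - p)) :=
        (continuous_id.sub continuous_const).tendsto p
      rw [sub_self] at this
      exact this.mono_left hNle
    have h2 := hV1.mul h1
    simp only [mul_one] at h2
    simpa only [sq] using h2
  have hV0 : ∀ᶠ x in N, (vandermonde fun l => Γ (T x l)) ≠ 0 := by
    have h1 : ∀ᶠ x in N, ∀ l, x ≠ s' l := by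
      refine Filter.eventually_all.2 fun l => ?_
      by_cases hl : l = j
      · subst hl; exact self_mem_nhdsWithin
      · exact hNle (eventually_ne_nhds fun h => hl (hinj h.symm))
    have h2 : ∀ᶠ x in N, x ∈ Ioo a b := hNle (isOpen_Ioo.mem_nhds hpI)
    filter_upwards [h1, h2] with x hx hxI
    refine vandermonde_ne_zero fun l l' hll => ?_
    have hTx := hins s' x hs' hxI
    have h3 : T x l = T x l' :=
      hi (Ioo_subset_Ico_self (hsub (hTx l))) (Ioo_subset_Ico_self (hsub (hTx l'))) hll
    revert h3
    refine i.succAboveCases ?_ (fun m => ?_) l <;> refine i.succAboveCases ?_ (fun m' => ?_) l'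
    · exact fun _ => rfl
    · rw [hTi, hTj]; exact fun h => absurd h (hx m')
    · rw [hTi, hTj]; exact fun h => absurd h.symm (hx m)
    · rw [hTj, hTj]; exact fun h => by rw [hinj h]
  have hD : (fun _ => (1 : ℂ)) =O[N]
      fun x => (∏ l, deriv Γ (T x l)) * g fun l => Γ (T x l) := by
    have hcont : ContinuousAt (fun x => (∏ l, deriv Γ (T x l)) * g fun l => Γ (T x l)) p := by
      refine ContinuousAt.mul ?_ (ContinuousAt.comp (f := T) (hgc _ hTp) hTc.continuousAt)
      refine tendsto_finsetProd _ fun l _ => ?_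
      exact ContinuousAt.comp (f := fun x => T x l)
        (hc.continuousAt (isOpen_Ioo.mem_nhds (hTp l)))
        ((continuous_apply l).comp hTc).continuousAt
    refine Asymptotics.IsBigO.mono ?_ hNle
    refine (Asymptotics.isBigO_const_left_iff_pos_le_norm one_ne_zero).2 ?_
    have hne0 : (∏ l, deriv Γ (T p l)) * g (fun l => Γ (T p l)) ≠ 0 :=
      mul_ne_zero (Finset.prod_ne_zero_iff.2 fun l _ => (hd _ (hTp l)).2) hgne
    refine ⟨_, half_pos (norm_pos_iff.2 hne0), ?_⟩
    exact (hcont.norm.eventually (lt_mem_nhds (half_lt_self (norm_pos_iff.2 hne0)))).mono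
      fun x hx => hx.le
  have hfin : (fun x => (x - p)⁻¹) =O[N]
      fun x => pullback Γ (fun x => g x / vandermonde x ^ 2) (T x) := by
    have h1 := hV2.inv_rev (hV0.mono fun x hx h0 => absurd h0 (pow_ne_zero 2 hx))
    have h2 := h1.norm_left.mul hD.norm_left
    simp only [norm_one, mul_one] at h2
    exact h2.of_norm_left.congr_right fun x => by rw [pullback]; ring
  refine not_intervalIntegrable_of_sub_inv_isBigO_punctured hfin zero_ne_one ?_
    ((intervalIntegrable_iff_integrableOn_Icc_of_le zero_le_one).2 hsi)
  rw [uIcc_of_le zero_le_one]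
  exact Ioo_subset_Icc_self (hsub hpI)

end Dichotomy

/-! ### The biorthogonality relation in the region -/

section Diagonals

variable {k : ℕ} {O : Set ℂ}

theorem sepHolo_diagonal {n : ℕ} (hO : IsOpen O) {f : (Fin (n + 1) → ℂ) → ℂ}
    (hf : DifferentiableOn ℂ f (poly (n + 1) O)) (i : Fin (n + 1)) (j : Fin n) :
    SepHolo (fun y : Fin n → ℂ => f (i.insertNth (y j) y)) O := by
  refine sepHolo_of_differentiableOn hO (hf.comp ?_ fun y hy l => ?_)
  · refine (differentiable_pi.2 fun l => ?_).differentiableOn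
    refine i.succAboveCases ?_ (fun l => ?_) l
    · simp only [Fin.insertNth_apply_same]; fun_prop
    · simp only [Fin.insertNth_apply_succAbove]; fun_prop
  · refine i.succAboveCases ?_ (fun l => ?_) l
    · simpa using hy j
    · simpa using hy l

theorem eq_zero_on_diagonal {n : ℕ} {f : (Fin (n + 1) → ℂ) → ℂ} {i : Fin (n + 1)} {j : Fin n}
    (h : ∀ y ∈ poly n O, f (i.insertNth (y j) y) = 0) {x : Fin (n + 1) → ℂ}
    (hx : x ∈ poly (n + 1) O) (hij : x i = x (i.succAbove j)) : f x = 0 := by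
  have h1 := h (fun l => x (i.succAbove l)) fun l => hx _
  have h2 : (i.insertNth (x (i.succAbove j)) fun l => x (i.succAbove l)) = x := by
    rw [← hij]; exact Fin.insertNth_self_removeNth i x
  rwa [h2] at h1

theorem exists_perm_apply_eq {i j i' j' : Fin k} (hij : i ≠ j) (hij' : i' ≠ j') :
    ∃ τ : Equiv.Perm (Fin k), τ i = i' ∧ τ j = j' := by
  have h1 : Equiv.swap i i' j ≠ i' := fun h => hij (by
    rw [Equiv.swap_apply_eq_iff, Equiv.swap_apply_right] at h; exact h.symm)
  refine ⟨Equiv.swap (Equiv.swap i i' j) j' * Equiv.swap i i', ?_, ?_⟩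
  · rw [Equiv.Perm.mul_apply, Equiv.swap_apply_left, Equiv.swap_apply_of_ne_of_ne h1.symm hij']
  · rw [Equiv.Perm.mul_apply, Equiv.swap_apply_left]

end Diagonals

section Final

variable {q ν : ℝ} {k : ℕ} {Γ : ℝ → ℂ} {B O : Set ℂ} {R₀ R : ℝ}

/-- The right-hand integrand is `weight · H · S / V²` off the diagonals. Integrability makes `H S`
vanish at the diagonal points over a regular arc, where the weight is nonzero. The restrictions of
`H` and `S` to the diagonal are holomorphic in one variable fewer, so one of them vanishes
identically. -/
theorem symm_eq_zero_on_diagonal (hΓ : PiecewiseC1 Γ) (hi : InjOn Γ (Ico 0 1)) (hO : IsOpen O)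
    (hOc : IsPreconnected O) (hΓO : trace Γ ⊆ O)
    (hW : ∀ x : Fin k → ℂ, (∀ j, x j ∈ trace Γ) → weight q ν x ≠ 0) {F H G K : (Fin k → ℂ) → ℂ}
    (hF : IsRegular Γ O F H) (hG : IsRegular Γ O G K) (hH : DifferentiableOn ℂ H (poly k O))
    (hK : DifferentiableOn ℂ K (poly k O)) (hint : ContourIntegrable Γ (rhsXi q ν F G))
    {i j : Fin k} (hij : i ≠ j) : (∀ x ∈ poly k O, x i = x j → H x = 0) ∨
      ∀ x ∈ poly k O, x i = x j → ∑ σ : Equiv.Perm (Fin k), K (fun j => x (σ j)) = 0 := by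
  obtain ⟨n, rfl⟩ : ∃ n, k = n + 1 := ⟨k - 1, by have := i.pos; omega⟩
  obtain ⟨j, rfl⟩ := Fin.exists_succAbove_eq hij.symm
  obtain ⟨a, b, ha, hab, hb, hd, hc⟩ := hΓ.exists_regular hi
  set S : (Fin (n + 1) → ℂ) → ℂ := fun x =>
    ∑ σ : Equiv.Perm (Fin (n + 1)), K fun j => x (σ j) with hS
  have hSd : DifferentiableOn ℂ S (poly (n + 1) O) := by
    refine DifferentiableOn.fun_sum fun σ _ => hK.comp ?_ fun x hx l => hx _
    exact (differentiable_pi.2 fun l => by fun_prop).differentiableOn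
  have hcont : ContinuousOn (fun x => weight q ν x * (H x * S x)) (poly (n + 1) O) :=
    differentiable_weight.continuous.continuousOn.mul (hH.continuousOn.mul hSd.continuousOn)
  have hint' : ContourIntegrable Γ
      fun x => weight q ν x * (H x * S x) / vandermonde x ^ 2 := by
    refine hint.congr hi fun x hx hxi => ?_
    have hV := vandermonde_ne_zero hxi
    rw [eq_div_iff (pow_ne_zero 2 hV), rhsXi_eq, ← hF.eq x hx hxi]
    have h1 : vandermonde x * ∑ σ : Equiv.Perm (Fin (n + 1)),
        sgn σ * F x * G (fun j => x (σ j)) = F x * S x := by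
      rw [hS, Finset.mul_sum, Finset.mul_sum]
      refine Finset.sum_congr rfl fun σ _ => ?_
      rw [← hG.eq (fun j => x (σ j)) (fun j => hx (σ j)) (hxi.comp σ.injective), vandermonde_perm]
      ring
    linear_combination weight q ν x * vandermonde x * h1
  have hzero := fun (s : Fin n → ℝ) (hs : ∀ l, s l ∈ Ioo a b) =>
    eq_zero_of_integrable_div_sq hi ha hb hd hc hO hΓO hcont hint' i j hs
  have hsub : Ioo a b ⊆ Icc 0 1 := fun t ht => ⟨ha.trans ht.1.le, ht.2.le.trans hb⟩
  have hJO : Γ '' Ioo a b ⊆ O := (image_mono hsub).trans hΓO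
  obtain ⟨z, hz, hzf⟩ := frequently_mem_arc hi ha hab hb hd
  have key := eq_zero_or_eq_zero_of_mul hO hOc hJO ⟨z, hJO hz, hzf⟩
    (sepHolo_diagonal hO hH i j) (sepHolo_diagonal hO hSd i j) fun y hy => by
      choose s hs hsy using hy
      have h1 := hzero s hs
      have h2 : (fun l => Γ ((i.insertNth (s j) s : Fin (n + 1) → ℝ) l)) = i.insertNth (y j) y := by
        funext l
        refine i.succAboveCases ?_ (fun l => ?_) l
        · simp [hsy]
        · simp [hsy]
      rw [h2] at h1
      refine (mul_eq_zero.1 h1).resolve_left (hW _ fun l => ?_)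
      rw [← h2]
      refine mem_image_of_mem _ ?_
      refine i.succAboveCases ?_ (fun l => ?_) l
      · simpa using hsub (hs j)
      · simpa using hsub (hs l)
  exact key.imp (fun h x hx hxij => eq_zero_on_diagonal h hx hxij)
    fun h x hx hxij => eq_zero_on_diagonal (f := S) h hx hxij

/-- Either `H` vanishes on all diagonals, and so does its symmetrization, which settles the case
with `F` and `G` exchanged. Or it fails on one diagonal; there the symmetrization of `K` vanishes,
and its symmetry carries this to all diagonals. -/
theorem IsRegion.biorthogonalityXi (hq0 : 0 < q) (hq1 : q < 1) (hν0 : 0 ≤ ν) (hν1 : ν < 1)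
    (hB : IsRegion ν Γ B R₀ R) (hΓ : PiecewiseC1 Γ) (hcl : Γ 0 = Γ 1) (hi : InjOn Γ (Ico 0 1))
    (hO : IsOpen O) (hOc : IsPreconnected O) (hBO : B ⊆ O) (h0 : (0 : ℂ) ∉ O)
    (hW : ∀ x : Fin k → ℂ, (∀ j, x j ∈ trace Γ) → weight q ν x ≠ 0) {F H G K : (Fin k → ℂ) → ℂ}
    (hF : IsRegular Γ O F H) (hG : IsRegular Γ O G K) (hH : DifferentiableOn ℂ H (poly k O))
    (hK : DifferentiableOn ℂ K (poly k O)) (hint : ContourIntegrable Γ (rhsXi q ν F G)) :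
    (∀ n : Weyl k, ContourIntegrable Γ (fun x => PhiR q ν n x * F x) ∧
      ContourIntegrable Γ fun x => PhiL q ν n x * G x) ∧ BiorthogonalityXi q ν Γ F G := by
  have hl := hΓ.isLoop hcl
  have hΓO := hB.trace_subset.trans hBO
  refine ⟨fun n => ⟨(hF.exists_mul hl hi hO hΓO (sepHolo_PhiR h0 n) (PhiR_perm n)).1,
    (hG.exists_mul hl hi hO hΓO (sepHolo_PhiL h0 n) (PhiL_perm n)).1⟩, ?_⟩
  by_cases hdiag : ∀ i j, i ≠ j → ∀ x ∈ poly k O, x i = x j → H x = 0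
  · obtain ⟨h1, h2⟩ := biorthogonalityXi_of_symm_eq_zero hq0 hq1 hν0 hν1 hB hl hi hO hBO h0 hG hF
      fun i j hij x hx hxij => Finset.sum_eq_zero fun σ _ =>
        hdiag (σ.symm i) (σ.symm j) (σ.symm.injective.ne hij) (fun j => x (σ j))
          (fun j => hx (σ j)) (by simpa using hxij)
    exact h1.swap h2 hint
  · push Not at hdiag
    obtain ⟨i, j, hij, x₀, hx₀, hx₀ij, hne⟩ := hdiag
    have h1 := (symm_eq_zero_on_diagonal hΓ hi hO hOc hΓO hW hF hG hH hK hint hij).resolve_left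
      fun h => hne (h x₀ hx₀ hx₀ij)
    refine (biorthogonalityXi_of_symm_eq_zero hq0 hq1 hν0 hν1 hB hl hi hO hBO h0 hF hG
      fun i' j' hij' x hx hxij => ?_).1
    obtain ⟨τ, hτi, hτj⟩ := exists_perm_apply_eq hij hij'
    rw [← sum_perm_perm K x τ]
    exact h1 (fun l => x (τ l)) (fun l => hx _) (by simpa only [hτi, hτj] using hxij)

end Final

/-! ### Holomorphic functions on the region -/

section Holo

variable {k : ℕ} {B : Set ℂ}

theorem differentiableOn_comp_coord {U : Set ℂ} {φ : ℂ → ℂ} (hφ : DifferentiableOn ℂ φ U) :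
    DifferentiableOn ℂ (fun x : Fin k → ℂ => fun j => φ (x j)) (poly k U) :=
  differentiableOn_pi.2 fun j => hφ.comp
    ((differentiable_apply (𝕜 := ℂ) (F' := fun _ : Fin k => ℂ) j).differentiableOn) fun _ hx => hx j

theorem exists_differentiableOn_comp {U : Set ℂ} (hU : IsOpen U) (hBU : B ⊆ U) {φ : ℂ → ℂ}
    (hφ : DifferentiableOn ℂ φ U) {W : Set (Fin k → ℂ)} (hW : IsOpen W)
    (hBW : ∀ x : Fin k → ℂ, (∀ j, x j ∈ B) → (fun j => φ (x j)) ∈ W) {H : (Fin k → ℂ) → ℂ}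
    (hH : DifferentiableOn ℂ H W) :
    ∃ W' : Set (Fin k → ℂ), IsOpen W' ∧ {x | ∀ j, x j ∈ B} ⊆ W' ∧
      DifferentiableOn ℂ (fun x => H fun j => φ (x j)) W' := by
  have h1 := differentiableOn_comp_coord (k := k) hφ
  refine ⟨poly k U ∩ (fun x => fun j => φ (x j)) ⁻¹' W,
    h1.continuousOn.isOpen_inter_preimage (isOpen_poly hU) hW,
    fun x hx => ⟨fun j => hBU (hx j), hBW x hx⟩, ?_⟩
  exact hH.comp (h1.mono inter_subset_left) fun x hx => hx.2

theorem HolomorphicNear.exists_comp {A : Set ℂ} {f : (Fin k → ℂ) → ℂ} (hf : HolomorphicNear A f)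
    {U : Set ℂ} (hU : IsOpen U) (hBU : B ⊆ U) {φ : ℂ → ℂ} (hφ : DifferentiableOn ℂ φ U)
    (hBA : ∀ x ∈ B, φ x ∈ A) :
    ∃ (W : Set (Fin k → ℂ)) (H : (Fin k → ℂ) → ℂ), IsOpen W ∧ {x | ∀ j, x j ∈ B} ⊆ W ∧
      DifferentiableOn ℂ H W ∧ ∀ x : Fin k → ℂ, (∀ j, x j ∈ B) →
        Function.Injective (fun j => φ (x j)) → f (fun j => φ (x j)) = H x := by
  obtain ⟨W, H, hW, hAW, hH, hfH⟩ := hf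
  obtain ⟨W', hW', hBW', hH'⟩ := exists_differentiableOn_comp hU hBU hφ hW
    (fun x hx => hAW fun j => hBA _ (hx j)) hH
  exact ⟨W', _, hW', hBW', hH', fun x hx hxi => hfH _ (fun j => hBA _ (hx j)) hxi⟩

/-- The centre `c` of the chart is inside the curve, and `φ` takes `B` into the closed exterior.
Hence `(φ - c)⁻¹` is holomorphic near `B`, and composition with it gives the extension. -/
theorem HolomorphicOnExterior.exists_comp {γ : ℝ → ℂ} {D : Set ℂ} {f : (Fin k → ℂ) → ℂ}
    (hf : HolomorphicOnExterior γ D f)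
    {U : Set ℂ} (hU : IsOpen U) (hBU : B ⊆ U) {φ : ℂ → ℂ} (hφ : DifferentiableOn ℂ φ U)
    (hBA : ∀ x ∈ B, φ x ∈ closedExterior γ) (hBD : ∀ x ∈ B, φ x ∈ D) :
    ∃ (W : Set (Fin k → ℂ)) (H : (Fin k → ℂ) → ℂ), IsOpen W ∧ {x | ∀ j, x j ∈ B} ⊆ W ∧
      DifferentiableOn ℂ H W ∧ ∀ x : Fin k → ℂ, (∀ j, x j ∈ B) →
        Function.Injective (fun j => φ (x j)) → f (fun j => φ (x j)) = H x := by
  obtain ⟨c, hc, W, H, hW, hAW, hH, hfH⟩ := hf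
  have hne : ∀ x ∈ B, φ x - c ≠ 0 := fun x hx h =>
    mem_inside_iff.1 hc (sub_eq_zero.1 h ▸ hBA x hx)
  have hU' : IsOpen (U ∩ (fun x => φ x - c) ⁻¹' {0}ᶜ) :=
    (hφ.continuousOn.sub continuousOn_const).isOpen_inter_preimage hU isOpen_compl_singleton
  obtain ⟨W', hW', hBW', hH'⟩ := exists_differentiableOn_comp hU'
    (fun x hx => ⟨hBU hx, hne x hx⟩) (φ := fun x => (φ x - c)⁻¹)
    (((hφ.mono inter_subset_left).sub_const c).inv fun x hx => hx.2) hW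
    (fun x hx => hAW fun j => Or.inr ⟨φ (x j), hBA _ (hx j), rfl⟩) hH
  exact ⟨W', _, hW', hBW', hH', fun x hx hxi =>
    hfH _ (fun j => hBA _ (hx j)) (fun j => hBD _ (hx j)) hxi⟩

theorem exists_thickening_subset_inter (hk : 1 ≤ k) (hB : IsCompact B) (hBc : IsPreconnected B)
    (hB0 : (0 : ℂ) ∉ B) {W₁ W₂ : Set (Fin k → ℂ)} (hW₁ : IsOpen W₁) (hW₂ : IsOpen W₂)
    (hBW₁ : {x | ∀ j, x j ∈ B} ⊆ W₁) (hBW₂ : {x | ∀ j, x j ∈ B} ⊆ W₂) {U : Set ℂ} (hU : IsOpen U)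
    (hBU : B ⊆ U) :
    ∃ O, IsOpen O ∧ IsPreconnected O ∧ B ⊆ O ∧ (0 : ℂ) ∉ O ∧ O ⊆ U ∧ poly k O ⊆ W₁ ∧
      poly k O ⊆ W₂ := by
  obtain ⟨δ, hδ, h⟩ := exists_thickening_poly_subset (k := k) hB
    (W := W₁ ∩ W₂ ∩ poly k (U ∩ {0}ᶜ))
    ((hW₁.inter hW₂).inter (isOpen_poly (hU.inter isOpen_compl_singleton)))
    fun x hx => ⟨⟨hBW₁ hx, hBW₂ hx⟩, fun j => ⟨hBU (hx j), fun h0 => hB0 (h0 ▸ hx j)⟩⟩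
  have hsub : ∀ z ∈ Metric.thickening δ B, z ∈ U ∩ {0}ᶜ := fun z hz =>
    (@h (fun _ => z) fun _ => hz).2 ⟨0, hk⟩
  exact ⟨Metric.thickening δ B, Metric.isOpen_thickening, isPreconnected_thickening hBc δ,
    Metric.self_subset_thickening hδ B, fun h0 => (hsub 0 h0).2 rfl, fun z hz => (hsub z hz).1,
    fun x hx => (h hx).1.1, fun x hx => (h hx).1.2⟩

end Holo

/-! ### The change of variables -/

section ChangeVar

variable {q ν : ℝ} {k : ℕ} {γ : ℝ → ℂ}

theorem prod_Iio_const (c : ℂ) :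
    ∏ A : Fin k, ∏ _B ∈ Finset.Iio A, c = c ^ (k * (k - 1) / 2) := by
  simp only [Finset.prod_const, Fin.card_Iio]
  rw [Finset.prod_pow_eq_pow_sum, Fin.sum_univ_eq_sum_range fun i => i, Finset.sum_range_id]

theorem prod_Iio_mul (d : Fin k → ℂ) :
    ∏ A, ∏ B ∈ Finset.Iio A, d A * d B = ∏ j, d j ^ (k - 1) := by
  have h1 := prod_pairs_eq_prod_lt (fun a b => if a = b then 1 else d a) (by simp)
  rw [← prod_erase_eq fun a _ => d a] at h1
  simp only [Finset.prod_const, Finset.card_erase_of_mem (Finset.mem_univ _), Finset.card_univ,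
    Fintype.card_fin] at h1
  rw [h1]
  refine Finset.prod_congr rfl fun A _ => Finset.prod_congr rfl fun B hB => ?_
  have := (Finset.mem_Iio.1 hB).ne
  rw [if_neg this.symm, if_neg this]

theorem prod_Iio_mul_perm (d : Fin k → ℂ) (σ : Equiv.Perm (Fin k)) :
    ∏ A, ∏ B ∈ Finset.Iio A, d (σ A) * d (σ B) = ∏ j, d j ^ (k - 1) := by
  rw [prod_Iio_mul fun j => d (σ j), Equiv.prod_comp σ fun j => d j ^ (k - 1)]

theorem prod_Iio_sub_perm (z : Fin k → ℂ) (σ : Equiv.Perm (Fin k)) :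
    ∏ A, ∏ B ∈ Finset.Iio A, (z (σ A) - z (σ B)) =
      (-1) ^ (k * (k - 1) / 2) * (sgn σ * vandermonde z) := by
  rw [vandermonde_eq_prod_Iio, ← prod_sub_perm, ← prod_Iio_const, ← Finset.prod_mul_distrib]
  refine Finset.prod_congr rfl fun A _ => ?_
  rw [← Finset.prod_mul_distrib]
  exact Finset.prod_congr rfl fun B _ => by ring

theorem neg_one_pow_mul_self (N : ℕ) : ((-1 : ℂ) ^ N) * (-1) ^ N = 1 := by
  rw [← mul_pow]; norm_num

theorem prod_div_Iio_sub {z : Fin k → ℂ} (hz : Function.Injective z) (p : Fin k → Fin k → ℂ)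
    (σ : Equiv.Perm (Fin k)) :
    (∏ A, ∏ B ∈ Finset.Iio A, p A B / (z (σ A) - z (σ B))) * vandermonde z =
      (-1) ^ (k * (k - 1) / 2) * sgn σ * ∏ A, ∏ B ∈ Finset.Iio A, p A B := by
  have hV := vandermonde_ne_zero hz
  simp only [Finset.prod_div_distrib]
  rw [prod_Iio_sub_perm]
  have h1 := neg_one_pow_mul_self (k * (k - 1) / 2)
  have h2 := sgn_mul_self σ
  have h3 : (-1 : ℂ) ^ (k * (k - 1) / 2) ≠ 0 := left_ne_zero_of_mul_eq_one h1
  have h4 : sgn σ ≠ 0 := left_ne_zero_of_mul_eq_one h2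
  rw [div_mul_eq_mul_div, div_eq_iff (mul_ne_zero h3 (mul_ne_zero h4 hV))]
  linear_combination (-(vandermonde z) * (∏ A, ∏ B ∈ Finset.Iio A, p A B)) *
    ((-1 : ℂ) ^ (k * (k - 1) / 2) * (-1) ^ (k * (k - 1) / 2) * h2 + h1)

theorem PsiL_mul_vandermonde (n : Weyl k) {z : Fin k → ℂ} (hz : Function.Injective z) :
    PsiL q ν n z * vandermonde z = (-1) ^ (k * (k - 1) / 2) * ∑ σ : Equiv.Perm (Fin k),
      sgn σ * (∏ A, ∏ B ∈ Finset.Iio A, (z (σ A) - q * z (σ B))) *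
        ∏ j, xi ν (z (σ j)) ^ (-n.1 j) := by
  rw [PsiL, Finset.sum_mul, Finset.mul_sum]
  refine Finset.sum_congr rfl fun σ _ => ?_
  rw [mul_right_comm, prod_div_Iio_sub hz (fun A B => z (σ A) - q * z (σ B))]
  ring

/-- The factor `q ^ (k (k - 1) / 2)` and the sign from the denominators turn each `z_A - q⁻¹ z_B`
into `z_B - q z_A`, which matches the reversed cross terms of `PhiR`. -/
theorem PsiR_mul_vandermonde (hq0 : 0 < q) (n : Weyl k) {z : Fin k → ℂ}
    (hz : Function.Injective z) :
    PsiR q ν n z * vandermonde z = (-1) ^ k * (1 - q) ^ k * stat q ν n *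
      ∑ σ : Equiv.Perm (Fin k), sgn σ * (∏ A, ∏ B ∈ Finset.Iio A, (z (σ B) - q * z (σ A))) *
        ∏ j, xi ν (z (σ j)) ^ (n.1 j) := by
  have hq : (q : ℂ) ≠ 0 := by exact_mod_cast hq0.ne'
  rw [PsiR, mul_assoc, Finset.sum_mul, Finset.mul_sum, Finset.mul_sum]
  refine Finset.sum_congr rfl fun σ _ => ?_
  rw [mul_right_comm (∏ A, _), prod_div_Iio_sub hz (fun A B => z (σ A) - (q : ℂ)⁻¹ * z (σ B))]
  have h1 : ∏ A, ∏ B ∈ Finset.Iio A, (z (σ B) - q * z (σ A)) =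
      (-1) ^ (k * (k - 1) / 2) * q ^ (k * (k - 1) / 2) *
        ∏ A, ∏ B ∈ Finset.Iio A, (z (σ A) - (q : ℂ)⁻¹ * z (σ B)) := by
    rw [← prod_Iio_const, ← prod_Iio_const, ← Finset.prod_mul_distrib, ← Finset.prod_mul_distrib]
    refine Finset.prod_congr rfl fun A _ => ?_
    rw [← Finset.prod_mul_distrib, ← Finset.prod_mul_distrib]
    refine Finset.prod_congr rfl fun B _ => ?_
    field_simp
    ring
  rw [h1]
  ring

theorem prod_crossS_xi (hq0 : 0 < q) (hq1 : q < 1) (hν1 : ν < 1) {z : Fin k → ℂ}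
    (hz : ∀ j, 1 - ν * z j ≠ 0) (σ : Equiv.Perm (Fin k)) :
    ∏ A, ∏ B ∈ Finset.Iio A, crossS q ν (xi ν (z (σ A))) (xi ν (z (σ B))) =
      ((1 - ν) ^ 2 / (1 - q * ν)) ^ (k * (k - 1) / 2) *
        (∏ A, ∏ B ∈ Finset.Iio A, (z (σ A) - q * z (σ B))) / ∏ j, (1 - ν * z j) ^ (k - 1) := by
  rw [← prod_Iio_mul_perm (fun j => 1 - ν * z j) σ, ← prod_Iio_const, ← Finset.prod_mul_distrib,
    ← Finset.prod_div_distrib]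
  refine Finset.prod_congr rfl fun A _ => ?_
  rw [← Finset.prod_mul_distrib, ← Finset.prod_div_distrib]
  refine Finset.prod_congr rfl fun B _ => ?_
  rw [crossS_xi hq0 hq1 hν1 (hz _) (hz _)]
  have h1 := one_sub_mul_ne hq0 hq1 hν1
  have h2 := hz (σ A)
  have h3 := hz (σ B)
  field_simp

theorem prod_crossS_xi' (hq0 : 0 < q) (hq1 : q < 1) (hν1 : ν < 1) {z : Fin k → ℂ}
    (hz : ∀ j, 1 - ν * z j ≠ 0) (σ : Equiv.Perm (Fin k)) :
    ∏ A, ∏ B ∈ Finset.Iio A, crossS q ν (xi ν (z (σ B))) (xi ν (z (σ A))) =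
      ((1 - ν) ^ 2 / (1 - q * ν)) ^ (k * (k - 1) / 2) *
        (∏ A, ∏ B ∈ Finset.Iio A, (z (σ B) - q * z (σ A))) / ∏ j, (1 - ν * z j) ^ (k - 1) := by
  rw [← prod_Iio_mul_perm (fun j => 1 - ν * z j) σ, ← prod_Iio_const, ← Finset.prod_mul_distrib,
    ← Finset.prod_div_distrib]
  refine Finset.prod_congr rfl fun A _ => ?_
  rw [← Finset.prod_mul_distrib, ← Finset.prod_div_distrib]
  refine Finset.prod_congr rfl fun B _ => ?_
  rw [crossS_xi hq0 hq1 hν1 (hz _) (hz _)]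
  have h1 := one_sub_mul_ne hq0 hq1 hν1
  have h2 := hz (σ A)
  have h3 := hz (σ B)
  field_simp

/-- The constant in the change of variables for the product of the cross terms. -/
noncomputable def crossConst (q ν : ℝ) (k : ℕ) : ℂ :=
  ((1 - ν) ^ 2 / (1 - q * ν)) ^ (k * (k - 1) / 2)

theorem PhiL_xi (hq0 : 0 < q) (hq1 : q < 1) (hν1 : ν < 1) (n : Weyl k)
    {z : Fin k → ℂ} (hz : ∀ j, 1 - ν * z j ≠ 0) (hzi : Function.Injective z) :
    PhiL q ν n (fun j => xi ν (z j)) = crossConst q ν k * (-1) ^ (k * (k - 1) / 2) *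
      (∏ j, (1 - ν * z j) ^ (k - 1))⁻¹ * (PsiL q ν n z * vandermonde z) := by
  rw [PsiL_mul_vandermonde n hzi, mul_left_comm, ← mul_assoc, ← mul_assoc, ← mul_assoc,
    mul_comm _ (crossConst q ν k), mul_assoc (crossConst q ν k), neg_one_pow_mul_self, mul_one,
    Finset.mul_sum, PhiL]
  refine Finset.sum_congr rfl fun σ _ => ?_
  rw [prod_crossS_xi hq0 hq1 hν1 hz, crossConst]
  ring

theorem PhiR_xi (hq0 : 0 < q) (hq1 : q < 1) (hν1 : ν < 1) (n : Weyl k)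
    {z : Fin k → ℂ} (hz : ∀ j, 1 - ν * z j ≠ 0) (hzi : Function.Injective z) :
    PhiR q ν n (fun j => xi ν (z j)) = crossConst q ν k * (-1 / (1 - ν)) ^ k *
      (∏ j, (1 - ν * z j) ^ (k - 1))⁻¹ * (PsiR q ν n z * vandermonde z) := by
  have h1 : ((1 - q) / (1 - ν) : ℂ) ^ k = (-1 / (1 - ν)) ^ k * ((-1) ^ k * (1 - q) ^ k) := by
    rw [← mul_pow, ← mul_pow]; congr 1; ring
  rw [PsiR_mul_vandermonde hq0 n hzi, PhiR, h1, Finset.mul_sum, Finset.mul_sum, Finset.mul_sum]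
  refine Finset.sum_congr rfl fun σ _ => ?_
  rw [prod_crossS_xi' hq0 hq1 hν1 hz, crossConst]
  ring

/-- The Jacobian of the change of variables. -/
noncomputable def jac (ν : ℝ) (z : Fin k → ℂ) : ℂ := ∏ j, (-(1 - ν) / (1 - ν * z j) ^ 2)

theorem jac_eq {z : Fin k → ℂ} :
    jac ν z = (-(1 - ν)) ^ k * (∏ j, (1 - ν * z j) ^ 2)⁻¹ := by
  rw [jac, Finset.prod_div_distrib, Finset.prod_const, Finset.card_univ, Fintype.card_fin,
    div_eq_mul_inv]

theorem changeVar_eq {z : Fin k → ℂ} (hz : ∀ j, 1 - ν * z j ≠ 0) (F : (Fin k → ℂ) → ℂ) :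
    changeVar ν F z = ((1 - ν : ℂ) ^ (k + 1)) ^ k * (∏ j, (1 - ν * z j) ^ (k + 1))⁻¹ *
      F fun j => xi ν (z j) := by
  rw [changeVar, Finset.prod_congr rfl fun j _ => by rw [one_sub_nu_xi (hz j), div_pow],
    Finset.prod_div_distrib, Finset.prod_const, Finset.card_univ, Fintype.card_fin, div_eq_mul_inv]

/-- This accounts for the exponent `k + 1`: the Jacobian contributes `2`, and each variable occurs
in `k - 1` cross terms. -/
theorem prod_pow_cancel (hk : 1 ≤ k) (z : Fin k → ℂ) :
    (∏ j, (1 - ν * z j) ^ (k + 1))⁻¹ = (∏ j, (1 - ν * z j) ^ 2)⁻¹ *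
      (∏ j, (1 - ν * z j) ^ (k - 1))⁻¹ := by
  rw [← mul_inv, ← Finset.prod_mul_distrib]
  congr 1
  refine Finset.prod_congr rfl fun j _ => ?_
  rw [← pow_add]
  congr 1
  omega

/-- The constant that relates the test functions. -/
noncomputable def testConst (ν : ℝ) (k : ℕ) : ℂ := ((1 - ν : ℂ) ^ (k + 1)) ^ k

theorem testConst_ne_zero (hν1 : ν < 1) : testConst ν k ≠ 0 :=
  pow_ne_zero _ (pow_ne_zero _ (one_sub_nu_ne hν1))

theorem jac_mul_PhiL (hq0 : 0 < q) (hq1 : q < 1) (hν1 : ν < 1) (hk : 1 ≤ k)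
    (n : Weyl k) {z : Fin k → ℂ} (hz : ∀ j, 1 - ν * z j ≠ 0) (hzi : Function.Injective z)
    (G : (Fin k → ℂ) → ℂ) :
    jac ν z * (PhiL q ν n (fun j => xi ν (z j)) * G fun j => xi ν (z j)) =
      (-(1 - ν)) ^ k * crossConst q ν k * (-1) ^ (k * (k - 1) / 2) * (testConst ν k)⁻¹ *
        (PsiL q ν n z * vandermonde z * changeVar ν G z) := by
  have h := testConst_ne_zero (k := k) hν1
  rw [PhiL_xi hq0 hq1 hν1 n hz hzi, jac_eq, changeVar_eq hz, prod_pow_cancel hk z,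
    ← testConst]
  field_simp

theorem jac_mul_PhiR (hq0 : 0 < q) (hq1 : q < 1) (hν1 : ν < 1) (hk : 1 ≤ k)
    (n : Weyl k) {z : Fin k → ℂ} (hz : ∀ j, 1 - ν * z j ≠ 0) (hzi : Function.Injective z)
    (F : (Fin k → ℂ) → ℂ) :
    jac ν z * (PhiR q ν n (fun j => xi ν (z j)) * F fun j => xi ν (z j)) =
      crossConst q ν k * (testConst ν k)⁻¹ *
        (PsiR q ν n z * vandermonde z * changeVar ν F z) := by
  have h := testConst_ne_zero (k := k) hν1
  have h1 : (-(1 - ν) : ℂ) ^ k * (-1 / (1 - ν)) ^ k = 1 := by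
    have := one_sub_nu_ne hν1
    rw [← mul_pow]
    have h2 : (-(1 - ν) : ℂ) * (-1 / (1 - ν)) = 1 := by
      rw [neg_mul, mul_div_cancel₀ _ this, neg_neg]
    rw [h2, one_pow]
  rw [PhiR_xi hq0 hq1 hν1 n hz hzi, jac_eq, changeVar_eq hz, prod_pow_cancel hk z,
    ← testConst]
  have h3 : (testConst ν k)⁻¹ * testConst ν k = 1 := inv_mul_cancel₀ h
  set P := (∏ j, (1 - ν * z j) ^ 2)⁻¹
  set Q := (∏ j, (1 - ν * z j) ^ (k - 1))⁻¹
  linear_combination (crossConst q ν k * P * Q * (PsiR q ν n z * vandermonde z) *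
    F fun j => xi ν (z j)) * (h1 - h3)

theorem prod_erase_crossS_xi (hq0 : 0 < q) (hq1 : q < 1) (hν1 : ν < 1)
    {z : Fin k → ℂ} (hz : ∀ j, 1 - ν * z j ≠ 0) :
    ∏ A, ∏ B ∈ Finset.univ.erase A, crossS q ν (xi ν (z A)) (xi ν (z B)) =
      crossConst q ν k ^ 2 * ((∏ j, (1 - ν * z j) ^ (k - 1))⁻¹) ^ 2 *
        ∏ A, ∏ B ∈ Finset.univ.erase A, (z A - q * z B) := by
  have key : ∀ G : Fin k → Fin k → ℂ, ∏ A, ∏ B ∈ Finset.univ.erase A, G A B =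
      (∏ A, ∏ B ∈ Finset.Iio A, G A B) * ∏ A, ∏ B ∈ Finset.Iio A, G B A := by
    intro G
    rw [prod_erase_eq G, prod_pairs_eq_prod_lt (fun a b => if a = b then 1 else G a b) (by simp),
      ← Finset.prod_mul_distrib]
    refine Finset.prod_congr rfl fun A _ => ?_
    rw [← Finset.prod_mul_distrib]
    refine Finset.prod_congr rfl fun B hB => ?_
    have := (Finset.mem_Iio.1 hB).ne
    rw [if_neg this.symm, if_neg this]
  have h1 := prod_crossS_xi hq0 hq1 hν1 hz 1
  have h2 := prod_crossS_xi' hq0 hq1 hν1 hz 1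
  simp only [Equiv.Perm.coe_one, id_eq] at h1 h2
  rw [key fun A B => crossS q ν (xi ν (z A)) (xi ν (z B)), key fun A B => z A - q * z B, h1, h2,
    crossConst]
  ring

/-- The constant is the product of those for the right and the left eigenfunctions, so both sides of
the identity are rescaled alike. -/
theorem jac_mul_rhsXi (hq0 : 0 < q) (hq1 : q < 1) (hν1 : ν < 1) (hk : 1 ≤ k)
    {z : Fin k → ℂ} (hz : ∀ j, 1 - ν * z j ≠ 0) (F G : (Fin k → ℂ) → ℂ) :
    jac ν z * rhsXi q ν F G (fun j => xi ν (z j)) =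
      (crossConst q ν k * (testConst ν k)⁻¹) *
      ((-(1 - ν)) ^ k * crossConst q ν k * (-1) ^ (k * (k - 1) / 2) * (testConst ν k)⁻¹) *
        rhsZ q ν (changeVar ν F) (changeVar ν G) z := by
  have h := testConst_ne_zero (k := k) hν1
  have hd : ∏ j, (1 - ν * z j) ≠ 0 := Finset.prod_ne_zero_iff.2 fun j _ => hz j
  have hE := neg_one_pow_mul_self (k * (k - 1) / 2)
  have h1 : ∏ j, xi ν (z j) = (∏ j, (1 - z j)) * (∏ j, (1 - ν * z j))⁻¹ := by
    simp only [xi, div_eq_mul_inv, Finset.prod_mul_distrib,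
      Finset.prod_inv_distrib]
  have h2 : ∑ σ : Equiv.Perm (Fin k), sgn σ * changeVar ν F z * changeVar ν G (fun j => z (σ j)) =
      testConst ν k ^ 2 * ((∏ j, (1 - ν * z j) ^ (k + 1))⁻¹) ^ 2 *
        ∑ σ : Equiv.Perm (Fin k), sgn σ * F (fun j => xi ν (z j)) * G fun j => xi ν (z (σ j)) := by
    rw [Finset.mul_sum]
    refine Finset.sum_congr rfl fun σ _ => ?_
    rw [changeVar_eq hz, changeVar_eq fun j => hz (σ j),
      Equiv.prod_comp σ fun j => (1 - ν * z j) ^ (k + 1), testConst]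
    ring
  rw [rhsXi, rhsZ, h1, h2, prod_erase_crossS_xi hq0 hq1 hν1 hz, jac_eq,
    prod_pow_cancel hk z, Finset.prod_mul_distrib]
  simp only [Finset.prod_pow]
  set E : ℂ := (-1) ^ (k * (k - 1) / 2)
  set D := ∏ j, (1 - ν * z j)
  set T := testConst ν k
  set S := ∑ σ : Equiv.Perm (Fin k), sgn σ * F (fun j => xi ν (z j)) * G fun j => xi ν (z (σ j))
  set X := ∏ A, ∏ B ∈ Finset.univ.erase A, (z A - q * z B)
  have hT : T⁻¹ * T = 1 := inv_mul_cancel₀ h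
  have hD : D * D⁻¹ = 1 := mul_inv_cancel₀ hd
  field_simp
  rw [sq E, hE]
  ring

end ChangeVar

/-! ### Contour integrals under the change of variables -/

section Transfer

variable {q ν : ℝ} {k : ℕ} {γ γ' : ℝ → ℂ}

theorem IsLoop.ae_cube_differentiableAt (hγ : IsLoop γ) (k : ℕ) :
    ∀ᵐ t ∂(volume.restrict (Icc (0 : Fin k → ℝ) 1)), ∀ j, DifferentiableAt ℝ γ (t j) := by
  rw [restrict_cube]
  exact ae_all_iff.2 fun j =>
    (Measure.tendsto_eval_ae_ae (μ := fun _ : Fin k => (volume : Measure ℝ).restrict (Icc 0 1))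
      (i := j)).eventually hγ.ae_differentiableAt

theorem pullback_xi (hγ : IsLoop γ) (hi : InjOn γ (Ico 0 1)) (hne : ∀ z ∈ trace γ, 1 - ν * z ≠ 0)
    {f g : (Fin k → ℂ) → ℂ} {c : ℂ}
    (h : ∀ z : Fin k → ℂ, (∀ j, z j ∈ trace γ) → Function.Injective z →
      jac ν z * f (fun j => xi ν (z j)) = c * g z) :
    pullback (xi ν ∘ γ) f =ᵐ[volume.restrict (Icc 0 1)] fun t => c * pullback γ g t := by
  filter_upwards [hγ.ae_cube_differentiableAt k, ae_cube_interior k] with t ht hti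
  have hmem : ∀ j, γ (t j) ∈ trace γ := fun j =>
    mem_image_of_mem _ (Ioo_subset_Icc_self (hti.1 j))
  have h1 : ∏ j, deriv (xi ν ∘ γ) (t j) = jac ν (fun j => γ (t j)) * ∏ j, deriv γ (t j) := by
    rw [jac, ← Finset.prod_mul_distrib]
    exact Finset.prod_congr rfl fun j _ => deriv_xi_comp (ht j) (hne _ (hmem j))
  have h2 := h (fun j => γ (t j)) hmem fun i j hij =>
    hti.2 (hi (Ioo_subset_Ico_self (hti.1 i)) (Ioo_subset_Ico_self (hti.1 j)) hij)
  rw [pullback, pullback, h1, mul_right_comm]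
  simp only [Function.comp]
  rw [h2]; ring

theorem contourIntegral_xi (hγ : IsLoop γ) (hi : InjOn γ (Ico 0 1))
    (hne : ∀ z ∈ trace γ, 1 - ν * z ≠ 0) {f g : (Fin k → ℂ) → ℂ} {c : ℂ}
    (h : ∀ z : Fin k → ℂ, (∀ j, z j ∈ trace γ) → Function.Injective z →
      jac ν z * f (fun j => xi ν (z j)) = c * g z) :
    contourIntegral (xi ν ∘ γ) f = c * contourIntegral γ g := by
  rw [contourIntegral, contourIntegral, integral_congr_ae (pullback_xi hγ hi hne h),
    integral_const_mul, mul_left_comm]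

theorem contourIntegrable_xi_iff (hγ : IsLoop γ) (hi : InjOn γ (Ico 0 1))
    (hne : ∀ z ∈ trace γ, 1 - ν * z ≠ 0) {f g : (Fin k → ℂ) → ℂ} {c : ℂ} (hc : c ≠ 0)
    (h : ∀ z : Fin k → ℂ, (∀ j, z j ∈ trace γ) → Function.Injective z →
      jac ν z * f (fun j => xi ν (z j)) = c * g z) :
    ContourIntegrable (xi ν ∘ γ) f ↔ ContourIntegrable γ g := by
  rw [ContourIntegrable, ContourIntegrable, IntegrableOn, IntegrableOn,
    integrable_congr (pullback_xi hγ hi hne h)]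
  exact integrable_const_mul_iff hc.isUnit _

theorem crossConst_ne_zero (hq0 : 0 < q) (hq1 : q < 1) (hν1 : ν < 1) :
    crossConst q ν k ≠ 0 :=
  pow_ne_zero _ (div_ne_zero (pow_ne_zero _ (one_sub_nu_ne hν1))
    (one_sub_mul_ne hq0 hq1 hν1))

theorem constR_ne_zero (hq0 : 0 < q) (hq1 : q < 1) (hν1 : ν < 1) :
    crossConst q ν k * (testConst ν k)⁻¹ ≠ 0 :=
  mul_ne_zero (crossConst_ne_zero hq0 hq1 hν1) (inv_ne_zero (testConst_ne_zero hν1))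

theorem constL_ne_zero (hq0 : 0 < q) (hq1 : q < 1) (hν1 : ν < 1) :
    (-(1 - ν) : ℂ) ^ k * crossConst q ν k * (-1) ^ (k * (k - 1) / 2) * (testConst ν k)⁻¹ ≠ 0 :=
  mul_ne_zero (mul_ne_zero (mul_ne_zero (pow_ne_zero _ (neg_ne_zero.2 (one_sub_nu_ne hν1)))
    (crossConst_ne_zero hq0 hq1 hν1)) (pow_ne_zero _ (by norm_num)))
    (inv_ne_zero (testConst_ne_zero hν1))

/-- The integrands correspond pointwise off the diagonals, before any integration, so nothing has to
be assumed about `F` and `G`. All terms and the sum scale by one nonzero constant. -/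
theorem biorthogonalityXi_iff (hq0 : 0 < q) (hq1 : q < 1) (hν1 : ν < 1)
    (hk : 1 ≤ k) (hγ : IsSpectralContour q ν γ) (F G : (Fin k → ℂ) → ℂ) :
    BiorthogonalityXi q ν (xi ν ∘ γ) F G ↔
      BiorthogonalityZ q ν γ (changeVar ν F) (changeVar ν G) := by
  have hl := hγ.isLoop
  have hi := hγ.contour.simple
  have hne := hγ.one_sub_nu_ne
  have hR := constR_ne_zero (k := k) hq0 hq1 hν1
  have hL := constL_ne_zero (k := k) hq0 hq1 hν1
  unfold BiorthogonalityXi BiorthogonalityZ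
  rw [contourIntegral_xi hl hi hne fun z hz _ =>
    jac_mul_rhsXi hq0 hq1 hν1 hk (fun j => hne _ (hz j)) F G]
  have hterm : ∀ n : Weyl k, contourIntegral (xi ν ∘ γ) (fun x => PhiR q ν n x * F x) *
      contourIntegral (xi ν ∘ γ) (fun x => PhiL q ν n x * G x) =
      (crossConst q ν k * (testConst ν k)⁻¹) *
      ((-(1 - ν)) ^ k * crossConst q ν k * (-1) ^ (k * (k - 1) / 2) * (testConst ν k)⁻¹) *
      (contourIntegral γ (fun z => PsiR q ν n z * vandermonde z * changeVar ν F z) *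
        contourIntegral γ fun z => PsiL q ν n z * vandermonde z * changeVar ν G z) := fun n => by
    rw [contourIntegral_xi hl hi hne fun z hz hzi =>
        jac_mul_PhiR hq0 hq1 hν1 hk n (fun j => hne _ (hz j)) hzi F,
      contourIntegral_xi hl hi hne fun z hz hzi =>
        jac_mul_PhiL hq0 hq1 hν1 hk n (fun j => hne _ (hz j)) hzi G]
    ring
  simp only [hterm]
  exact hasSum_mul_left_iff (mul_ne_zero hR hL)

/-- A vanishing cross term would give `z_A = q z_B` with both points on `γ`, but `q γ` lies inside;
a vanishing coordinate would put `1` on `γ`. -/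
theorem weight_ne_zero (hq0 : 0 < q) (hq1 : q < 1) (hν1 : ν < 1)
    (hγ : IsSpectralContour q ν γ) {x : Fin k → ℂ} (hx : ∀ j, x j ∈ trace (xi ν ∘ γ)) :
    weight q ν x ≠ 0 := by
  have hz : ∀ j, ∃ z ∈ trace γ, xi ν z = x j := fun j => by
    have := hx j
    rwa [trace_xi_comp] at this
  choose z hzγ hzx using hz
  have hne := fun j => hγ.one_sub_nu_ne _ (hzγ j)
  have hsub : ∀ i j, z i - q * z j ≠ 0 := by
    intro i j h
    obtain ⟨t, ht, htz⟩ := hzγ j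
    have h1 : (q : ℂ) * γ t ∈ inside γ :=
      hγ.image_subset (mem_image_of_mem (fun t => (q : ℂ) * γ t) ht)
    rw [htz, ← sub_eq_zero.1 h] at h1
    exact h1.1 (hzγ i)
  rw [weight]
  refine mul_ne_zero (Finset.prod_ne_zero_iff.2 fun j _ => ?_)
    (Finset.prod_ne_zero_iff.2 fun A _ => Finset.prod_ne_zero_iff.2 fun B _ => ?_)
  · rw [← hzx, xi]
    refine div_ne_zero (fun h => hγ.one_mem.1 ?_) (hne j)
    rw [sub_eq_zero.1 h]; exact hzγ j
  · rw [← hzx, ← hzx, crossS_xi hq0 hq1 hν1 (hne A) (hne B)]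
    exact div_ne_zero (mul_ne_zero (pow_ne_zero _ (one_sub_nu_ne hν1)) (hsub A B))
      (mul_ne_zero (one_sub_mul_ne hq0 hq1 hν1) (mul_ne_zero (hne A) (hne B)))

/-- The biorthogonality identity for functions that are holomorphic, up to a Vandermonde
determinant, near the region between the contours. -/
theorem IsRegion.biorthogonalityXi_of_differentiableOn (hq0 : 0 < q) (hq1 : q < 1) (hν0 : 0 ≤ ν)
    (hν1 : ν < 1) (hk : 1 ≤ k) (hγ : IsSpectralContour q ν γ) {B U : Set ℂ} {R₀ R : ℝ}
    (hB : IsRegion ν (xi ν ∘ γ) B R₀ R) (hU : IsOpen U) (hBU : B ⊆ U)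
    {W₁ W₂ : Set (Fin k → ℂ)} (hW₁ : IsOpen W₁) (hW₂ : IsOpen W₂)
    (hBW₁ : {x | ∀ j, x j ∈ B} ⊆ W₁) (hBW₂ : {x | ∀ j, x j ∈ B} ⊆ W₂)
    {F H G K a b : (Fin k → ℂ) → ℂ} (hH : DifferentiableOn ℂ H W₁) (hK : DifferentiableOn ℂ K W₂)
    (ha : DifferentiableOn ℂ a (poly k (U \ {0}))) (hb : DifferentiableOn ℂ b (poly k (U \ {0})))
    (hF : ∀ x : Fin k → ℂ, (∀ j, x j ∈ B) → Function.Injective x → vandermonde x * F x = a x * H x)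
    (hG : ∀ x : Fin k → ℂ, (∀ j, x j ∈ B) → Function.Injective x → vandermonde x * G x = b x * K x)
    (hint : ContourIntegrable (xi ν ∘ γ) (rhsXi q ν F G)) :
    (∀ n : Weyl k, ContourIntegrable (xi ν ∘ γ) (fun x => PhiR q ν n x * F x) ∧
      ContourIntegrable (xi ν ∘ γ) fun x => PhiL q ν n x * G x) ∧
      BiorthogonalityXi q ν (xi ν ∘ γ) F G := by
  obtain ⟨O, hO, hOc, hBO, h0, hOU, hO₁, hO₂⟩ := exists_thickening_subset_inter hk hB.compact
    hB.preconnected hB.zero_notMem hW₁ hW₂ hBW₁ hBW₂ hU hBU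
  have hsub : poly k O ⊆ poly k (U \ {0}) := fun x hx j => ⟨hOU (hx j), fun h => h0 (h ▸ hx j)⟩
  have hH' := (ha.mono hsub).mul (hH.mono hO₁)
  have hK' := (hb.mono hsub).mul (hK.mono hO₂)
  exact hB.biorthogonalityXi hq0 hq1 hν0 hν1 (hγ.contour.piecewiseC1.xi_comp hγ.one_sub_nu_ne)
    (by simp [hγ.contour.closed]) (injOn_xi_comp hν1 hγ.one_sub_nu_ne hγ.contour.simple) hO hOc hBO
    h0 (fun x hx => weight_ne_zero hq0 hq1 hν1 hγ hx)
    ⟨sepHolo_of_differentiableOn hO hH', fun x hx hxi =>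
      hF x (fun j => hB.trace_subset (hx j)) hxi⟩
    ⟨sepHolo_of_differentiableOn hO hK', fun x hx hxi =>
      hG x (fun j => hB.trace_subset (hx j)) hxi⟩ hH' hK' hint

theorem differentiableOn_prod_pow (M : ℕ) (s : Set (Fin k → ℂ)) :
    DifferentiableOn ℂ (fun x : Fin k → ℂ => ∏ j, x j ^ M) s :=
  Differentiable.differentiableOn (by fun_prop)

theorem biorthogonalityXi_of_test (hq0 : 0 < q) (hq1 : q < 1) (hν0 : 0 ≤ ν) (hν1 : ν < 1)
    (hk : 1 ≤ k) (hγ : IsSpectralContour q ν γ) (hγ' : IsGapContour q ν γ γ')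
    {F G : (Fin k → ℂ) → ℂ} (hF : TestFXi (xi ν ∘ γ) F)
    (hG : TestG (xi ν ∘ γ) (xi ν ∘ γ') G) (hint : ContourIntegrable (xi ν ∘ γ) (rhsXi q ν F G)) :
    (∀ n : Weyl k, ContourIntegrable (xi ν ∘ γ) (fun x => PhiR q ν n x * F x) ∧
      ContourIntegrable (xi ν ∘ γ) fun x => PhiL q ν n x * G x) ∧
      BiorthogonalityXi q ν (xi ν ∘ γ) F G := by
  obtain ⟨B, R₀, R, hB, hBb, -⟩ := exists_region hq0 hq1 hν0 hν1 hγ hγ'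
  obtain ⟨M, hF⟩ := hF
  obtain ⟨W₁, H, hW₁, hBW₁, hH, hFH⟩ := hF.exists_comp (B := B) isOpen_univ (subset_univ _)
    (φ := id) differentiableOn_id (fun x hx => (hBb hx).1) fun _ _ => mem_univ _
  obtain ⟨W₂, K, hW₂, hBW₂, hK, hGK⟩ := hG.exists_comp (B := B) isOpen_univ (subset_univ _)
    (φ := id) differentiableOn_id hBb
  refine hB.biorthogonalityXi_of_differentiableOn hq0 hq1 hν0 hν1 hk hγ isOpen_univ (subset_univ _)
    hW₁ hW₂ hBW₁ hBW₂ hH hK (differentiableOn_prod_pow M _) (differentiableOn_const 1)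
    (fun x hx hxi => ?_) (fun x hx hxi => ?_) hint
  · have h1 : ∏ j, x j ^ M ≠ 0 := Finset.prod_ne_zero_iff.2 fun j _ =>
      pow_ne_zero _ fun h => hB.zero_notMem (h ▸ hx j)
    rw [← hFH x hx hxi]
    simp only [id, Finset.prod_inv_distrib]
    field_simp
  · rw [one_mul]; exact hGK x hx hxi

/-- The inverse of the change of variables on test functions. -/
noncomputable def changeVarInv (ν : ℝ) (F : (Fin k → ℂ) → ℂ) (x : Fin k → ℂ) : ℂ :=
  (∏ j, (1 - ν * x j) ^ (k + 1))⁻¹ * F fun j => xi ν (x j)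

theorem changeVar_changeVarInv (hν1 : ν < 1) (F : (Fin k → ℂ) → ℂ) {z : Fin k → ℂ}
    (hz : ∀ j, 1 - ν * z j ≠ 0) : changeVar ν (changeVarInv ν F) z = F z := by
  have h1 : ∏ j, (1 - ν * xi ν (z j)) ^ (k + 1) ≠ 0 := Finset.prod_ne_zero_iff.2 fun j _ =>
    pow_ne_zero _ (one_sub_nu_xi_ne hν1 (hz j))
  rw [changeVar, changeVarInv, mul_inv_cancel_left₀ h1]
  simp only [xi_xi hν1 (hz _)]

theorem vandermonde_xi {z : Fin k → ℂ} (hz : ∀ j, 1 - ν * z j ≠ 0) :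
    vandermonde (fun j => xi ν (z j)) = (-(1 - ν)) ^ (k * (k - 1) / 2) *
      (∏ j, (1 - ν * z j) ^ (k - 1))⁻¹ * vandermonde z := by
  rw [vandermonde_eq_prod_Iio, vandermonde_eq_prod_Iio, ← prod_Iio_mul fun j => 1 - ν * z j,
    ← prod_Iio_const, ← Finset.prod_inv_distrib, ← Finset.prod_mul_distrib,
    ← Finset.prod_mul_distrib]
  refine Finset.prod_congr rfl fun A _ => ?_
  rw [← Finset.prod_inv_distrib, ← Finset.prod_mul_distrib, ← Finset.prod_mul_distrib]
  refine Finset.prod_congr rfl fun B _ => ?_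
  rw [xi_sub_xi (hz B) (hz A), mul_comm (1 - ν * z A)]
  ring

theorem vandermonde_mul_changeVarInv (hν1 : ν < 1) (hk : 1 ≤ k) (F : (Fin k → ℂ) → ℂ)
    {x : Fin k → ℂ} (hx : ∀ j, 1 - ν * x j ≠ 0) :
    vandermonde x * changeVarInv ν F x = ((-(1 - ν : ℂ)) ^ (k * (k - 1) / 2))⁻¹ *
      (∏ j, (1 - ν * x j) ^ 2)⁻¹ *
        (vandermonde (fun j => xi ν (x j)) * F fun j => xi ν (x j)) := by
  have h1 : (-(1 - ν) : ℂ) ^ (k * (k - 1) / 2) ≠ 0 :=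
    pow_ne_zero _ (neg_ne_zero.2 (one_sub_nu_ne hν1))
  rw [vandermonde_xi hx, changeVarInv, prod_pow_cancel hk]
  set c : ℂ := (-(1 - ν)) ^ (k * (k - 1) / 2)
  linear_combination (-(∏ j, (1 - ν * x j) ^ 2)⁻¹ * (∏ j, (1 - ν * x j) ^ (k - 1))⁻¹ *
    vandermonde x * F fun j => xi ν (x j)) * inv_mul_cancel₀ h1

/-- The test functions are pulled back by `Ξ` to the compact region `B` only, where `1 - ν x` has no
zero, instead of being carried from one exterior with its point at infinity to the other. On the
region the result in `ξ` applies to `changeVarInv`, and `changeVar` leads back to `F` and `G` on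
`γ`. -/
theorem biorthogonalityZ_of_test (hq0 : 0 < q) (hq1 : q < 1) (hν0 : 0 ≤ ν) (hν1 : ν < 1)
    (hk : 1 ≤ k) (hγ : IsSpectralContour q ν γ) (hγ' : IsGapContour q ν γ γ')
    {F G : (Fin k → ℂ) → ℂ} (hF : TestFZ ν γ F) (hG : TestG γ γ' G)
    (hint : ContourIntegrable γ (rhsZ q ν F G)) :
    (∀ n : Weyl k, ContourIntegrable γ (fun z => PsiR q ν n z * vandermonde z * F z) ∧
      ContourIntegrable γ fun w => PsiL q ν n w * vandermonde w * G w) ∧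
      BiorthogonalityZ q ν γ F G := by
  obtain ⟨B, R₀, R, hB, -, hBb⟩ := exists_region hq0 hq1 hν0 hν1 hγ hγ'
  have hl := hγ.isLoop
  have hi := hγ.contour.simple
  have hne := hγ.one_sub_nu_ne
  set U : Set ℂ := {x | 1 - ν * x ≠ 0} with hU
  have hUo : IsOpen U := isOpen_ne_fun (by fun_prop) (by fun_prop)
  have hBU : B ⊆ U := fun x hx => one_sub_nu_ne_of_norm_le hν0 hB.nu_mul_lt (hB.norm_le x hx)
  have hxiU : DifferentiableOn ℂ (xi ν) U := fun x hx =>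
    (hasDerivAt_xi hx).differentiableAt.differentiableWithinAt
  have hinj : ∀ x : Fin k → ℂ, (∀ j, x j ∈ B) → Function.Injective x →
      Function.Injective fun j => xi ν (x j) := fun x hx hxi i j hij => hxi (by
    have := congrArg (xi ν) hij
    simpa only [xi_xi hν1 (hBU (hx _))] using this)
  obtain ⟨M, hF⟩ := hF
  obtain ⟨W₁, H, hW₁, hBW₁, hH, hFH⟩ := hF.exists_comp (B := B) hUo hBU hxiU
    (fun x hx => (hBb x hx).1) fun x hx => one_sub_nu_xi_ne hν1 (hBU hx)
  obtain ⟨W₂, K, hW₂, hBW₂, hK, hGK⟩ := hG.exists_comp (B := B) hUo hBU hxiU hBb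
  have hFc : ∀ z : Fin k → ℂ, (∀ j, z j ∈ trace γ) → changeVar ν (changeVarInv ν F) z = F z :=
    fun z hz => changeVar_changeVarInv hν1 F fun j => hne _ (hz j)
  have hGc : ∀ z : Fin k → ℂ, (∀ j, z j ∈ trace γ) → changeVar ν (changeVarInv ν G) z = G z :=
    fun z hz => changeVar_changeVarInv hν1 G fun j => hne _ (hz j)
  have hrhs : ∀ z : Fin k → ℂ, (∀ j, z j ∈ trace γ) →
      rhsZ q ν (changeVar ν (changeVarInv ν F)) (changeVar ν (changeVarInv ν G)) z =
        rhsZ q ν F G z := fun z hz => by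
    rw [rhsZ, rhsZ, hFc z hz]
    congr 1
    exact Finset.sum_congr rfl fun σ _ => by rw [hGc _ fun j => hz (σ j)]
  have hR := constR_ne_zero (k := k) hq0 hq1 hν1
  have hL := constL_ne_zero (k := k) hq0 hq1 hν1
  have hpow : DifferentiableOn ℂ (fun x : Fin k → ℂ => ((-(1 - ν : ℂ)) ^ (k * (k - 1) / 2))⁻¹ *
      (∏ j, (1 - ν * x j) ^ 2)⁻¹) (poly k (U \ {0})) := by
    refine DifferentiableOn.const_mul (DifferentiableOn.inv
      (Differentiable.differentiableOn (by fun_prop)) fun x hx => ?_) _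
    exact Finset.prod_ne_zero_iff.2 fun j _ => pow_ne_zero _ (hx j).1
  have key := hB.biorthogonalityXi_of_differentiableOn hq0 hq1 hν0 hν1 hk hγ hUo hBU hW₁ hW₂ hBW₁
    hBW₂ (F := changeVarInv ν F) (G := changeVarInv ν G) hH hK
    (hpow.mul (differentiableOn_prod_pow M _)) hpow
    (fun x hx hxi => by
      have h1 : ∏ j, x j ^ M ≠ 0 := Finset.prod_ne_zero_iff.2 fun j _ =>
        pow_ne_zero _ fun h => hB.zero_notMem (h ▸ hx j)
      rw [vandermonde_mul_changeVarInv hν1 hk F fun j => hBU (hx j),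
        ← hFH x hx (hinj x hx hxi)]
      simp only [xi_xi hν1 (hBU (hx _)), Finset.prod_inv_distrib, Pi.mul_apply]
      field_simp)
    (fun x hx hxi => by
      rw [vandermonde_mul_changeVarInv hν1 hk G fun j => hBU (hx j),
        ← hGK x hx (hinj x hx hxi)])
    ((contourIntegrable_xi_iff hl hi hne (mul_ne_zero hR hL) fun z hz _ => by
      rw [jac_mul_rhsXi hq0 hq1 hν1 hk (fun j => hne _ (hz j)), hrhs z hz]).2 hint)
  refine ⟨fun n => ⟨?_, ?_⟩, ?_⟩
  · exact (contourIntegrable_xi_iff hl hi hne hR fun z hz hzi => by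
      rw [jac_mul_PhiR hq0 hq1 hν1 hk n (fun j => hne _ (hz j)) hzi, hFc z hz]).1 (key.1 n).1
  · exact (contourIntegrable_xi_iff hl hi hne hL fun z hz hzi => by
      rw [jac_mul_PhiL hq0 hq1 hν1 hk n (fun j => hne _ (hz j)) hzi, hGc z hz]).1 (key.1 n).2
  · have h1 := (biorthogonalityXi_iff hq0 hq1 hν1 hk hγ _ _).1 key.2
    unfold BiorthogonalityZ at h1 ⊢
    convert! h1 using 1
    · funext n
      congr 1
      · exact contourIntegral_congr hi fun z hz _ => by rw [hFc z hz]
      · exact contourIntegral_congr hi fun z hz _ => by rw [hGc z hz]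
    · exact contourIntegral_congr hi fun z hz _ => (hrhs z hz).symm

end Transfer

end QHahn

theorem theorem4p2 (q ν : ℝ) (hq0 : 0 < q) (hq1 : q < 1) (hν0 : 0 ≤ ν) (hν1 : ν < 1)
    (k : ℕ) (hk : 1 ≤ k) (γ γ' : ℝ → ℂ)
    (hγ : QHahn.IsSpectralContour q ν γ) (hγ' : QHahn.IsGapContour q ν γ γ') :
    -- the identity in the variables `z`
    (∀ F G : (Fin k → ℂ) → ℂ,
      QHahn.TestFZ ν γ F → QHahn.TestG γ γ' G →
      QHahn.ContourIntegrable γ (QHahn.rhsZ q ν F G) →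
        (∀ n : QHahn.Weyl k,
          QHahn.ContourIntegrable γ
            (fun z => QHahn.PsiR q ν n z * QHahn.vandermonde z * F z) ∧
          QHahn.ContourIntegrable γ
            (fun w => QHahn.PsiL q ν n w * QHahn.vandermonde w * G w)) ∧
        QHahn.BiorthogonalityZ q ν γ F G) ∧
    -- the identity in the variables `ξ`, on the images of the contours
    (∀ F G : (Fin k → ℂ) → ℂ,
      QHahn.TestFXi (QHahn.xi ν ∘ γ) F →
      QHahn.TestG (QHahn.xi ν ∘ γ) (QHahn.xi ν ∘ γ') G →
      QHahn.ContourIntegrable (QHahn.xi ν ∘ γ) (QHahn.rhsXi q ν F G) →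
        (∀ n : QHahn.Weyl k,
          QHahn.ContourIntegrable (QHahn.xi ν ∘ γ) (fun x => QHahn.PhiR q ν n x * F x) ∧
          QHahn.ContourIntegrable (QHahn.xi ν ∘ γ) (fun x => QHahn.PhiL q ν n x * G x)) ∧
        QHahn.BiorthogonalityXi q ν (QHahn.xi ν ∘ γ) F G) ∧
    -- the two identities are equivalent under the change of variables
    (∀ F G : (Fin k → ℂ) → ℂ,
      QHahn.BiorthogonalityXi q ν (QHahn.xi ν ∘ γ) F G ↔
        QHahn.BiorthogonalityZ q ν γ (QHahn.changeVar ν F) (QHahn.changeVar ν G)) := by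
  refine ⟨fun F G hF hG hint => ?_, fun F G hF hG hint => ?_, fun F G => ?_⟩
  · exact QHahn.biorthogonalityZ_of_test hq0 hq1 hν0 hν1 hk hγ hγ' hF hG hint
  · exact QHahn.biorthogonalityXi_of_test hq0 hq1 hν0 hν1 hk hγ hγ' hF hG hint
  · exact QHahn.biorthogonalityXi_iff hq0 hq1 hν1 hk hγ F G
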